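/- Fix an integer $N\ge 1$. All gradings are by $\mathbb Z$, and $M\{s\}$ denotes $M$ with a vector of degree $i$ placed in degree $i+s$. **The 2-category $\mathcal U^*$.** Its objects are the integers $n$. Its 1-morphisms are finite direct sums of shifts of composites of $\mathcal E\mathbf 1_n\colon n\to n+2$ and $\mathcal F\mathbf 1_{n+2}\colon n+2\to n$. Its 2-morphisms form the $\mathbb Q$-linear additive 2-category generated by isomorphisms $f\cong f\{s\}$ of degree $s$, dots $z_n,\hat z_n$ on $\mathcal E\mathbf 1_n$, $\mathcal F\mathbf 1_{n+2}$ (degree $2$), crossings $U_n,\hat U_n$ on $\mathcal E\mathcal E\mathbf 1_n$, $\mathcal F\mathcal F\mathbf 1_{n+4}$ (degree $-2$), $\eta_n\colon \mathbf 1_n\to\mathcal F\mathcal E\mathbf 1_n$ and $\hat\eta_n\colon\mathcal F\mathcal E\mathbf 1_n\to\mathbf 1_n$ (degree $n+1$), and $\hat\varepsilon_{m}\colon\mathbf 1_{m}\to\mathcal E\mathcal F\mathbf 1_{m}$ and $\varepsilon_{m}\colon\mathcal E\mathcal F\mathbf 1_{m}\to\mathbf 1_{m}$ (degree $1-m$),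 subject to Lauda's relations: biadjointness; cyclicity of dots and crossings; a bubble of negative degree is $0$ and a (non-fake) bubble of degree $0$ is $1$; the nilHecke relations; reduction of curls to (fake) bubbles; and the decompositions of the identities of $\mathcal E\mathcal F\mathbf 1_n$ and $\mathcal F\mathcal E\mathbf 1_n$. Let $\mathcal U\subset\mathcal U^*$ be the sub-2-category with all objects and 1-morphisms and the 2-morphisms of degree $0$, and let $\dot{\mathcal U}$ be its Karoubi envelope (same objects; every category of 1-morphisms is replaced by its idempotent completion). **Rings and bimodules.** For $0\le k\le N$ let $H_k=\mathbb Q[x_1,\dots,x_k,y_1,\dots,y_{N-k}]$ (the $GL_N$-equivariant cohomology ring of the Grassmannian of $k$-planes in $\mathbb C^N$) and for $0\le k<N$ let $H_{k,k+1}=\mathbb Q[x_1,\dots,x_k,\xi,y_1,\dots,y_{N-k-1}]$, with $\deg x_j=\deg y_j=2j$, $\deg\xi=2$. Put $x_0=y_0=1$ and let $x_j,y_j$ be $0$ for $j$ out of range. $H_{k,k+1}$ is an $(H_k,H_{k+1})$-bimodule by $H_k\to H_{k,k+1}$, $x_j\mapsto x_j$, $y_j\mapsto y_j+\xi y_{j-1}$,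 and $H_{k+1}\to H_{k,k+1}$, $x_j\mapsto x_j+\xi x_{j-1}$, $y_j\mapsto y_j$; write $H_{k+1,k}$ for it as an $(H_{k+1},H_k)$-bimodule. Let $\mathrm{EqFlag}_N$ be the 2-category whose objects are the rings $H_k$ (attached to the weight $n=2k-N$) and the zero ring (attached to every other weight), whose 1-morphisms are the graded bimodules generated by the $H_k$, $H_{k,k+1}$, $H_{k+1,k}$ under tensor products, shifts, finite direct sums and passage to direct summands, and whose 2-morphisms are degree-preserving bimodule maps. **The assignment $\Gamma_N^G$.** It sends the weight $n=2k-N$ to $H_k$, $\mathcal E\mathbf 1_n$ to $H_{k,k+1}\{1-N+k\}$, $\mathcal F\mathbf 1_{n+2}$ to $H_{k+1,k}\{-k\}$, everything at other weights to $0$, and composites to tensor products, the first tensor factor being the 1-morphism applied first. With $X_0=Y_0=1$, $X_\alpha=-\sum_{j\ge1}y_jX_{\alpha-j}$, $Y_\beta=-\sum_{j\ge1}x_jY_{\beta-j}$ (and $0$ for negative indices), it sends the generating 2-morphisms (for $n=2k-N$, $0\le k<N$) to the bimodule maps determined by $z_n,\hat z_n\colon \xi^a\mapsto\xi^{a+1}$;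 $\eta_n\colon 1\mapsto\sum_{j=0}^k(-1)^jx_j\otimes\xi^{k-j}$; $\hat\varepsilon_{n+2}\colon 1\mapsto\sum_{j=0}^{N-k-1}(-1)^jy_j\otimes\xi^{N-k-1-j}$; $\hat\eta_n\colon\xi^a\otimes\xi^b\mapsto(-1)^{a+b+1+k-N}X_{a+b+1+k-N}$; $\varepsilon_{n+2}\colon\xi^a\otimes\xi^b\mapsto(-1)^{a+b-k}Y_{a+b-k}$; $U_n\colon\xi^a\otimes\xi^b\mapsto\sum_{j=0}^{b-1}\xi^{a+b-1-j}\otimes\xi^j-\sum_{j=0}^{a-1}\xi^{a+b-1-j}\otimes\xi^j$; $\hat U_n\colon\xi^a\otimes\xi^b\mapsto\sum_{j=0}^{a-1}\xi^{a+b-1-j}\otimes\xi^j-\sum_{j=0}^{b-1}\xi^{a+b-1-j}\otimes\xi^j$. **Theorem.** 1. These bimodule maps exist, respect all relations of $\mathcal U^*$ and have the stated degrees, so that they define a 2-functor $\Gamma_N^G\colon\mathcal U\to\mathrm{EqFlag}_N$. Idempotent 2-morphisms split in $\mathrm{EqFlag}_N$, and $\Gamma_N^G$ extends along $\mathcal U\to\dot{\mathcal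 U}$ to a 2-functor $\dot\Gamma_N^G\colon\dot{\mathcal U}\to\mathrm{EqFlag}_N$; the extension agrees with $\Gamma_N^G$ on objects and, up to coherent isomorphism, on 1- and 2-morphisms, and it is unique up to an isomorphism that is the identity on objects. 2. For $0\le k\le N$, the ring $H_k$ is non-zero, concentrated in non-negative even degrees, with degree-zero part $\mathbb Q$, and it has a largest proper homogeneous ideal (it is graded local). Every finitely generated graded projective $H_k$-module is isomorphic to a finite direct sum of modules $H_k\{s\}$, and, up to isomorphism and shift, $H_k$ is the unique indecomposable one. 3. $\dot\Gamma_N^G$ categorifies $V_N$. Let $K_0(A)$ be the split Grothendieck group of finitely generated graded projective $A$-modules, a $\mathbb Z[q,q^{-1}]$-module by $q^s[P]=[P\{s\}]$, and let $K=\bigoplus_n K_0(\dot\Gamma_N^G(n))$. For every 1-morphism $f$ of $\dot{\mathcal U}$, tensoring with the bimodule $\dot\Gamma_N^G(f)$ preserves finitely generated graded projective modules and induces a $\mathbb Z[q,q^{-1}]$-linear map on Grothendieck groups. The operators on $K$ given by $\mathbf 1_n,\mathcal E\mathbf 1_n,\mathcal F\mathbf 1_{n+2}$ satisfy the relations of $\dot{\mathbf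 U}$: the $1_n$ are orthogonal idempotents whose images span $K$, $E1_n=1_{n+2}E1_n$, $F1_{n+2}=1_nF1_{n+2}$, and $EF1_n-FE1_n=[n]1_n$; and the divided powers $E^a1_n/[a]!$ and $F^a1_n/[a]!$ act on $K$. The $\mathbb Z[q,q^{-1}]$-module $K$ is free with basis $v_k=q^{-k(N-k)}[H_k]$, $0\le k\le N$, and $v_k$ has weight $2k-N$, $Ev_k=[k+1]v_{k+1}$, $Fv_{k+1}=[N-k]v_k$; thus $K$ is the integral form of $V_N$, and $K\otimes_{\mathbb Z[q,q^{-1}]}\mathbb Q(q)\cong V_N$ as representations of $\dot{\mathbf U}$, where $V_N$, given by the same formulas over $\mathbb Q(q)$, is irreducible of dimension $N+1$. -/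

import Mathlib

namespace CatVN

open CategoryTheory Bicategory
open scoped TensorProduct LaurentPolynomial

section Gradings

variable {M : Type} [AddCommGroup M] [Module ℚ M] (gr : ℤ → Submodule ℚ M)

variable (M) in
/-- The sum of a finitely supported family of vectors. -/
noncomputable abbrev total : (ℤ →₀ M) →ₗ[ℚ] M :=
  Finsupp.lsum ℚ (fun _ : ℤ => (LinearMap.id : M →ₗ[ℚ] M))

/-- A family of subspaces is an internal grading as soon as there is a map sending every vector
to its homogeneous components. -/
theorem isInternal_of_components (δ : M →ₗ[ℚ] (ℤ →₀ M)) (h1 : ∀ m i, δ m i ∈ gr i)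
    (h2 : ∀ m, total M (δ m) = m)
    (h3 : ∀ i, ∀ m ∈ gr i, δ m = Finsupp.single i m) : DirectSum.IsInternal gr := by
  classical
  constructor
  · rw [injective_iff_map_eq_zero]
    intro x hx
    have key : ∀ y : DirectSum ℤ (fun i => gr i), ∀ i,
        δ (DirectSum.coeAddMonoidHom gr y) i = y i := by
      intro y
      induction y using DirectSum.induction_on with
      | zero => intro i; simp
      | of j m =>
        intro i
        rw [DirectSum.coeAddMonoidHom_of, h3 j _ m.2, DirectSum.of_apply, Finsupp.single_apply]
        split_ifs with h
        · subst h; rfl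
        · simp
      | add a b ha hb => intro i; simp [ha i, hb i]
    ext i
    have := key x i
    rw [hx] at this
    simpa using this.symm
  · intro m
    refine ⟨(δ m).sum (fun i _ => DirectSum.of (fun i => gr i) i ⟨δ m i, h1 m i⟩), ?_⟩
    conv_rhs => rw [← h2 m]
    rw [total, Finsupp.lsum_apply, Finsupp.sum, Finsupp.sum, map_sum]
    simp

variable {gr}

theorem isInternal_shift (h : DirectSum.IsInternal gr) (s : ℤ) :
    DirectSum.IsInternal (fun i => gr (i - s)) := by
  rw [DirectSum.isInternal_submodule_iff_iSupIndep_and_iSup_eq_top] at h ⊢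
  exact ⟨h.1.comp (Equiv.subRight s).injective, by
    rw [← h.2]; exact (Equiv.subRight s).iSup_comp (g := gr)⟩

/-- The map sending a vector to the family of its homogeneous components. -/
noncomputable def components (h : DirectSum.IsInternal gr) : M →ₗ[ℚ] (ℤ →₀ M) :=
  (DirectSum.toModule ℚ ℤ (ℤ →₀ M) fun i => (Finsupp.lsingle i).comp (gr i).subtype).comp
    (LinearEquiv.ofBijective (DirectSum.coeLinearMap gr)
      (show Function.Bijective (DirectSum.coeLinearMap gr) from h)).symm.toLinearMap

theorem components_of_mem (h : DirectSum.IsInternal gr) {i : ℤ} {m : M} (hm : m ∈ gr i) :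
    components h m = Finsupp.single i m := by
  have : (LinearEquiv.ofBijective (DirectSum.coeLinearMap gr)
      (show Function.Bijective (DirectSum.coeLinearMap gr) from h)).symm m
      = DirectSum.lof ℚ ℤ (fun i => gr i) i ⟨m, hm⟩ := by
    rw [LinearEquiv.symm_apply_eq, LinearEquiv.ofBijective_apply, DirectSum.coeLinearMap_lof]
  simp [components, this]

theorem components_mem (h : DirectSum.IsInternal gr) (m : M) (i : ℤ) :
    components h m i ∈ gr i := by
  have hm : m ∈ ⨆ i, gr i := by rw [h.submodule_iSup_eq_top]; trivial
  induction hm using Submodule.iSup_induction' with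
  | mem j x hx =>
    rw [components_of_mem h hx, Finsupp.single_apply]
    split_ifs with hji
    · exact hji ▸ hx
    · exact zero_mem _
  | zero => simp
  | add x y _ _ hx hy => simpa using add_mem hx hy

theorem homogeneous_induction (h : DirectSum.IsInternal gr) {p : M → Prop} (m : M)
    (hom : ∀ i, ∀ x ∈ gr i, p x) (add : ∀ x y, p x → p y → p (x + y)) : p m := by
  have hm : m ∈ ⨆ i, gr i := by rw [h.submodule_iSup_eq_top]; trivial
  induction hm using Submodule.iSup_induction' with
  | mem i x hx => exact hom i x hx
  | zero => exact hom 0 0 (zero_mem _)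
  | add x y _ _ hx hy => exact add x y hx hy

theorem hom_ext_of_homogeneous (h : DirectSum.IsInternal gr) {X : Type*} [AddCommMonoid X]
    [Module ℚ X] {f g : M →ₗ[ℚ] X} (hfg : ∀ i, ∀ m ∈ gr i, f m = g m) : f = g := by
  have top := h.submodule_iSup_eq_top
  ext m
  have hm : m ∈ ⨆ i, gr i := by rw [top]; trivial
  induction hm using Submodule.iSup_induction' with
  | mem i x hx => exact hfg i x hx
  | zero => simp
  | add x y _ _ hx hy => simp [hx, hy]

theorem components_sum (h : DirectSum.IsInternal gr) (m : M) :
    total M (components h m) = m := by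
  have : (total M).comp (components h)
      = LinearMap.id :=
    hom_ext_of_homogeneous h fun i m hm => by simp [components_of_mem h hm]
  exact LinearMap.congr_fun this m

end Gradings

/-- A commutative `ℤ`-graded `ℚ`-algebra. -/
structure GrAlg where
  carrier : Type
  [ring : CommRing carrier]
  [alg : Algebra ℚ carrier]
  gr : ℤ → Submodule ℚ carrier
  one_mem : (1 : carrier) ∈ gr 0
  mul_mem : ∀ {i j : ℤ} {a b : carrier}, a ∈ gr i → b ∈ gr j → a * b ∈ gr (i + j)
  internal : DirectSum.IsInternal gr

attribute [instance] GrAlg.ring GrAlg.alg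

/-- A graded `(A, B)`-bimodule (over commutative graded algebras, so that left and right actions
of the two algebras are just commuting actions). -/
structure GrBimod (A B : GrAlg) where
  carrier : Type
  [acg : AddCommGroup carrier]
  [mod : Module ℚ carrier]
  left : A.carrier →ₐ[ℚ] Module.End ℚ carrier
  right : B.carrier →ₐ[ℚ] Module.End ℚ carrier
  left_right : ∀ a b m, left a (right b m) = right b (left a m)
  gr : ℤ → Submodule ℚ carrier
  internal : DirectSum.IsInternal gr
  left_mem : ∀ {i j : ℤ} {a : A.carrier} {m : carrier}, a ∈ A.gr i → m ∈ gr j →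
    left a m ∈ gr (i + j)
  right_mem : ∀ {i j : ℤ} {b : B.carrier} {m : carrier}, b ∈ B.gr i → m ∈ gr j →
    right b m ∈ gr (i + j)

attribute [instance] GrBimod.acg GrBimod.mod

/-- A map of bimodules, not necessarily compatible with the gradings. -/
@[ext]
structure BimHom {A B : GrAlg} (M P : GrBimod A B) where
  lin : M.carrier →ₗ[ℚ] P.carrier
  map_left : ∀ a m, lin (M.left a m) = P.left a (lin m)
  map_right : ∀ b m, lin (M.right b m) = P.right b (lin m)

namespace BimHom

variable {A B : GrAlg} {M P : GrBimod A B}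

/-- `φ` is homogeneous of degree `d`. -/
def HasDegree (φ : BimHom M P) (d : ℤ) : Prop := ∀ i, ∀ m ∈ M.gr i, φ.lin m ∈ P.gr (i + d)

end BimHom

instance (A B : GrAlg) : Category (GrBimod A B) where
  Hom := BimHom
  id M := ⟨LinearMap.id, fun _ _ => rfl, fun _ _ => rfl⟩
  comp φ ψ := ⟨ψ.lin ∘ₗ φ.lin, fun a m => by simp [φ.map_left, ψ.map_left],
    fun a m => by simp [φ.map_right, ψ.map_right]⟩

namespace GrBimod

section basics

variable {A B C D : GrAlg}

@[ext] theorem hom_ext {M P : GrBimod A B} {φ ψ : M ⟶ P} (h : φ.lin = ψ.lin) : φ = ψ :=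
  BimHom.ext h

@[simp] theorem id_lin (M : GrBimod A B) : (𝟙 M : M ⟶ M).lin = LinearMap.id := rfl

@[simp] theorem comp_lin {M P Q : GrBimod A B} (φ : M ⟶ P) (ψ : P ⟶ Q) :
    (φ ≫ ψ).lin = ψ.lin ∘ₗ φ.lin := rfl

/-- The regular bimodule. -/
abbrev regular (A : GrAlg) : GrBimod A A where
  carrier := A.carrier
  left := Algebra.lmul ℚ A.carrier
  right := Algebra.lmul ℚ A.carrier
  left_right a b m := by simp [mul_left_comm]
  gr := A.gr
  internal := A.internal
  left_mem := A.mul_mem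
  right_mem := A.mul_mem

/-- The grading shift: `m` of degree `i` in `M` has degree `i + s` in `M.shift s`. -/
def shift (M : GrBimod A B) (s : ℤ) : GrBimod A B where
  carrier := M.carrier
  left := M.left
  right := M.right
  left_right := M.left_right
  gr i := M.gr (i - s)
  internal := isInternal_shift M.internal s
  left_mem ha hm := by have := M.left_mem ha hm; rwa [add_sub_assoc]
  right_mem ha hm := by have := M.right_mem ha hm; rwa [add_sub_assoc]

/-- The zero bimodule. -/
def zero (A B : GrAlg) : GrBimod A B where
  carrier := PUnit
  left := ⟨⟨⟨⟨fun _ => 0, Subsingleton.elim _ _⟩, fun _ _ => Subsingleton.elim _ _⟩,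
    Subsingleton.elim _ _, fun _ _ => Subsingleton.elim _ _⟩, fun _ => Subsingleton.elim _ _⟩
  right := ⟨⟨⟨⟨fun _ => 0, Subsingleton.elim _ _⟩, fun _ _ => Subsingleton.elim _ _⟩,
    Subsingleton.elim _ _, fun _ _ => Subsingleton.elim _ _⟩, fun _ => Subsingleton.elim _ _⟩
  left_right _ _ _ := Subsingleton.elim _ _
  gr _ := ⊤
  internal := by
    refine isInternal_of_components _ 0 (fun _ _ => trivial) (fun _ => Subsingleton.elim _ _)
      (fun i m _ => ?_)
    rw [Subsingleton.elim m 0]; exact (Finsupp.single_zero i).symm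
  left_mem _ _ := trivial
  right_mem _ _ := trivial

/-- The direct sum of two graded bimodules. -/
def sum (M P : GrBimod A B) : GrBimod A B where
  carrier := M.carrier × P.carrier
  left :=
    { toFun := fun a => (M.left a).prodMap (P.left a)
      map_one' := by ext <;> simp
      map_mul' := fun a b => by ext <;> simp
      map_zero' := by ext <;> simp
      map_add' := fun a b => by ext <;> simp
      commutes' := fun r => by ext <;> simp }
  right :=
    { toFun := fun a => (M.right a).prodMap (P.right a)
      map_one' := by ext <;> simp
      map_mul' := fun a b => by ext <;> simp
      map_zero' := by ext <;> simp
      map_add' := fun a b => by ext <;> simp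
      commutes' := fun r => by ext <;> simp }
  left_right a b m := by simp [M.left_right, P.left_right]
  gr i := (M.gr i).prod (P.gr i)
  internal := by
    refine isInternal_of_components _
      (LinearMap.coprod ((Finsupp.mapRange.linearMap (LinearMap.inl ℚ M.carrier P.carrier)).comp
          (components M.internal))
        ((Finsupp.mapRange.linearMap (LinearMap.inr ℚ M.carrier P.carrier)).comp
          (components P.internal))) ?_ ?_ ?_
    · rintro ⟨m, p⟩ i
      simp [Submodule.mem_prod, components_mem]
    · intro x
      refine LinearMap.congr_fun (f := (total (M.carrier × P.carrier)).comp
        (LinearMap.coprod _ _)) (g := LinearMap.id) (LinearMap.prod_ext ?_ ?_) x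
      · refine hom_ext_of_homogeneous M.internal fun i m hm => ?_
        simp [components_of_mem M.internal hm]
      · refine hom_ext_of_homogeneous P.internal fun i m hm => ?_
        simp [components_of_mem P.internal hm]
    · rintro i ⟨m, p⟩ ⟨hm, hp⟩
      simp at hm hp
      simp [components_of_mem M.internal hm, components_of_mem P.internal hp, ← Finsupp.single_add]
  left_mem ha hm := ⟨M.left_mem ha hm.1, P.left_mem ha hm.2⟩
  right_mem ha hm := ⟨M.right_mem ha hm.1, P.right_mem ha hm.2⟩

section tensor

variable (M : GrBimod A B) (P : GrBimod B C)

/-- The subspace of `M ⊗ P` spanned by the elements `m b ⊗ p - m ⊗ b p`. -/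
def tensorRel : Submodule ℚ (M.carrier ⊗[ℚ] P.carrier) :=
  Submodule.span ℚ {x | ∃ m b p, x = M.right b m ⊗ₜ[ℚ] p - m ⊗ₜ[ℚ] P.left b p}

/-- The underlying vector space of `M ⊗_B P`. -/
abbrev Tensor : Type := (M.carrier ⊗[ℚ] P.carrier) ⧸ tensorRel M P

/-- The image of `m ⊗ p` in `M ⊗_B P`. -/
def tmk : M.carrier →ₗ[ℚ] P.carrier →ₗ[ℚ] Tensor M P :=
  (TensorProduct.mk ℚ M.carrier P.carrier).compr₂ (tensorRel M P).mkQ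

variable {M P}

theorem tmk_right (m : M.carrier) (b : B.carrier) (p : P.carrier) :
    tmk M P (M.right b m) p = tmk M P m (P.left b p) := by
  rw [← sub_eq_zero]
  change (tensorRel M P).mkQ _ - (tensorRel M P).mkQ _ = 0
  rw [← map_sub]
  exact (Submodule.Quotient.mk_eq_zero _).2 (Submodule.subset_span ⟨m, b, p, rfl⟩)

/-- The universal property of `M ⊗_B P`. -/
def tlift {X : Type*} [AddCommGroup X] [Module ℚ X] (f : M.carrier →ₗ[ℚ] P.carrier →ₗ[ℚ] X)
    (hf : ∀ m b p, f (M.right b m) p = f m (P.left b p)) : Tensor M P →ₗ[ℚ] X :=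
  (tensorRel M P).liftQ (TensorProduct.lift f) (by
    rw [tensorRel, Submodule.span_le]
    rintro _ ⟨m, b, p, rfl⟩
    simp [hf])

@[simp] theorem tlift_tmk {X : Type*} [AddCommGroup X] [Module ℚ X]
    (f : M.carrier →ₗ[ℚ] P.carrier →ₗ[ℚ] X) (hf : ∀ m b p, f (M.right b m) p = f m (P.left b p))
    (m : M.carrier) (p : P.carrier) : tlift f hf (tmk M P m p) = f m p := by
  simp [tlift, tmk]

theorem tensor_ext {X : Type*} [AddCommGroup X] [Module ℚ X] {f g : Tensor M P →ₗ[ℚ] X}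
    (h : ∀ m p, f (tmk M P m p) = g (tmk M P m p)) : f = g := by
  apply Submodule.linearMap_qext
  apply TensorProduct.ext'
  exact h

theorem tensor_induction {p : Tensor M P → Prop} (x : Tensor M P)
    (h : ∀ m q, p (tmk M P m q)) (hadd : ∀ x y, p x → p y → p (x + y)) : p x := by
  obtain ⟨x, rfl⟩ := Submodule.mkQ_surjective _ x
  induction x with
  | zero => have := h 0 0; simpa using this
  | tmul m q => exact h m q
  | add x y hx hy => rw [map_add]; exact hadd _ _ hx hy

/-- The map `φ ⊗ ψ` on `M ⊗_B P`. -/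
def tmap {A' C' : GrAlg}
    {M'' : GrBimod A' B} {P'' : GrBimod B C'}
    (φ : M.carrier →ₗ[ℚ] M''.carrier) (ψ : P.carrier →ₗ[ℚ] P''.carrier)
    (hφ : ∀ b m, φ (M.right b m) = M''.right b (φ m))
    (hψ : ∀ b p, ψ (P.left b p) = P''.left b (ψ p)) : Tensor M P →ₗ[ℚ] Tensor M'' P'' :=
  tlift ((tmk M'' P'').compl₁₂ φ ψ) (fun m b p => by simp [hφ, hψ, tmk_right])

@[simp] theorem tmap_tmk {A' C' : GrAlg} {M'' : GrBimod A' B} {P'' : GrBimod B C'}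
    (φ : M.carrier →ₗ[ℚ] M''.carrier) (ψ : P.carrier →ₗ[ℚ] P''.carrier)
    (hφ : ∀ b m, φ (M.right b m) = M''.right b (φ m))
    (hψ : ∀ b p, ψ (P.left b p) = P''.left b (ψ p)) (m : M.carrier) (p : P.carrier) :
    tmap φ ψ hφ hψ (tmk M P m p) = tmk M'' P'' (φ m) (ψ p) := by
  simp [tmap]

variable (M P) in
/-- The degree `d` part of `M ⊗_B P`. -/
def tensorGr (d : ℤ) : Submodule ℚ (Tensor M P) :=
  Submodule.span ℚ {x | ∃ i j, i + j = d ∧ ∃ m ∈ M.gr i, ∃ p ∈ P.gr j, x = tmk M P m p}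

theorem tmk_mem {i j : ℤ} {m : M.carrier} {p : P.carrier} (hm : m ∈ M.gr i) (hp : p ∈ P.gr j) :
    tmk M P m p ∈ tensorGr M P (i + j) :=
  Submodule.subset_span ⟨i, j, rfl, m, hm, p, hp, rfl⟩

theorem tensor_ext_homogeneous {X : Type*} [AddCommGroup X] [Module ℚ X]
    {f g : Tensor M P →ₗ[ℚ] X}
    (h : ∀ i, ∀ m ∈ M.gr i, ∀ j, ∀ p ∈ P.gr j, f (tmk M P m p) = g (tmk M P m p)) : f = g := by
  refine tensor_ext fun m p => ?_
  have h1 : (tmk M P).compr₂ f = (tmk M P).compr₂ g :=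
    hom_ext_of_homogeneous M.internal fun i m hm =>
      hom_ext_of_homogeneous P.internal fun j p hp => h i m hm j p hp
  exact LinearMap.congr_fun (LinearMap.congr_fun h1 m) p

variable (M P) in
/-- `(m, p) ↦ ∑ (m_i ⊗ p_j)`, with `m_i ⊗ p_j` in degree `i + j`. -/
noncomputable def preComponents :
    M.carrier →ₗ[ℚ] P.carrier →ₗ[ℚ] (ℤ →₀ Tensor M P) :=
  TensorProduct.curry
    ((Finsupp.mapRange.linearMap (tensorRel M P).mkQ) ∘ₗ
      (Finsupp.lmapDomain (M.carrier ⊗[ℚ] P.carrier) ℚ (fun x : ℤ × ℤ => x.1 + x.2)) ∘ₗ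
      (finsuppTensorFinsupp ℚ ℚ M.carrier P.carrier ℤ ℤ).toLinearMap ∘ₗ
      (TensorProduct.map (components M.internal) (components P.internal)))

theorem preComponents_of_mem {i j : ℤ} {m : M.carrier} {p : P.carrier} (hm : m ∈ M.gr i)
    (hp : p ∈ P.gr j) : preComponents M P m p = Finsupp.single (i + j) (tmk M P m p) := by
  simp [preComponents, components_of_mem M.internal hm, components_of_mem P.internal hp, tmk]

/-- Homogeneous components in `M ⊗_B P`. -/
noncomputable def tensorComponents : Tensor M P →ₗ[ℚ] (ℤ →₀ Tensor M P) :=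
  tlift (preComponents M P) (by
    intro m b p
    induction m using homogeneous_induction M.internal with
    | add x y hx hy => simp [hx, hy]
    | hom i m hm =>
    induction p using homogeneous_induction P.internal with
    | add x y hx hy => simp [hx, hy]
    | hom j p hp =>
    induction b using homogeneous_induction B.internal with
    | add x y hx hy => simp [hx, hy]
    | hom l b hb =>
      rw [preComponents_of_mem (M.right_mem hb hm) hp, preComponents_of_mem hm (P.left_mem hb hp),
        tmk_right, show l + i + j = i + (l + j) by ring])

theorem tensorGr_internal : DirectSum.IsInternal (tensorGr M P) := by
  refine isInternal_of_components _ tensorComponents ?_ ?_ ?_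
  · intro x d
    induction x using tensor_induction with
    | h m p =>
      induction m using homogeneous_induction M.internal with
      | add x y hx hy => simpa using add_mem hx hy
      | hom i m hm =>
      induction p using homogeneous_induction P.internal with
      | add x y hx hy => simpa using add_mem hx hy
      | hom j p hp =>
        simp only [tensorComponents, tlift_tmk, preComponents_of_mem hm hp, Finsupp.single_apply]
        split_ifs with h
        · exact h ▸ tmk_mem hm hp
        · exact zero_mem _
    | hadd x y hx hy => simpa using add_mem hx hy
  · intro x
    refine LinearMap.congr_fun (f := (total _).comp tensorComponents) (g := LinearMap.id)
      (tensor_ext_homogeneous fun i m hm j p hp => ?_) x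
    simp [tensorComponents, preComponents_of_mem hm hp]
  · intro d x hx
    induction hx using Submodule.span_induction with
    | mem x hx =>
      obtain ⟨i, j, rfl, m, hm, p, hp, rfl⟩ := hx
      simp [tensorComponents, preComponents_of_mem hm hp]
    | zero => simp
    | add x y _ _ hx hy => simp [hx, hy]
    | smul c x _ hx => simp [hx]

end tensor

/-- The tensor product `M ⊗_B P` of graded bimodules. -/
def tensor (M : GrBimod A B) (P : GrBimod B C) : GrBimod A C where
  carrier := Tensor M P
  left :=
    { toFun := fun a => tmap (M.left a) LinearMap.id (fun b m => M.left_right a b m)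
        (fun _ _ => rfl)
      map_one' := tensor_ext fun m p => by simp
      map_mul' := fun a b => tensor_ext fun m p => by simp
      map_zero' := tensor_ext fun m p => by simp
      map_add' := fun a b => tensor_ext fun m p => by simp
      commutes' := fun r => tensor_ext fun m p => by simp [Module.algebraMap_end_apply] }
  right :=
    { toFun := fun c => tmap LinearMap.id (P.right c) (fun _ _ => rfl)
        (fun b p => (P.left_right b c p).symm)
      map_one' := tensor_ext fun m p => by simp
      map_mul' := fun a b => tensor_ext fun m p => by simp
      map_zero' := tensor_ext fun m p => by simp
      map_add' := fun a b => tensor_ext fun m p => by simp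
      commutes' := fun r => tensor_ext fun m p => by simp [Module.algebraMap_end_apply] }
  left_right a c x := by
    induction x using tensor_induction with
    | h m p => simp
    | hadd x y hx hy => rw [map_add, map_add, map_add, map_add, hx, hy]
  gr := tensorGr M P
  internal := tensorGr_internal
  left_mem {i j a x} ha hx := by
    induction hx using Submodule.span_induction with
    | mem x hx =>
      obtain ⟨k, l, rfl, m, hm, p, hp, rfl⟩ := hx
      rw [← add_assoc]
      simpa using tmk_mem (M.left_mem ha hm) hp
    | zero => rw [map_zero]; exact zero_mem _
    | add x y _ _ hx hy => rw [map_add]; exact add_mem hx hy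
    | smul c x _ hx => rw [map_smul]; exact Submodule.smul_mem _ _ hx
  right_mem {i j a x} ha hx := by
    induction hx using Submodule.span_induction with
    | mem x hx =>
      obtain ⟨k, l, rfl, m, hm, p, hp, rfl⟩ := hx
      rw [add_left_comm]
      simpa using tmk_mem hm (P.right_mem ha hp)
    | zero => rw [map_zero]; exact zero_mem _
    | add x y _ _ hx hy => rw [map_add]; exact add_mem hx hy
    | smul c x _ hx => rw [map_smul]; exact Submodule.smul_mem _ _ hx

/-- The element `m ⊗ p` of `M ⊗_B P`. -/
def tm (M : GrBimod A B) (P : GrBimod B C) :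
    M.carrier →ₗ[ℚ] P.carrier →ₗ[ℚ] (tensor M P).carrier := tmk M P

section

variable {M : GrBimod A B} {P : GrBimod B C} {Q : GrBimod A C}

theorem tm_right (m : M.carrier) (b : B.carrier) (p : P.carrier) :
    tm M P (M.right b m) p = tm M P m (P.left b p) := tmk_right m b p

theorem tensor_left (a : A.carrier) (m : M.carrier) (p : P.carrier) :
    (tensor M P).left a (tm M P m p) = tm M P (M.left a m) p :=
  tmap_tmk (M.left a) LinearMap.id (fun b m => M.left_right a b m) (fun _ _ => rfl) m p

theorem tensor_right (c : C.carrier) (m : M.carrier) (p : P.carrier) :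
    (tensor M P).right c (tm M P m p) = tm M P m (P.right c p) :=
  tmap_tmk LinearMap.id (P.right c) (fun _ _ => rfl) (fun b p => (P.left_right b c p).symm) m p

theorem tm_mem {i j : ℤ} {m : M.carrier} {p : P.carrier} (hm : m ∈ M.gr i) (hp : p ∈ P.gr j) :
    tm M P m p ∈ (tensor M P).gr (i + j) := tmk_mem hm hp

theorem tensor_gr_induction {d : ℤ} {p : (tensor M P).carrier → Prop} {x : (tensor M P).carrier}
    (hx : x ∈ (tensor M P).gr d)
    (h : ∀ i j, i + j = d → ∀ m ∈ M.gr i, ∀ q ∈ P.gr j, p (tm M P m q))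
    (zero : p 0) (add : ∀ x y, p x → p y → p (x + y)) (smul : ∀ (c : ℚ) x, p x → p (c • x)) :
    p x := by
  refine Submodule.span_induction (p := fun x _ => p x) ?_ zero (fun x y _ _ => add x y)
    (fun c x _ => smul c x) hx
  rintro _ ⟨i, j, hij, m, hm, q, hq, rfl⟩
  exact h i j hij m hm q hq

theorem tm_induction {p : (tensor M P).carrier → Prop} (x : (tensor M P).carrier)
    (h : ∀ m q, p (tm M P m q)) (hadd : ∀ x y, p x → p y → p (x + y)) : p x :=
  tensor_induction x h hadd

/-- Linear maps out of `M ⊗_B P`. -/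
def tdesc {X : Type*} [AddCommGroup X] [Module ℚ X] (f : M.carrier →ₗ[ℚ] P.carrier →ₗ[ℚ] X)
    (hf : ∀ m b p, f (M.right b m) p = f m (P.left b p)) : (tensor M P).carrier →ₗ[ℚ] X :=
  tlift f hf

@[simp] theorem tdesc_tm {X : Type*} [AddCommGroup X] [Module ℚ X]
    (f : M.carrier →ₗ[ℚ] P.carrier →ₗ[ℚ] X) (hf : ∀ m b p, f (M.right b m) p = f m (P.left b p))
    (m : M.carrier) (p : P.carrier) : tdesc f hf (tm M P m p) = f m p := tlift_tmk f hf m p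

/-- A map of bimodules out of `M ⊗_B P`, from its values on pure tensors. -/
def tensorDesc (f : M.carrier →ₗ[ℚ] P.carrier →ₗ[ℚ] Q.carrier)
    (hf : ∀ m b p, f (M.right b m) p = f m (P.left b p))
    (hl : ∀ a m p, f (M.left a m) p = Q.left a (f m p))
    (hr : ∀ c m p, f m (P.right c p) = Q.right c (f m p)) : tensor M P ⟶ Q where
  lin := tdesc f hf
  map_left a x := by
    induction x using tm_induction with
    | h m p => rw [tensor_left, tdesc_tm, tdesc_tm, hl]
    | hadd x y hx hy => simp only [map_add, hx, hy]
  map_right a x := by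
    induction x using tm_induction with
    | h m p => rw [tensor_right, tdesc_tm, tdesc_tm, hr]
    | hadd x y hx hy => simp only [map_add, hx, hy]

@[simp] theorem tensorDesc_tm (f : M.carrier →ₗ[ℚ] P.carrier →ₗ[ℚ] Q.carrier)
    (hf : ∀ m b p, f (M.right b m) p = f m (P.left b p))
    (hl : ∀ a m p, f (M.left a m) p = Q.left a (f m p))
    (hr : ∀ c m p, f m (P.right c p) = Q.right c (f m p)) (m : M.carrier) (p : P.carrier) :
    (tensorDesc f hf hl hr).lin (tm M P m p) = f m p := tdesc_tm f hf m p

theorem tensor_hom_ext {φ ψ : tensor M P ⟶ Q}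
    (h : ∀ m p, φ.lin (tm M P m p) = ψ.lin (tm M P m p)) : φ = ψ :=
  hom_ext (tensor_ext h)

theorem tensor_hom_ext₃ {Q : GrBimod C D} {R : GrBimod A D}
    {φ ψ : tensor (tensor M P) Q ⟶ R}
    (h : ∀ m p q, φ.lin (tm (tensor M P) Q (tm M P m p) q) =
      ψ.lin (tm (tensor M P) Q (tm M P m p) q)) : φ = ψ := by
  refine tensor_hom_ext fun x q => ?_
  induction x using tm_induction with
  | h m p => exact h m p q
  | hadd x y hx hy => simp only [map_add, LinearMap.add_apply, hx, hy]

theorem tensor_hom_ext₃' {Q : GrBimod C D} {R : GrBimod A D}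
    {φ ψ : tensor M (tensor P Q) ⟶ R}
    (h : ∀ m p q, φ.lin (tm M (tensor P Q) m (tm P Q p q)) =
      ψ.lin (tm M (tensor P Q) m (tm P Q p q))) : φ = ψ := by
  refine tensor_hom_ext fun m x => ?_
  induction x using tm_induction with
  | h p q => exact h m p q
  | hadd x y hx hy => simp only [map_add, hx, hy]

end

/-- `M ⊗ φ`. -/
def tensorWhiskerLeft (M : GrBimod A B) {P Q : GrBimod B C} (φ : P ⟶ Q) :
    tensor M P ⟶ tensor M Q :=
  tensorDesc ((tm M Q).compl₂ φ.lin)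
    (fun m b p => by simp [tm_right, φ.map_left])
    (fun a m p => by simp [tensor_left]) (fun a m p => by simp [φ.map_right, tensor_right])

/-- `φ ⊗ Q`. -/
def tensorWhiskerRight {M P : GrBimod A B} (φ : M ⟶ P) (Q : GrBimod B C) :
    tensor M Q ⟶ tensor P Q :=
  tensorDesc ((tm P Q).comp φ.lin)
    (fun m b p => by simp [tm_right, φ.map_right])
    (fun a m p => by simp [φ.map_left, tensor_left]) (fun a m p => by simp [tensor_right])

@[simp] theorem tensorWhiskerLeft_tm (M : GrBimod A B) {P Q : GrBimod B C} (φ : P ⟶ Q)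
    (m : M.carrier) (p : P.carrier) :
    (tensorWhiskerLeft M φ).lin (tm M P m p) = tm M Q m (φ.lin p) := by
  exact tensorDesc_tm (Q := tensor M Q) ((tm M Q).compl₂ φ.lin) _ _ _ m p

@[simp] theorem tensorWhiskerRight_tm {M P : GrBimod A B} (φ : M ⟶ P) (Q : GrBimod B C)
    (m : M.carrier) (q : Q.carrier) :
    (tensorWhiskerRight φ Q).lin (tm M Q m q) = tm P Q (φ.lin m) q := by
  simp [tensorWhiskerRight]

/-- The map `(M ⊗ P) ⊗ Q → M ⊗ (P ⊗ Q)`. -/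
def assocHom (M : GrBimod A B) (P : GrBimod B C) (Q : GrBimod C D) :
    tensor (tensor M P) Q ⟶ tensor M (tensor P Q) :=
  tensorDesc (M := tensor M P) (P := Q)
    (tdesc (M := M) (P := P)
      (LinearMap.mk₂ ℚ (fun m p => (tm M (tensor P Q) m).comp (tm P Q p))
        (fun _ _ _ => by ext; simp) (fun _ _ _ => by ext; simp) (fun _ _ _ => by ext; simp)
        (fun _ _ _ => by ext; simp))
      (fun m b p => by ext q; simp [tm_right, tensor_left]))
    (fun x b q => by
      induction x using tm_induction with
      | h m p => simp [tm_right, tensor_right]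
      | hadd x y hx hy => simp only [map_add, LinearMap.add_apply, hx, hy])
    (fun a x q => by
      induction x using tm_induction with
      | h m p => simp [tensor_left]
      | hadd x y hx hy => simp only [map_add, LinearMap.add_apply, hx, hy])
    (fun a x q => by
      induction x using tm_induction with
      | h m p => simp [tensor_right]
      | hadd x y hx hy => simp only [map_add, LinearMap.add_apply, hx, hy])

/-- The map `M ⊗ (P ⊗ Q) → (M ⊗ P) ⊗ Q`. -/
def assocInv (M : GrBimod A B) (P : GrBimod B C) (Q : GrBimod C D) :
    tensor M (tensor P Q) ⟶ tensor (tensor M P) Q :=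
  tensorDesc (M := M) (P := tensor P Q)
    (LinearMap.flip (tdesc (M := P) (P := Q)
      (LinearMap.mk₂ ℚ (fun p q => ((tm (tensor M P) Q).flip q).comp ((tm M P).flip p))
        (fun _ _ _ => by ext; simp) (fun _ _ _ => by ext; simp) (fun _ _ _ => by ext; simp)
        (fun _ _ _ => by ext; simp))
      (fun m b p => by ext q; simp [tm_right, ← tensor_right])))
    (fun m b x => by
      induction x using tm_induction with
      | h p q => simp [tm_right, tensor_left]
      | hadd x y hx hy => simp_all only [map_add])
    (fun a m x => by
      induction x using tm_induction with
      | h p q => simp [tensor_left]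
      | hadd x y hx hy => simp_all only [map_add])
    (fun a m x => by
      induction x using tm_induction with
      | h p q => simp [tensor_right]
      | hadd x y hx hy => simp_all only [map_add])

@[simp] theorem assocHom_tm (M : GrBimod A B) (P : GrBimod B C) (Q : GrBimod C D)
    (m : M.carrier) (p : P.carrier) (q : Q.carrier) :
    (assocHom M P Q).lin (tm (tensor M P) Q (tm M P m p) q) =
      tm M (tensor P Q) m (tm P Q p q) := by
  simp [assocHom]

@[simp] theorem assocInv_tm (M : GrBimod A B) (P : GrBimod B C) (Q : GrBimod C D)
    (m : M.carrier) (p : P.carrier) (q : Q.carrier) :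
    (assocInv M P Q).lin (tm M (tensor P Q) m (tm P Q p q)) =
      tm (tensor M P) Q (tm M P m p) q := by
  simp [assocInv]

/-- The isomorphism `A ⊗_A M ≅ M`. -/
def leftUnit (M : GrBimod A B) : tensor (regular A) M ≅ M where
  hom := tensorDesc (M := regular A) M.left.toLinearMap
    (fun a b m => by
      change M.left (b * (show A.carrier from a)) m = M.left a (M.left b m)
      rw [mul_comm, map_mul]; rfl)
    (fun a b m => by
      change M.left (a * (show A.carrier from b)) m = M.left a (M.left b m)
      rw [map_mul]; rfl)
    (fun b a m => M.left_right a b m)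
  inv := ⟨tm (regular A) M (1 : A.carrier),
    fun a m => by
      rw [tensor_left, ← tm_right],
    fun b m => by rw [tensor_right]⟩
  hom_inv_id := tensor_hom_ext fun a m => by
    simp only [comp_lin, LinearMap.comp_apply, id_lin, LinearMap.id_apply]
    change tm (regular A) M (1 : A.carrier) (M.left a m) = _
    rw [← tm_right]
    change tm (regular A) M (a * 1) m = _
    rw [mul_one]
  inv_hom_id := hom_ext (LinearMap.ext fun m => by
    simp only [comp_lin, LinearMap.comp_apply, id_lin, LinearMap.id_apply]
    change M.left 1 m = m
    simp)

/-- The isomorphism `M ⊗_B B ≅ M`. -/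
def rightUnit (M : GrBimod A B) : tensor M (regular B) ≅ M where
  hom := tensorDesc (P := regular B) M.right.toLinearMap.flip
    (fun m b c => by
      change M.right c (M.right b m) = M.right (b * (show B.carrier from c)) m
      rw [mul_comm, map_mul]; rfl)
    (fun a m b => (M.left_right a b m).symm)
    (fun c m b => by
      change M.right (c * (show B.carrier from b)) m = M.right c (M.right b m)
      rw [map_mul]; rfl)
  inv := ⟨(tm M (regular B)).flip (1 : B.carrier),
    fun b m => by rw [LinearMap.flip_apply, LinearMap.flip_apply, tensor_left],
    fun b m => by
      rw [LinearMap.flip_apply, LinearMap.flip_apply, tensor_right, tm_right]⟩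
  hom_inv_id := tensor_hom_ext fun m b => by
    simp only [comp_lin, LinearMap.comp_apply, id_lin, LinearMap.id_apply]
    change tm M (regular B) (M.right b m) (1 : B.carrier) = _
    rw [tm_right]
    change tm M (regular B) m (b * 1) = _
    rw [mul_one]
  inv_hom_id := hom_ext (LinearMap.ext fun m => by
    simp only [comp_lin, LinearMap.comp_apply, id_lin, LinearMap.id_apply]
    change M.right 1 m = m
    simp)

theorem leftUnit_tm (M : GrBimod A B) (a : A.carrier) (m : M.carrier) :
    (leftUnit M).hom.lin (tm (regular A) M a m) = M.left a m := by
  exact tdesc_tm (M := regular A) M.left.toLinearMap (fun a b m => by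
      change M.left (b * (show A.carrier from a)) m = M.left a (M.left b m)
      rw [mul_comm, map_mul]; rfl) a m

theorem rightUnit_tm (M : GrBimod A B) (b : B.carrier) (m : M.carrier) :
    (rightUnit M).hom.lin (tm M (regular B) m b) = M.right b m := by
  exact tdesc_tm (P := regular B) M.right.toLinearMap.flip (fun m b c => by
      change M.right c (M.right b m) = M.right (b * (show B.carrier from c)) m
      rw [mul_comm, map_mul]; rfl) m b

theorem leftUnit_naturality {M P : GrBimod A B} (φ : M ⟶ P) :
    tensorWhiskerLeft (regular A) φ ≫ (leftUnit P).hom = (leftUnit M).hom ≫ φ :=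
  tensor_hom_ext fun a m =>
    (congrArg (leftUnit P).hom.lin (tensorWhiskerLeft_tm (regular A) φ a m)).trans
      ((leftUnit_tm P a (φ.lin m)).trans ((φ.map_left a m).symm.trans
        (congrArg φ.lin (leftUnit_tm M a m)).symm))

theorem rightUnit_naturality {M P : GrBimod A B} (φ : M ⟶ P) :
    tensorWhiskerRight φ (regular B) ≫ (rightUnit P).hom = (rightUnit M).hom ≫ φ :=
  tensor_hom_ext fun m b =>
    (congrArg (rightUnit P).hom.lin (tensorWhiskerRight_tm φ (regular B) m b)).trans
      ((rightUnit_tm P b (φ.lin m)).trans ((φ.map_right b m).symm.trans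
        (congrArg φ.lin (rightUnit_tm M b m)).symm))

theorem unit_triangle (M : GrBimod A B) (P : GrBimod B C) :
    assocHom M (regular B) P ≫ tensorWhiskerLeft M (leftUnit P).hom =
      tensorWhiskerRight (rightUnit M).hom P :=
  tensor_hom_ext₃ fun m b p =>
    (congrArg (tensorWhiskerLeft M (leftUnit P).hom).lin
      (assocHom_tm M (regular B) P m b p)).trans
    ((tensorWhiskerLeft_tm M (leftUnit P).hom m (tm (regular B) P b p)).trans
      ((congrArg (tm M P m) (leftUnit_tm P b p)).trans
        ((tm_right m b p).symm.trans
          ((congrArg (fun x => tm M P x p) (rightUnit_tm M b m)).symm.trans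
            (tensorWhiskerRight_tm (rightUnit M).hom P (tm M (regular B) m b) p).symm))))

end basics
end GrBimod

open GrBimod

/-- The bicategory of commutative graded algebras, graded bimodules (composed by the tensor
product) and all maps of bimodules. -/
instance : Bicategory GrAlg where
  Hom A B := GrBimod A B
  id A := regular A
  comp M P := tensor M P
  homCategory A B := inferInstance
  whiskerLeft M _ _ φ := tensorWhiskerLeft M φ
  whiskerRight φ M := tensorWhiskerRight φ M
  associator M P Q := ⟨assocHom M P Q, assocInv M P Q,
    tensor_hom_ext₃ fun m p q => by simp, tensor_hom_ext₃' fun m p q => by simp⟩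
  leftUnitor M := leftUnit M
  rightUnitor M := rightUnit M
  whiskerLeft_id M P := tensor_hom_ext fun m p => by simp
  whiskerLeft_comp M _ _ _ φ ψ := tensor_hom_ext fun m p => by simp
  id_whiskerLeft φ := by
    rw [← Category.assoc, Iso.eq_comp_inv]
    exact leftUnit_naturality φ
  comp_whiskerLeft M P _ _ φ := tensor_hom_ext₃ fun m p q => by simp
  id_whiskerRight M P := tensor_hom_ext fun m p => by simp
  comp_whiskerRight φ ψ P := tensor_hom_ext fun m p => by simp
  whiskerRight_id φ := by
    rw [← Category.assoc, Iso.eq_comp_inv]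
    exact rightUnit_naturality φ
  whiskerRight_comp φ P Q := tensor_hom_ext₃' fun m p q => by simp
  whisker_assoc M _ _ φ P := tensor_hom_ext₃ fun m p q => by simp
  whisker_exchange φ ψ := tensor_hom_ext fun m p => by simp
  pentagon M P Q R := by
    refine tensor_hom_ext₃ fun x q r => ?_
    induction x using tm_induction with
    | h m p => simp
    | hadd x y hx hy => simp only [map_add, LinearMap.add_apply, hx, hy]
  triangle M P := unit_triangle M P

/-- Formal 1-morphisms `n ⟶ m` between weights: composites, grading shifts and finite direct sums
of the generators `E 1_n : n ⟶ n + 2` and `F 1_{n+2} : n + 2 ⟶ n`.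
Composition is written in diagrammatic order. -/
inductive Mor : ℤ → ℤ → Type
  | id (n : ℤ) : Mor n n
  | E (n : ℤ) : Mor n (n + 2)
  | F (n : ℤ) : Mor (n + 2) n
  | comp {n m p : ℤ} (f : Mor n m) (g : Mor m p) : Mor n p
  | shift {n m : ℤ} (f : Mor n m) (s : ℤ) : Mor n m
  | zero (n m : ℤ) : Mor n m
  | sum {n m : ℤ} (f g : Mor n m) : Mor n m

/-- Formal 2-morphisms: expressions in the generators, the structural 2-morphisms of a bicategory,
the isomorphisms `f ≃ f{s}`, the injections and projections of direct sums, and `ℚ`-linear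
combinations. -/
inductive Tm : ∀ {n m : ℤ}, Mor n m → Mor n m → Type
  | id {n m : ℤ} (f : Mor n m) : Tm f f
  | comp {n m : ℤ} {f g h : Mor n m} (s : Tm f g) (t : Tm g h) : Tm f h
  | whiskerLeft {n m p : ℤ} (f : Mor n m) {g h : Mor m p} (t : Tm g h) :
      Tm (f.comp g) (f.comp h)
  | whiskerRight {n m p : ℤ} {f g : Mor n m} (h : Mor m p) (t : Tm f g) :
      Tm (f.comp h) (g.comp h)
  | assoc {n m p r : ℤ} (f : Mor n m) (g : Mor m p) (h : Mor p r) :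
      Tm ((f.comp g).comp h) (f.comp (g.comp h))
  | assocInv {n m p r : ℤ} (f : Mor n m) (g : Mor m p) (h : Mor p r) :
      Tm (f.comp (g.comp h)) ((f.comp g).comp h)
  | leftUnit {n m : ℤ} (f : Mor n m) : Tm ((Mor.id n).comp f) f
  | leftUnitInv {n m : ℤ} (f : Mor n m) : Tm f ((Mor.id n).comp f)
  | rightUnit {n m : ℤ} (f : Mor n m) : Tm (f.comp (Mor.id m)) f
  | rightUnitInv {n m : ℤ} (f : Mor n m) : Tm f (f.comp (Mor.id m))
  | zero {n m : ℤ} (f g : Mor n m) : Tm f g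
  | add {n m : ℤ} {f g : Mor n m} (s t : Tm f g) : Tm f g
  | smul {n m : ℤ} {f g : Mor n m} (c : ℚ) (t : Tm f g) : Tm f g
  | toShift {n m : ℤ} (f : Mor n m) (s : ℤ) : Tm f (f.shift s)
  | ofShift {n m : ℤ} (f : Mor n m) (s : ℤ) : Tm (f.shift s) f
  | inl {n m : ℤ} (f g : Mor n m) : Tm f (f.sum g)
  | inr {n m : ℤ} (f g : Mor n m) : Tm g (f.sum g)
  | fst {n m : ℤ} (f g : Mor n m) : Tm (f.sum g) f
  | snd {n m : ℤ} (f g : Mor n m) : Tm (f.sum g) g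
  /-- the dot `z_n` on an upward strand -/
  | z (n : ℤ) : Tm (Mor.E n) (Mor.E n)
  /-- the dot `ẑ_n` on a downward strand -/
  | zh (n : ℤ) : Tm (Mor.F n) (Mor.F n)
  /-- the crossing `U_n` of two upward strands -/
  | U (n : ℤ) : Tm ((Mor.E n).comp (Mor.E (n + 2))) ((Mor.E n).comp (Mor.E (n + 2)))
  /-- the crossing `Û_n` of two downward strands -/
  | Uh (n : ℤ) : Tm ((Mor.F (n + 2)).comp (Mor.F n)) ((Mor.F (n + 2)).comp (Mor.F n))
  /-- the cup `η_n : 1_n ⟶ F E 1_n` -/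
  | eta (n : ℤ) : Tm (Mor.id n) ((Mor.E n).comp (Mor.F n))
  /-- the cup `ε̂_{n+2} : 1_{n+2} ⟶ E F 1_{n+2}` -/
  | epsh (n : ℤ) : Tm (Mor.id (n + 2)) ((Mor.F n).comp (Mor.E n))
  /-- the cap `η̂_n : F E 1_n ⟶ 1_n` -/
  | etah (n : ℤ) : Tm ((Mor.E n).comp (Mor.F n)) (Mor.id n)
  /-- the cap `ε_{n+2} : E F 1_{n+2} ⟶ 1_{n+2}` -/
  | eps (n : ℤ) : Tm ((Mor.F n).comp (Mor.E n)) (Mor.id (n + 2))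

/-- `HasDeg t d`: the expression `t` is homogeneous of degree `d`. -/
inductive HasDeg : ∀ {n m : ℤ} {f g : Mor n m}, Tm f g → ℤ → Prop
  | id {n m : ℤ} (f : Mor n m) : HasDeg (Tm.id f) 0
  | comp {n m : ℤ} {f g h : Mor n m} {s : Tm f g} {t : Tm g h} {d e : ℤ} :
      HasDeg s d → HasDeg t e → HasDeg (s.comp t) (d + e)
  | whiskerLeft {n m p : ℤ} (f : Mor n m) {g h : Mor m p} {t : Tm g h} {d : ℤ} :
      HasDeg t d → HasDeg (t.whiskerLeft f) d
  | whiskerRight {n m p : ℤ} {f g : Mor n m} (h : Mor m p) {t : Tm f g} {d : ℤ} :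
      HasDeg t d → HasDeg (t.whiskerRight h) d
  | assoc {n m p r : ℤ} (f : Mor n m) (g : Mor m p) (h : Mor p r) : HasDeg (Tm.assoc f g h) 0
  | assocInv {n m p r : ℤ} (f : Mor n m) (g : Mor m p) (h : Mor p r) :
      HasDeg (Tm.assocInv f g h) 0
  | leftUnit {n m : ℤ} (f : Mor n m) : HasDeg (Tm.leftUnit f) 0
  | leftUnitInv {n m : ℤ} (f : Mor n m) : HasDeg (Tm.leftUnitInv f) 0
  | rightUnit {n m : ℤ} (f : Mor n m) : HasDeg (Tm.rightUnit f) 0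
  | rightUnitInv {n m : ℤ} (f : Mor n m) : HasDeg (Tm.rightUnitInv f) 0
  | zero {n m : ℤ} (f g : Mor n m) (d : ℤ) : HasDeg (Tm.zero f g) d
  | add {n m : ℤ} {f g : Mor n m} {s t : Tm f g} {d : ℤ} :
      HasDeg s d → HasDeg t d → HasDeg (s.add t) d
  | smul {n m : ℤ} {f g : Mor n m} (c : ℚ) {t : Tm f g} {d : ℤ} :
      HasDeg t d → HasDeg (t.smul c) d
  | toShift {n m : ℤ} (f : Mor n m) (s : ℤ) : HasDeg (Tm.toShift f s) s
  | ofShift {n m : ℤ} (f : Mor n m) (s : ℤ) : HasDeg (Tm.ofShift f s) (-s)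
  | inl {n m : ℤ} (f g : Mor n m) : HasDeg (Tm.inl f g) 0
  | inr {n m : ℤ} (f g : Mor n m) : HasDeg (Tm.inr f g) 0
  | fst {n m : ℤ} (f g : Mor n m) : HasDeg (Tm.fst f g) 0
  | snd {n m : ℤ} (f g : Mor n m) : HasDeg (Tm.snd f g) 0
  | z (n : ℤ) : HasDeg (Tm.z n) 2
  | zh (n : ℤ) : HasDeg (Tm.zh n) 2
  | U (n : ℤ) : HasDeg (Tm.U n) (-2)
  | Uh (n : ℤ) : HasDeg (Tm.Uh n) (-2)
  | eta (n : ℤ) : HasDeg (Tm.eta n) (n + 1)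
  | epsh (n : ℤ) : HasDeg (Tm.epsh n) (1 - (n + 2))
  | etah (n : ℤ) : HasDeg (Tm.etah n) (n + 1)
  | eps (n : ℤ) : HasDeg (Tm.eps n) (1 - (n + 2))

namespace Tm

/-- The structural 2-morphism (built from associators and unitors) between two 1-morphisms that
differ by bracketing and identities. -/
class Coh {n m : ℤ} (f g : Mor n m) where
  tm : Tm f g

instance {n m : ℤ} (f : Mor n m) : Coh f f := ⟨id f⟩
instance {n m p : ℤ} (f : Mor n m) (g h : Mor m p) [Coh g h] : Coh (f.comp g) (f.comp h) :=
  ⟨whiskerLeft f (Coh.tm (f := g) (g := h))⟩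
instance {n m p : ℤ} (f g : Mor n m) (h : Mor m p) [Coh f g] : Coh (f.comp h) (g.comp h) :=
  ⟨whiskerRight h (Coh.tm (f := f) (g := g))⟩
instance {n m : ℤ} (f g : Mor n m) [Coh f g] : Coh ((Mor.id n).comp f) g :=
  ⟨(leftUnit f).comp (Coh.tm (f := f) (g := g))⟩
instance {n m : ℤ} (f g : Mor n m) [Coh f g] : Coh f ((Mor.id n).comp g) :=
  ⟨(Coh.tm (f := f) (g := g)).comp (leftUnitInv g)⟩
instance {n m : ℤ} (f g : Mor n m) [Coh f g] : Coh (f.comp (Mor.id m)) g :=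
  ⟨(rightUnit f).comp (Coh.tm (f := f) (g := g))⟩
instance {n m : ℤ} (f g : Mor n m) [Coh f g] : Coh f (g.comp (Mor.id m)) :=
  ⟨(Coh.tm (f := f) (g := g)).comp (rightUnitInv g)⟩
instance {n m p r : ℤ} (f : Mor n m) (g : Mor m p) (h : Mor p r) (k : Mor n r)
    [Coh (f.comp (g.comp h)) k] : Coh ((f.comp g).comp h) k :=
  ⟨(assoc f g h).comp (Coh.tm (f := f.comp (g.comp h)) (g := k))⟩
instance {n m p r : ℤ} (f : Mor n m) (g : Mor m p) (h : Mor p r) (k : Mor n r)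
    [Coh k (f.comp (g.comp h))] : Coh k ((f.comp g).comp h) :=
  ⟨(Coh.tm (f := k) (g := f.comp (g.comp h))).comp (assocInv f g h)⟩

/-- Vertical composition, with structural 2-morphisms inserted where needed. -/
def cc {n m : ℤ} {f g g' h : Mor n m} [Coh g g'] (s : Tm f g) (t : Tm g' h) : Tm f h :=
  (s.comp (Coh.tm (f := g) (g := g'))).comp t

def neg {n m : ℤ} {f g : Mor n m} (t : Tm f g) : Tm f g := t.smul (-1)

def sub {n m : ℤ} {f g : Mor n m} (s t : Tm f g) : Tm f g := s.add t.neg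

/-- `t 0 + ⋯ + t (k - 1)`. -/
def sum {n m : ℤ} {f g : Mor n m} : (k : ℕ) → (Fin k → Tm f g) → Tm f g
  | 0, _ => zero f g
  | k + 1, t => (sum k fun i => t i.castSucc).add (t (Fin.last k))

/-- The vertical power `t^k`. -/
def pow {n m : ℤ} {f : Mor n m} (t : Tm f f) : ℕ → Tm f f
  | 0 => id f
  | k + 1 => (pow t k).comp t

end Tm

section

/- Composition of 1-morphisms and of 2-morphisms, and whiskering, in diagrammatic order. -/
local infixr:80 " ⬝ " => Mor.comp
local infixr:60 " ⊚ " => Tm.cc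
local infixr:70 " ◃ " => Tm.whiskerLeft
local notation:70 t:71 " ▹ " h:71 => Tm.whiskerRight h t

/-- The clockwise bubble with `m` dots in a region of weight `n + 2`. -/
def cbub (n : ℤ) (m : ℕ) : Tm (Mor.id (n + 2)) (Mor.id (n + 2)) :=
  ((Tm.epsh n).comp (Mor.F n ◃ (Tm.z n).pow m)).comp (Tm.eps n)

/-- The counter-clockwise bubble with `m` dots in a region of weight `n`. -/
def ccbub (n : ℤ) (m : ℕ) : Tm (Mor.id n) (Mor.id n) :=
  ((Tm.eta n).comp ((Tm.z n).pow m ▹ Mor.F n)).comp (Tm.etah n)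

/-- The fake counter-clockwise bubble of degree `2j`, i.e. with `-w-1+j < 0` dots, in a region of
weight `w = n + 2 ≥ j`, defined recursively by the infinite Grassmannian equation. -/
def fakeCC (n : ℤ) : ℕ → Tm (Mor.id (n + 2)) (Mor.id (n + 2))
  | 0 => Tm.id _
  | j + 1 => (Tm.sum (j + 1) fun i =>
      (cbub n ((n + 2) - 1 + ((j + 1 : ℕ) - (i : ℕ))).toNat).comp (fakeCC n i)).neg

/-- The fake clockwise bubble of degree `2j`, i.e. with `w-1+j < 0` dots, in a region of
weight `w = n + 2 ≤ -j`. -/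
def fakeC (n : ℤ) : ℕ → Tm (Mor.id (n + 2)) (Mor.id (n + 2))
  | 0 => Tm.id _
  | j + 1 => (Tm.sum (j + 1) fun i =>
      (ccbub (n + 2) (-(n + 2) - 1 + ((j + 1 : ℕ) - (i : ℕ))).toNat).comp (fakeC n i)).neg

/-- The sideways crossing `E F 1_{n+2} ⟶ F E 1_{n+2}`. -/
def efToFe (n : ℤ) : Tm (Mor.F n ⬝ Mor.E n) (Mor.E (n + 2) ⬝ Mor.F (n + 2)) :=
  Tm.id _ ⊚ ((Mor.F n ⬝ Mor.E n) ◃ Tm.eta (n + 2)) ⊚ (Mor.F n ◃ (Tm.U n ▹ Mor.F (n + 2))) ⊚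
    (Tm.eps n ▹ (Mor.E (n + 2) ⬝ Mor.F (n + 2))) ⊚ Tm.id _

/-- The sideways crossing `F E 1_{n+2} ⟶ E F 1_{n+2}`. -/
def feToEf (n : ℤ) : Tm (Mor.E (n + 2) ⬝ Mor.F (n + 2)) (Mor.F n ⬝ Mor.E n) :=
  Tm.id _ ⊚ (Tm.epsh n ▹ (Mor.E (n + 2) ⬝ Mor.F (n + 2))) ⊚
    (Mor.F n ◃ (Tm.U n ▹ Mor.F (n + 2))) ⊚ ((Mor.F n ⬝ Mor.E n) ◃ Tm.etah (n + 2)) ⊚ Tm.id _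

/-- The defining relations between the generating 2-morphisms. -/
inductive BasicRel : ∀ {n m : ℤ} {f g : Mor n m}, Tm f g → Tm f g → Prop
  -- biadjointness of `E 1_n` and `F 1_{n+2}`
  | zigzagE₁ (n : ℤ) : BasicRel
      (Tm.id (Mor.E n) ⊚ (Tm.eta n ▹ Mor.E n) ⊚ (Mor.E n ◃ Tm.eps n) ⊚ Tm.id (Mor.E n))
      (Tm.id (Mor.E n))
  | zigzagE₂ (n : ℤ) : BasicRel
      (Tm.id (Mor.E n) ⊚ (Mor.E n ◃ Tm.epsh n) ⊚ (Tm.etah n ▹ Mor.E n) ⊚ Tm.id (Mor.E n))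
      (Tm.id (Mor.E n))
  | zigzagF₁ (n : ℤ) : BasicRel
      (Tm.id (Mor.F n) ⊚ (Mor.F n ◃ Tm.eta n) ⊚ (Tm.eps n ▹ Mor.F n) ⊚ Tm.id (Mor.F n))
      (Tm.id (Mor.F n))
  | zigzagF₂ (n : ℤ) : BasicRel
      (Tm.id (Mor.F n) ⊚ (Tm.epsh n ▹ Mor.F n) ⊚ (Mor.F n ◃ Tm.etah n) ⊚ Tm.id (Mor.F n))
      (Tm.id (Mor.F n))
  -- cyclicity of the dot
  | dotCyclic₁ (n : ℤ) : BasicRel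
      (Tm.id (Mor.F n) ⊚ (Tm.epsh n ▹ Mor.F n) ⊚ (Mor.F n ◃ (Tm.z n ▹ Mor.F n)) ⊚
        (Mor.F n ◃ Tm.etah n) ⊚ Tm.id (Mor.F n))
      (Tm.zh n)
  | dotCyclic₂ (n : ℤ) : BasicRel
      (Tm.id (Mor.F n) ⊚ (Mor.F n ◃ Tm.eta n) ⊚ (Mor.F n ◃ (Tm.z n ▹ Mor.F n)) ⊚
        (Tm.eps n ▹ Mor.F n) ⊚ Tm.id (Mor.F n))
      (Tm.zh n)
  -- cyclicity of the crossing
  | crossCyclic₁ (n : ℤ) : BasicRel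
      (Tm.id (Mor.F (n + 2) ⬝ Mor.F n) ⊚
        (Tm.epsh (n + 2) ▹ (Mor.F (n + 2) ⬝ Mor.F n)) ⊚
        (Mor.F (n + 2) ◃ (Tm.epsh n ▹ (Mor.E (n + 2) ⬝ Mor.F (n + 2) ⬝ Mor.F n))) ⊚
        ((Mor.F (n + 2) ⬝ Mor.F n) ◃ (Tm.U n ▹ (Mor.F (n + 2) ⬝ Mor.F n))) ⊚
        ((Mor.F (n + 2) ⬝ Mor.F n ⬝ Mor.E n) ◃ (Tm.etah (n + 2) ▹ Mor.F n)) ⊚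
        ((Mor.F (n + 2) ⬝ Mor.F n) ◃ Tm.etah n) ⊚ Tm.id (Mor.F (n + 2) ⬝ Mor.F n))
      (Tm.Uh n)
  | crossCyclic₂ (n : ℤ) : BasicRel
      (Tm.id (Mor.F (n + 2) ⬝ Mor.F n) ⊚
        ((Mor.F (n + 2) ⬝ Mor.F n) ◃ Tm.eta n) ⊚
        ((Mor.F (n + 2) ⬝ Mor.F n ⬝ Mor.E n) ◃ (Tm.eta (n + 2) ▹ Mor.F n)) ⊚
        ((Mor.F (n + 2) ⬝ Mor.F n) ◃ (Tm.U n ▹ (Mor.F (n + 2) ⬝ Mor.F n))) ⊚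
        (Mor.F (n + 2) ◃ (Tm.eps n ▹ (Mor.E (n + 2) ⬝ Mor.F (n + 2) ⬝ Mor.F n))) ⊚
        (Tm.eps (n + 2) ▹ (Mor.F (n + 2) ⬝ Mor.F n)) ⊚ Tm.id (Mor.F (n + 2) ⬝ Mor.F n))
      (Tm.Uh n)
  -- positivity of bubbles, and bubbles of degree zero
  | cbub_zero (n : ℤ) (m : ℕ) (h : (m : ℤ) < (n + 2) - 1) : BasicRel (cbub n m) (Tm.zero _ _)
  | cbub_one (n : ℤ) (m : ℕ) (h : (m : ℤ) = (n + 2) - 1) : BasicRel (cbub n m) (Tm.id _)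
  | ccbub_zero (n : ℤ) (m : ℕ) (h : (m : ℤ) < -n - 1) : BasicRel (ccbub n m) (Tm.zero _ _)
  | ccbub_one (n : ℤ) (m : ℕ) (h : (m : ℤ) = -n - 1) : BasicRel (ccbub n m) (Tm.id _)
  -- nilHecke relations
  | cross_sq (n : ℤ) : BasicRel ((Tm.U n).comp (Tm.U n)) (Tm.zero _ _)
  | nilHecke₁ (n : ℤ) : BasicRel
      (((Mor.E n ◃ Tm.z (n + 2)).comp (Tm.U n)).sub ((Tm.U n).comp (Tm.z n ▹ Mor.E (n + 2))))
      (Tm.id _)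
  | nilHecke₂ (n : ℤ) : BasicRel
      (((Tm.U n).comp (Mor.E n ◃ Tm.z (n + 2))).sub ((Tm.z n ▹ Mor.E (n + 2)).comp (Tm.U n)))
      (Tm.id _)
  | braid (n : ℤ) : BasicRel
      ((Tm.U n ▹ Mor.E (n + 2 + 2)) ⊚ (Mor.E n ◃ Tm.U (n + 2)) ⊚ (Tm.U n ▹ Mor.E (n + 2 + 2)))
      (Tm.id ((Mor.E n ⬝ Mor.E (n + 2)) ⬝ Mor.E (n + 2 + 2)) ⊚ (Mor.E n ◃ Tm.U (n + 2)) ⊚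
        (Tm.U n ▹ Mor.E (n + 2 + 2)) ⊚ (Mor.E n ◃ Tm.U (n + 2)) ⊚ Tm.id _)
  -- reduction of curls to bubbles, where `w = n + 2`
  | curl₁ (n : ℤ) : BasicRel
      (Tm.id (Mor.E (n + 2)) ⊚ (Tm.epsh n ▹ Mor.E (n + 2)) ⊚ (Mor.F n ◃ Tm.U n) ⊚
        (Tm.eps n ▹ Mor.E (n + 2)) ⊚ Tm.id (Mor.E (n + 2)))
      (Tm.sum (-(n + 2) + 1).toNat fun l =>
        Tm.id (Mor.E (n + 2)) ⊚ (fakeC n l ▹ Mor.E (n + 2)) ⊚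
          (Tm.z (n + 2)).pow (-(n + 2) - (l : ℕ)).toNat).neg
  | curl₂ (n : ℤ) : BasicRel
      (Tm.id (Mor.E n) ⊚ (Mor.E n ◃ Tm.eta (n + 2)) ⊚ (Tm.U n ▹ Mor.F (n + 2)) ⊚
        (Mor.E n ◃ Tm.etah (n + 2)) ⊚ Tm.id (Mor.E n))
      (Tm.sum ((n + 2) + 1).toNat fun j =>
        (Tm.z n).pow ((n + 2) - (j : ℕ)).toNat ⊚ (Mor.E n ◃ fakeCC n j) ⊚ Tm.id (Mor.E n))
  -- decomposition of the identities of `E F 1_w` and `F E 1_w`, where `w = n + 2`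
  | decompEF (n : ℤ) : BasicRel (Tm.id (Mor.F n ⬝ Mor.E n))
      (((efToFe n).comp (feToEf n)).neg.add
        (Tm.sum (n + 2).toNat fun l => Tm.sum ((l : ℕ) + 1) fun j =>
          ((((Mor.F n ◃ (Tm.z n).pow ((l : ℕ) - j)).comp (Tm.eps n)).comp (fakeCC n j)).comp
            (Tm.epsh n)).comp (Mor.F n ◃ (Tm.z n).pow ((n + 2) - 1 - (l : ℕ)).toNat)))
  | decompFE (n : ℤ) : BasicRel (Tm.id (Mor.E (n + 2) ⬝ Mor.F (n + 2)))
      (((feToEf n).comp (efToFe n)).neg.add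
        (Tm.sum (-(n + 2)).toNat fun l => Tm.sum ((l : ℕ) + 1) fun j =>
          (((((Tm.z (n + 2)).pow ((l : ℕ) - j) ▹ Mor.F (n + 2)).comp (Tm.etah (n + 2))).comp
            (fakeC n j)).comp (Tm.eta (n + 2))).comp
            ((Tm.z (n + 2)).pow (-(n + 2) - 1 - (l : ℕ)).toNat ▹ Mor.F (n + 2))))

end

section

local infixr:0 " ≫ₜ " => Tm.comp
local notation f " ◁ₜ " η => Tm.whiskerLeft f η
local notation η " ▷ₜ " h => Tm.whiskerRight h η

/-- The congruence on formal 2-morphisms generated by the axioms of an additive `ℚ`-linear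
bicategory with shift isomorphisms and by `BasicRel`. -/
inductive Rel : ∀ {n m : ℤ} {f g : Mor n m}, Tm f g → Tm f g → Prop
  | basic {n m : ℤ} {f g : Mor n m} (s t : Tm f g) : BasicRel s t → Rel s t
  -- compatibility with the operations
  | comp_right {a b : ℤ} {f g h : Mor a b} (η : Tm f g) (θ₁ θ₂ : Tm g h) :
      Rel θ₁ θ₂ → Rel (η ≫ₜ θ₁) (η ≫ₜ θ₂)
  | comp_left {a b : ℤ} {f g h : Mor a b} (η₁ η₂ : Tm f g) (θ : Tm g h) :
      Rel η₁ η₂ → Rel (η₁ ≫ₜ θ) (η₂ ≫ₜ θ)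
  | whiskerLeft {a b c : ℤ} (f : Mor a b) (g h : Mor b c) (η η' : Tm g h) :
      Rel η η' → Rel (f ◁ₜ η) (f ◁ₜ η')
  | whiskerRight {a b c : ℤ} (f g : Mor a b) (h : Mor b c) (η η' : Tm f g) :
      Rel η η' → Rel (η ▷ₜ h) (η' ▷ₜ h)
  | add_left {a b : ℤ} {f g : Mor a b} (s s' t : Tm f g) : Rel s s' → Rel (s.add t) (s'.add t)
  | add_right {a b : ℤ} {f g : Mor a b} (s t t' : Tm f g) : Rel t t' → Rel (s.add t) (s.add t')
  | smul {a b : ℤ} {f g : Mor a b} (c : ℚ) (t t' : Tm f g) : Rel t t' → Rel (t.smul c) (t'.smul c)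
  -- the axioms of a bicategory
  | id_comp {a b : ℤ} {f g : Mor a b} (η : Tm f g) : Rel (Tm.id f ≫ₜ η) η
  | comp_id {a b : ℤ} {f g : Mor a b} (η : Tm f g) : Rel (η ≫ₜ Tm.id g) η
  | assoc {a b : ℤ} {f g h i : Mor a b} (η : Tm f g) (θ : Tm g h) (ι : Tm h i) :
      Rel ((η ≫ₜ θ) ≫ₜ ι) (η ≫ₜ θ ≫ₜ ι)
  | whiskerLeft_id {a b c : ℤ} (f : Mor a b) (g : Mor b c) :
      Rel (f ◁ₜ Tm.id g) (Tm.id (f.comp g))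
  | whiskerLeft_comp {a b c : ℤ} (f : Mor a b) {g h i : Mor b c} (η : Tm g h) (θ : Tm h i) :
      Rel (f ◁ₜ (η ≫ₜ θ)) ((f ◁ₜ η) ≫ₜ (f ◁ₜ θ))
  | id_whiskerLeft {a b : ℤ} {f g : Mor a b} (η : Tm f g) :
      Rel (Mor.id a ◁ₜ η) (Tm.leftUnit f ≫ₜ η ≫ₜ Tm.leftUnitInv g)
  | comp_whiskerLeft {a b c d : ℤ} (f : Mor a b) (g : Mor b c) {h h' : Mor c d} (η : Tm h h') :
      Rel (f.comp g ◁ₜ η) (Tm.assoc f g h ≫ₜ (f ◁ₜ (g ◁ₜ η)) ≫ₜ Tm.assocInv f g h')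
  | id_whiskerRight {a b c : ℤ} (f : Mor a b) (g : Mor b c) :
      Rel (Tm.id f ▷ₜ g) (Tm.id (f.comp g))
  | comp_whiskerRight {a b c : ℤ} {f g h : Mor a b} (i : Mor b c) (η : Tm f g) (θ : Tm g h) :
      Rel ((η ≫ₜ θ) ▷ₜ i) ((η ▷ₜ i) ≫ₜ (θ ▷ₜ i))
  | whiskerRight_id {a b : ℤ} {f g : Mor a b} (η : Tm f g) :
      Rel (η ▷ₜ Mor.id b) (Tm.rightUnit f ≫ₜ η ≫ₜ Tm.rightUnitInv g)
  | whiskerRight_comp {a b c d : ℤ} {f f' : Mor a b} (g : Mor b c) (h : Mor c d) (η : Tm f f') :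
      Rel (η ▷ₜ g.comp h) (Tm.assocInv f g h ≫ₜ ((η ▷ₜ g) ▷ₜ h) ≫ₜ Tm.assoc f' g h)
  | whisker_assoc {a b c d : ℤ} (f : Mor a b) {g g' : Mor b c} (η : Tm g g') (h : Mor c d) :
      Rel ((f ◁ₜ η) ▷ₜ h) (Tm.assoc f g h ≫ₜ (f ◁ₜ (η ▷ₜ h)) ≫ₜ Tm.assocInv f g' h)
  | whisker_exchange {a b c : ℤ} {f g : Mor a b} {h i : Mor b c} (η : Tm f g) (θ : Tm h i) :
      Rel ((f ◁ₜ θ) ≫ₜ (η ▷ₜ i)) ((η ▷ₜ h) ≫ₜ (g ◁ₜ θ))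
  | assoc_hom_inv {a b c d : ℤ} (f : Mor a b) (g : Mor b c) (h : Mor c d) :
      Rel (Tm.assoc f g h ≫ₜ Tm.assocInv f g h) (Tm.id ((f.comp g).comp h))
  | assoc_inv_hom {a b c d : ℤ} (f : Mor a b) (g : Mor b c) (h : Mor c d) :
      Rel (Tm.assocInv f g h ≫ₜ Tm.assoc f g h) (Tm.id (f.comp (g.comp h)))
  | leftUnit_hom_inv {a b : ℤ} (f : Mor a b) :
      Rel (Tm.leftUnit f ≫ₜ Tm.leftUnitInv f) (Tm.id ((Mor.id a).comp f))
  | leftUnit_inv_hom {a b : ℤ} (f : Mor a b) :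
      Rel (Tm.leftUnitInv f ≫ₜ Tm.leftUnit f) (Tm.id f)
  | rightUnit_hom_inv {a b : ℤ} (f : Mor a b) :
      Rel (Tm.rightUnit f ≫ₜ Tm.rightUnitInv f) (Tm.id (f.comp (Mor.id b)))
  | rightUnit_inv_hom {a b : ℤ} (f : Mor a b) :
      Rel (Tm.rightUnitInv f ≫ₜ Tm.rightUnit f) (Tm.id f)
  | pentagon {a b c d e : ℤ} (f : Mor a b) (g : Mor b c) (h : Mor c d) (i : Mor d e) :
      Rel ((Tm.assoc f g h ▷ₜ i) ≫ₜ Tm.assoc f (g.comp h) i ≫ₜ (f ◁ₜ Tm.assoc g h i))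
        (Tm.assoc (f.comp g) h i ≫ₜ Tm.assoc f g (h.comp i))
  | triangle {a b c : ℤ} (f : Mor a b) (g : Mor b c) :
      Rel (Tm.assoc f (Mor.id b) g ≫ₜ (f ◁ₜ Tm.leftUnit g)) (Tm.rightUnit f ▷ₜ g)
  -- `ℚ`-linearity
  | add_comm {a b : ℤ} {f g : Mor a b} (s t : Tm f g) : Rel (s.add t) (t.add s)
  | add_assoc {a b : ℤ} {f g : Mor a b} (s t u : Tm f g) :
      Rel ((s.add t).add u) (s.add (t.add u))
  | add_zero {a b : ℤ} {f g : Mor a b} (s : Tm f g) : Rel (s.add (Tm.zero f g)) s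
  | zero_smul {a b : ℤ} {f g : Mor a b} (s : Tm f g) : Rel (s.smul 0) (Tm.zero f g)
  | one_smul {a b : ℤ} {f g : Mor a b} (s : Tm f g) : Rel (s.smul 1) s
  | mul_smul {a b : ℤ} {f g : Mor a b} (c d : ℚ) (s : Tm f g) :
      Rel (s.smul (c * d)) ((s.smul d).smul c)
  | add_smul {a b : ℤ} {f g : Mor a b} (c d : ℚ) (s : Tm f g) :
      Rel (s.smul (c + d)) ((s.smul c).add (s.smul d))
  | smul_add {a b : ℤ} {f g : Mor a b} (c : ℚ) (s t : Tm f g) :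
      Rel ((s.add t).smul c) ((s.smul c).add (t.smul c))
  | add_comp {a b : ℤ} {f g h : Mor a b} (s s' : Tm f g) (t : Tm g h) :
      Rel (s.add s' ≫ₜ t) ((s ≫ₜ t).add (s' ≫ₜ t))
  | comp_add {a b : ℤ} {f g h : Mor a b} (s : Tm f g) (t t' : Tm g h) :
      Rel (s ≫ₜ t.add t') ((s ≫ₜ t).add (s ≫ₜ t'))
  | smul_comp {a b : ℤ} {f g h : Mor a b} (c : ℚ) (s : Tm f g) (t : Tm g h) :
      Rel (s.smul c ≫ₜ t) ((s ≫ₜ t).smul c)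
  | comp_smul {a b : ℤ} {f g h : Mor a b} (c : ℚ) (s : Tm f g) (t : Tm g h) :
      Rel (s ≫ₜ t.smul c) ((s ≫ₜ t).smul c)
  | whiskerLeft_add {a b c : ℤ} (f : Mor a b) {g h : Mor b c} (s t : Tm g h) :
      Rel (f ◁ₜ s.add t) ((f ◁ₜ s).add (f ◁ₜ t))
  | whiskerLeft_smul {a b c : ℤ} (f : Mor a b) {g h : Mor b c} (r : ℚ) (s : Tm g h) :
      Rel (f ◁ₜ s.smul r) ((f ◁ₜ s).smul r)
  | add_whiskerRight {a b c : ℤ} {f g : Mor a b} (h : Mor b c) (s t : Tm f g) :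
      Rel (s.add t ▷ₜ h) ((s ▷ₜ h).add (t ▷ₜ h))
  | smul_whiskerRight {a b c : ℤ} {f g : Mor a b} (h : Mor b c) (r : ℚ) (s : Tm f g) :
      Rel (s.smul r ▷ₜ h) ((s ▷ₜ h).smul r)
  -- shifts and direct sums
  | toShift_ofShift {a b : ℤ} (f : Mor a b) (s : ℤ) :
      Rel (Tm.toShift f s ≫ₜ Tm.ofShift f s) (Tm.id f)
  | ofShift_toShift {a b : ℤ} (f : Mor a b) (s : ℤ) :
      Rel (Tm.ofShift f s ≫ₜ Tm.toShift f s) (Tm.id (f.shift s))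
  | inl_fst {a b : ℤ} (f g : Mor a b) : Rel (Tm.inl f g ≫ₜ Tm.fst f g) (Tm.id f)
  | inl_snd {a b : ℤ} (f g : Mor a b) : Rel (Tm.inl f g ≫ₜ Tm.snd f g) (Tm.zero f g)
  | inr_fst {a b : ℤ} (f g : Mor a b) : Rel (Tm.inr f g ≫ₜ Tm.fst f g) (Tm.zero g f)
  | inr_snd {a b : ℤ} (f g : Mor a b) : Rel (Tm.inr f g ≫ₜ Tm.snd f g) (Tm.id g)
  | sum_total {a b : ℤ} (f g : Mor a b) :
      Rel ((Tm.fst f g ≫ₜ Tm.inl f g).add (Tm.snd f g ≫ₜ Tm.inr f g)) (Tm.id (f.sum g))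
  | id_zero (a b : ℤ) : Rel (Tm.id (Mor.zero a b)) (Tm.zero _ _)

end

/-- Objects of the 2-category `U*`: weights. -/
structure Ustar where
  wt : ℤ

instance : CategoryStruct Ustar where
  Hom a b := Mor a.wt b.wt
  id a := Mor.id a.wt
  comp f g := Mor.comp f g

/-- The 2-morphisms of `U*`. -/
abbrev Cell {n m : ℤ} (f g : Mor n m) : Type := Quot (@Rel n m f g)

instance (a b : Ustar) : Category (a ⟶ b) where
  Hom f g := Cell (n := a.wt) (m := b.wt) f g
  id f := Quot.mk _ (Tm.id f)
  comp := Quot.map₂ Tm.comp Rel.comp_right Rel.comp_left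
  id_comp := by
    rintro f g ⟨η⟩
    exact Quot.sound (Rel.id_comp η)
  comp_id := by
    rintro f g ⟨η⟩
    exact Quot.sound (Rel.comp_id η)
  assoc := by
    rintro f g h i ⟨η⟩ ⟨θ⟩ ⟨ι⟩
    exact Quot.sound (Rel.assoc η θ ι)

/-- The 2-category `U*`. -/
instance : Bicategory Ustar where
  whiskerLeft := @fun _ _ _ f g h η => Quot.map (Tm.whiskerLeft f) (Rel.whiskerLeft f g h) η
  whiskerRight := @fun _ _ _ f g η h => Quot.map (Tm.whiskerRight h) (Rel.whiskerRight f g h) η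
  associator := @fun _ _ _ _ f g h =>
    { hom := Quot.mk _ (Tm.assoc f g h)
      inv := Quot.mk _ (Tm.assocInv f g h)
      hom_inv_id := Quot.sound (Rel.assoc_hom_inv f g h)
      inv_hom_id := Quot.sound (Rel.assoc_inv_hom f g h) }
  leftUnitor := @fun _ _ f =>
    { hom := Quot.mk _ (Tm.leftUnit f)
      inv := Quot.mk _ (Tm.leftUnitInv f)
      hom_inv_id := Quot.sound (Rel.leftUnit_hom_inv f)
      inv_hom_id := Quot.sound (Rel.leftUnit_inv_hom f) }
  rightUnitor := @fun _ _ f =>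
    { hom := Quot.mk _ (Tm.rightUnit f)
      inv := Quot.mk _ (Tm.rightUnitInv f)
      hom_inv_id := Quot.sound (Rel.rightUnit_hom_inv f)
      inv_hom_id := Quot.sound (Rel.rightUnit_inv_hom f) }
  whiskerLeft_id := @fun _ _ _ f g => Quot.sound (Rel.whiskerLeft_id f g)
  whiskerLeft_comp := by
    rintro a b c f g h i ⟨η⟩ ⟨θ⟩
    exact Quot.sound (Rel.whiskerLeft_comp f η θ)
  id_whiskerLeft := by
    rintro a b f g ⟨η⟩
    exact Quot.sound (Rel.id_whiskerLeft η)
  comp_whiskerLeft := by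
    rintro a b c d f g h h' ⟨η⟩
    exact Quot.sound (Rel.comp_whiskerLeft f g η)
  id_whiskerRight := @fun _ _ _ f g => Quot.sound (Rel.id_whiskerRight f g)
  comp_whiskerRight := by
    rintro a b c f g h ⟨η⟩ ⟨θ⟩ i
    exact Quot.sound (Rel.comp_whiskerRight i η θ)
  whiskerRight_id := by
    rintro a b f g ⟨η⟩
    exact Quot.sound (Rel.whiskerRight_id η)
  whiskerRight_comp := by
    rintro a b c d f f' ⟨η⟩ g h
    exact Quot.sound (Rel.whiskerRight_comp g h η)
  whisker_assoc := by
    rintro a b c d f g g' ⟨η⟩ h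
    exact Quot.sound (Rel.whisker_assoc f η h)
  whisker_exchange := by
    rintro a b c f g h i ⟨η⟩ ⟨θ⟩
    exact Quot.sound (Rel.whisker_exchange η θ)
  pentagon := @fun _ _ _ _ _ f g h i => Quot.sound (Rel.pentagon f g h i)
  triangle := @fun _ _ _ f g => Quot.sound (Rel.triangle f g)

universe w v u

/-- Data cutting a (not necessarily full) sub-bicategory out of a bicategory `B`: a family of
objects, and classes of 1- and 2-morphisms closed under all operations. -/
structure SubData (B : Type u) [Bicategory.{w, v} B] (ι : Type) where
  obj : ι → B
  P₁ : ∀ {a b : ι}, (obj a ⟶ obj b) → Prop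
  P₂ : ∀ {a b : ι} {f g : obj a ⟶ obj b}, (f ⟶ g) → Prop
  id₁ : ∀ a, P₁ (𝟙 (obj a))
  comp₁ : ∀ {a b c} {f : obj a ⟶ obj b} {g : obj b ⟶ obj c}, P₁ f → P₁ g → P₁ (f ≫ g)
  id₂ : ∀ {a b} (f : obj a ⟶ obj b), P₂ (𝟙 f)
  comp₂ : ∀ {a b} {f g h : obj a ⟶ obj b} {η : f ⟶ g} {θ : g ⟶ h}, P₂ η → P₂ θ → P₂ (η ≫ θ)
  left₂ : ∀ {a b c} (f : obj a ⟶ obj b) {g h : obj b ⟶ obj c} {η : g ⟶ h},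
    P₂ η → P₂ (f ◁ η)
  right₂ : ∀ {a b c} {f g : obj a ⟶ obj b} (h : obj b ⟶ obj c) {η : f ⟶ g},
    P₂ η → P₂ (η ▷ h)
  assoc₂ : ∀ {a b c d} (f : obj a ⟶ obj b) (g : obj b ⟶ obj c) (h : obj c ⟶ obj d),
    P₂ (α_ f g h).hom ∧ P₂ (α_ f g h).inv
  leftUnit₂ : ∀ {a b} (f : obj a ⟶ obj b), P₂ (λ_ f).hom ∧ P₂ (λ_ f).inv
  rightUnit₂ : ∀ {a b} (f : obj a ⟶ obj b), P₂ (ρ_ f).hom ∧ P₂ (ρ_ f).inv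

/-- The sub-bicategory determined by `D`. -/
structure Sub {B : Type u} [Bicategory.{w, v} B] {ι : Type} (D : SubData B ι) where
  idx : ι

namespace Sub

variable {B : Type u} [Bicategory.{w, v} B] {ι : Type} {D : SubData B ι}

structure Hom₁ (a b : Sub D) where
  val : D.obj a.idx ⟶ D.obj b.idx
  prop : D.P₁ val

@[ext]
structure Hom₂ {a b : Sub D} (f g : Hom₁ a b) where
  val : f.val ⟶ g.val
  prop : D.P₂ val

instance : CategoryStruct (Sub D) where
  Hom a b := Hom₁ a b
  id a := ⟨𝟙 (D.obj a.idx), D.id₁ a.idx⟩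
  comp f g := ⟨f.val ≫ g.val, D.comp₁ f.prop g.prop⟩

instance homCat (a b : Sub D) : Category (a ⟶ b) where
  Hom f g := Hom₂ f g
  id f := ⟨𝟙 f.val, D.id₂ f.val⟩
  comp η θ := ⟨η.val ≫ θ.val, D.comp₂ η.prop θ.prop⟩
  id_comp η := Hom₂.ext (Category.id_comp η.val)
  comp_id η := Hom₂.ext (Category.comp_id η.val)
  assoc η θ κ := Hom₂.ext (Category.assoc η.val θ.val κ.val)

/-- An invertible 2-morphism of the sub-bicategory. -/
def isoMk {a b : Sub D} {f g : a ⟶ b} (e : f.val ≅ g.val) (h : D.P₂ e.hom ∧ D.P₂ e.inv) :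
    f ≅ g where
  hom := (⟨e.hom, h.1⟩ : Hom₂ f g)
  inv := (⟨e.inv, h.2⟩ : Hom₂ g f)
  hom_inv_id := Hom₂.ext e.hom_inv_id
  inv_hom_id := Hom₂.ext e.inv_hom_id

def wl {a b c : Sub D} (f : a ⟶ b) {g h : b ⟶ c} (η : g ⟶ h) : f ≫ g ⟶ f ≫ h :=
  (⟨f.val ◁ η.val, D.left₂ f.val η.prop⟩ : Hom₂ (f ≫ g) (f ≫ h))

def wr {a b c : Sub D} {f g : a ⟶ b} (η : f ⟶ g) (h : b ⟶ c) : f ≫ h ⟶ g ≫ h :=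
  (⟨η.val ▷ h.val, D.right₂ h.val η.prop⟩ : Hom₂ (f ≫ h) (g ≫ h))

instance : Bicategory (Sub D) where
  homCategory a b := homCat a b
  whiskerLeft f _ _ η := wl f η
  whiskerRight η h := wr η h
  associator f g h := isoMk (α_ f.val g.val h.val) (D.assoc₂ _ _ _)
  leftUnitor f := isoMk (λ_ f.val) (D.leftUnit₂ _)
  rightUnitor f := isoMk (ρ_ f.val) (D.rightUnit₂ _)
  whiskerLeft_id f g := Hom₂.ext (Bicategory.whiskerLeft_id f.val g.val)
  whiskerLeft_comp f _ _ _ η θ := Hom₂.ext (Bicategory.whiskerLeft_comp f.val η.val θ.val)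
  id_whiskerLeft η := Hom₂.ext (Bicategory.id_whiskerLeft η.val)
  comp_whiskerLeft f g _ _ η := Hom₂.ext (Bicategory.comp_whiskerLeft f.val g.val η.val)
  id_whiskerRight f g := Hom₂.ext (Bicategory.id_whiskerRight f.val g.val)
  comp_whiskerRight η θ i := Hom₂.ext (Bicategory.comp_whiskerRight η.val θ.val i.val)
  whiskerRight_id η := Hom₂.ext (Bicategory.whiskerRight_id η.val)
  whiskerRight_comp η g h := Hom₂.ext (Bicategory.whiskerRight_comp η.val g.val h.val)
  whisker_assoc f _ _ η h := Hom₂.ext (Bicategory.whisker_assoc f.val η.val h.val)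
  whisker_exchange η θ := Hom₂.ext (Bicategory.whisker_exchange η.val θ.val)
  pentagon f g h i := Hom₂.ext (Bicategory.pentagon f.val g.val h.val i.val)
  triangle f g := Hom₂.ext (Bicategory.triangle f.val g.val)

end Sub

/-- The data defining `𝒰 ⊆ 𝒰*`: all objects and 1-morphisms, and the 2-morphisms of degree zero. -/
def UData : SubData Ustar ℤ where
  obj n := ⟨n⟩
  P₁ _ := True
  P₂ {a b f g} η := ∃ t : Tm (n := a) (m := b) f g, HasDeg t 0 ∧ η = Quot.mk _ t
  id₁ _ := trivial
  comp₁ _ _ := trivial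
  id₂ f := ⟨Tm.id f, .id _, rfl⟩
  comp₂ := by
    rintro a b f g h _ _ ⟨s, hs, rfl⟩ ⟨t, ht, rfl⟩
    exact ⟨s.comp t, by simpa using hs.comp ht, rfl⟩
  left₂ := by
    rintro a b c f g h _ ⟨t, ht, rfl⟩
    exact ⟨t.whiskerLeft f, ht.whiskerLeft f, rfl⟩
  right₂ := by
    rintro a b c f g h _ ⟨t, ht, rfl⟩
    exact ⟨t.whiskerRight h, ht.whiskerRight h, rfl⟩
  assoc₂ f g h := ⟨⟨Tm.assoc f g h, .assoc _ _ _, rfl⟩, ⟨Tm.assocInv f g h, .assocInv _ _ _, rfl⟩⟩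
  leftUnit₂ f := ⟨⟨Tm.leftUnit f, .leftUnit _, rfl⟩, ⟨Tm.leftUnitInv f, .leftUnitInv _, rfl⟩⟩
  rightUnit₂ f := ⟨⟨Tm.rightUnit f, .rightUnit _, rfl⟩, ⟨Tm.rightUnitInv f, .rightUnitInv _, rfl⟩⟩

/-- The 2-category `𝒰`. -/
abbrev Ucat := Sub UData

/-- The local Karoubi envelope of a bicategory: the objects are the same, and the categories of
1-morphisms are replaced by their Karoubi envelopes. -/
structure Kar (B : Type u) where
  as : B

namespace Kar

open Idempotents

variable {B : Type u} [Bicategory.{w, v} B]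

section horizontal

variable {a b c d : B}

/-- Horizontal composition of 2-morphisms. -/
def hc {f f' : a ⟶ b} {g g' : b ⟶ c} (η : f ⟶ f') (θ : g ⟶ g') : f ≫ g ⟶ f' ≫ g' :=
  η ▷ g ≫ f' ◁ θ

theorem hc_comp {f f' f'' : a ⟶ b} {g g' g'' : b ⟶ c} (η : f ⟶ f') (η' : f' ⟶ f'')
    (θ : g ⟶ g') (θ' : g' ⟶ g'') : hc η θ ≫ hc η' θ' = hc (η ≫ η') (θ ≫ θ') := by
  simp only [hc, Category.assoc, comp_whiskerRight, Bicategory.whiskerLeft_comp,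
    whisker_exchange_assoc]

theorem hc_id (f : a ⟶ b) (g : b ⟶ c) : hc (𝟙 f) (𝟙 g) = 𝟙 (f ≫ g) := by simp [hc]

theorem hc_assoc {f f' : a ⟶ b} {g g' : b ⟶ c} {h h' : c ⟶ d} (η : f ⟶ f') (θ : g ⟶ g')
    (κ : h ⟶ h') : hc (hc η θ) κ ≫ (α_ f' g' h').hom = (α_ f g h).hom ≫ hc η (hc θ κ) := by
  simp [hc]

theorem hc_leftUnit {f f' : a ⟶ b} (η : f ⟶ f') :
    hc (𝟙 (𝟙 a)) η ≫ (λ_ f').hom = (λ_ f).hom ≫ η := by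
  simp [hc]

theorem hc_rightUnit {f f' : a ⟶ b} (η : f ⟶ f') :
    hc η (𝟙 (𝟙 b)) ≫ (ρ_ f').hom = (ρ_ f).hom ≫ η := by
  simp [hc]

end horizontal

instance : CategoryStruct (Kar B) where
  Hom a b := Karoubi (a.as ⟶ b.as)
  id a := ⟨𝟙 a.as, 𝟙 _, Category.id_comp _⟩
  comp P Q := ⟨P.X ≫ Q.X, hc P.p Q.p, by rw [hc_comp, P.idem, Q.idem]⟩

instance homCat (a b : Kar B) : Category (a ⟶ b) :=
  inferInstanceAs (Category (Karoubi (a.as ⟶ b.as)))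

/-- An invertible morphism in a Karoubi envelope. -/
def isoMk {C : Type u} [Category.{v} C] {P Q : Karoubi C} (e : P.X ≅ Q.X)
    (h : P.p ≫ e.hom = e.hom ≫ Q.p) : P ≅ Q where
  hom := ⟨P.p ≫ e.hom, by rw [Category.assoc, ← h, P.idem_assoc, P.idem_assoc]⟩
  inv := ⟨Q.p ≫ e.inv, by
    have : Q.p ≫ e.inv = e.inv ≫ P.p := by
      rw [Iso.comp_inv_eq, Category.assoc, h, e.inv_hom_id_assoc]
    rw [Category.assoc, ← this, Q.idem_assoc, Q.idem_assoc]⟩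
  hom_inv_id := by
    apply Karoubi.hom_ext
    change (P.p ≫ e.hom) ≫ (Q.p ≫ e.inv) = P.p
    rw [Category.assoc, ← reassoc_of% h, e.hom_inv_id, Category.comp_id, P.idem]
  inv_hom_id := by
    apply Karoubi.hom_ext
    change (Q.p ≫ e.inv) ≫ (P.p ≫ e.hom) = Q.p
    rw [Category.assoc, h, e.inv_hom_id_assoc, Q.idem]

def wl {a b c : Kar B} (P : a ⟶ b) {Q R : b ⟶ c} (η : Q ⟶ R) : P ≫ Q ⟶ P ≫ R :=
  (⟨hc P.p η.f, by
    change hc P.p Q.p ≫ hc P.p η.f ≫ hc P.p R.p = _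
    rw [hc_comp, hc_comp, P.idem, P.idem, η.comm]⟩ : Karoubi.Hom (P ≫ Q) (P ≫ R))

def wr {a b c : Kar B} {P Q : a ⟶ b} (η : P ⟶ Q) (R : b ⟶ c) : P ≫ R ⟶ Q ≫ R :=
  (⟨hc η.f R.p, by
    change hc P.p R.p ≫ hc η.f R.p ≫ hc Q.p R.p = _
    rw [hc_comp, hc_comp, R.idem, R.idem, η.comm]⟩ : Karoubi.Hom (P ≫ R) (Q ≫ R))

def assoc {a b c d : Kar B} (P : a ⟶ b) (Q : b ⟶ c) (R : c ⟶ d) :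
    (P ≫ Q) ≫ R ≅ P ≫ Q ≫ R :=
  isoMk (P := (P ≫ Q) ≫ R) (Q := P ≫ Q ≫ R) (α_ P.X Q.X R.X) (hc_assoc P.p Q.p R.p)

def leftUnit {a b : Kar B} (P : a ⟶ b) : 𝟙 a ≫ P ≅ P :=
  isoMk (P := 𝟙 a ≫ P) (Q := P) (λ_ P.X) (hc_leftUnit P.p)

def rightUnit {a b : Kar B} (P : a ⟶ b) : P ≫ 𝟙 b ≅ P :=
  isoMk (P := P ≫ 𝟙 b) (Q := P) (ρ_ P.X) (hc_rightUnit P.p)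

section

variable {a b c d : B}

theorem ax_id_left {P Q : Karoubi (a ⟶ b)} (η : P ⟶ Q) :
    hc (𝟙 (𝟙 a)) η.f = (hc (𝟙 (𝟙 a)) P.p ≫ (λ_ P.X).hom) ≫ η.f ≫ Q.p ≫ (λ_ Q.X).inv := by
  rw [Karoubi.comp_p_assoc, ← Category.assoc, Iso.eq_comp_inv, hc_leftUnit, hc_leftUnit,
    Category.assoc, Karoubi.p_comp]

theorem ax_id_right {P Q : Karoubi (a ⟶ b)} (η : P ⟶ Q) :
    hc η.f (𝟙 (𝟙 b)) = (hc P.p (𝟙 (𝟙 b)) ≫ (ρ_ P.X).hom) ≫ η.f ≫ Q.p ≫ (ρ_ Q.X).inv := by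
  rw [Karoubi.comp_p_assoc, ← Category.assoc, Iso.eq_comp_inv, hc_rightUnit, hc_rightUnit,
    Category.assoc, Karoubi.p_comp]

/-- Naturality of the associators of the Karoubi envelope. -/
theorem ax_assoc {P P' : Karoubi (a ⟶ b)} {Q Q' : Karoubi (b ⟶ c)} {R R' : Karoubi (c ⟶ d)}
    (η : P ⟶ P') (θ : Q ⟶ Q') (κ : R ⟶ R') :
    hc (hc η.f θ.f) κ.f = (hc (hc P.p Q.p) R.p ≫ (α_ P.X Q.X R.X).hom) ≫ hc η.f (hc θ.f κ.f) ≫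
      hc P'.p (hc Q'.p R'.p) ≫ (α_ P'.X Q'.X R'.X).inv := by
  have h : hc η.f (hc θ.f κ.f) ≫ hc P'.p (hc Q'.p R'.p) = hc η.f (hc θ.f κ.f) := by
    rw [hc_comp, hc_comp, Karoubi.comp_p, Karoubi.comp_p, Karoubi.comp_p]
  have h' : hc (hc P.p Q.p) R.p ≫ hc (hc η.f θ.f) κ.f = hc (hc η.f θ.f) κ.f := by
    rw [hc_comp, hc_comp, Karoubi.p_comp, Karoubi.p_comp, Karoubi.p_comp]
  rw [reassoc_of% h, ← Category.assoc, Iso.eq_comp_inv, Category.assoc, ← hc_assoc,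
    reassoc_of% h']

theorem ax_assoc' {P P' : Karoubi (a ⟶ b)} {Q Q' : Karoubi (b ⟶ c)} {R R' : Karoubi (c ⟶ d)}
    (η : P ⟶ P') (θ : Q ⟶ Q') (κ : R ⟶ R') :
    hc η.f (hc θ.f κ.f) = (hc P.p (hc Q.p R.p) ≫ (α_ P.X Q.X R.X).inv) ≫ hc (hc η.f θ.f) κ.f ≫
      hc (hc P'.p Q'.p) R'.p ≫ (α_ P'.X Q'.X R'.X).hom := by
  have h : hc (hc η.f θ.f) κ.f ≫ hc (hc P'.p Q'.p) R'.p = hc (hc η.f θ.f) κ.f := by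
    rw [hc_comp, hc_comp, Karoubi.comp_p, Karoubi.comp_p, Karoubi.comp_p]
  have h' : hc P.p (hc Q.p R.p) ≫ hc η.f (hc θ.f κ.f) = hc η.f (hc θ.f κ.f) := by
    rw [hc_comp, hc_comp, Karoubi.p_comp, Karoubi.p_comp, Karoubi.p_comp]
  rw [reassoc_of% h, hc_assoc, Category.assoc, Iso.inv_hom_id_assoc, h']

theorem ax_pentagon {e : B} (P : Karoubi (a ⟶ b)) (Q : Karoubi (b ⟶ c)) (R : Karoubi (c ⟶ d))
    (S : Karoubi (d ⟶ e)) :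
    hc (hc (hc P.p Q.p) R.p ≫ (α_ P.X Q.X R.X).hom) S.p ≫
      (hc (hc P.p (hc Q.p R.p)) S.p ≫ (α_ P.X (Q.X ≫ R.X) S.X).hom) ≫
        hc P.p (hc (hc Q.p R.p) S.p ≫ (α_ Q.X R.X S.X).hom) =
    (hc (hc (hc P.p Q.p) R.p) S.p ≫ (α_ (P.X ≫ Q.X) R.X S.X).hom) ≫
      hc (hc P.p Q.p) (hc R.p S.p) ≫ (α_ P.X Q.X (R.X ≫ S.X)).hom := by
  have e1 : hc (hc (hc P.p Q.p) R.p ≫ (α_ P.X Q.X R.X).hom) S.p =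
      hc (hc (hc P.p Q.p) R.p) S.p ≫ (α_ P.X Q.X R.X).hom ▷ S.X := by
    rw [← Category.comp_id S.p, ← hc_comp, Category.comp_id]
    simp [hc]
  have e2 : hc P.p (hc (hc Q.p R.p) S.p ≫ (α_ Q.X R.X S.X).hom) =
      hc P.p (hc (hc Q.p R.p) S.p) ≫ P.X ◁ (α_ Q.X R.X S.X).hom := by
    rw [← Category.comp_id P.p, ← hc_comp, Category.comp_id]
    simp [hc]
  have e3 : (α_ P.X Q.X R.X).hom ▷ S.X ≫ hc (hc P.p (hc Q.p R.p)) S.p =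
      hc (hc (hc P.p Q.p) R.p) S.p ≫ (α_ P.X Q.X R.X).hom ▷ S.X := by
    have : (α_ P.X Q.X R.X).hom ▷ S.X = hc (α_ P.X Q.X R.X).hom (𝟙 S.X) := by simp [hc]
    rw [this, hc_comp, hc_comp, hc_assoc, Category.comp_id, Category.id_comp]
  have i4 : hc (hc (hc P.p Q.p) R.p) S.p ≫ hc (hc (hc P.p Q.p) R.p) S.p =
      hc (hc (hc P.p Q.p) R.p) S.p := by
    simp only [hc_comp, Karoubi.idem]
  rw [e1, e2]
  simp only [Category.assoc]
  rw [reassoc_of% e3, reassoc_of% i4]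
  have e5 : (α_ P.X (Q.X ≫ R.X) S.X).hom ≫ hc P.p (hc (hc Q.p R.p) S.p) =
      hc (hc P.p (hc Q.p R.p)) S.p ≫ (α_ P.X (Q.X ≫ R.X) S.X).hom := (hc_assoc _ _ _).symm
  rw [reassoc_of% e5, reassoc_of% e3, reassoc_of% i4, Bicategory.pentagon]
  have e6 : (α_ (P.X ≫ Q.X) R.X S.X).hom ≫ hc (hc P.p Q.p) (hc R.p S.p) =
      hc (hc (hc P.p Q.p) R.p) S.p ≫ (α_ (P.X ≫ Q.X) R.X S.X).hom := (hc_assoc _ _ _).symm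
  rw [reassoc_of% e6, reassoc_of% i4]

theorem ax_triangle (P : Karoubi (a ⟶ b)) (Q : Karoubi (b ⟶ c)) :
    (hc (hc P.p (𝟙 (𝟙 b))) Q.p ≫ (α_ P.X (𝟙 b) Q.X).hom) ≫
      hc P.p (hc (𝟙 (𝟙 b)) Q.p ≫ (λ_ Q.X).hom) =
    hc (hc P.p (𝟙 (𝟙 b)) ≫ (ρ_ P.X).hom) Q.p := by
  have e1 : hc P.p (hc (𝟙 (𝟙 b)) Q.p ≫ (λ_ Q.X).hom) =
      hc P.p (hc (𝟙 (𝟙 b)) Q.p) ≫ P.X ◁ (λ_ Q.X).hom := by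
    rw [← Category.comp_id P.p, ← hc_comp, Category.comp_id]
    simp [hc]
  have e2 : hc (hc P.p (𝟙 (𝟙 b)) ≫ (ρ_ P.X).hom) Q.p =
      hc (hc P.p (𝟙 (𝟙 b))) Q.p ≫ (ρ_ P.X).hom ▷ Q.X := by
    rw [← Category.comp_id Q.p, ← hc_comp, Category.comp_id]
    simp [hc]
  rw [e1, e2, ← Bicategory.triangle, Category.assoc, ← Category.assoc _ (hc _ _), ← hc_assoc,
    Category.assoc, ← Category.assoc]
  simp only [hc_comp, Karoubi.idem, Category.comp_id]

end

instance : Bicategory (Kar B) where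
  homCategory a b := homCat a b
  whiskerLeft P _ _ η := wl P η
  whiskerRight η R := wr η R
  associator P Q R := assoc P Q R
  leftUnitor P := leftUnit P
  rightUnitor P := rightUnit P
  whiskerLeft_id _ _ := rfl
  whiskerLeft_comp P _ _ _ η θ := Karoubi.hom_ext _ _ (by
    change hc P.p (η.f ≫ θ.f) = hc P.p η.f ≫ hc P.p θ.f
    rw [hc_comp, P.idem])
  id_whiskerLeft η := Karoubi.hom_ext _ _ (ax_id_left η)
  comp_whiskerLeft P Q _ _ η := Karoubi.hom_ext _ _ (ax_assoc (𝟙 P) (𝟙 Q) η)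
  id_whiskerRight _ _ := rfl
  comp_whiskerRight η θ R := Karoubi.hom_ext _ _ (by
    change hc (η.f ≫ θ.f) R.p = hc η.f R.p ≫ hc θ.f R.p
    rw [hc_comp, R.idem])
  whiskerRight_id η := Karoubi.hom_ext _ _ (ax_id_right η)
  whiskerRight_comp η Q R := Karoubi.hom_ext _ _ (ax_assoc' η (𝟙 Q) (𝟙 R))
  whisker_assoc P _ _ η R := Karoubi.hom_ext _ _ (ax_assoc (𝟙 P) η (𝟙 R))
  whisker_exchange {a b c P Q R S} η θ := Karoubi.hom_ext _ _ (by
    change hc P.p θ.f ≫ hc η.f S.p = hc η.f R.p ≫ hc Q.p θ.f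
    rw [hc_comp, hc_comp, Karoubi.comp_p, Karoubi.comp_p, Karoubi.p_comp, Karoubi.p_comp])
  pentagon P Q R S := Karoubi.hom_ext _ _ (ax_pentagon P Q R S)
  triangle P Q := Karoubi.hom_ext _ _ (ax_triangle P Q)

/-- The inclusion of a bicategory in its local Karoubi envelope. -/
def incl (B : Type u) [Bicategory.{w, v} B] : Pseudofunctor B (Kar B) where
  obj a := ⟨a⟩
  map {a b} f := (⟨f, 𝟙 f, Category.comp_id _⟩ : Karoubi (a ⟶ b))
  map₂ {a b f g} η := (⟨η, by simp⟩ :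
    Karoubi.Hom (⟨f, 𝟙 f, Category.comp_id _⟩ : Karoubi (a ⟶ b)) ⟨g, 𝟙 g, Category.comp_id _⟩)
  mapId a := Iso.refl _
  mapComp {a b c} f g := isoMk (P := (⟨f ≫ g, 𝟙 _, Category.comp_id _⟩ : Karoubi (a ⟶ c)))
    (Q := ⟨f ≫ g, hc (𝟙 f) (𝟙 g), by rw [hc_id, Category.comp_id]⟩) (Iso.refl _) (by simp [hc_id])
  map₂_id _ := rfl
  map₂_comp _ _ := rfl
  map₂_whisker_left {a b c} f {g h} η := Karoubi.hom_ext _ _ (by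
    change f ◁ η = (𝟙 (f ≫ g) ≫ 𝟙 (f ≫ g)) ≫ hc (𝟙 f) η ≫ hc (𝟙 f) (𝟙 h) ≫ 𝟙 (f ≫ h)
    simp [hc])
  map₂_whisker_right {a b c f g} η h := Karoubi.hom_ext _ _ (by
    change η ▷ h = (𝟙 (f ≫ h) ≫ 𝟙 (f ≫ h)) ≫ hc η (𝟙 h) ≫ hc (𝟙 g) (𝟙 h) ≫ 𝟙 (g ≫ h)
    simp [hc])
  map₂_associator {a b c d} f g h := Karoubi.hom_ext _ _ (by
    change (α_ f g h).hom = (𝟙 ((f ≫ g) ≫ h) ≫ 𝟙 ((f ≫ g) ≫ h)) ≫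
      hc (𝟙 (f ≫ g) ≫ 𝟙 (f ≫ g)) (𝟙 h) ≫ (hc (hc (𝟙 f) (𝟙 g)) (𝟙 h) ≫ (α_ f g h).hom) ≫
      hc (𝟙 f) (hc (𝟙 g) (𝟙 h) ≫ 𝟙 (g ≫ h)) ≫ hc (𝟙 f) (𝟙 (g ≫ h)) ≫ 𝟙 (f ≫ g ≫ h)
    simp [hc])
  map₂_left_unitor {a b} f := Karoubi.hom_ext _ _ (by
    change (λ_ f).hom = (𝟙 (𝟙 a ≫ f) ≫ 𝟙 (𝟙 a ≫ f)) ≫ hc (𝟙 (𝟙 a)) (𝟙 f) ≫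
      hc (𝟙 (𝟙 a)) (𝟙 f) ≫ (λ_ f).hom
    simp [hc])
  map₂_right_unitor {a b} f := Karoubi.hom_ext _ _ (by
    change (ρ_ f).hom = (𝟙 (f ≫ 𝟙 b) ≫ 𝟙 (f ≫ 𝟙 b)) ≫ hc (𝟙 f) (𝟙 (𝟙 b)) ≫
      hc (𝟙 f) (𝟙 (𝟙 b)) ≫ (ρ_ f).hom
    simp [hc])

end Kar

namespace GrAlg

/-- A polynomial ring over `ℚ`, graded by giving the variable `i` the degree `w i`. -/
noncomputable def poly (σ : Type) (w : σ → ℤ) : GrAlg where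
  carrier := MvPolynomial σ ℚ
  gr := MvPolynomial.weightedHomogeneousSubmodule ℚ w
  one_mem := MvPolynomial.isWeightedHomogeneous_one ℚ w
  mul_mem ha hb := MvPolynomial.IsWeightedHomogeneous.mul ha hb
  internal := by
    classical
    let _ := MvPolynomial.weightedGradedAlgebra ℚ w
    exact DirectSum.Decomposition.isInternal (MvPolynomial.weightedHomogeneousSubmodule ℚ w)

theorem poly_X_mem {σ : Type} (w : σ → ℤ) (i : σ) {d : ℤ} (h : w i = d) :
    (MvPolynomial.X i : MvPolynomial σ ℚ) ∈ (poly σ w).gr d :=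
  h ▸ MvPolynomial.isWeightedHomogeneous_X ℚ w i

theorem total_mapRange {M P : Type} [AddCommGroup M] [Module ℚ M] [AddCommGroup P] [Module ℚ P]
    (L : M →ₗ[ℚ] P) (x : ℤ →₀ M) :
    total P (Finsupp.mapRange.linearMap L x) = L (total M x) := by
  have : (total P).comp (Finsupp.mapRange.linearMap L) = L.comp (total M) := by
    ext; simp
  exact LinearMap.congr_fun this x

/-- `A` if the proposition `p` holds, and the zero ring otherwise: functions on a set with at most
one element. -/
def cond (p : Prop) (A : GrAlg) : GrAlg where
  carrier := PLift p → A.carrier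
  gr d := Submodule.pi Set.univ fun _ => A.gr d
  one_mem _ _ := A.one_mem
  mul_mem ha hb h _ := A.mul_mem (ha h trivial) (hb h trivial)
  internal := by
    by_cases h : p
    · refine isInternal_of_components _ ((Finsupp.mapRange.linearMap
        (LinearMap.pi fun _ : PLift p => LinearMap.id)).comp
        ((components A.internal).comp (LinearMap.proj ⟨h⟩))) ?_ ?_ ?_
      · intro m i j _
        simpa using components_mem A.internal (m ⟨h⟩) i
      · intro m
        rw [LinearMap.comp_apply, total_mapRange, LinearMap.comp_apply, components_sum]
        funext j
        obtain rfl : j = ⟨h⟩ := Subsingleton.elim _ _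
        rfl
      · intro i m hm
        rw [LinearMap.comp_apply, LinearMap.comp_apply]
        refine (congrArg _ (components_of_mem A.internal (hm ⟨h⟩ trivial))).trans ?_
        rw [Finsupp.mapRange.linearMap_apply, Finsupp.mapRange_single]
        congr 1
    · have : IsEmpty (PLift p) := ⟨fun x => h x.down⟩
      refine isInternal_of_components _ 0 (fun m i j _ => isEmptyElim j)
        (fun m => Subsingleton.elim _ _) fun i m _ => ?_
      rw [Subsingleton.elim m 0]; exact (Finsupp.single_zero i).symm

theorem pow_mem (A : GrAlg) {i : ℤ} {a : A.carrier} (h : a ∈ A.gr i) (n : ℕ) :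
    a ^ n ∈ A.gr (n * i) := by
  induction n with
  | zero => simpa using A.one_mem
  | succ n ih =>
    rw [pow_succ]
    have := A.mul_mem ih h
    convert this using 2
    push_cast; ring

theorem prod_mem (A : GrAlg) {ι : Type} (s : Finset ι) (f : ι → A.carrier) (w : ι → ℤ)
    (h : ∀ i ∈ s, f i ∈ A.gr (w i)) : ∏ i ∈ s, f i ∈ A.gr (∑ i ∈ s, w i) := by
  classical
  induction s using Finset.induction_on with
  | empty => simpa using A.one_mem
  | insert a s ha ih =>
    rw [Finset.prod_insert ha, Finset.sum_insert ha]
    exact A.mul_mem (h a (Finset.mem_insert_self _ _))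
      (ih fun i hi => h i (Finset.mem_insert_of_mem hi))

/-- Evaluation of weighted homogeneous polynomials at homogeneous elements. -/
theorem aeval_mem (A : GrAlg) {σ : Type} (w : σ → ℤ) (g : σ → A.carrier)
    (hg : ∀ i, g i ∈ A.gr (w i)) {d : ℤ} {p : MvPolynomial σ ℚ} (hp : p ∈ (poly σ w).gr d) :
    MvPolynomial.aeval g p ∈ A.gr d := by
  rw [MvPolynomial.aeval_def, MvPolynomial.eval₂_eq]
  refine sum_mem fun m hm => ?_
  have hd : Finsupp.weight w m = d := hp (MvPolynomial.mem_support_iff.1 hm)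
  rw [← Algebra.smul_def]
  refine Submodule.smul_mem _ _ ?_
  have := A.prod_mem m.support (fun i => g i ^ m i) (fun i => (m i : ℤ) * w i)
    fun i _ => A.pow_mem (hg i) (m i)
  rw [← hd, Finsupp.weight_apply]
  simpa [Finsupp.sum] using this

end GrAlg

/-- The bimodule structure on a graded algebra `C` coming from homomorphisms `A → C ← B`. -/
def GrBimod.ofHoms {A B C : GrAlg} (l : A.carrier →ₐ[ℚ] C.carrier) (r : B.carrier →ₐ[ℚ] C.carrier)
    (hl : ∀ d, ∀ a ∈ A.gr d, l a ∈ C.gr d) (hr : ∀ d, ∀ b ∈ B.gr d, r b ∈ C.gr d) :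
    GrBimod A B where
  carrier := C.carrier
  left := (Algebra.lmul ℚ C.carrier).comp l
  right := (Algebra.lmul ℚ C.carrier).comp r
  left_right a b m := mul_left_comm (l a) (r b) m
  gr := C.gr
  internal := C.internal
  left_mem ha hm := C.mul_mem (hl _ _ ha) hm
  right_mem hb hm := C.mul_mem (hr _ _ hb) hm

section flags

variable (N : ℕ) (n : ℤ)

/-- The weight `n` occurs in the `(N+1)`-dimensional representation: `n = 2k - N`, `0 ≤ k ≤ N`. -/
def Valid : Prop := ∃ k : ℕ, k ≤ N ∧ n = 2 * k - N

/-- `n = 2k - N` with `0 ≤ k < N`. -/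
def ValidE : Prop := ∃ k : ℕ, k < N ∧ n = 2 * k - N

/-- The number `k` with `n = 2k - N`. -/
def kk : ℕ := ((n + N) / 2).toNat

variable {N n}

theorem kk_eq {k : ℕ} (h : n = 2 * k - N) : kk N n = k := by
  unfold kk; omega

theorem ValidE.valid (h : ValidE N n) : Valid N n := by
  obtain ⟨k, hk, h⟩ := h; exact ⟨k, hk.le, h⟩

theorem ValidE.valid_succ (h : ValidE N n) : Valid N (n + 2) := by
  obtain ⟨k, hk, h⟩ := h; exact ⟨k + 1, hk, by push_cast; omega⟩

theorem ValidE.kk_succ (h : ValidE N n) : kk N (n + 2) = kk N n + 1 := by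
  obtain ⟨k, hk, h⟩ := h
  rw [kk_eq h, kk_eq (k := k + 1) (by push_cast; omega)]

theorem ValidE.kk_lt (h : ValidE N n) : kk N n < N := by
  obtain ⟨k, hk, h⟩ := h
  rwa [kk_eq h]

variable (N n)

/-- The variables `x_1, …, x_k, y_1, …, y_{N-k}` of `H_k^G`. -/
abbrev Var : Type := Fin (kk N n) ⊕ Fin (N - kk N n)

/-- The variables `x_1, …, x_k, ξ, y_1, …, y_{N-k-1}` of `H_{k,k+1}^G`. -/
abbrev VarE : Type := Fin (kk N n) ⊕ Unit ⊕ Fin (N - kk N n - 1)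

/-- The ring `H_k^G = ℚ[x_1, …, x_k, y_1, …, y_{N-k}]` with `deg x_j = deg y_j = 2j`, where
`n = 2k - N`; it is the zero ring if `n` is not of this form. -/
noncomputable def H : GrAlg := GrAlg.cond (Valid N n)
  (GrAlg.poly (Var N n)
    (Sum.elim (fun j => 2 * ((j : ℤ) + 1)) (fun j => 2 * ((j : ℤ) + 1))))

/-- The ring `H_{k,k+1}^G = ℚ[x_1, …, x_k, ξ, y_1, …, y_{N-k-1}]` with `deg x_j = deg y_j = 2j`,
`deg ξ = 2`, where `n = 2k - N` and `0 ≤ k < N`; it is the zero ring if `n` is not of this form. -/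
noncomputable def HE : GrAlg := GrAlg.cond (ValidE N n)
  (GrAlg.poly (VarE N n)
    (Sum.elim (fun j => 2 * ((j : ℤ) + 1)) (Sum.elim (fun _ => 2) (fun j => 2 * ((j : ℤ) + 1)))))

/-- `x_j ∈ H_k^G`, with `x_0 = 1` and `x_j = 0` for `j > k`. -/
noncomputable def x : ℕ → (H N n).carrier
  | 0 => 1
  | j + 1 => fun _ => if h : j < kk N n then MvPolynomial.X (Sum.inl ⟨j, h⟩) else
      (0 : MvPolynomial (Var N n) ℚ)

/-- `y_j ∈ H_k^G`, with `y_0 = 1` and `y_j = 0` for `j > N - k`. -/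
noncomputable def y : ℕ → (H N n).carrier
  | 0 => 1
  | j + 1 => fun _ => if h : j < N - kk N n then MvPolynomial.X (Sum.inr ⟨j, h⟩) else
      (0 : MvPolynomial (Var N n) ℚ)

/-- `x_j ∈ H_{k,k+1}^G`, with `x_0 = 1` and `x_j = 0` for `j > k`. -/
noncomputable def xE : ℕ → (HE N n).carrier
  | 0 => 1
  | j + 1 => fun _ => if h : j < kk N n then MvPolynomial.X (Sum.inl ⟨j, h⟩) else
      (0 : MvPolynomial (VarE N n) ℚ)

/-- `y_j ∈ H_{k,k+1}^G`, with `y_0 = 1` and `y_j = 0` for `j > N - k - 1`. -/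
noncomputable def yE : ℕ → (HE N n).carrier
  | 0 => 1
  | j + 1 => fun _ => if h : j < N - kk N n - 1 then MvPolynomial.X (Sum.inr (Sum.inr ⟨j, h⟩)) else
      (0 : MvPolynomial (VarE N n) ℚ)

/-- `ξ ∈ H_{k,k+1}^G`. -/
noncomputable def xi : (HE N n).carrier := fun _ =>
  (MvPolynomial.X (Sum.inr (Sum.inl ())) : MvPolynomial (VarE N n) ℚ)

theorem xE_mem (j : ℕ) : xE N n j ∈ (HE N n).gr (2 * j) := by
  cases j with
  | zero => exact (HE N n).one_mem
  | succ j =>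
    intro _ _
    change (if h : j < kk N n then MvPolynomial.X (Sum.inl ⟨j, h⟩) else
      (0 : MvPolynomial (VarE N n) ℚ)) ∈ _
    split_ifs with h
    · exact GrAlg.poly_X_mem _ _ (by push_cast; rfl)
    · exact zero_mem _

theorem yE_mem (j : ℕ) : yE N n j ∈ (HE N n).gr (2 * j) := by
  cases j with
  | zero => exact (HE N n).one_mem
  | succ j =>
    intro _ _
    change (if h : j < N - kk N n - 1 then MvPolynomial.X (Sum.inr (Sum.inr ⟨j, h⟩)) else
      (0 : MvPolynomial (VarE N n) ℚ)) ∈ _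
    split_ifs with h
    · exact GrAlg.poly_X_mem _ _ (by push_cast; rfl)
    · exact zero_mem _

theorem xi_mem : xi N n ∈ (HE N n).gr 2 := by
  intro _ _
  exact MvPolynomial.isWeightedHomogeneous_X ℚ _ _

/-- The images in `H_{k,k+1}^G` of the generators of `H_k^G`:
`x_j ↦ x_j` and `y_j ↦ y_j + ξ y_{j-1}`. -/
noncomputable def lGen : Var N n → (HE N n).carrier :=
  Sum.elim (fun j => xE N n (j + 1)) (fun j => yE N n (j + 1) + xi N n * yE N n j)

/-- The images in `H_{k,k+1}^G` of the generators of `H_{k+1}^G`: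
`x_j ↦ x_j + ξ x_{j-1}` and `y_j ↦ y_j`. -/
noncomputable def rGen : Var N (n + 2) → (HE N n).carrier :=
  Sum.elim (fun j => xE N n (j + 1) + xi N n * xE N n j) (fun j => yE N n (j + 1))

/-- The homomorphism `H_k^G → H_{k,k+1}^G`. -/
noncomputable def lHom : (H N n).carrier →ₐ[ℚ] (HE N n).carrier :=
  AlgHom.pi fun h : PLift (ValidE N n) =>
    ((Pi.evalAlgHom ℚ _ h).comp (MvPolynomial.aeval (lGen N n))).comp
      (Pi.evalAlgHom ℚ _ (⟨h.down.valid⟩ : PLift (Valid N n)))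

/-- The homomorphism `H_{k+1}^G → H_{k,k+1}^G`. -/
noncomputable def rHom : (H N (n + 2)).carrier →ₐ[ℚ] (HE N n).carrier :=
  AlgHom.pi fun h : PLift (ValidE N n) =>
    ((Pi.evalAlgHom ℚ _ h).comp (MvPolynomial.aeval (rGen N n))).comp
      (Pi.evalAlgHom ℚ _ (⟨h.down.valid_succ⟩ : PLift (Valid N (n + 2))))

theorem lHom_mem (d : ℤ) (a : (H N n).carrier) (ha : a ∈ (H N n).gr d) :
    lHom N n a ∈ (HE N n).gr d := by
  intro h _
  refine GrAlg.aeval_mem (HE N n) _ (lGen N n) ?_ (ha ⟨h.down.valid⟩ trivial) h trivial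
  rintro (j | j)
  · simpa [lGen] using xE_mem N n (j + 1)
  · refine add_mem (by simpa using yE_mem N n (j + 1)) ?_
    have := (HE N n).mul_mem (xi_mem N n) (yE_mem N n j)
    simpa [mul_add, add_comm] using this

theorem rHom_mem (d : ℤ) (a : (H N (n + 2)).carrier) (ha : a ∈ (H N (n + 2)).gr d) :
    rHom N n a ∈ (HE N n).gr d := by
  intro h _
  refine GrAlg.aeval_mem (HE N n) _ (rGen N n) ?_ (ha ⟨h.down.valid_succ⟩ trivial) h trivial
  rintro (j | j)
  · refine add_mem (by simpa using xE_mem N n (j + 1)) ?_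
    have := (HE N n).mul_mem (xi_mem N n) (xE_mem N n j)
    simpa [mul_add, add_comm] using this
  · simpa [rGen] using yE_mem N n (j + 1)

/-- The bimodule `Γ(E 1_n) = H_{k,k+1}^G {1 - N + k}`. -/
noncomputable def BE : GrBimod (H N n) (H N (n + 2)) :=
  (GrBimod.ofHoms (lHom N n) (rHom N n) (lHom_mem N n) (rHom_mem N n)).shift (1 - N + kk N n)

/-- The bimodule `Γ(F 1_{n+2}) = H_{k+1,k}^G {-k}`. -/
noncomputable def BF : GrBimod (H N (n + 2)) (H N n) :=
  (GrBimod.ofHoms (rHom N n) (lHom N n) (rHom_mem N n) (lHom_mem N n)).shift (-kk N n)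

/-- Elements of `H_{k,k+1}^G` as elements of `Γ(E 1_n)`. -/
noncomputable def vE : (HE N n).carrier →ₗ[ℚ] (BE N n).carrier := LinearMap.id

/-- Elements of `H_{k,k+1}^G` as elements of `Γ(F 1_{n+2})`. -/
noncomputable def vF : (HE N n).carrier →ₗ[ℚ] (BF N n).carrier := LinearMap.id

/-- `X_α = -∑_{j ≥ 1} y_j X_{α-j}`, `X_0 = 1`. -/
noncomputable def Xs : ℕ → (H N n).carrier
  | 0 => 1
  | a + 1 => -∑ i : Fin (a + 1), y N n (a + 1 - i) * Xs i

/-- `Y_β = -∑_{j ≥ 1} x_j Y_{β-j}`, `Y_0 = 1`. -/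
noncomputable def Ys : ℕ → (H N n).carrier
  | 0 => 1
  | a + 1 => -∑ i : Fin (a + 1), x N n (a + 1 - i) * Ys i

/-- `(-1)^d X_d`, which is zero for `d < 0`. -/
noncomputable def sX (d : ℤ) : (H N n).carrier :=
  if d < 0 then 0 else (-1) ^ d.toNat * Xs N n d.toNat

/-- `(-1)^d Y_d`, which is zero for `d < 0`. -/
noncomputable def sY (d : ℤ) : (H N n).carrier :=
  if d < 0 then 0 else (-1) ^ d.toNat * Ys N n d.toNat

end flags

namespace BimHom

variable {A B C : GrAlg} {M P Q : GrBimod A B}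

protected def zero (M P : GrBimod A B) : M ⟶ P :=
  ⟨0, fun _ _ => by simp, fun _ _ => by simp⟩

protected def add (φ ψ : M ⟶ P) : M ⟶ P :=
  ⟨φ.lin + ψ.lin, fun _ _ => by simp [φ.map_left, ψ.map_left],
    fun _ _ => by simp [φ.map_right, ψ.map_right]⟩

protected def smul (c : ℚ) (φ : M ⟶ P) : M ⟶ P :=
  ⟨c • φ.lin, fun _ _ => by simp [φ.map_left], fun _ _ => by simp [φ.map_right]⟩

/-- The identity map `M → M{s}`, of degree `s`. -/
def toShift (M : GrBimod A B) (s : ℤ) : M ⟶ M.shift s :=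
  ⟨LinearMap.id, fun _ _ => rfl, fun _ _ => rfl⟩

/-- The identity map `M{s} → M`, of degree `-s`. -/
def ofShift (M : GrBimod A B) (s : ℤ) : M.shift s ⟶ M :=
  ⟨LinearMap.id, fun _ _ => rfl, fun _ _ => rfl⟩

def inl (M P : GrBimod A B) : M ⟶ M.sum P :=
  ⟨LinearMap.inl ℚ M.carrier P.carrier, fun a _ => Prod.ext rfl (map_zero (P.left a)).symm,
    fun b _ => Prod.ext rfl (map_zero (P.right b)).symm⟩

def inr (M P : GrBimod A B) : P ⟶ M.sum P :=
  ⟨LinearMap.inr ℚ M.carrier P.carrier, fun a _ => Prod.ext (map_zero (M.left a)).symm rfl,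
    fun b _ => Prod.ext (map_zero (M.right b)).symm rfl⟩

def fst (M P : GrBimod A B) : M.sum P ⟶ M :=
  ⟨LinearMap.fst ℚ M.carrier P.carrier, fun _ _ => rfl, fun _ _ => rfl⟩

def snd (M P : GrBimod A B) : M.sum P ⟶ P :=
  ⟨LinearMap.snd ℚ M.carrier P.carrier, fun _ _ => rfl, fun _ _ => rfl⟩

theorem hasDegree_id (M : GrBimod A B) : HasDegree (𝟙 M : M ⟶ M) 0 := fun i m hm => by
  rw [add_zero]; exact hm

theorem HasDegree.comp {φ : M ⟶ P} {ψ : P ⟶ Q} {d e : ℤ} (hφ : HasDegree φ d)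
    (hψ : HasDegree ψ e) : HasDegree (φ ≫ ψ) (d + e) := fun i m hm => by
  rw [← add_assoc]; exact hψ _ _ (hφ _ _ hm)

theorem hasDegree_tensor {R : GrBimod A B} {S : GrBimod B C} {T : GrBimod A C} {d : ℤ}
    {φ : tensor R S ⟶ T}
    (h : ∀ i j, ∀ m ∈ R.gr i, ∀ p ∈ S.gr j, φ.lin (tm R S m p) ∈ T.gr (i + j + d)) :
    HasDegree φ d := fun i x hx => by
  refine tensor_gr_induction (p := fun x => φ.lin x ∈ T.gr (i + d)) hx ?_ ?_ ?_ ?_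
  · intro k l hkl m hm q hq
    rw [← hkl]; exact h k l m hm q hq
  · rw [map_zero]; exact zero_mem _
  · intro x y hx hy
    rw [map_add]; exact add_mem hx hy
  · intro c x hx
    rw [map_smul]; exact Submodule.smul_mem _ _ hx

theorem HasDegree.left (R : GrBimod A B) {S T : GrBimod B C} {φ : S ⟶ T} {d : ℤ}
    (h : HasDegree φ d) : HasDegree (tensorWhiskerLeft R φ) d :=
  hasDegree_tensor fun i j m hm p hp => by
    rw [tensorWhiskerLeft_tm, add_assoc]; exact tm_mem hm (h _ _ hp)

theorem HasDegree.right {R S : GrBimod A B} (T : GrBimod B C) {φ : R ⟶ S} {d : ℤ}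
    (h : HasDegree φ d) : HasDegree (tensorWhiskerRight φ T) d :=
  hasDegree_tensor fun i j m hm p hp => by
    rw [tensorWhiskerRight_tm, add_right_comm]; exact tm_mem (h _ _ hm) hp

theorem hasDegree_assocHom {D : GrAlg} (R : GrBimod A B) (S : GrBimod B C) (T : GrBimod C D) :
    HasDegree (assocHom R S T) 0 :=
  hasDegree_tensor fun i j x hx p hp => by
    refine tensor_gr_induction (p := fun x => (assocHom R S T).lin (tm _ _ x p) ∈ _) hx ?_ ?_ ?_ ?_
    · intro k l hkl m hm q hq
      rw [assocHom_tm, add_zero, ← hkl, add_assoc]; exact tm_mem hm (tm_mem hq hp)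
    · rw [map_zero, LinearMap.zero_apply, map_zero]; exact zero_mem _
    · intro x y hx hy
      rw [map_add, LinearMap.add_apply, map_add]; exact add_mem hx hy
    · intro c x hx
      rw [map_smul, LinearMap.smul_apply, map_smul]; exact Submodule.smul_mem _ _ hx

theorem hasDegree_assocInv {D : GrAlg} (R : GrBimod A B) (S : GrBimod B C) (T : GrBimod C D) :
    HasDegree (assocInv R S T) 0 :=
  hasDegree_tensor fun i j p hp x hx => by
    refine tensor_gr_induction (p := fun x => (assocInv R S T).lin (tm _ _ p x) ∈ _) hx ?_ ?_ ?_ ?_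
    · intro k l hkl m hm q hq
      rw [assocInv_tm, add_zero, ← hkl, ← add_assoc]; exact tm_mem (tm_mem hp hm) hq
    · rw [map_zero, map_zero]; exact zero_mem _
    · intro x y hx hy
      rw [map_add, map_add]; exact add_mem hx hy
    · intro c x hx
      rw [map_smul, map_smul]; exact Submodule.smul_mem _ _ hx

theorem hasDegree_leftUnit (M : GrBimod A B) :
    HasDegree (leftUnit M).hom 0 ∧ HasDegree (leftUnit M).inv 0 :=
  ⟨hasDegree_tensor fun i j a ha m hm => by
      rw [add_zero]; erw [leftUnit_tm]; exact M.left_mem ha hm,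
    fun i m hm => by
      have := tm_mem (M := regular A) (P := M) A.one_mem hm
      rw [zero_add] at this
      rw [add_zero]; exact this⟩

theorem hasDegree_rightUnit (M : GrBimod A B) :
    HasDegree (rightUnit M).hom 0 ∧ HasDegree (rightUnit M).inv 0 :=
  ⟨hasDegree_tensor fun i j m hm a ha => by
      rw [add_zero, add_comm]; erw [rightUnit_tm]; exact M.right_mem ha hm,
    fun i m hm => by
      have := tm_mem (M := M) (P := regular B) hm B.one_mem
      exact this⟩

end BimHom

section

variable (N : ℕ)

/-- The bimodule `Γ(f)` attached to a 1-morphism `f`. -/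
noncomputable def Γ₁ : ∀ {n m : ℤ}, Mor n m → GrBimod (H N n) (H N m)
  | _, _, .id n => regular (H N n)
  | _, _, .E n => BE N n
  | _, _, .F n => BF N n
  | _, _, .comp f g => tensor (Γ₁ f) (Γ₁ g)
  | _, _, .shift f s => (Γ₁ f).shift s
  | _, _, .zero n m => GrBimod.zero (H N n) (H N m)
  | _, _, .sum f g => (Γ₁ f).sum (Γ₁ g)

/-- The maps of bimodules attached to the generating 2-morphisms, given by their values on the
bimodule generators `ξ^a` and `ξ^a ⊗ ξ^b`. (If `n` is not `2k - N` with `0 ≤ k < N`, the bimodules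
attached to `E 1_n` and `F 1_{n+2}` vanish and there is nothing to prescribe.) -/
structure GenMaps where
  z : ∀ n, BE N n ⟶ BE N n
  zh : ∀ n, BF N n ⟶ BF N n
  U : ∀ n, tensor (BE N n) (BE N (n + 2)) ⟶ tensor (BE N n) (BE N (n + 2))
  Uh : ∀ n, tensor (BF N (n + 2)) (BF N n) ⟶ tensor (BF N (n + 2)) (BF N n)
  eta : ∀ n, regular (H N n) ⟶ tensor (BE N n) (BF N n)
  epsh : ∀ n, regular (H N (n + 2)) ⟶ tensor (BF N n) (BE N n)
  etah : ∀ n, tensor (BE N n) (BF N n) ⟶ regular (H N n)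
  eps : ∀ n, tensor (BF N n) (BE N n) ⟶ regular (H N (n + 2))
  z_apply : ∀ n (a : ℕ), (z n).lin (vE N n (xi N n ^ a)) = vE N n (xi N n ^ (a + 1))
  zh_apply : ∀ n (a : ℕ), (zh n).lin (vF N n (xi N n ^ a)) = vF N n (xi N n ^ (a + 1))
  U_apply : ∀ n (a b : ℕ),
    (U n).lin (tm _ _ (vE N n (xi N n ^ a)) (vE N (n + 2) (xi N (n + 2) ^ b))) =
      ∑ j ∈ Finset.range b,
        tm _ _ (vE N n (xi N n ^ (a + b - 1 - j))) (vE N (n + 2) (xi N (n + 2) ^ j)) -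
      ∑ j ∈ Finset.range a,
        tm _ _ (vE N n (xi N n ^ (a + b - 1 - j))) (vE N (n + 2) (xi N (n + 2) ^ j))
  Uh_apply : ∀ n (a b : ℕ),
    (Uh n).lin (tm _ _ (vF N (n + 2) (xi N (n + 2) ^ a)) (vF N n (xi N n ^ b))) =
      ∑ j ∈ Finset.range a,
        tm _ _ (vF N (n + 2) (xi N (n + 2) ^ (a + b - 1 - j))) (vF N n (xi N n ^ j)) -
      ∑ j ∈ Finset.range b,
        tm _ _ (vF N (n + 2) (xi N (n + 2) ^ (a + b - 1 - j))) (vF N n (xi N n ^ j))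
  eta_apply : ∀ n, (eta n).lin (1 : (H N n).carrier) =
    ∑ j ∈ Finset.range (kk N n + 1), (-1 : ℚ) ^ j •
      (tensor (BE N n) (BF N n)).left (x N n j)
        (tm _ _ (vE N n 1) (vF N n (xi N n ^ (kk N n - j))))
  epsh_apply : ∀ n, (epsh n).lin (1 : (H N (n + 2)).carrier) =
    ∑ j ∈ Finset.range (N - kk N n), (-1 : ℚ) ^ j •
      (tensor (BF N n) (BE N n)).left (y N (n + 2) j)
        (tm _ _ (vF N n 1) (vE N n (xi N n ^ (N - kk N n - 1 - j))))
  etah_apply : ∀ n, ValidE N n → ∀ a b : ℕ,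
    (etah n).lin (tm _ _ (vE N n (xi N n ^ a)) (vF N n (xi N n ^ b))) =
      sX N n (a + b + 1 + kk N n - N)
  eps_apply : ∀ n, ValidE N n → ∀ a b : ℕ,
    (eps n).lin (tm _ _ (vF N n (xi N n ^ a)) (vE N n (xi N n ^ b))) =
      sY N (n + 2) (a + b - kk N n)

variable {N}

/-- The map of bimodules `Γ(t)` attached to a formal 2-morphism `t`. -/
noncomputable def Γ₂ (G : GenMaps N) : ∀ {n m : ℤ} {f g : Mor n m}, Tm f g → (Γ₁ N f ⟶ Γ₁ N g)
  | _, _, _, _, .id f => 𝟙 (Γ₁ N f)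
  | _, _, _, _, .comp s t => Γ₂ G s ≫ Γ₂ G t
  | _, _, _, _, .whiskerLeft f t => tensorWhiskerLeft (Γ₁ N f) (Γ₂ G t)
  | _, _, _, _, .whiskerRight h t => tensorWhiskerRight (Γ₂ G t) (Γ₁ N h)
  | _, _, _, _, .assoc f g h => assocHom (Γ₁ N f) (Γ₁ N g) (Γ₁ N h)
  | _, _, _, _, .assocInv f g h => assocInv (Γ₁ N f) (Γ₁ N g) (Γ₁ N h)
  | _, _, _, _, .leftUnit f => (leftUnit (Γ₁ N f)).hom
  | _, _, _, _, .leftUnitInv f => (leftUnit (Γ₁ N f)).inv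
  | _, _, _, _, .rightUnit f => (rightUnit (Γ₁ N f)).hom
  | _, _, _, _, .rightUnitInv f => (rightUnit (Γ₁ N f)).inv
  | _, _, _, _, .zero f g => BimHom.zero (Γ₁ N f) (Γ₁ N g)
  | _, _, _, _, .add s t => BimHom.add (Γ₂ G s) (Γ₂ G t)
  | _, _, _, _, .smul c t => BimHom.smul c (Γ₂ G t)
  | _, _, _, _, .toShift f s => BimHom.toShift (Γ₁ N f) s
  | _, _, _, _, .ofShift f s => BimHom.ofShift (Γ₁ N f) s
  | _, _, _, _, .inl f g => BimHom.inl (Γ₁ N f) (Γ₁ N g)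
  | _, _, _, _, .inr f g => BimHom.inr (Γ₁ N f) (Γ₁ N g)
  | _, _, _, _, .fst f g => BimHom.fst (Γ₁ N f) (Γ₁ N g)
  | _, _, _, _, .snd f g => BimHom.snd (Γ₁ N f) (Γ₁ N g)
  | _, _, _, _, .z n => G.z n
  | _, _, _, _, .zh n => G.zh n
  | _, _, _, _, .U n => G.U n
  | _, _, _, _, .Uh n => G.Uh n
  | _, _, _, _, .eta n => G.eta n
  | _, _, _, _, .epsh n => G.epsh n
  | _, _, _, _, .etah n => G.etah n
  | _, _, _, _, .eps n => G.eps n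

/-- The assignments on generators define a graded 2-functor on `𝒰*`: the defining relations of
`𝒰*` and the degrees are preserved. -/
structure IsRep (G : GenMaps N) : Prop where
  rel : ∀ {n m : ℤ} {f g : Mor n m} (s t : Tm f g), Rel s t → Γ₂ G s = Γ₂ G t
  deg : ∀ {n m : ℤ} {f g : Mor n m} (t : Tm f g) (d : ℤ), HasDeg t d → (Γ₂ G t).HasDegree d

variable (N)

/-- The 1-morphisms of `EqFlag_N`: the class of graded bimodules generated by the regular
bimodules, `H_{k,k+1}^G` and `H_{k+1,k}^G` under tensor products, shifts, finite direct sums and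
passage to direct summands. -/
inductive IsEqFlag : ∀ {n m : ℤ}, GrBimod (H N n) (H N m) → Prop
  | id (n : ℤ) : IsEqFlag (regular (H N n))
  | E (n : ℤ) : IsEqFlag (BE N n)
  | F (n : ℤ) : IsEqFlag (BF N n)
  | comp {n m p : ℤ} {M : GrBimod (H N n) (H N m)} {P : GrBimod (H N m) (H N p)} :
      IsEqFlag M → IsEqFlag P → IsEqFlag (tensor M P)
  | shift {n m : ℤ} {M : GrBimod (H N n) (H N m)} (s : ℤ) : IsEqFlag M → IsEqFlag (M.shift s)
  | zero (n m : ℤ) : IsEqFlag (GrBimod.zero (H N n) (H N m))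
  | sum {n m : ℤ} {M P : GrBimod (H N n) (H N m)} :
      IsEqFlag M → IsEqFlag P → IsEqFlag (M.sum P)
  | retract {n m : ℤ} {M P : GrBimod (H N n) (H N m)} (i : P ⟶ M) (r : M ⟶ P)
      (hi : i.HasDegree 0) (hr : r.HasDegree 0) (h : i ≫ r = 𝟙 P) : IsEqFlag M → IsEqFlag P

theorem isEqFlag_Γ₁ : ∀ {n m : ℤ} (f : Mor n m), IsEqFlag N (Γ₁ N f)
  | _, _, .id n => .id n
  | _, _, .E n => .E n
  | _, _, .F n => .F n
  | _, _, .comp f g => .comp (isEqFlag_Γ₁ f) (isEqFlag_Γ₁ g)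
  | _, _, .shift f s => .shift s (isEqFlag_Γ₁ f)
  | _, _, .zero n m => .zero n m
  | _, _, .sum f g => .sum (isEqFlag_Γ₁ f) (isEqFlag_Γ₁ g)

/-- The data defining `EqFlag_N` inside the bicategory of graded bimodules. Its objects are the
rings `H_k^G`, indexed by the weights `n = 2k - N`, and the zero ring for all other weights;
its 2-morphisms are the degree-preserving maps of bimodules. -/
noncomputable def EqFlagData : SubData GrAlg ℤ where
  obj n := H N n
  P₁ M := IsEqFlag N M
  P₂ φ := BimHom.HasDegree φ 0
  id₁ n := .id n
  comp₁ h h' := .comp h h'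
  id₂ f := BimHom.hasDegree_id f
  comp₂ h h' := BimHom.HasDegree.comp h h'
  left₂ f _ _ _ h := BimHom.HasDegree.left f h
  right₂ h _ h' := BimHom.HasDegree.right h h'
  assoc₂ f g h := ⟨BimHom.hasDegree_assocHom f g h, BimHom.hasDegree_assocInv f g h⟩
  leftUnit₂ f := BimHom.hasDegree_leftUnit f
  rightUnit₂ f := BimHom.hasDegree_rightUnit f

/-- The 2-category `EqFlag_N`. -/
abbrev EqFlag := Sub (EqFlagData N)

variable {N}

theorem aux_assoc {B : Type*} [Bicategory B] {a b c d : B} (f : a ⟶ b) (g : b ⟶ c) (h : c ⟶ d) :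
    (α_ f g h).hom = 𝟙 _ ≫ 𝟙 (f ≫ g) ▷ h ≫ (α_ f g h).hom ≫ f ◁ 𝟙 (g ≫ h) ≫ 𝟙 _ := by simp

theorem aux_left {B : Type*} [Bicategory B] {a b : B} (f : a ⟶ b) :
    (λ_ f).hom = 𝟙 _ ≫ 𝟙 (𝟙 a) ▷ f ≫ (λ_ f).hom := by simp

theorem aux_right {B : Type*} [Bicategory B] {a b : B} (f : a ⟶ b) :
    (ρ_ f).hom = 𝟙 _ ≫ f ◁ 𝟙 (𝟙 b) ≫ (ρ_ f).hom := by simp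

/-- `Γ_N^G` on 1-morphisms. -/
noncomputable abbrev Gmap {a b : Ucat} (f : a ⟶ b) : (⟨a.idx⟩ : EqFlag N) ⟶ ⟨b.idx⟩ :=
  (⟨Γ₁ N f.val, isEqFlag_Γ₁ N _⟩ : Sub.Hom₁ (D := EqFlagData N) ⟨a.idx⟩ ⟨b.idx⟩)

/-- `Γ_N^G` on 2-morphisms. -/
noncomputable def Gmap₂ {G : GenMaps N} (hG : IsRep G) {a b : Ucat} {f g : a ⟶ b} (η : f ⟶ g) :
    Gmap (N := N) f ⟶ Gmap g :=
  (⟨Quot.lift (Γ₂ G) hG.rel η.val, by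
    obtain ⟨t, ht, h⟩ := η.prop
    rw [h]
    exact hG.deg t 0 ht⟩ : Sub.Hom₂ (Gmap (N := N) f) (Gmap g))

theorem Gmap₂_assoc {G : GenMaps N} (hG : IsRep G) {a b c d : Ucat} (f : a ⟶ b) (g : b ⟶ c)
    (h : c ⟶ d) :
    Gmap₂ hG (α_ f g h).hom = (α_ (Gmap (N := N) f) (Gmap g) (Gmap h)).hom := rfl

theorem Gmap₂_left {G : GenMaps N} (hG : IsRep G) {a b : Ucat} (f : a ⟶ b) :
    Gmap₂ hG (λ_ f).hom = (λ_ (Gmap (N := N) f)).hom := rfl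

theorem Gmap₂_right {G : GenMaps N} (hG : IsRep G) {a b : Ucat} (f : a ⟶ b) :
    Gmap₂ hG (ρ_ f).hom = (ρ_ (Gmap (N := N) f)).hom := rfl

/-- The 2-functor `Γ_N^G : 𝒰 → EqFlag_N`. -/
noncomputable def Gamma (G : GenMaps N) (hG : IsRep G) : Pseudofunctor Ucat (EqFlag N) where
  obj a := ⟨a.idx⟩
  map f := Gmap f
  map₂ η := Gmap₂ hG η
  mapId a := Iso.refl (𝟙 (⟨a.idx⟩ : EqFlag N))
  mapComp f g := Iso.refl (Gmap (N := N) f ≫ Gmap g)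
  map₂_id _ := rfl
  map₂_comp := by
    rintro a b f g h ⟨⟨η⟩, _⟩ ⟨⟨θ⟩, _⟩
    rfl
  map₂_whisker_left := by
    rintro a b c f g h ⟨⟨η⟩, _⟩
    refine Eq.trans ?_ ((Category.id_comp _).trans (Category.comp_id _)).symm
    rfl
  map₂_whisker_right := by
    rintro a b c f g ⟨⟨η⟩, _⟩ h
    refine Eq.trans ?_ ((Category.id_comp _).trans (Category.comp_id _)).symm
    rfl
  map₂_associator f g h := (Gmap₂_assoc hG f g h).trans (aux_assoc _ _ _)
  map₂_left_unitor f := (Gmap₂_left hG f).trans (aux_left _)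
  map₂_right_unitor f := (Gmap₂_right hG f).trans (aux_right _)

end

section modules

/-- The field `ℚ`, in degree zero. -/
abbrev ground : GrAlg where
  carrier := ℚ
  gr d := if d = 0 then ⊤ else ⊥
  one_mem := by simp
  mul_mem {i j a b} ha hb := by
    by_cases hi : i = 0
    · by_cases hj : j = 0
      · simp [hi, hj]
      · have : b = 0 := by simpa [hj] using hb
        simp [this]
    · have : a = 0 := by simpa [hi] using ha
      simp [this]
  internal := by
    refine isInternal_of_components _ (Finsupp.lsingle 0) ?_ ?_ ?_
    · intro m i
      by_cases hi : i = 0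
      · simp [hi]
      · simp [hi]
    · intro m; simp
    · intro i m hm
      by_cases hi : i = 0
      · simp [hi]
      · have : m = 0 := by simpa [hi] using hm
        simp [this]

/-- Graded modules over the graded algebra `A`. -/
abbrev GrMod (A : GrAlg) := GrBimod ground A

/-- The graded free module `A{s}` of rank one, whose generator `1` has degree `s`. -/
def freeMod (A : GrAlg) (s : ℤ) : GrMod A :=
  (GrBimod.ofHoms (C := A) (Algebra.ofId ℚ A.carrier) (AlgHom.id ℚ A.carrier)
    (fun d a ha => by
      by_cases hd : d = 0
      · subst hd
        rw [Algebra.ofId_apply, Algebra.algebraMap_eq_smul_one]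
        exact Submodule.smul_mem _ _ A.one_mem
      · have h0 : a = 0 := by simpa [hd] using ha
        rw [h0, map_zero]; exact zero_mem _)
    (fun _ _ h => h)).shift s

/-- The graded free module `A{s_1} ⊕ ⋯ ⊕ A{s_r}`. -/
def freeSum (A : GrAlg) : List ℤ → GrMod A
  | [] => GrBimod.zero ground A
  | s :: l => (freeMod A s).sum (freeSum A l)

/-- `M` and `P` are isomorphic by a degree-preserving isomorphism. -/
def GrIso {A B : GrAlg} (M P : GrBimod A B) : Prop :=
  ∃ (φ : M ⟶ P) (ψ : P ⟶ M), φ.HasDegree 0 ∧ ψ.HasDegree 0 ∧ φ ≫ ψ = 𝟙 M ∧ ψ ≫ φ = 𝟙 P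

/-- `P` is a finitely generated graded projective `A`-module. -/
def IsPmod {A : GrAlg} (P : GrMod A) : Prop :=
  let _ : Module A.carrier P.carrier := Module.compHom P.carrier P.right.toRingHom
  Module.Finite A.carrier P.carrier ∧ Module.Projective A.carrier P.carrier

/-- `P` is an indecomposable graded module. -/
def IsIndecomposable {A : GrAlg} (P : GrMod A) : Prop :=
  Nontrivial P.carrier ∧ ∀ Q R : GrMod A, GrIso P (Q.sum R) →
    Subsingleton Q.carrier ∨ Subsingleton R.carrier

/-- `I` is a homogeneous ideal. -/
def IsHomogeneousIdeal {A : GrAlg} (I : Ideal A.carrier) : Prop :=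
  ∀ a ∈ I, ∀ d, components A.internal a d ∈ I

/-- `A` is a positively and evenly graded local ring with degree zero part `ℚ`. -/
structure IsGradedLocal (A : GrAlg) : Prop where
  nontrivial : Nontrivial A.carrier
  gr_neg : ∀ d < 0, A.gr d = ⊥
  gr_odd : ∀ d, Odd d → A.gr d = ⊥
  gr_zero : A.gr 0 = Submodule.span ℚ {1}
  isLocal : ∃ I : Ideal A.carrier, IsHomogeneousIdeal I ∧ I ≠ ⊤ ∧
    ∀ J : Ideal A.carrier, IsHomogeneousIdeal J → J ≠ ⊤ → J ≤ I

end modules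

section Grothendieck

/-- Finitely generated graded projective `A`-modules. -/
def Pmod (A : GrAlg) := {P : GrMod A // IsPmod P}

/-- The defining relations of the split Grothendieck group: `[R] = [P] + [Q]` if `R ≅ P ⊕ Q`, and
`[R] = q^s [P]` if `R ≅ P{s}`. -/
inductive K0Rel (A : GrAlg) : (Pmod A →₀ ℤ[T;T⁻¹]) → Prop
  | sum (P Q R : Pmod A) (h : GrIso R.1 (P.1.sum Q.1)) :
      K0Rel A (Finsupp.single R 1 - Finsupp.single P 1 - Finsupp.single Q 1)
  | shift (P R : Pmod A) (s : ℤ) (h : GrIso R.1 (P.1.shift s)) :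
      K0Rel A (Finsupp.single R 1 - Finsupp.single P (LaurentPolynomial.T s))

/-- The split Grothendieck group of the category of finitely generated graded projective
`A`-modules, a module over `ℤ[q, q⁻¹]`, where `q` acts by the grading shift. -/
abbrev K0 (A : GrAlg) : Type 1 :=
  (Pmod A →₀ ℤ[T;T⁻¹]) ⧸ Submodule.span ℤ[T;T⁻¹] {r | K0Rel A r}

/-- The class `[P]` of `P`. -/
noncomputable def K0.cls {A : GrAlg} (P : GrMod A) (h : IsPmod P) : K0 A :=
  Submodule.Quotient.mk (Finsupp.single (⟨P, h⟩ : Pmod A) 1)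

/-- The functor `- ⊗_A M` preserves finitely generated graded projective modules and induces the
map `t` on Grothendieck groups. -/
def Induces {A B : GrAlg} (M : GrBimod A B) (t : K0 A →ₗ[ℤ[T;T⁻¹]] K0 B) : Prop :=
  ∀ (P : GrMod A) (h : IsPmod P), ∃ h' : IsPmod (tensor P M),
    t (K0.cls P h) = K0.cls (tensor P M) h'

end Grothendieck

section quantum

/-- The quantum integer `[m] = q^{m-1} + q^{m-3} + ⋯ + q^{1-m}`, for `m ≥ 0`. -/
noncomputable def qnat (m : ℕ) : ℤ[T;T⁻¹] :=
  ∑ i ∈ Finset.range m, LaurentPolynomial.T ((m : ℤ) - 1 - 2 * i)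

/-- The quantum integer `[n]`, with `[-n] = -[n]`. -/
noncomputable def qint (n : ℤ) : ℤ[T;T⁻¹] := qnat n.toNat - qnat (-n).toNat

/-- The quantum factorial `[a]! = [a] [a-1] ⋯ [1]`. -/
noncomputable def qfact (a : ℕ) : ℤ[T;T⁻¹] := ∏ i ∈ Finset.range a, qnat (i + 1)

variable {R : Type*} [CommRing R] [Algebra ℤ[T;T⁻¹] R] {V : Type*} [AddCommMonoid V] [Module R V]

/-- The operators `one n = 1_n`, `E n = E 1_n` and `F n = F 1_{n+2}` define a unital representation
of the idempotented form of quantum `sl(2)` on `V`. -/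
structure IsUdotRep (one E F : ℤ → Module.End R V) : Prop where
  one_mul_self : ∀ n, one n * one n = one n
  one_mul : ∀ n m, n ≠ m → one n * one m = 0
  E_weight : ∀ n, one (n + 2) * E n * one n = E n
  F_weight : ∀ n, one n * F n * one (n + 2) = F n
  comm : ∀ n, E n * F n =
    F (n + 2) * E (n + 2) + algebraMap ℤ[T;T⁻¹] R (qint (n + 2)) • one (n + 2)
  unital : ⨆ n, LinearMap.range (one n) = ⊤

/-- `E^a 1_n`. -/
def Epow (one E : ℤ → Module.End R V) (n : ℤ) : ℕ → Module.End R V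
  | 0 => one n
  | a + 1 => E (n + 2 * a) * Epow one E n a

/-- `F^a 1_n`. -/
def Fpow (one F : ℤ → Module.End R V) (n : ℤ) : ℕ → Module.End R V
  | 0 => one n
  | a + 1 => F (n - 2 * (a + 1)) * Fpow one F n a

/-- The divided powers `E^{(a)} 1_n = E^a 1_n / [a]!` and `F^{(a)} 1_n = F^a 1_n / [a]!` act
on `V`. -/
def HasDividedPowers (one E F : ℤ → Module.End R V) : Prop :=
  ∀ n a, (∃! D : Module.End R V, algebraMap ℤ[T;T⁻¹] R (qfact a) • D = Epow one E n a) ∧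
    ∃! D : Module.End R V, algebraMap ℤ[T;T⁻¹] R (qfact a) • D = Fpow one F n a

/-- `V` is an irreducible representation. -/
def IsIrred (one E F : ℤ → Module.End R V) : Prop :=
  Nontrivial V ∧ ∀ W : Submodule R V,
    (∀ n, ∀ w ∈ W, one n w ∈ W ∧ E n w ∈ W ∧ F n w ∈ W) → W = ⊥ ∨ W = ⊤

variable (R) (N : ℕ)

/-- `1_n` on `V_N`, with basis `v_0, …, v_N`, where `v_k` has weight `2k - N`. -/
noncomputable def vOne (n : ℤ) : Module.End R (Fin (N + 1) → R) :=
  Matrix.toLin' (Matrix.of fun i j : Fin (N + 1) =>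
    if i = j ∧ n = 2 * (j : ℕ) - N then 1 else 0)

/-- `E 1_n` on `V_N`: `E v_k = [k+1] v_{k+1}`. -/
noncomputable def vEE (n : ℤ) : Module.End R (Fin (N + 1) → R) :=
  Matrix.toLin' (Matrix.of fun i j : Fin (N + 1) =>
    if (i : ℕ) = j + 1 ∧ n = 2 * (j : ℕ) - N then algebraMap ℤ[T;T⁻¹] R (qnat (j + 1)) else 0)

/-- `F 1_{n+2}` on `V_N`: `F v_{k+1} = [N-k] v_k`. -/
noncomputable def vFF (n : ℤ) : Module.End R (Fin (N + 1) → R) :=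
  Matrix.toLin' (Matrix.of fun i j : Fin (N + 1) =>
    if (j : ℕ) = i + 1 ∧ n = 2 * (i : ℕ) - N then algebraMap ℤ[T;T⁻¹] R (qnat (N - i)) else 0)

end quantum

section extension

universe w₁ w₂ v₁ v₂ u₁ u₂

/-- A strong transformation between pseudofunctors that agree on objects, all of whose components
are identities. -/
def IsIcon {B : Type u₁} [Bicategory.{w₁, v₁} B] {C : Type u₂} [Bicategory.{w₂, v₂} C]
    {F G : Pseudofunctor B C} (η : Pseudofunctor.StrongTrans F G) : Prop :=
  ∀ a, ∃ h : F.obj a = G.obj a, η.app a = h ▸ 𝟙 (F.obj a)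

/-- The 2-category `𝒰̇`, the Karoubi envelope of `𝒰`. -/
abbrev Udot := Kar Ucat

/-- The object `n` of `𝒰̇`. -/
def Udot.obj (n : ℤ) : Udot := ⟨⟨n⟩⟩

/-- A 1-morphism of `𝒰`, viewed in `𝒰̇`. -/
def Udot.of {n m : ℤ} (f : Mor n m) : Udot.obj n ⟶ Udot.obj m :=
  (Kar.incl Ucat).map (X := ⟨n⟩) (Y := ⟨m⟩) (⟨f, trivial⟩ : Sub.Hom₁ (D := UData) ⟨n⟩ ⟨m⟩)

variable {N : ℕ}

/-- `P` extends the representation `Γ` of `𝒰` to `𝒰̇`. -/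
def Extends (P : Pseudofunctor Udot (EqFlag N)) (Γ : Pseudofunctor Ucat (EqFlag N)) : Prop :=
  ∃ η : Pseudofunctor.StrongTrans ((Kar.incl Ucat).comp P) Γ, IsIcon η

variable (P : Pseudofunctor Udot (EqFlag N))

/-- The ring attached by the representation `P` to an object. -/
noncomputable def ringOf (a : Udot) : GrAlg := H N (P.obj a).idx

/-- The bimodule attached by the representation `P` to a 1-morphism. -/
def bimodOf {a b : Udot} (f : a ⟶ b) : GrBimod (ringOf P a) (ringOf P b) := (P.map f).val

/-- The split Grothendieck group of the direct sum of the categories of finitely generated graded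
projective modules over the rings attached by `P` to all weights. -/
abbrev K0tot : Type 1 := DirectSum ℤ fun n => K0 (ringOf P (Udot.obj n))

/-- The operator on the total Grothendieck group given by a map between two summands. -/
noncomputable def opOf {n m : ℤ}
    (t : K0 (ringOf P (Udot.obj n)) →ₗ[ℤ[T;T⁻¹]] K0 (ringOf P (Udot.obj m))) :
    Module.End ℤ[T;T⁻¹] (K0tot P) :=
  (DirectSum.lof ℤ[T;T⁻¹] ℤ (fun n => K0 (ringOf P (Udot.obj n))) m).comp
    (t.comp (DirectSum.component ℤ[T;T⁻¹] ℤ (fun n => K0 (ringOf P (Udot.obj n))) n))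

/-- The field of fractions `ℚ(q)` of `ℤ[q, q⁻¹]`. -/
abbrev Kq : Type := FractionRing ℤ[T;T⁻¹]

/-- `P` categorifies the irreducible `(N+1)`-dimensional representation `V_N`: the 1-morphisms of
`𝒰̇` act on the split Grothendieck group of the module categories attached to the weights; the
images of `1_n`, `E 1_n` and `F 1_{n+2}` satisfy the relations of quantum `sl(2)`, and the
representation so obtained is the integral form of `V_N`, and `V_N` itself over `ℚ(q)`. -/
def Categorifies : Prop :=
  ∃ t : ∀ {a b : Udot}, (a ⟶ b) →
      (K0 (ringOf P a) →ₗ[ℤ[T;T⁻¹]] K0 (ringOf P b)),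
    (∀ {a b : Udot} (f : a ⟶ b), Induces (bimodOf P f) (t f)) ∧
    let one := fun n => opOf P (t (Udot.of (Mor.id n)))
    let E := fun n => opOf P (t (Udot.of (Mor.E n)))
    let F := fun n => opOf P (t (Udot.of (Mor.F n)))
    IsUdotRep one E F ∧ HasDividedPowers one E F ∧
    (∃ Φ : (Fin (N + 1) → ℤ[T;T⁻¹]) ≃ₗ[ℤ[T;T⁻¹]] K0tot P,
      (∀ k : Fin (N + 1), ∃ h : IsPmod (freeMod (ringOf P (Udot.obj (2 * (k : ℕ) - N))) 0),
        Φ (Pi.single k 1) =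
          (LaurentPolynomial.T (-((k : ℕ) * ((N : ℤ) - (k : ℕ)))) : ℤ[T;T⁻¹]) •
          DirectSum.lof ℤ[T;T⁻¹] ℤ (fun n => K0 (ringOf P (Udot.obj n))) (2 * (k : ℕ) - N)
            (K0.cls _ h)) ∧
      ∀ n v, Φ (vOne ℤ[T;T⁻¹] N n v) = one n (Φ v) ∧ Φ (vEE ℤ[T;T⁻¹] N n v) = E n (Φ v) ∧
        Φ (vFF ℤ[T;T⁻¹] N n v) = F n (Φ v)) ∧
    ∃ Ψ : (Kq ⊗[ℤ[T;T⁻¹]] K0tot P) ≃ₗ[Kq]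
        (Fin (N + 1) → Kq),
      ∀ n w, Ψ ((one n).baseChange Kq w) =
          vOne Kq N n (Ψ w) ∧
        Ψ ((E n).baseChange Kq w) = vEE Kq N n (Ψ w) ∧
        Ψ ((F n).baseChange Kq w) = vFF Kq N n (Ψ w)

end extension

end CatVN

namespace CatVN
open CategoryTheory Bicategory
open scoped TensorProduct LaurentPolynomial
open GrBimod
set_option linter.unusedSectionVars false
set_option linter.unusedSimpArgs false

local infixr:80 " ⬝ " => Mor.comp
local infixr:60 " ⊚ " => Tm.cc
local infixr:70 " ◃ " => Tm.whiskerLeft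
local notation:70 t:71 " ▹ " h:71 => Tm.whiskerRight h t

namespace BimHom

variable {A B C : GrAlg} {M P Q : GrBimod A B}

@[simp] theorem zero_lin (M P : GrBimod A B) : (BimHom.zero M P).lin = 0 := rfl
@[simp] theorem add_lin (φ ψ : M ⟶ P) : (BimHom.add φ ψ).lin = φ.lin + ψ.lin := rfl
@[simp] theorem smul_lin (c : ℚ) (φ : M ⟶ P) : (BimHom.smul c φ).lin = c • φ.lin := rfl

theorem hasDegree_zero (M P : GrBimod A B) (d : ℤ) : HasDegree (BimHom.zero M P) d :=
  fun _ _ _ => zero_mem _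

theorem HasDegree.add {φ ψ : M ⟶ P} {d : ℤ} (h : HasDegree φ d) (h' : HasDegree ψ d) :
    HasDegree (BimHom.add φ ψ) d := fun i m hm => add_mem (h i m hm) (h' i m hm)

theorem HasDegree.smul {φ : M ⟶ P} {d : ℤ} (c : ℚ) (h : HasDegree φ d) :
    HasDegree (BimHom.smul c φ) d := fun i m hm => Submodule.smul_mem _ _ (h i m hm)

theorem hasDegree_toShift (M : GrBimod A B) (s : ℤ) : HasDegree (toShift M s) s :=
  fun i m hm => by
    change m ∈ M.gr (i + s - s)
    rwa [add_sub_cancel_right]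

theorem hasDegree_ofShift (M : GrBimod A B) (s : ℤ) : HasDegree (ofShift M s) (-s) :=
  fun i m hm => by
    change m ∈ M.gr (i - s) at hm
    change m ∈ M.gr (i + -s)
    rwa [← sub_eq_add_neg]

theorem hasDegree_inl (M P : GrBimod A B) : HasDegree (inl M P) 0 := fun i m hm => by
  rw [add_zero]; exact ⟨hm, zero_mem _⟩

theorem hasDegree_inr (M P : GrBimod A B) : HasDegree (inr M P) 0 := fun i m hm => by
  rw [add_zero]; exact ⟨zero_mem _, hm⟩

theorem hasDegree_fst (M P : GrBimod A B) : HasDegree (fst M P) 0 := fun i m hm => by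
  rw [add_zero]; exact hm.1

theorem hasDegree_snd (M P : GrBimod A B) : HasDegree (snd M P) 0 := fun i m hm => by
  rw [add_zero]; exact hm.2

end BimHom

/-- The generating maps have the prescribed degrees. -/
structure HasGenDegrees {N : ℕ} (G : GenMaps N) : Prop where
  z : ∀ n, (G.z n).HasDegree 2
  zh : ∀ n, (G.zh n).HasDegree 2
  U : ∀ n, (G.U n).HasDegree (-2)
  Uh : ∀ n, (G.Uh n).HasDegree (-2)
  eta : ∀ n, (G.eta n).HasDegree (n + 1)
  epsh : ∀ n, (G.epsh n).HasDegree (1 - (n + 2))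
  etah : ∀ n, (G.etah n).HasDegree (n + 1)
  eps : ∀ n, (G.eps n).HasDegree (1 - (n + 2))

theorem HasGenDegrees.hasDegree {N : ℕ} {G : GenMaps N} (hG : HasGenDegrees G) {n m : ℤ}
    {f g : Mor n m} (t : Tm f g) (d : ℤ) (h : HasDeg t d) : (Γ₂ G t).HasDegree d := by
  induction h with
  | id f => exact BimHom.hasDegree_id _
  | comp _ _ h h' => exact BimHom.HasDegree.comp h h'
  | whiskerLeft f _ h => exact BimHom.HasDegree.left _ h
  | whiskerRight f _ h => exact BimHom.HasDegree.right _ h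
  | assoc f g h => exact BimHom.hasDegree_assocHom _ _ _
  | assocInv f g h => exact BimHom.hasDegree_assocInv _ _ _
  | leftUnit f => exact (BimHom.hasDegree_leftUnit _).1
  | leftUnitInv f => exact (BimHom.hasDegree_leftUnit _).2
  | rightUnit f => exact (BimHom.hasDegree_rightUnit _).1
  | rightUnitInv f => exact (BimHom.hasDegree_rightUnit _).2
  | zero f g d => exact BimHom.hasDegree_zero _ _ _
  | add _ _ h h' => exact BimHom.HasDegree.add h h'
  | smul c _ h => exact BimHom.HasDegree.smul c h
  | toShift f s => exact BimHom.hasDegree_toShift _ _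
  | ofShift f s => exact BimHom.hasDegree_ofShift _ _
  | inl f g => exact BimHom.hasDegree_inl _ _
  | inr f g => exact BimHom.hasDegree_inr _ _
  | fst f g => exact BimHom.hasDegree_fst _ _
  | snd f g => exact BimHom.hasDegree_snd _ _
  | z n => exact hG.z n
  | zh n => exact hG.zh n
  | U n => exact hG.U n
  | Uh n => exact hG.Uh n
  | eta n => exact hG.eta n
  | epsh n => exact hG.epsh n
  | etah n => exact hG.etah n
  | eps n => exact hG.eps n

section linearity

variable {A B C : GrAlg}

theorem add_comp_bim {M P Q : GrBimod A B} (s s' : M ⟶ P) (t : P ⟶ Q) :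
    BimHom.add s s' ≫ t = BimHom.add (s ≫ t) (s' ≫ t) :=
  hom_ext (LinearMap.comp_add _ _ _)

theorem comp_add_bim {M P Q : GrBimod A B} (s : M ⟶ P) (t t' : P ⟶ Q) :
    s ≫ BimHom.add t t' = BimHom.add (s ≫ t) (s ≫ t') :=
  hom_ext (LinearMap.add_comp _ _ _)

theorem smul_comp_bim {M P Q : GrBimod A B} (c : ℚ) (s : M ⟶ P) (t : P ⟶ Q) :
    BimHom.smul c s ≫ t = BimHom.smul c (s ≫ t) :=
  hom_ext (LinearMap.comp_smul _ _ _)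

theorem comp_smul_bim {M P Q : GrBimod A B} (c : ℚ) (s : M ⟶ P) (t : P ⟶ Q) :
    s ≫ BimHom.smul c t = BimHom.smul c (s ≫ t) :=
  hom_ext (LinearMap.smul_comp _ _ _)

theorem whiskerLeft_add_bim (M : GrBimod A B) {P Q : GrBimod B C} (s t : P ⟶ Q) :
    tensorWhiskerLeft M (BimHom.add s t) =
      BimHom.add (tensorWhiskerLeft M s) (tensorWhiskerLeft M t) :=
  tensor_hom_ext fun m p => by simp

theorem whiskerLeft_smul_bim (M : GrBimod A B) {P Q : GrBimod B C} (c : ℚ) (s : P ⟶ Q) :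
    tensorWhiskerLeft M (BimHom.smul c s) = BimHom.smul c (tensorWhiskerLeft M s) :=
  tensor_hom_ext fun m p => by simp

theorem add_whiskerRight_bim {M P : GrBimod A B} (Q : GrBimod B C) (s t : M ⟶ P) :
    tensorWhiskerRight (BimHom.add s t) Q =
      BimHom.add (tensorWhiskerRight s Q) (tensorWhiskerRight t Q) :=
  tensor_hom_ext fun m p => by simp

theorem smul_whiskerRight_bim {M P : GrBimod A B} (Q : GrBimod B C) (c : ℚ) (s : M ⟶ P) :
    tensorWhiskerRight (BimHom.smul c s) Q = BimHom.smul c (tensorWhiskerRight s Q) :=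
  tensor_hom_ext fun m p => by simp

end linearity

/-- The axioms of an additive linear bicategory hold for bimodules, so only the basic relations
have to be checked. -/
theorem rel_of_basicRel {N : ℕ} {G : GenMaps N}
    (hb : ∀ {n m : ℤ} {f g : Mor n m} (s t : Tm f g), BasicRel s t → Γ₂ G s = Γ₂ G t)
    {n m : ℤ} {f g : Mor n m} (s t : Tm f g) (h : Rel s t) : Γ₂ G s = Γ₂ G t := by
  induction h with
  | basic s t h => exact hb s t h
  | comp_right η θ₁ θ₂ _ ih => exact congrArg (fun x => Γ₂ G η ≫ x) ih
  | comp_left η₁ η₂ θ _ ih => exact congrArg (fun x => x ≫ Γ₂ G θ) ih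
  | whiskerLeft f g h η η' _ ih => exact congrArg (tensorWhiskerLeft (Γ₁ N f)) ih
  | whiskerRight f g h η η' _ ih => exact congrArg (fun x => tensorWhiskerRight x (Γ₁ N h)) ih
  | add_left s s' t _ ih => exact congrArg (fun x => BimHom.add x (Γ₂ G t)) ih
  | add_right s t t' _ ih => exact congrArg (BimHom.add (Γ₂ G s)) ih
  | smul c t t' _ ih => exact congrArg (BimHom.smul c) ih
  | id_comp η => exact Category.id_comp (Γ₂ G η)
  | comp_id η => exact Category.comp_id (Γ₂ G η)
  | assoc η θ ι => exact Category.assoc (Γ₂ G η) (Γ₂ G θ) (Γ₂ G ι)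
  | whiskerLeft_id f g => exact Bicategory.whiskerLeft_id (B := GrAlg) (Γ₁ N f) (Γ₁ N g)
  | whiskerLeft_comp f η θ =>
    exact Bicategory.whiskerLeft_comp (B := GrAlg) (Γ₁ N f) (Γ₂ G η) (Γ₂ G θ)
  | id_whiskerLeft η => exact Bicategory.id_whiskerLeft (B := GrAlg) (Γ₂ G η)
  | comp_whiskerLeft f g η =>
    exact Bicategory.comp_whiskerLeft (B := GrAlg) (Γ₁ N f) (Γ₁ N g) (Γ₂ G η)
  | id_whiskerRight f g => exact Bicategory.id_whiskerRight (B := GrAlg) (Γ₁ N f) (Γ₁ N g)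
  | comp_whiskerRight i η θ =>
    exact Bicategory.comp_whiskerRight (B := GrAlg) (Γ₂ G η) (Γ₂ G θ) (Γ₁ N i)
  | whiskerRight_id η => exact Bicategory.whiskerRight_id (B := GrAlg) (Γ₂ G η)
  | whiskerRight_comp g h η =>
    exact Bicategory.whiskerRight_comp (B := GrAlg) (Γ₂ G η) (Γ₁ N g) (Γ₁ N h)
  | whisker_assoc f η h =>
    exact Bicategory.whisker_assoc (B := GrAlg) (Γ₁ N f) (Γ₂ G η) (Γ₁ N h)
  | whisker_exchange η θ => exact Bicategory.whisker_exchange (B := GrAlg) (Γ₂ G η) (Γ₂ G θ)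
  | assoc_hom_inv f g h => exact (Bicategory.associator (B := GrAlg) (Γ₁ N f) (Γ₁ N g) (Γ₁ N h)).hom_inv_id
  | assoc_inv_hom f g h => exact (Bicategory.associator (B := GrAlg) (Γ₁ N f) (Γ₁ N g) (Γ₁ N h)).inv_hom_id
  | leftUnit_hom_inv f => exact (leftUnit (Γ₁ N f)).hom_inv_id
  | leftUnit_inv_hom f => exact (leftUnit (Γ₁ N f)).inv_hom_id
  | rightUnit_hom_inv f => exact (rightUnit (Γ₁ N f)).hom_inv_id
  | rightUnit_inv_hom f => exact (rightUnit (Γ₁ N f)).inv_hom_id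
  | pentagon f g h i =>
    exact Bicategory.pentagon (B := GrAlg) (Γ₁ N f) (Γ₁ N g) (Γ₁ N h) (Γ₁ N i)
  | triangle f g => exact unit_triangle (Γ₁ N f) (Γ₁ N g)
  | add_comm s t => exact hom_ext (add_comm (Γ₂ G s).lin (Γ₂ G t).lin)
  | add_assoc s t u => exact hom_ext (add_assoc (Γ₂ G s).lin (Γ₂ G t).lin (Γ₂ G u).lin)
  | add_zero s => exact hom_ext (add_zero (Γ₂ G s).lin)
  | zero_smul s => exact hom_ext (zero_smul ℚ (Γ₂ G s).lin)
  | one_smul s => exact hom_ext (one_smul ℚ (Γ₂ G s).lin)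
  | mul_smul c d s => exact hom_ext (mul_smul c d (Γ₂ G s).lin)
  | add_smul c d s => exact hom_ext (add_smul c d (Γ₂ G s).lin)
  | smul_add c s t => exact hom_ext (smul_add c (Γ₂ G s).lin (Γ₂ G t).lin)
  | add_comp s s' t => exact add_comp_bim (Γ₂ G s) (Γ₂ G s') (Γ₂ G t)
  | comp_add s t t' => exact comp_add_bim (Γ₂ G s) (Γ₂ G t) (Γ₂ G t')
  | smul_comp c s t => exact smul_comp_bim c (Γ₂ G s) (Γ₂ G t)
  | comp_smul c s t => exact comp_smul_bim c (Γ₂ G s) (Γ₂ G t)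
  | whiskerLeft_add f s t => exact whiskerLeft_add_bim (Γ₁ N f) (Γ₂ G s) (Γ₂ G t)
  | whiskerLeft_smul f r s => exact whiskerLeft_smul_bim (Γ₁ N f) r (Γ₂ G s)
  | add_whiskerRight h s t => exact add_whiskerRight_bim (Γ₁ N h) (Γ₂ G s) (Γ₂ G t)
  | smul_whiskerRight h r s => exact smul_whiskerRight_bim (Γ₁ N h) r (Γ₂ G s)
  | toShift_ofShift f s => rfl
  | ofShift_toShift f s => rfl
  | inl_fst f g => rfl
  | inl_snd f g => rfl
  | inr_fst f g => rfl
  | inr_snd f g => rfl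
  | sum_total f g =>
    exact hom_ext (LinearMap.ext fun x : (Γ₁ N f).carrier × (Γ₁ N g).carrier => by
      change (x.1, (0 : (Γ₁ N g).carrier)) + ((0 : (Γ₁ N f).carrier), x.2) = x
      simp)
  | id_zero a b => exact hom_ext (LinearMap.ext fun x => (rfl : (PUnit.unit : PUnit) = PUnit.unit))

section FreeExtensions

open Polynomial

variable {A R : Type} [CommRing A] [Algebra ℚ A] [CommRing R] [Algebra ℚ R]

/-- `R` is free over `A` with basis `1, ξ, …, ξ^(m-1)`. -/
def IsFreeExt (φ : A →ₐ[ℚ] R) (ξ : R) (m : ℕ) : Prop :=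
  ∀ f : R, ∃! g : Fin m → A, f = ∑ i, φ (g i) * ξ ^ (i : ℕ)

theorem isFreeExt_of_adjoinRoot [Nontrivial A] {P : A[X]} (hP : P.Monic) (φ : A →ₐ[ℚ] R) (ξ : R)
    (hξ : P.eval₂ (φ : A →+* R) ξ = 0) (gen : ∀ f : R, ∃ p : A[X], f = p.eval₂ (φ : A →+* R) ξ)
    (ρ : R →+* AdjoinRoot P) (hρ : ∀ a, ρ (φ a) = AdjoinRoot.of P a)
    (hρξ : ρ ξ = AdjoinRoot.root P) : IsFreeExt φ ξ P.natDegree := by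
  have key : ∀ p : A[X], ρ (p.eval₂ (φ : A →+* R) ξ) = AdjoinRoot.mk P p := by
    intro p
    rw [Polynomial.hom_eval₂, hρξ, ← AdjoinRoot.aeval_eq, Polynomial.aeval_def]
    congr 1
    ext a
    exact hρ a
  intro f
  obtain ⟨p, rfl⟩ := gen f
  refine ⟨fun i => (p %ₘ P).coeff i, ?_, ?_⟩
  · have h1 : p.eval₂ (φ : A →+* R) ξ = (p %ₘ P).eval₂ (φ : A →+* R) ξ := by
      conv_lhs => rw [← Polynomial.modByMonic_add_div p P]
      rw [Polynomial.eval₂_add, Polynomial.eval₂_mul, hξ, zero_mul, add_zero]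
    change _ = ∑ i : Fin P.natDegree, φ ((p %ₘ P).coeff i) * ξ ^ (i : ℕ)
    rw [h1]
    by_cases hd : P.natDegree = 0
    · have : P = 1 := Polynomial.eq_one_of_monic_natDegree_zero hP hd
      subst this
      simp [Polynomial.modByMonic_one]
    · rw [Polynomial.eval₂_eq_sum_range' _ (Polynomial.natDegree_modByMonic_lt p hP
        (fun h => hd (by rw [h, Polynomial.natDegree_one]))) ξ, Finset.sum_range]
      rfl
  · intro g hg
    set q : A[X] := ∑ i : Fin P.natDegree, Polynomial.monomial (i : ℕ) (g i) with hq
    have hqe : q.eval₂ (φ : A →+* R) ξ = p.eval₂ (φ : A →+* R) ξ := by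
      rw [hg, hq, Polynomial.eval₂_finsetSum]
      exact Finset.sum_congr rfl fun i _ => Polynomial.eval₂_monomial _ _
    have hmk : AdjoinRoot.mk P q = AdjoinRoot.mk P (p %ₘ P) := by
      rw [← key, ← key, hqe]
      congr 1
      conv_lhs => rw [← Polynomial.modByMonic_add_div p P]
      rw [Polynomial.eval₂_add, Polynomial.eval₂_mul, hξ, zero_mul, add_zero]
    have hqd : q.degree < P.degree := by
      rw [Polynomial.degree_eq_natDegree hP.ne_zero]
      refine (Polynomial.degree_sum_le _ _).trans_lt ?_
      rw [Finset.sup_lt_iff (WithBot.bot_lt_coe _)]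
      intro i _
      exact (Polynomial.degree_monomial_le _ _).trans_lt (by exact_mod_cast i.2)
    have hq2 : q = p %ₘ P := by
      rw [← sub_eq_zero]
      have hdvd : P ∣ q - p %ₘ P := by
        rw [← AdjoinRoot.mk_eq_zero, map_sub, hmk, sub_self]
      by_contra hne
      refine hP.not_dvd_of_degree_lt hne ?_ hdvd
      exact (Polynomial.degree_sub_le _ _).trans_lt
        (max_lt hqd (Polynomial.degree_modByMonic_lt p hP))
    funext i
    rw [← hq2, hq, Polynomial.finsetSum_coeff]
    simp [Polynomial.coeff_monomial, Fin.val_inj]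

namespace IsFreeExt

variable {φ : A →ₐ[ℚ] R} {ξ : R} {m : ℕ}

/-- The coordinates with respect to `1, ξ, …, ξ^(m-1)`. -/
noncomputable def coord (h : IsFreeExt φ ξ m) (f : R) : Fin m → A := (h f).choose

theorem coord_spec (h : IsFreeExt φ ξ m) (f : R) : f = ∑ i, φ (h.coord f i) * ξ ^ (i : ℕ) :=
  (h f).choose_spec.1

theorem coord_eq (h : IsFreeExt φ ξ m) {f : R} {g : Fin m → A}
    (hg : f = ∑ i, φ (g i) * ξ ^ (i : ℕ)) : h.coord f = g :=
  ((h f).choose_spec.2 g hg).symm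

theorem coord_add (h : IsFreeExt φ ξ m) (f g : R) : h.coord (f + g) = h.coord f + h.coord g := by
  apply h.coord_eq
  conv_lhs => rw [h.coord_spec f, h.coord_spec g]
  simp [add_mul, Finset.sum_add_distrib]

theorem coord_mul (h : IsFreeExt φ ξ m) (a : A) (f : R) :
    h.coord (φ a * f) = fun i => a * h.coord f i := by
  apply h.coord_eq
  conv_lhs => rw [h.coord_spec f]
  simp [Finset.mul_sum, mul_assoc]

theorem coord_pow (h : IsFreeExt φ ξ m) (i : Fin m) : h.coord (ξ ^ (i : ℕ)) = Pi.single i 1 := by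
  apply h.coord_eq
  rw [Finset.sum_eq_single i]
  · simp
  · intro j _ hj
    simp [Pi.single_eq_of_ne hj]
  · simp

/-- The coordinate of `ξ^i`, as a linear map. -/
noncomputable def coordLin (h : IsFreeExt φ ξ m) (i : Fin m) : R →ₗ[ℚ] A where
  toFun f := h.coord f i
  map_add' f g := by rw [h.coord_add]; rfl
  map_smul' c f := by
    have := congrFun (h.coord_mul (algebraMap ℚ A c) f) i
    rw [AlgHom.commutes, ← Algebra.smul_def, ← Algebra.smul_def] at this
    exact this

/-- The Frobenius trace takes the values `s (a - m)` on the powers of `ξ`, where `s` is the inverse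
of the polynomial satisfied by `ξ`. -/
theorem coordLin_last_pow (h : IsFreeExt φ ξ (m + 1)) (c : ℕ → A) (s : ℤ → A) (c0 : c 0 = 1)
    (hξ : ∑ j ∈ Finset.range (m + 2), (-1) ^ j * φ (c j) * ξ ^ (m + 1 - j) = 0)
    (hneg : ∀ d < 0, s d = 0) (h0 : s 0 = 1)
    (hs : ∀ d : ℕ, ∑ j ∈ Finset.range (m + 2), (-1) ^ j * c j * s (d + 1 - j) = 0) (a : ℕ) :
    h.coordLin (Fin.last m) (ξ ^ a) = s (a - m) := by
  induction a using Nat.strong_induction_on with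
  | _ a ih =>
    rcases lt_or_ge a (m + 1) with ha | ha
    · have := congrFun (h.coord_pow ⟨a, ha⟩) (Fin.last m)
      refine this.trans ?_
      rcases Nat.lt_succ_iff_lt_or_eq.1 ha with h' | rfl
      · rw [Pi.single_eq_of_ne, hneg]
        · omega
        · intro he; have := congrArg Fin.val he; simp at this; omega
      · rw [sub_self, h0]
        exact Pi.single_eq_same (M := fun _ : Fin (a + 1) => A) (Fin.last a) 1
    · obtain ⟨d, rfl⟩ := Nat.exists_eq_add_of_le ha
      have h1 : ξ ^ (m + 1 + d) = -∑ j ∈ Finset.range (m + 1),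
          φ ((-1) ^ (j + 1) * c (j + 1)) * ξ ^ (m + 1 + d - (j + 1)) := by
        rw [Finset.sum_range_succ'] at hξ
        have hξ' := congrArg (· * ξ ^ d) hξ
        simp only [add_mul, zero_mul, c0, map_one, pow_zero, one_mul, Nat.sub_zero] at hξ'
        rw [← pow_add, add_comm] at hξ'
        rw [eq_neg_of_add_eq_zero_left hξ', Finset.sum_mul]
        congr 1
        refine Finset.sum_congr rfl fun j hj => ?_
        rw [Finset.mem_range] at hj
        rw [mul_assoc, ← pow_add, map_mul, map_pow, map_neg, map_one,
          show m + 1 - (j + 1) + d = m + 1 + d - (j + 1) by omega]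
      rw [h1, map_neg, map_sum]
      have h2 := hs d
      rw [Finset.sum_range_succ'] at h2
      simp only [pow_zero, c0, one_mul, Nat.cast_zero, sub_zero] at h2
      rw [show ((m + 1 + d : ℕ) : ℤ) - m = d + 1 by push_cast; ring, eq_neg_of_add_eq_zero_right h2]
      congr 1
      refine Finset.sum_congr rfl fun j hj => ?_
      rw [Finset.mem_range] at hj
      refine (congrFun (h.coord_mul _ _) (Fin.last m)).trans ?_
      congr 1
      refine (ih (m + 1 + d - (j + 1)) (by omega)).trans (congrArg s ?_)
      push_cast [show j + 1 ≤ m + 1 + d by omega]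
      ring

end IsFreeExt

/-- The polynomial `∑ (-1)^j c_j X^(m-j)`. -/
noncomputable def charPoly (c : ℕ → A) (m : ℕ) : A[X] :=
  ∑ j ∈ Finset.range (m + 1), Polynomial.monomial (m - j) ((-1) ^ j * c j)

theorem charPoly_eval₂ (c : ℕ → A) (m : ℕ) (φ : A →+* R) (ξ : R) :
    (charPoly c m).eval₂ φ ξ = ∑ j ∈ Finset.range (m + 1), (-1) ^ j * φ (c j) * ξ ^ (m - j) := by
  rw [charPoly, Polynomial.eval₂_finsetSum]
  simp [Polynomial.eval₂_monomial]

theorem charPoly_tail_degree (c : ℕ → A) (m : ℕ) :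
    (∑ j ∈ Finset.range m, Polynomial.monomial (m - (j + 1)) ((-1) ^ (j + 1) * c (j + 1))).degree <
      (m : WithBot ℕ) := by
  refine (Polynomial.degree_sum_le _ _).trans_lt ?_
  rw [Finset.sup_lt_iff (WithBot.bot_lt_coe _)]
  intro j hj
  rw [Finset.mem_range] at hj
  exact (Polynomial.degree_monomial_le _ _).trans_lt (by exact_mod_cast (by omega))

theorem charPoly_eq (c : ℕ → A) (c0 : c 0 = 1) (m : ℕ) : charPoly c m = X ^ m +
    ∑ j ∈ Finset.range m, Polynomial.monomial (m - (j + 1)) ((-1) ^ (j + 1) * c (j + 1)) := by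
  rw [charPoly, Finset.sum_range_succ', add_comm, c0, pow_zero, one_mul, Nat.sub_zero,
    Polynomial.monomial_one_right_eq_X_pow]

theorem charPoly_monic (c : ℕ → A) (c0 : c 0 = 1) (m : ℕ) : (charPoly c m).Monic := by
  rw [charPoly_eq c c0]
  exact Polynomial.monic_X_pow_add (charPoly_tail_degree c m)

theorem charPoly_natDegree [Nontrivial A] (c : ℕ → A) (c0 : c 0 = 1) (m : ℕ) :
    (charPoly c m).natDegree = m := by
  rw [charPoly_eq c c0]
  exact Polynomial.natDegree_eq_of_degree_eq_some (by
    rw [Polynomial.degree_add_eq_left_of_degree_lt, Polynomial.degree_X_pow]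
    rw [Polynomial.degree_X_pow]; exact charPoly_tail_degree c m)

/-- If `c(t) = d(t) (1 + ξ t)` then `ξ` is a root of `∑ (-1)^j c_j X^(m-j)`. -/
theorem telescope (c d : ℕ → R) (ξ : R) (h0 : c 0 = d 0)
    (h : ∀ j, c (j + 1) = d (j + 1) + ξ * d j) (m : ℕ) :
    ∑ j ∈ Finset.range (m + 1), (-1) ^ j * c j * ξ ^ (m - j) = (-1) ^ m * d m := by
  induction m with
  | zero => simp [h0]
  | succ m ih =>
    rw [Finset.sum_range_succ, h m]
    have : ∑ j ∈ Finset.range (m + 1), (-1) ^ j * c j * ξ ^ (m + 1 - j) =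
        ξ * ∑ j ∈ Finset.range (m + 1), (-1) ^ j * c j * ξ ^ (m - j) := by
      rw [Finset.mul_sum]
      refine Finset.sum_congr rfl fun j hj => ?_
      rw [Finset.mem_range] at hj
      rw [show m + 1 - j = m - j + 1 by omega]
      ring
    rw [this, ih]
    simp
    ring

/-- The criterion for freeness used for the rings of partial flags: `c(t) = d(t) (1 + ξ t)`. -/
theorem isFreeExt_of_factor [Nontrivial A] (c : ℕ → A) (m : ℕ) (c0 : c 0 = 1)
    (φ : A →ₐ[ℚ] R) (ξ : R) (d : ℕ → R) (d0 : d 0 = 1) (dm : d m = 0)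
    (h : ∀ j, φ (c (j + 1)) = d (j + 1) + ξ * d j)
    (gen : ∀ f : R, ∃ p : A[X], f = p.eval₂ (φ : A →+* R) ξ)
    (ρ : R →+* AdjoinRoot (charPoly c m)) (hρ : ∀ a, ρ (φ a) = AdjoinRoot.of _ a)
    (hρξ : ρ ξ = AdjoinRoot.root _) : IsFreeExt φ ξ m := by
  have := isFreeExt_of_adjoinRoot (charPoly_monic c c0 m) φ ξ (by
    rw [charPoly_eval₂]
    exact (telescope (fun j => φ (c j)) d ξ (by simp [c0, d0]) h m).trans (by simp [dm])) gen ρ hρ hρξ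
  rwa [charPoly_natDegree c c0] at this

/-- The elements `d_j` with `c(t) = d(t) (1 + X t)` in `A[X]/(∑ (-1)^j c_j X^(m-j))`. -/
noncomputable def quotSeq (c : ℕ → A) (m : ℕ) : ℕ → AdjoinRoot (charPoly c m)
  | 0 => 1
  | j + 1 => AdjoinRoot.of _ (c (j + 1)) - AdjoinRoot.root _ * quotSeq c m j

theorem quotSeq_succ (c : ℕ → A) (m j : ℕ) : AdjoinRoot.of (charPoly c m) (c (j + 1)) =
    quotSeq c m (j + 1) + AdjoinRoot.root _ * quotSeq c m j := by
  rw [quotSeq]; ring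

theorem quotSeq_self (c : ℕ → A) (m : ℕ) (c0 : c 0 = 1) : quotSeq c m m = 0 := by
  have h1 := telescope (fun j => AdjoinRoot.of (charPoly c m) (c j)) (quotSeq c m)
    (AdjoinRoot.root _) (by simp [c0, quotSeq]) (quotSeq_succ c m) m
  rw [← charPoly_eval₂, AdjoinRoot.eval₂_root] at h1
  have h2 : (-1 : AdjoinRoot (charPoly c m)) ^ m * ((-1) ^ m * quotSeq c m m) = quotSeq c m m := by
    rw [← mul_assoc, ← mul_pow]; simp
  rw [← h2, ← h1, mul_zero]

theorem quotSeq_of_le (c : ℕ → A) (m : ℕ) (c0 : c 0 = 1) (hc : ∀ j, m < j → c j = 0) (j : ℕ)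
    (hj : m ≤ j) : quotSeq c m j = 0 := by
  induction j, hj using Nat.le_induction with
  | base => exact quotSeq_self c m c0
  | succ j hj ih => rw [quotSeq, ih, hc _ (by omega)]; simp

end FreeExtensions

section Series

variable {A : Type} [CommRing A]

/-- The coefficients of a power series, extended by zero to negative indices. -/
noncomputable def zcoeff (p : PowerSeries A) (d : ℤ) : A :=
  if d < 0 then 0 else PowerSeries.coeff d.toNat p

theorem zcoeff_neg (p : PowerSeries A) {d : ℤ} (h : d < 0) : zcoeff p d = 0 := if_pos h

@[simp] theorem zcoeff_natCast (p : PowerSeries A) (d : ℕ) :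
    zcoeff p d = PowerSeries.coeff d p := by
  simp [zcoeff]

theorem sum_coeff_mul_zcoeff (p q : PowerSeries A) (d : ℤ) (M : ℕ)
    (hM : ∀ j : ℕ, M ≤ j → PowerSeries.coeff j p = 0 ∨ d < j) :
    ∑ j ∈ Finset.range M, PowerSeries.coeff j p * zcoeff q (d - j) = zcoeff (p * q) d := by
  rcases lt_or_ge d 0 with hd | hd
  · rw [zcoeff_neg _ hd]
    refine Finset.sum_eq_zero fun j _ => ?_
    rw [zcoeff_neg _ (by omega), mul_zero]
  · lift d to ℕ using hd
    rw [zcoeff_natCast, PowerSeries.coeff_mul, Finset.Nat.sum_antidiagonal_eq_sum_range_succ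
      (f := fun i j => PowerSeries.coeff i p * PowerSeries.coeff j q)]
    have h1 : ∑ j ∈ Finset.range M, PowerSeries.coeff j p * zcoeff q (d - j) =
        ∑ j ∈ Finset.range (max M (d + 1)), PowerSeries.coeff j p * zcoeff q (d - j) := by
      refine Finset.sum_subset (Finset.range_mono (le_max_left _ _)) fun j _ hj => ?_
      rw [Finset.mem_range, not_lt] at hj
      rcases hM j hj with h | h
      · rw [h, zero_mul]
      · rw [zcoeff_neg _ (by omega), mul_zero]
    have h2 : ∑ j ∈ Finset.range (d + 1), PowerSeries.coeff j p * zcoeff q (d - j) =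
        ∑ j ∈ Finset.range (max M (d + 1)), PowerSeries.coeff j p * zcoeff q (d - j) := by
      refine Finset.sum_subset (Finset.range_mono (le_max_right _ _)) fun j _ hj => ?_
      rw [Finset.mem_range, not_lt] at hj
      rw [zcoeff_neg _ (by omega), mul_zero]
    rw [h1, ← h2]
    refine Finset.sum_congr rfl fun j hj => ?_
    rw [Finset.mem_range] at hj
    rw [show (d : ℤ) - j = ((d - j : ℕ) : ℤ) by omega, zcoeff_natCast]

theorem zcoeff_one (d : ℤ) : zcoeff (1 : PowerSeries A) d = if d = 0 then 1 else 0 := by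
  rcases lt_or_ge d 0 with hd | hd
  · rw [zcoeff_neg _ hd, if_neg (by omega)]
  · lift d to ℕ using hd
    rw [zcoeff_natCast, PowerSeries.coeff_one]
    simp

theorem zcoeff_map {B : Type} [CommRing B] (φ : A →+* B) (p : PowerSeries A) (d : ℤ) :
    zcoeff (PowerSeries.map φ p) d = φ (zcoeff p d) := by
  unfold zcoeff; split_ifs <;> simp

theorem zcoeff_mul_linear (p : PowerSeries A) (u : A) (d : ℤ) :
    zcoeff (p * (1 - PowerSeries.C u * PowerSeries.X)) d = zcoeff p d - u * zcoeff p (d - 1) := by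
  rcases lt_or_ge d 0 with hd | hd
  · simp [zcoeff_neg _ hd, zcoeff_neg p (show d - 1 < 0 by omega)]
  · lift d to ℕ using hd
    rw [zcoeff_natCast, zcoeff_natCast, mul_sub, mul_one, map_sub, mul_left_comm,
      PowerSeries.coeff_C_mul]
    congr 2
    cases d with
    | zero => simp [zcoeff_neg]
    | succ d =>
      rw [PowerSeries.coeff_succ_mul_X, show ((d + 1 : ℕ) : ℤ) - 1 = d by push_cast; ring,
        zcoeff_natCast]

/-- The series `∑ (-1)^j c_j t^j`. -/
noncomputable def altSeries (c : ℕ → A) : PowerSeries A := PowerSeries.mk fun j => (-1) ^ j * c j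

@[simp] theorem coeff_altSeries (c : ℕ → A) (j : ℕ) :
    PowerSeries.coeff j (altSeries c) = (-1) ^ j * c j := PowerSeries.coeff_mk _ _

theorem altSeries_mul_inverse (c C : ℕ → A) (c0 : c 0 = 1) (C0 : C 0 = 1)
    (hC : ∀ a, C (a + 1) = -∑ i : Fin (a + 1), c (a + 1 - i) * C i) :
    altSeries c * altSeries C = 1 := by
  ext d
  rw [mul_comm, PowerSeries.coeff_mul, Finset.Nat.sum_antidiagonal_eq_sum_range_succ
      (f := fun i j => PowerSeries.coeff i (altSeries C) * PowerSeries.coeff j (altSeries c))]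
  cases d with
  | zero => simp [c0, C0]
  | succ d =>
    rw [Finset.sum_range_succ, PowerSeries.coeff_one, if_neg (by omega)]
    simp only [coeff_altSeries, Nat.sub_self, c0, pow_zero, mul_one]
    rw [hC, mul_neg, Finset.mul_sum, Finset.sum_range, ← sub_eq_add_neg, ← Finset.sum_sub_distrib]
    refine Finset.sum_eq_zero fun i _ => ?_
    have : (-1 : A) ^ (d + 1) = (-1) ^ (i : ℕ) * (-1) ^ (d + 1 - (i : ℕ)) := by
      rw [← pow_add]; congr 1; omega
    rw [this]; ring

theorem altSeries_factor (c d : ℕ → A) (u : A) (h0 : c 0 = d 0)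
    (h : ∀ j, c (j + 1) = d (j + 1) + u * d j) :
    altSeries c = altSeries d * (1 - PowerSeries.C u * PowerSeries.X) := by
  ext j
  rw [← zcoeff_natCast (altSeries d * _), zcoeff_mul_linear, zcoeff_natCast, coeff_altSeries]
  cases j with
  | zero => simp [h0, zcoeff_neg]
  | succ j =>
    rw [show ((j + 1 : ℕ) : ℤ) - 1 = j by push_cast; ring, zcoeff_natCast, coeff_altSeries,
      coeff_altSeries, h, pow_succ]
    ring

theorem map_altSeries {B : Type} [CommRing B] (φ : A →+* B) (c : ℕ → A) :
    PowerSeries.map φ (altSeries c) = altSeries fun j => φ (c j) := by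
  ext j; simp

end Series

section FlagRings

variable {N : ℕ} {n : ℤ}

theorem x_zero : x N n 0 = 1 := rfl
theorem y_zero : y N n 0 = 1 := rfl
theorem xE_zero : xE N n 0 = 1 := rfl
theorem yE_zero : yE N n 0 = 1 := rfl

theorem x_eq_zero {j : ℕ} (h : kk N n < j) : x N n j = 0 := by
  obtain ⟨j, rfl⟩ : ∃ i, j = i + 1 := ⟨j - 1, by omega⟩
  exact funext fun _ => dif_neg (by omega)

theorem y_eq_zero {j : ℕ} (h : N - kk N n < j) : y N n j = 0 := by
  obtain ⟨j, rfl⟩ : ∃ i, j = i + 1 := ⟨j - 1, by omega⟩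
  exact funext fun _ => dif_neg (by omega)

theorem xE_eq_zero {j : ℕ} (h : kk N n < j) : xE N n j = 0 := by
  obtain ⟨j, rfl⟩ : ∃ i, j = i + 1 := ⟨j - 1, by omega⟩
  exact funext fun _ => dif_neg (by omega)

theorem yE_eq_zero {j : ℕ} (h : N - kk N n - 1 < j) : yE N n j = 0 := by
  obtain ⟨j, rfl⟩ : ∃ i, j = i + 1 := ⟨j - 1, by omega⟩
  exact funext fun _ => dif_neg (by omega)

theorem lHom_eq (h : ValidE N n) (a : (H N n).carrier) :
    lHom N n a = MvPolynomial.aeval (lGen N n) (a ⟨h.valid⟩) :=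
  funext fun i => by obtain rfl : i = ⟨h⟩ := Subsingleton.elim _ _; rfl

theorem rHom_eq (h : ValidE N n) (a : (H N (n + 2)).carrier) :
    rHom N n a = MvPolynomial.aeval (rGen N n) (a ⟨h.valid_succ⟩) :=
  funext fun i => by obtain rfl : i = ⟨h⟩ := Subsingleton.elim _ _; rfl

theorem lHom_x (h : ValidE N n) (j : ℕ) : lHom N n (x N n j) = xE N n j := by
  cases j with
  | zero => exact map_one (lHom N n)
  | succ j =>
    by_cases hj : j < kk N n
    · rw [lHom_eq h, show x N n (j + 1) ⟨h.valid⟩ = MvPolynomial.X (Sum.inl ⟨j, hj⟩) from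
        dif_pos hj, MvPolynomial.aeval_X]
      rfl
    · rw [x_eq_zero (by omega), xE_eq_zero (by omega), map_zero]

theorem lHom_y (h : ValidE N n) (j : ℕ) :
    lHom N n (y N n (j + 1)) = yE N n (j + 1) + xi N n * yE N n j := by
  have hk := h.kk_lt
  by_cases hj : j < N - kk N n
  · rw [lHom_eq h, show y N n (j + 1) ⟨h.valid⟩ = MvPolynomial.X (Sum.inr ⟨j, hj⟩) from
      dif_pos hj, MvPolynomial.aeval_X]
    rfl
  · rw [y_eq_zero (by omega), yE_eq_zero (by omega), yE_eq_zero (by omega), map_zero]; simp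

theorem rHom_x (h : ValidE N n) (j : ℕ) :
    rHom N n (x N (n + 2) (j + 1)) = xE N n (j + 1) + xi N n * xE N n j := by
  have hk := h.kk_succ
  by_cases hj : j < kk N (n + 2)
  · rw [rHom_eq h, show x N (n + 2) (j + 1) ⟨h.valid_succ⟩ = MvPolynomial.X (Sum.inl ⟨j, hj⟩) from
      dif_pos hj, MvPolynomial.aeval_X]
    rfl
  · rw [x_eq_zero (by omega), xE_eq_zero (by omega), xE_eq_zero (by omega), map_zero]; simp

theorem rHom_y (h : ValidE N n) (j : ℕ) : rHom N n (y N (n + 2) j) = yE N n j := by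
  have hk := h.kk_succ
  cases j with
  | zero => exact map_one (rHom N n)
  | succ j =>
    by_cases hj : j < N - kk N (n + 2)
    · rw [rHom_eq h, show y N (n + 2) (j + 1) ⟨h.valid_succ⟩ = MvPolynomial.X (Sum.inr ⟨j, hj⟩) from
        dif_pos hj, MvPolynomial.aeval_X]
      rfl
    · rw [y_eq_zero (by omega), yE_eq_zero (by omega), map_zero]

theorem H_nontrivial (h : Valid N n) : Nontrivial (H N n).carrier :=
  have : Nonempty (PLift (Valid N n)) := ⟨⟨h⟩⟩
  inferInstanceAs (Nontrivial (PLift (Valid N n) → MvPolynomial (Var N n) ℚ))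

theorem HE_subsingleton (h : ¬ValidE N n) : Subsingleton (HE N n).carrier :=
  have : IsEmpty (PLift (ValidE N n)) := ⟨fun x => h x.down⟩
  inferInstanceAs (Subsingleton (PLift (ValidE N n) → MvPolynomial (VarE N n) ℚ))

theorem H_subsingleton (h : ¬Valid N n) : Subsingleton (H N n).carrier :=
  have : IsEmpty (PLift (Valid N n)) := ⟨fun x => h x.down⟩
  inferInstanceAs (Subsingleton (PLift (Valid N n) → MvPolynomial (Var N n) ℚ))

/-- Evaluation at the unique point identifies `H_k` with a polynomial ring. -/
noncomputable def Hpoly (h : Valid N n) : (H N n).carrier ≃ₐ[ℚ] MvPolynomial (Var N n) ℚ where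
  toFun f := f ⟨h⟩
  invFun p := fun _ => p
  left_inv f := funext fun _ => congrArg f (Subsingleton.elim _ _)
  right_inv _ := rfl
  map_mul' _ _ := rfl
  map_add' _ _ := rfl
  commutes' _ := rfl

/-- Evaluation at the unique point identifies `H_{k,k+1}` with a polynomial ring. -/
noncomputable def HEpoly (h : ValidE N n) : (HE N n).carrier ≃ₐ[ℚ] MvPolynomial (VarE N n) ℚ where
  toFun f := f ⟨h⟩
  invFun p := fun _ => p
  left_inv f := funext fun _ => congrArg f (Subsingleton.elim _ _)
  right_inv _ := rfl
  map_mul' _ _ := rfl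
  map_add' _ _ := rfl
  commutes' _ := rfl

variable {S : Type} [CommRing S] [Algebra ℚ S]

theorem Hpoly_symm_inl (h : Valid N n) (j : Fin (kk N n)) :
    (Hpoly h).symm (MvPolynomial.X (Sum.inl j)) = x N n (j + 1) :=
  funext fun i => (show x N n (j + 1) i = _ from dif_pos j.2).symm

theorem Hpoly_symm_inr (h : Valid N n) (j : Fin (N - kk N n)) :
    (Hpoly h).symm (MvPolynomial.X (Sum.inr j)) = y N n (j + 1) :=
  funext fun i => (show y N n (j + 1) i = _ from dif_pos j.2).symm

theorem HEpoly_symm_inl (h : ValidE N n) (j : Fin (kk N n)) :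
    (HEpoly h).symm (MvPolynomial.X (Sum.inl j)) = xE N n (j + 1) :=
  funext fun i => (show xE N n (j + 1) i = _ from dif_pos j.2).symm

theorem HEpoly_symm_inr (h : ValidE N n) (j : Fin (N - kk N n - 1)) :
    (HEpoly h).symm (MvPolynomial.X (Sum.inr (Sum.inr j))) = yE N n (j + 1) :=
  funext fun i => (show yE N n (j + 1) i = _ from dif_pos j.2).symm

theorem H_hom_ext (h : Valid N n) {f g : (H N n).carrier →ₐ[ℚ] S}
    (hx : ∀ j, f (x N n j) = g (x N n j)) (hy : ∀ j, f (y N n j) = g (y N n j)) : f = g := by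
  have : f.comp (Hpoly h).symm.toAlgHom = g.comp (Hpoly h).symm.toAlgHom := by
    apply MvPolynomial.algHom_ext
    rintro (j | j)
    · refine (congrArg f (Hpoly_symm_inl h j)).trans (.trans ?_ (congrArg g (Hpoly_symm_inl h j)).symm)
      exact hx _
    · refine (congrArg f (Hpoly_symm_inr h j)).trans (.trans ?_ (congrArg g (Hpoly_symm_inr h j)).symm)
      exact hy _
  ext a
  have := AlgHom.congr_fun this (Hpoly h a)
  simpa using this

theorem HE_hom_ext (h : ValidE N n) {f g : (HE N n).carrier →ₐ[ℚ] S}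
    (hx : ∀ j, f (xE N n j) = g (xE N n j)) (hξ : f (xi N n) = g (xi N n))
    (hy : ∀ j, f (yE N n j) = g (yE N n j)) : f = g := by
  have : f.comp (HEpoly h).symm.toAlgHom = g.comp (HEpoly h).symm.toAlgHom := by
    apply MvPolynomial.algHom_ext
    rintro (j | ⟨⟩ | j)
    · refine (congrArg f (HEpoly_symm_inl h j)).trans
        (.trans ?_ (congrArg g (HEpoly_symm_inl h j)).symm)
      exact hx _
    · exact hξ
    · refine (congrArg f (HEpoly_symm_inr h j)).trans
        (.trans ?_ (congrArg g (HEpoly_symm_inr h j)).symm)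
      exact hy _
  ext a
  have := AlgHom.congr_fun this (HEpoly h a)
  simpa using this

theorem HE_subalgebra_eq_top (h : ValidE N n) (T : Subalgebra ℚ (HE N n).carrier)
    (hx : ∀ j, xE N n j ∈ T) (hξ : xi N n ∈ T) (hy : ∀ j, yE N n j ∈ T) : T = ⊤ := by
  rw [eq_top_iff]
  rintro a -
  have h1 : T.comap (HEpoly h).symm.toAlgHom = ⊤ := by
    rw [← top_le_iff, ← MvPolynomial.adjoin_range_X, Algebra.adjoin_le_iff]
    have hgen : ∀ s, (HEpoly h).symm (MvPolynomial.X s) ∈ T := by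
      rintro (j | ⟨⟩ | j)
      · rw [HEpoly_symm_inl]; exact hx _
      · exact hξ
      · rw [HEpoly_symm_inr]; exact hy _
    rintro _ ⟨s, rfl⟩
    exact hgen s
  have h2 : HEpoly h a ∈ T.comap (HEpoly h).symm.toAlgHom := by rw [h1]; trivial
  change (HEpoly h).symm (HEpoly h a) ∈ T at h2
  rwa [AlgEquiv.symm_apply_apply] at h2

/-- Homomorphisms out of `H_{k,k+1}`. -/
noncomputable def HElift (h : ValidE N n) (gx : ℕ → S) (gξ : S) (gy : ℕ → S) :
    (HE N n).carrier →ₐ[ℚ] S :=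
  (MvPolynomial.aeval (σ := VarE N n) (Sum.elim (fun j => gx (j + 1)) (Sum.elim (fun _ => gξ)
    (fun j => gy (j + 1))))).comp (HEpoly h).toAlgHom

theorem HElift_xE (h : ValidE N n) {gx : ℕ → S} {gξ : S} {gy : ℕ → S} (h0 : gx 0 = 1)
    (hx : ∀ j, kk N n < j → gx j = 0) (j : ℕ) : HElift h gx gξ gy (xE N n j) = gx j := by
  cases j with
  | zero => rw [xE_zero, map_one, h0]
  | succ j =>
    by_cases hj : j < kk N n
    · rw [← HEpoly_symm_inl h ⟨j, hj⟩]
      exact (MvPolynomial.aeval_X (R := ℚ) _ _).trans rfl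
    · rw [xE_eq_zero (by omega), hx _ (by omega), map_zero]

theorem HElift_yE (h : ValidE N n) {gx : ℕ → S} {gξ : S} {gy : ℕ → S} (h0 : gy 0 = 1)
    (hy : ∀ j, N - kk N n - 1 < j → gy j = 0) (j : ℕ) : HElift h gx gξ gy (yE N n j) = gy j := by
  cases j with
  | zero => rw [yE_zero, map_one, h0]
  | succ j =>
    by_cases hj : j < N - kk N n - 1
    · rw [← HEpoly_symm_inr h ⟨j, hj⟩]
      exact (MvPolynomial.aeval_X (R := ℚ) _ _).trans rfl
    · rw [yE_eq_zero (by omega), hy _ (by omega), map_zero]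

theorem HElift_xi (h : ValidE N n) {gx : ℕ → S} {gξ : S} {gy : ℕ → S} :
    HElift h gx gξ gy (xi N n) = gξ := by
  change MvPolynomial.aeval _ (MvPolynomial.X _) = _
  rw [MvPolynomial.aeval_X]; rfl

open Polynomial in
theorem isFreeExt_lHom (h : ValidE N n) : IsFreeExt (lHom N n) (xi N n) (N - kk N n - 1 + 1) := by
  have hk := h.kk_lt
  have := H_nontrivial h.valid
  let Q := AdjoinRoot (charPoly (y N n) (N - kk N n - 1 + 1))
  have hyz := quotSeq_of_le (y N n) (N - kk N n - 1 + 1) y_zero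
    (fun j hj => y_eq_zero (by omega))
  let ρ : (HE N n).carrier →ₐ[ℚ] Q := HElift h (fun j => AdjoinRoot.of _ (x N n j))
    (AdjoinRoot.root _) (quotSeq (y N n) _)
  have ρx : ∀ j, ρ (xE N n j) = AdjoinRoot.of _ (x N n j) := HElift_xE h
    (by rw [x_zero, map_one]) fun j hj => by rw [x_eq_zero hj, map_zero]
  have ρy : ∀ j, ρ (yE N n j) = quotSeq (y N n) _ j := HElift_yE h rfl
    fun j hj => hyz j (by omega)
  have ρξ : ρ (xi N n) = AdjoinRoot.root _ := HElift_xi h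
  have hρ : ρ.comp (lHom N n) = AdjoinRoot.ofAlgHom ℚ (charPoly (y N n) (N - kk N n - 1 + 1)) := by
    refine H_hom_ext h.valid (fun j => ?_) (fun j => ?_)
    · change ρ (lHom N n _) = AdjoinRoot.of _ _
      rw [lHom_x h, ρx]
    · change ρ (lHom N n _) = AdjoinRoot.of _ _
      cases j with
      | zero => rw [y_zero, map_one, map_one, map_one]
      | succ j => rw [lHom_y h, map_add, map_mul, ρy, ρy, ρξ, ← quotSeq_succ]
  refine isFreeExt_of_factor (y N n) _ y_zero _ _ (yE N n) yE_zero (yE_eq_zero (by omega))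
    (lHom_y h) ?_ ρ.toRingHom (fun a => AlgHom.congr_fun hρ a) ρξ
  let T : Subalgebra ℚ (HE N n).carrier := (Polynomial.eval₂AlgHom (lHom N n) (xi N n)
    (fun a => Commute.all _ _)).range
  have hX : ∀ a, lHom N n a ∈ T := fun a => ⟨C a, Polynomial.eval₂_C _ _⟩
  have hξ : xi N n ∈ T := ⟨X, Polynomial.eval₂_X _ _⟩
  have hT : T = ⊤ := by
    refine HE_subalgebra_eq_top h T (fun j => lHom_x h j ▸ hX _) hξ fun j => ?_
    induction j with
    | zero => exact T.one_mem
    | succ j ih =>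
      have : yE N n (j + 1) = lHom N n (y N n (j + 1)) - xi N n * yE N n j := by rw [lHom_y h]; ring
      rw [this]
      exact T.sub_mem (hX _) (T.mul_mem hξ ih)
  intro f
  have hf : f ∈ T := by rw [hT]; trivial
  obtain ⟨p, hp⟩ := hf
  exact ⟨p, hp.symm⟩

open Polynomial in
theorem isFreeExt_rHom (h : ValidE N n) : IsFreeExt (rHom N n) (xi N n) (kk N n + 1) := by
  have hk := h.kk_succ
  have := H_nontrivial h.valid_succ
  let Q := AdjoinRoot (charPoly (x N (n + 2)) (kk N n + 1))
  have hxz := quotSeq_of_le (x N (n + 2)) (kk N n + 1) x_zero (fun j hj => x_eq_zero (by omega))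
  let ρ : (HE N n).carrier →ₐ[ℚ] Q := HElift h (quotSeq (x N (n + 2)) _) (AdjoinRoot.root _)
    (fun j => AdjoinRoot.of _ (y N (n + 2) j))
  have ρx : ∀ j, ρ (xE N n j) = quotSeq (x N (n + 2)) _ j := HElift_xE h rfl
    fun j hj => hxz j (by omega)
  have ρy : ∀ j, ρ (yE N n j) = AdjoinRoot.of _ (y N (n + 2) j) := HElift_yE h
    (by rw [y_zero, map_one]) fun j hj => by rw [y_eq_zero (by omega), map_zero]
  have ρξ : ρ (xi N n) = AdjoinRoot.root _ := HElift_xi h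
  have hρ : ρ.comp (rHom N n) = AdjoinRoot.ofAlgHom ℚ (charPoly (x N (n + 2)) (kk N n + 1)) := by
    refine H_hom_ext h.valid_succ (fun j => ?_) (fun j => ?_)
    · change ρ (rHom N n _) = AdjoinRoot.of _ _
      cases j with
      | zero => rw [x_zero, map_one, map_one, map_one]
      | succ j => rw [rHom_x h, map_add, map_mul, ρx, ρx, ρξ, ← quotSeq_succ]
    · change ρ (rHom N n _) = AdjoinRoot.of _ _
      rw [rHom_y h, ρy]
  refine isFreeExt_of_factor (x N (n + 2)) _ x_zero _ _ (xE N n) xE_zero (xE_eq_zero (by omega))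
    (rHom_x h) ?_ ρ.toRingHom (fun a => AlgHom.congr_fun hρ a) ρξ
  let T : Subalgebra ℚ (HE N n).carrier := (Polynomial.eval₂AlgHom (rHom N n) (xi N n)
    (fun a => Commute.all _ _)).range
  have hX : ∀ a, rHom N n a ∈ T := fun a => ⟨C a, Polynomial.eval₂_C _ _⟩
  have hξ : xi N n ∈ T := ⟨X, Polynomial.eval₂_X _ _⟩
  have hT : T = ⊤ := by
    refine HE_subalgebra_eq_top h T (fun j => ?_) hξ (fun j => rHom_y h j ▸ hX _)
    induction j with
    | zero => exact T.one_mem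
    | succ j ih =>
      have : xE N n (j + 1) = rHom N n (x N (n + 2) (j + 1)) - xi N n * xE N n j := by
        rw [rHom_x h]; ring
      rw [this]
      exact T.sub_mem (hX _) (T.mul_mem hξ ih)
  intro f
  have hf : f ∈ T := by rw [hT]; trivial
  obtain ⟨p, hp⟩ := hf
  exact ⟨p, hp.symm⟩

/-- `H_{k,k+1}` is generated by the images of `H_k` and `H_{k+1}`. -/
theorem HE_cyclic (h : ValidE N n) {p : (HE N n).carrier → Prop}
    (mul : ∀ a b, p (lHom N n a * rHom N n b)) (add : ∀ f g, p f → p g → p (f + g))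
    (f : (HE N n).carrier) : p f := by
  let T := Algebra.TensorProduct.lift (lHom N n) (rHom N n) (fun _ _ => Commute.all _ _)
  have hl : ∀ a, lHom N n a ∈ T.range := fun a => ⟨a ⊗ₜ 1, by simp [T]⟩
  have hr : ∀ a, rHom N n a ∈ T.range := fun a => ⟨1 ⊗ₜ a, by simp [T]⟩
  have hT : T.range = ⊤ := by
    refine HE_subalgebra_eq_top h _ (fun j => lHom_x h j ▸ hl _) ?_ (fun j => rHom_y h j ▸ hr _)
    have : xi N n = rHom N n (x N (n + 2) 1) - lHom N n (x N n 1) := by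
      rw [rHom_x h, lHom_x h, xE_zero]; ring
    rw [this]
    exact T.range.sub_mem (hr _) (hl _)
  have hf : f ∈ T.range := by rw [hT]; trivial
  obtain ⟨t, ht⟩ := hf
  change T t = f at ht
  subst ht
  induction t with
  | zero => have := mul 0 0; simpa using this
  | tmul a b => simpa [T] using mul a b
  | add s t hs ht => rw [map_add]; exact add _ _ hs ht

end FlagRings

section Traces

variable {N : ℕ} {n : ℤ}

theorem sX_eq (d : ℤ) : sX N n d = zcoeff (altSeries (Xs N n)) d := by
  unfold sX zcoeff; split_ifs <;> simp

theorem sY_eq (d : ℤ) : sY N n d = zcoeff (altSeries (Ys N n)) d := by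
  unfold sY zcoeff; split_ifs <;> simp

theorem y_mul_Xs : altSeries (y N n) * altSeries (Xs N n) = 1 :=
  altSeries_mul_inverse _ _ y_zero (by rw [Xs]) fun a => by rw [Xs]

theorem x_mul_Ys : altSeries (x N n) * altSeries (Ys N n) = 1 :=
  altSeries_mul_inverse _ _ x_zero (by rw [Ys]) fun a => by rw [Ys]

theorem sX_neg {d : ℤ} (h : d < 0) : sX N n d = 0 := if_pos h
theorem sY_neg {d : ℤ} (h : d < 0) : sY N n d = 0 := if_pos h
theorem sX_zero : sX N n 0 = 1 := by simp [sX, Xs]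
theorem sY_zero : sY N n 0 = 1 := by simp [sY, Ys]

open Classical in
/-- The Frobenius trace `H_{k,k+1} → H_k`. -/
noncomputable def traceL (N : ℕ) (n : ℤ) : (HE N n).carrier →ₗ[ℚ] (H N n).carrier :=
  if h : ValidE N n then (isFreeExt_lHom h).coordLin (Fin.last _) else 0

open Classical in
/-- The Frobenius trace `H_{k,k+1} → H_{k+1}`. -/
noncomputable def traceR (N : ℕ) (n : ℤ) : (HE N n).carrier →ₗ[ℚ] (H N (n + 2)).carrier :=
  if h : ValidE N n then (isFreeExt_rHom h).coordLin (Fin.last _) else 0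

theorem traceL_mul (a : (H N n).carrier) (f : (HE N n).carrier) :
    traceL N n (lHom N n a * f) = a * traceL N n f := by
  unfold traceL
  split_ifs with h
  · exact congrFun ((isFreeExt_lHom h).coord_mul a f) _
  · simp

theorem traceR_mul (a : (H N (n + 2)).carrier) (f : (HE N n).carrier) :
    traceR N n (rHom N n a * f) = a * traceR N n f := by
  unfold traceR
  split_ifs with h
  · exact congrFun ((isFreeExt_rHom h).coord_mul a f) _
  · simp

theorem traceL_pow (h : ValidE N n) (a : ℕ) :
    traceL N n (xi N n ^ a) = sX N n (a + 1 + kk N n - N) := by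
  have hk := h.kk_lt
  unfold traceL
  rw [dif_pos h, (isFreeExt_lHom h).coordLin_last_pow (y N n) (sX N n) y_zero]
  · congr 1; push_cast [hk.le, show 1 ≤ N - kk N n by omega]; ring
  · rw [telescope (fun j => lHom N n (y N n j)) (yE N n) _ (map_one _) (lHom_y h),
      yE_eq_zero (by omega), mul_zero]
  · exact fun d hd => sX_neg hd
  · exact sX_zero
  · intro d
    have := sum_coeff_mul_zcoeff (altSeries (y N n)) (altSeries (Xs N n)) (d + 1)
      (N - kk N n - 1 + 2) fun j hj => Or.inl (by rw [coeff_altSeries, y_eq_zero (by omega), mul_zero])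
    rw [y_mul_Xs, zcoeff_one, if_neg (by omega)] at this
    simpa [sX_eq] using this

theorem traceR_pow (h : ValidE N n) (a : ℕ) :
    traceR N n (xi N n ^ a) = sY N (n + 2) (a - kk N n) := by
  have hk := h.kk_succ
  unfold traceR
  rw [dif_pos h, (isFreeExt_rHom h).coordLin_last_pow (x N (n + 2)) (sY N (n + 2)) x_zero]
  · rw [telescope (fun j => rHom N n (x N (n + 2) j)) (xE N n) _ (map_one _) (rHom_x h),
      xE_eq_zero (by omega), mul_zero]
  · exact fun d hd => sY_neg hd
  · exact sY_zero
  · intro d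
    have := sum_coeff_mul_zcoeff (altSeries (x N (n + 2))) (altSeries (Ys N (n + 2))) (d + 1)
      (kk N n + 2) fun j hj => Or.inl (by rw [coeff_altSeries, x_eq_zero (by omega), mul_zero])
    rw [x_mul_Ys, zcoeff_one, if_neg (by omega)] at this
    simpa [sY_eq] using this

end Traces

section DividedDifferences

variable {σ : Type} [DecidableEq σ]

/-- The transposition of two variables. -/
noncomputable def swapVars (i j : σ) : MvPolynomial σ ℚ →ₐ[ℚ] MvPolynomial σ ℚ :=
  MvPolynomial.rename (Equiv.swap i j)

theorem swapVars_X (i j k : σ) :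
    swapVars i j (MvPolynomial.X k) = MvPolynomial.X (Equiv.swap i j k) :=
  MvPolynomial.rename_X _ _

theorem swapVars_swapVars (i j : σ) (p : MvPolynomial σ ℚ) :
    swapVars i j (swapVars i j p) = p := by
  unfold swapVars
  rw [MvPolynomial.rename_rename]
  have : (Equiv.swap i j ∘ Equiv.swap i j : σ → σ) = id := funext fun k => Equiv.swap_apply_self i j k
  rw [this, MvPolynomial.rename_id_apply]

theorem X_sub_X_ne_zero {i j : σ} (h : i ≠ j) :
    (MvPolynomial.X i - MvPolynomial.X j : MvPolynomial σ ℚ) ≠ 0 :=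
  sub_ne_zero.2 fun e => h (MvPolynomial.X_injective e)

theorem dvd_swapVars_sub (i j : σ) (p : MvPolynomial σ ℚ) :
    (MvPolynomial.X i - MvPolynomial.X j : MvPolynomial σ ℚ) ∣ swapVars i j p - p := by
  induction p using MvPolynomial.induction_on with
  | C c => rw [show swapVars i j (MvPolynomial.C c) = MvPolynomial.C c from
      MvPolynomial.rename_C _ _, sub_self]; exact dvd_zero _
  | add p q hp hq =>
    rw [map_add, add_sub_add_comm]; exact dvd_add hp hq
  | mul_X p k hp =>
    have : swapVars i j (p * MvPolynomial.X k) - p * MvPolynomial.X k =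
        (swapVars i j p - p) * swapVars i j (MvPolynomial.X k) +
          p * (swapVars i j (MvPolynomial.X k) - MvPolynomial.X k) := by
      rw [map_mul]; ring
    rw [this]
    refine dvd_add (Dvd.dvd.mul_right hp _) (Dvd.dvd.mul_left ?_ _)
    rw [swapVars_X, Equiv.swap_apply_def]
    split_ifs with h1 h2
    · subst h1; exact ⟨-1, by ring⟩
    · subst h2; exact dvd_rfl
    · rw [sub_self]; exact dvd_zero _

/-- The divided difference `(s p - p) / (X_i - X_j)`, where `s` exchanges `X_i` and `X_j`. -/
noncomputable def divDiff {i j : σ} (h : i ≠ j) : MvPolynomial σ ℚ →ₗ[ℚ] MvPolynomial σ ℚ where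
  toFun p := (dvd_swapVars_sub i j p).choose
  map_add' p q := by
    apply mul_left_cancel₀ (X_sub_X_ne_zero h)
    rw [mul_add, ← (dvd_swapVars_sub i j (p + q)).choose_spec,
      ← (dvd_swapVars_sub i j p).choose_spec, ← (dvd_swapVars_sub i j q).choose_spec, map_add]
    ring
  map_smul' c p := by
    apply mul_left_cancel₀ (X_sub_X_ne_zero h)
    rw [RingHom.id_apply, mul_smul_comm, ← (dvd_swapVars_sub i j (c • p)).choose_spec,
      ← (dvd_swapVars_sub i j p).choose_spec, map_smul, smul_sub]

theorem mul_divDiff {i j : σ} (h : i ≠ j) (p : MvPolynomial σ ℚ) :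
    (MvPolynomial.X i - MvPolynomial.X j) * divDiff h p = swapVars i j p - p :=
  (dvd_swapVars_sub i j p).choose_spec.symm

theorem divDiff_eq {i j : σ} (h : i ≠ j) {p q : MvPolynomial σ ℚ}
    (hpq : (MvPolynomial.X i - MvPolynomial.X j) * q = swapVars i j p - p) : divDiff h p = q :=
  mul_left_cancel₀ (X_sub_X_ne_zero h) ((mul_divDiff h p).trans hpq.symm)

theorem divDiff_mul {i j : σ} (h : i ≠ j) {c : MvPolynomial σ ℚ} (hc : swapVars i j c = c)
    (p : MvPolynomial σ ℚ) : divDiff h (c * p) = c * divDiff h p := by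
  apply divDiff_eq
  rw [mul_left_comm, mul_divDiff, map_mul, hc]; ring

theorem swapVars_divDiff {i j : σ} (h : i ≠ j) (p : MvPolynomial σ ℚ) :
    swapVars i j (divDiff h p) = divDiff h p := by
  apply mul_left_cancel₀ (X_sub_X_ne_zero h)
  have := congrArg (swapVars i j) (mul_divDiff h p)
  rw [map_mul, map_sub, map_sub, swapVars_X, swapVars_X, Equiv.swap_apply_left,
    Equiv.swap_apply_right, swapVars_swapVars] at this
  rw [mul_divDiff]
  linear_combination -this

theorem divDiff_divDiff {i j : σ} (h : i ≠ j) (p : MvPolynomial σ ℚ) :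
    divDiff h (divDiff h p) = 0 :=
  divDiff_eq h (by rw [swapVars_divDiff, sub_self, mul_zero])

theorem divDiff_X_right_mul {i j : σ} (h : i ≠ j) (p : MvPolynomial σ ℚ) :
    divDiff h (MvPolynomial.X j * p) = MvPolynomial.X i * divDiff h p + p := by
  apply divDiff_eq
  rw [map_mul, swapVars_X, Equiv.swap_apply_right]
  linear_combination MvPolynomial.X i * mul_divDiff h p

theorem divDiff_X_left_mul {i j : σ} (h : i ≠ j) (p : MvPolynomial σ ℚ) :
    divDiff h (MvPolynomial.X i * p) = MvPolynomial.X j * divDiff h p - p := by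
  apply divDiff_eq
  rw [map_mul, swapVars_X, Equiv.swap_apply_left]
  linear_combination MvPolynomial.X j * mul_divDiff h p

theorem pow_mul_geom_sum {R : Type} [CommRing R] (u v : R) (a b : ℕ) :
    (u - v) * ∑ j ∈ Finset.range b, u ^ (a + b - 1 - j) * v ^ j = u ^ a * (u ^ b - v ^ b) := by
  have h := (Commute.all v u).mul_geom_sum₂ b
  have h2 : ∑ j ∈ Finset.range b, u ^ (a + b - 1 - j) * v ^ j =
      u ^ a * ∑ j ∈ Finset.range b, v ^ j * u ^ (b - 1 - j) := by
    rw [Finset.mul_sum]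
    refine Finset.sum_congr rfl fun j hj => ?_
    rw [Finset.mem_range] at hj
    rw [show a + b - 1 - j = a + (b - 1 - j) by omega, pow_add]; ring
  rw [h2]
  linear_combination -(u ^ a) * h

theorem divDiff_pow_mul_pow {i j : σ} (h : i ≠ j) (a b : ℕ) :
    divDiff h (MvPolynomial.X i ^ a * MvPolynomial.X j ^ b) =
      ∑ l ∈ Finset.range b, MvPolynomial.X i ^ (a + b - 1 - l) * MvPolynomial.X j ^ l -
      ∑ l ∈ Finset.range a, MvPolynomial.X i ^ (a + b - 1 - l) * MvPolynomial.X j ^ l := by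
  apply divDiff_eq
  have h1 := pow_mul_geom_sum (MvPolynomial.X i : MvPolynomial σ ℚ) (MvPolynomial.X j) a b
  have h2 := pow_mul_geom_sum (MvPolynomial.X i : MvPolynomial σ ℚ) (MvPolynomial.X j) b a
  rw [add_comm b a] at h2
  rw [mul_sub, h1, h2, map_mul, map_pow, map_pow, swapVars_X, swapVars_X, Equiv.swap_apply_left,
    Equiv.swap_apply_right]
  ring

theorem divDiff_pow_mul_pow' {i j : σ} (h : i ≠ j) (a b : ℕ) :
    divDiff h (MvPolynomial.X i ^ b * MvPolynomial.X j ^ a) =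
      ∑ l ∈ Finset.range a, MvPolynomial.X i ^ l * MvPolynomial.X j ^ (a + b - 1 - l) -
      ∑ l ∈ Finset.range b, MvPolynomial.X i ^ l * MvPolynomial.X j ^ (a + b - 1 - l) := by
  apply divDiff_eq
  have h1 := pow_mul_geom_sum (MvPolynomial.X j : MvPolynomial σ ℚ) (MvPolynomial.X i) a b
  have h2 := pow_mul_geom_sum (MvPolynomial.X j : MvPolynomial σ ℚ) (MvPolynomial.X i) b a
  rw [add_comm b a] at h2
  simp only [mul_comm (MvPolynomial.X i ^ _) (MvPolynomial.X j ^ _)]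
  rw [map_mul, map_pow, map_pow, swapVars_X, swapVars_X, Equiv.swap_apply_left,
    Equiv.swap_apply_right]
  linear_combination h1 - h2

theorem divDiff_braid {i j k : σ} (hij : i ≠ j) (hjk : j ≠ k) (hik : i ≠ k) (p : MvPolynomial σ ℚ) :
    divDiff hij (divDiff hjk (divDiff hij p)) = divDiff hjk (divDiff hij (divDiff hjk p)) := by
  set s := swapVars i j with hs
  set t := swapVars j k with ht
  have s1 : s (MvPolynomial.X i) = MvPolynomial.X j := by
    rw [hs, swapVars_X, Equiv.swap_apply_left]
  have s2 : s (MvPolynomial.X j) = MvPolynomial.X i := by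
    rw [hs, swapVars_X, Equiv.swap_apply_right]
  have s3 : s (MvPolynomial.X k) = MvPolynomial.X k := by
    rw [hs, swapVars_X, Equiv.swap_apply_of_ne_of_ne hik.symm hjk.symm]
  have t1 : t (MvPolynomial.X i) = MvPolynomial.X i := by
    rw [ht, swapVars_X, Equiv.swap_apply_of_ne_of_ne hij hik]
  have t2 : t (MvPolynomial.X j) = MvPolynomial.X k := by
    rw [ht, swapVars_X, Equiv.swap_apply_left]
  have t3 : t (MvPolynomial.X k) = MvPolynomial.X j := by
    rw [ht, swapVars_X, Equiv.swap_apply_right]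
  have ss : ∀ q, s (s q) = q := swapVars_swapVars i j
  have tt : ∀ q, t (t q) = q := swapVars_swapVars j k
  have sts : ∀ q, s (t (s q)) = t (s (t q)) := by
    have : (s.comp t).comp s = (t.comp s).comp t := by
      apply MvPolynomial.algHom_ext
      intro l
      change s (t (s _)) = t (s (t _))
      by_cases hi : l = i
      · subst hi; rw [s1, t2, s3, t1, s1, t2]
      by_cases hj : l = j
      · subst hj; rw [s2, t1, s1, t2, s3, t3]
      by_cases hk : l = k
      · subst hk; rw [s3, t3, s2, t1]
      · rw [hs, ht, swapVars_X, Equiv.swap_apply_of_ne_of_ne hi hj, swapVars_X,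
          Equiv.swap_apply_of_ne_of_ne hj hk, swapVars_X, Equiv.swap_apply_of_ne_of_ne hi hj,
          swapVars_X, Equiv.swap_apply_of_ne_of_ne hj hk]
    exact fun q => AlgHom.congr_fun this q
  have hne : (MvPolynomial.X i - MvPolynomial.X j) * (MvPolynomial.X j - MvPolynomial.X k) *
      (MvPolynomial.X i - MvPolynomial.X k) ≠ (0 : MvPolynomial σ ℚ) :=
    mul_ne_zero (mul_ne_zero (X_sub_X_ne_zero hij) (X_sub_X_ne_zero hjk)) (X_sub_X_ne_zero hik)
  apply mul_left_cancel₀ hne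
  have e1 := mul_divDiff hij p
  have e1t := congrArg t e1
  have e1s := congrArg s e1t
  have e2 := mul_divDiff hjk (divDiff hij p)
  have e2s := congrArg s e2
  have e3 := mul_divDiff hij (divDiff hjk (divDiff hij p))
  have d1 := mul_divDiff hjk p
  have d1s := congrArg s d1
  have d1t := congrArg t d1s
  have d2 := mul_divDiff hij (divDiff hjk p)
  have d2t := congrArg t d2
  have d3 := mul_divDiff hjk (divDiff hij (divDiff hjk p))
  have f1 : s (divDiff hij p) = divDiff hij p := swapVars_divDiff hij p
  have g1 : t (divDiff hjk p) = divDiff hjk p := swapVars_divDiff hjk p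
  simp only [← hs, ← ht, map_mul, map_sub, s1, s2, s3, t1, t2, t3, f1, g1, sts]
    at e1 e1t e1s e2 e2s e3 d1 d1s d1t d2 d2t d3
  linear_combination (MvPolynomial.X j - MvPolynomial.X k) * (MvPolynomial.X i - MvPolynomial.X k) * e3
    + (MvPolynomial.X j - MvPolynomial.X k) * e2s + e1s - (MvPolynomial.X i - MvPolynomial.X k) * e2
    - e1t + e1 - ((MvPolynomial.X i - MvPolynomial.X j) * (MvPolynomial.X i - MvPolynomial.X k) * d3
    + (MvPolynomial.X i - MvPolynomial.X j) * d2t + d1t - (MvPolynomial.X i - MvPolynomial.X k) * d2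
    - d1s + d1)

end DividedDifferences
section Cyclic

variable {A B C : GrAlg}

/-- `g` generates the bimodule `M`. -/
def IsCyclicGen (M : GrBimod A B) (g : M.carrier) : Prop :=
  ∀ p : M.carrier → Prop, (∀ a b, p (M.left a (M.right b g))) → (∀ m m', p m → p m' → p (m + m')) →
    ∀ m, p m

theorem IsCyclicGen.hom_ext {M P : GrBimod A B} {g : M.carrier} (hg : IsCyclicGen M g) {φ ψ : M ⟶ P}
    (h : φ.lin g = ψ.lin g) : φ = ψ :=
  GrBimod.hom_ext (LinearMap.ext fun m => hg (fun m => φ.lin m = ψ.lin m)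
    (fun a b => by rw [φ.map_left, ψ.map_left, φ.map_right, ψ.map_right, h])
    (fun m m' h h' => by rw [map_add, map_add, h, h']) m)

theorem hom_eq_of_subsingleton {M P : GrBimod A B} (h : Subsingleton M.carrier) (φ ψ : M ⟶ P) :
    φ = ψ :=
  GrBimod.hom_ext (LinearMap.ext fun m => by rw [Subsingleton.elim m 0, map_zero, map_zero])

theorem hom_eq_of_subsingleton' {M P : GrBimod A B} (h : Subsingleton P.carrier) (φ ψ : M ⟶ P) :
    φ = ψ :=
  GrBimod.hom_ext (LinearMap.ext fun _ => Subsingleton.elim _ _)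

theorem tensor_subsingleton_left {M : GrBimod A B} (P : GrBimod B C) (h : Subsingleton M.carrier) :
    Subsingleton (tensor M P).carrier :=
  subsingleton_of_forall_eq 0 fun x => by
    induction x using tm_induction with
    | h m p => rw [Subsingleton.elim m 0, map_zero, LinearMap.zero_apply]
    | hadd x y hx hy => rw [hx, hy, add_zero]

theorem tensor_subsingleton_right (M : GrBimod A B) {P : GrBimod B C} (h : Subsingleton P.carrier) :
    Subsingleton (tensor M P).carrier :=
  subsingleton_of_forall_eq 0 fun x => by
    induction x using tm_induction with
    | h m p => rw [Subsingleton.elim p 0, map_zero]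
    | hadd x y hx hy => rw [hx, hy, add_zero]

/-- A linear map is homogeneous if it has the right degree on a spanning set of homogeneous
vectors. -/
theorem mem_gr_of_span {M P : Type} [AddCommGroup M] [Module ℚ M] [AddCommGroup P] [Module ℚ P]
    {gr : ℤ → Submodule ℚ M} (hgr : DirectSum.IsInternal gr) {gr' : ℤ → Submodule ℚ P}
    (L : M →ₗ[ℚ] P) (d : ℤ)
    (h : ∀ m, m ∈ Submodule.span ℚ {m | ∃ i, m ∈ gr i ∧ L m ∈ gr' (i + d)})
    (i : ℤ) (m : M) (hm : m ∈ gr i) : L m ∈ gr' (i + d) := by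
  have key : ∀ m, ∀ i, L (components hgr m i) ∈ gr' (i + d) := by
    intro m
    induction h m using Submodule.span_induction with
    | mem m hm =>
      obtain ⟨j, hj, hj'⟩ := hm
      intro i
      rw [components_of_mem hgr hj, Finsupp.single_apply]
      split_ifs with hij
      · rwa [← hij]
      · rw [map_zero]; exact zero_mem _
    | zero => intro i; simp
    | add x y _ _ hx hy => intro i; simpa using add_mem (hx i) (hy i)
    | smul c x _ hx => intro i; simpa using Submodule.smul_mem _ c (hx i)
  have := key m i
  rwa [components_of_mem hgr hm, Finsupp.single_eq_same] at this

end Cyclic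

section Generators

variable (N : ℕ) (n : ℤ)

theorem BE_left (a : (H N n).carrier) (f : (HE N n).carrier) :
    (BE N n).left a (vE N n f) = vE N n (lHom N n a * f) := rfl

theorem BE_right (a : (H N (n + 2)).carrier) (f : (HE N n).carrier) :
    (BE N n).right a (vE N n f) = vE N n (rHom N n a * f) := rfl

theorem BF_left (a : (H N (n + 2)).carrier) (f : (HE N n).carrier) :
    (BF N n).left a (vF N n f) = vF N n (rHom N n a * f) := rfl

theorem BF_right (a : (H N n).carrier) (f : (HE N n).carrier) :
    (BF N n).right a (vF N n f) = vF N n (lHom N n a * f) := rfl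

variable {N n}

theorem vE_mem {d : ℤ} {f : (HE N n).carrier} (h : f ∈ (HE N n).gr d) :
    vE N n f ∈ (BE N n).gr (d + (1 - N + kk N n)) := by
  change f ∈ (HE N n).gr (d + (1 - N + kk N n) - (1 - N + kk N n))
  rwa [add_sub_cancel_right]

theorem vF_mem {d : ℤ} {f : (HE N n).carrier} (h : f ∈ (HE N n).gr d) :
    vF N n f ∈ (BF N n).gr (d + -kk N n) := by
  change f ∈ (HE N n).gr (d + -kk N n - -kk N n)
  rwa [add_sub_cancel_right]

theorem BE_isCyclicGen : IsCyclicGen (BE N n) (vE N n 1) := by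
  intro p hp hadd m
  by_cases h : ValidE N n
  · refine HE_cyclic h (p := fun f => p (vE N n f)) (fun a b => ?_) hadd m
    have := hp a b
    rwa [BE_right, BE_left, mul_one] at this
  · have := HE_subsingleton h
    have h0 := hp 0 0
    rwa [show m = (BE N n).left 0 ((BE N n).right 0 (vE N n 1)) from
      @Subsingleton.elim (HE N n).carrier this _ _]

theorem BF_isCyclicGen : IsCyclicGen (BF N n) (vF N n 1) := by
  intro p hp hadd m
  by_cases h : ValidE N n
  · refine HE_cyclic h (p := fun f => p (vF N n f)) (fun a b => ?_) hadd m
    have := hp b a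
    rwa [BF_right, BF_left, mul_one, mul_comm] at this
  · have := HE_subsingleton h
    have h0 := hp 0 0
    rwa [show m = (BF N n).left 0 ((BF N n).right 0 (vF N n 1)) from
      @Subsingleton.elim (HE N n).carrier this _ _]

variable (N n)

/-- Multiplication by `f` on `Γ(E 1_n)`. -/
noncomputable def mulE (f : (HE N n).carrier) : BE N n ⟶ BE N n where
  lin := (LinearMap.mulLeft ℚ f : (HE N n).carrier →ₗ[ℚ] (HE N n).carrier)
  map_left a (m : (HE N n).carrier) := mul_left_comm f (lHom N n a) m
  map_right a (m : (HE N n).carrier) := mul_left_comm f (rHom N n a) m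

/-- Multiplication by `f` on `Γ(F 1_{n+2})`. -/
noncomputable def mulF (f : (HE N n).carrier) : BF N n ⟶ BF N n where
  lin := (LinearMap.mulLeft ℚ f : (HE N n).carrier →ₗ[ℚ] (HE N n).carrier)
  map_left a (m : (HE N n).carrier) := mul_left_comm f (rHom N n a) m
  map_right a (m : (HE N n).carrier) := mul_left_comm f (lHom N n a) m

theorem mulE_apply (f g : (HE N n).carrier) : (mulE N n f).lin (vE N n g) = vE N n (f * g) := rfl
theorem mulF_apply (f g : (HE N n).carrier) : (mulF N n f).lin (vF N n g) = vF N n (f * g) := rfl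

/-- The cap `Γ(η̂_n)`: multiplication followed by the trace to `H_k`. -/
noncomputable def capL : tensor (BE N n) (BF N n) ⟶ regular (H N n) :=
  tensorDesc (M := BE N n) (P := BF N n) (Q := regular (H N n))
    ((LinearMap.mul ℚ (HE N n).carrier).compr₂ (traceL N n))
    (fun (m : (HE N n).carrier) b (p : (HE N n).carrier) => congrArg (traceL N n)
      (show rHom N n b * m * p = m * (rHom N n b * p) by ring))
    (fun a (m p : (HE N n).carrier) =>
      (congrArg (traceL N n) (mul_assoc (lHom N n a) m p)).trans (traceL_mul a _))
    (fun a (m p : (HE N n).carrier) =>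
      (congrArg (traceL N n) (mul_left_comm m (lHom N n a) p)).trans (traceL_mul a _))

/-- The cap `Γ(ε_{n+2})`: multiplication followed by the trace to `H_{k+1}`. -/
noncomputable def capR : tensor (BF N n) (BE N n) ⟶ regular (H N (n + 2)) :=
  tensorDesc (M := BF N n) (P := BE N n) (Q := regular (H N (n + 2)))
    ((LinearMap.mul ℚ (HE N n).carrier).compr₂ (traceR N n))
    (fun (m : (HE N n).carrier) b (p : (HE N n).carrier) => congrArg (traceR N n)
      (show lHom N n b * m * p = m * (lHom N n b * p) by ring))
    (fun a (m p : (HE N n).carrier) =>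
      (congrArg (traceR N n) (mul_assoc (rHom N n a) m p)).trans (traceR_mul a _))
    (fun a (m p : (HE N n).carrier) =>
      (congrArg (traceR N n) (mul_left_comm m (rHom N n a) p)).trans (traceR_mul a _))

theorem capL_tm (f g : (HE N n).carrier) :
    (capL N n).lin (tm _ _ (vE N n f) (vF N n g)) = traceL N n (f * g) := by
  exact tensorDesc_tm (M := BE N n) (P := BF N n) (Q := regular (H N n)) _ _ _ _ _ _

theorem capR_tm (f g : (HE N n).carrier) :
    (capR N n).lin (tm _ _ (vF N n f) (vE N n g)) = traceR N n (f * g) := by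
  exact tensorDesc_tm (M := BF N n) (P := BE N n) (Q := regular (H N (n + 2))) _ _ _ _ _ _

end Generators

section Frobenius

variable {A R : Type} [CommRing A] [Algebra ℚ A] [CommRing R] [Algebra ℚ R]

/-- The Casimir element of a Frobenius extension commutes with all elements. -/
theorem casimir_slide {φ : A →ₐ[ℚ] R} {ξ : R} {m : ℕ} (hfree : IsFreeExt φ ξ (m + 1)) (c : ℕ → A)
    (d : ℕ → R) (h0 : φ (c 0) = d 0) (h : ∀ j, φ (c (j + 1)) = d (j + 1) + ξ * d j)
    (hd : d (m + 1) = 0) {T : Type} [AddCommGroup T] [Module ℚ T] (b : R →ₗ[ℚ] R →ₗ[ℚ] T)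
    (hb : ∀ a f g, b (φ a * f) g = b f (φ a * g)) (f : R) :
    ∑ j ∈ Finset.range (m + 1), (-1 : ℚ) ^ j • b (f * d j) (ξ ^ (m - j)) =
      ∑ j ∈ Finset.range (m + 1), (-1 : ℚ) ^ j • b (d j) (f * ξ ^ (m - j)) := by
  let S : R → R → T := fun f g =>
    ∑ j ∈ Finset.range (m + 1), (-1 : ℚ) ^ j • b (f * d j) (g * ξ ^ (m - j))
  have step : ∀ f g, S (f * ξ) g = S f (g * ξ) := by
    intro f g
    have key : ∑ j ∈ Finset.range (m + 2), (-1 : ℚ) ^ j • b f (g * (φ (c j) * ξ ^ (m + 1 - j))) = 0 := by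
      have h1 := telescope (fun j => φ (c j)) d ξ h0 h (m + 1)
      rw [hd, mul_zero] at h1
      have h2 := congrArg (fun z => b f (g * z)) h1
      simp only [mul_zero, map_zero, Finset.mul_sum, map_sum] at h2
      rw [← h2]
      refine Finset.sum_congr rfl fun j _ => ?_
      rw [← map_smul, Algebra.smul_def]
      congr 1
      simp
      ring
    have e1 : ∀ j, b f (g * (φ (c j) * ξ ^ (m + 1 - j))) = b (f * φ (c j)) (g * ξ ^ (m + 1 - j)) := by
      intro j
      rw [mul_comm f, hb]; congr 1; ring
    simp only [e1] at key
    rw [Finset.sum_range_succ'] at key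
    simp only [h, h0, mul_add, map_add, LinearMap.add_apply, smul_add, Finset.sum_add_distrib] at key
    rw [Finset.sum_range_succ, hd, mul_zero, map_zero, LinearMap.zero_apply, smul_zero, add_zero,
      add_right_comm] at key
    have e2 := Finset.sum_range_succ' (fun j => (-1 : ℚ) ^ j • b (f * d j) (g * ξ ^ (m + 1 - j))) m
    rw [← e2] at key
    have e3 : S f (g * ξ) = ∑ j ∈ Finset.range (m + 1),
        (-1 : ℚ) ^ j • b (f * d j) (g * ξ ^ (m + 1 - j)) := by
      refine Finset.sum_congr rfl fun j hj => ?_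
      rw [Finset.mem_range] at hj
      rw [mul_assoc, ← pow_succ', show m - j + 1 = m + 1 - j by omega]
    have e4 : S (f * ξ) g = -∑ j ∈ Finset.range (m + 1),
        (-1 : ℚ) ^ (j + 1) • b (f * (ξ * d j)) (g * ξ ^ (m + 1 - (j + 1))) := by
      rw [← Finset.sum_neg_distrib]
      refine Finset.sum_congr rfl fun j hj => ?_
      rw [pow_succ, mul_neg_one, neg_smul, neg_neg, mul_assoc, Nat.add_sub_add_right]
    rw [e3, e4]
    exact neg_eq_of_add_eq_zero_left key
  have step' : ∀ i f g, S (f * ξ ^ i) g = S f (g * ξ ^ i) := by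
    intro i
    induction i with
    | zero => intro f g; simp
    | succ i ih => intro f g; rw [pow_succ, ← mul_assoc, step, ih]; congr 1; ring
  have hS : S f 1 = S 1 f := by
    have hl : ∀ g, S g 1 = ∑ j ∈ Finset.range (m + 1), (-1 : ℚ) ^ j • b (g * d j) (1 * ξ ^ (m - j)) :=
      fun _ => rfl
    rw [hfree.coord_spec f]
    have addl : S (∑ i, φ (hfree.coord f i) * ξ ^ (i : ℕ)) 1 =
        ∑ i, S (φ (hfree.coord f i) * ξ ^ (i : ℕ)) 1 := by
      simp only [S, Finset.sum_mul, map_sum, LinearMap.sum_apply, Finset.smul_sum]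
      exact Finset.sum_comm
    have addr : S 1 (∑ i, φ (hfree.coord f i) * ξ ^ (i : ℕ)) =
        ∑ i, S 1 (φ (hfree.coord f i) * ξ ^ (i : ℕ)) := by
      simp only [S, Finset.sum_mul, map_sum, Finset.smul_sum]
      exact Finset.sum_comm
    rw [addl, addr]
    refine Finset.sum_congr rfl fun i _ => ?_
    rw [step', one_mul]
    refine Finset.sum_congr rfl fun j _ => ?_
    rw [hb, one_mul, mul_assoc]
  simpa [S] using hS

/-- The dual bases of a Frobenius extension. -/
theorem casimir_trace {φ : A →ₐ[ℚ] R} {ξ : R} {m : ℕ} (hfree : IsFreeExt φ ξ (m + 1)) (c : ℕ → A)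
    (d : ℕ → R) (h0 : φ (c 0) = d 0) (h : ∀ j, φ (c (j + 1)) = d (j + 1) + ξ * d j)
    (hd : d (m + 1) = 0) (hd0 : d 0 = 1) (τ : R →ₗ[ℚ] A) (hτ : ∀ a f, τ (φ a * f) = a * τ f)
    (hlow : ∀ i < m, τ (ξ ^ i) = 0) (htop : τ (ξ ^ m) = 1) (f : R) :
    ∑ j ∈ Finset.range (m + 1), (-1 : ℚ) ^ j • (d j * φ (τ (ξ ^ (m - j) * f))) = f := by
  have := casimir_slide hfree c d h0 h hd
    (LinearMap.mk₂ ℚ (fun f g => f * φ (τ g)) (fun _ _ _ => add_mul _ _ _)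
      (fun _ _ _ => smul_mul_assoc _ _ _) (fun _ _ _ => by simp [mul_add])
      (fun _ _ _ => by simp)) (fun a f g => by
        simp only [LinearMap.mk₂_apply, hτ, map_mul]; ring) f
  simp only [LinearMap.mk₂_apply] at this
  simp only [mul_comm (ξ ^ _) f]
  rw [← this, Finset.sum_range_succ', Finset.sum_eq_zero]
  · simp [htop, hd0]
  · intro j hj
    rw [Finset.mem_range] at hj
    rw [hlow _ (by omega)]; simp

end Frobenius
section Cups

/-- A map out of the regular bimodule, from a central element. -/
def ofCentral {A : GrAlg} (M : GrBimod A A) (g : M.carrier) (hg : ∀ a, M.left a g = M.right a g) :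
    regular A ⟶ M where
  lin := (LinearMap.applyₗ g).comp M.left.toLinearMap
  map_left a (m : A.carrier) := by
    change M.left (a * m) g = M.left a (M.left m g)
    rw [map_mul]; rfl
  map_right a (m : A.carrier) := by
    change M.left (a * m) g = M.right a (M.left m g)
    rw [mul_comm, map_mul, ← M.left_right, ← hg]; rfl

theorem ofCentral_apply {A : GrAlg} (M : GrBimod A A) (g : M.carrier)
    (hg : ∀ a, M.left a g = M.right a g) (a : A.carrier) :
    (ofCentral M g hg).lin a = M.left a g := rfl

theorem ofCentral_one {A : GrAlg} (M : GrBimod A A) (g : M.carrier)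
    (hg : ∀ a, M.left a g = M.right a g) : (ofCentral M g hg).lin (1 : A.carrier) = g := by
  rw [ofCentral_apply, map_one]; rfl

theorem hasDegree_ofCentral {A : GrAlg} (M : GrBimod A A) {g : M.carrier}
    (hg : ∀ a, M.left a g = M.right a g) {d : ℤ} (hd : g ∈ M.gr d) :
    (ofCentral M g hg).HasDegree d := fun _ _ hm => M.left_mem hm hd

variable (N : ℕ) (n : ℤ)

/-- The element `∑ (-1)^j x_j ⊗ ξ^(k-j)`. -/
noncomputable def casL : (tensor (BE N n) (BF N n)).carrier :=
  ∑ j ∈ Finset.range (kk N n + 1), (-1 : ℚ) ^ j •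
    (tensor (BE N n) (BF N n)).left (x N n j) (tm _ _ (vE N n 1) (vF N n (xi N n ^ (kk N n - j))))

/-- The element `∑ (-1)^j y_j ⊗ ξ^(N-k-1-j)`. -/
noncomputable def casR : (tensor (BF N n) (BE N n)).carrier :=
  ∑ j ∈ Finset.range (N - kk N n), (-1 : ℚ) ^ j •
    (tensor (BF N n) (BE N n)).left (y N (n + 2) j)
      (tm _ _ (vF N n 1) (vE N n (xi N n ^ (N - kk N n - 1 - j))))

variable {N n}

theorem BE_subsingleton (h : ¬ValidE N n) : Subsingleton (BE N n).carrier := HE_subsingleton h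
theorem BF_subsingleton (h : ¬ValidE N n) : Subsingleton (BF N n).carrier := HE_subsingleton h

theorem casL_eq (h : ValidE N n) : casL N n = ∑ j ∈ Finset.range (kk N n + 1), (-1 : ℚ) ^ j •
    tm _ _ (vE N n (xE N n j)) (vF N n (xi N n ^ (kk N n - j))) := by
  simp only [casL, tensor_left, BE_left, lHom_x h, mul_one]

theorem casR_eq (h : ValidE N n) : casR N n = ∑ j ∈ Finset.range (N - kk N n - 1 + 1), (-1 : ℚ) ^ j •
    tm _ _ (vF N n (yE N n j)) (vE N n (xi N n ^ (N - kk N n - 1 - j))) := by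
  have := h.kk_lt
  simp only [casR, tensor_left, BF_left, rHom_y h, mul_one, show N - kk N n - 1 + 1 = N - kk N n by omega]

theorem casL_slide (h : ValidE N n) {T : Type} [AddCommGroup T] [Module ℚ T]
    (b : (HE N n).carrier →ₗ[ℚ] (HE N n).carrier →ₗ[ℚ] T)
    (hb : ∀ a f g, b (rHom N n a * f) g = b f (rHom N n a * g)) (f : (HE N n).carrier) :
    ∑ j ∈ Finset.range (kk N n + 1), (-1 : ℚ) ^ j • b (f * xE N n j) (xi N n ^ (kk N n - j)) =
    ∑ j ∈ Finset.range (kk N n + 1), (-1 : ℚ) ^ j • b (xE N n j) (f * xi N n ^ (kk N n - j)) :=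
  casimir_slide (isFreeExt_rHom h) (x N (n + 2)) (xE N n) (map_one _) (rHom_x h)
    (xE_eq_zero (by omega)) b hb f

theorem casR_slide (h : ValidE N n) {T : Type} [AddCommGroup T] [Module ℚ T]
    (b : (HE N n).carrier →ₗ[ℚ] (HE N n).carrier →ₗ[ℚ] T)
    (hb : ∀ a f g, b (lHom N n a * f) g = b f (lHom N n a * g)) (f : (HE N n).carrier) :
    ∑ j ∈ Finset.range (N - kk N n - 1 + 1),
      (-1 : ℚ) ^ j • b (f * yE N n j) (xi N n ^ (N - kk N n - 1 - j)) =
    ∑ j ∈ Finset.range (N - kk N n - 1 + 1),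
      (-1 : ℚ) ^ j • b (yE N n j) (f * xi N n ^ (N - kk N n - 1 - j)) :=
  casimir_slide (isFreeExt_lHom h) (y N n) (yE N n) (map_one _) (lHom_y h)
    (yE_eq_zero (by omega)) b hb f

theorem casL_central (a : (H N n).carrier) : (tensor (BE N n) (BF N n)).left a (casL N n) =
    (tensor (BE N n) (BF N n)).right a (casL N n) := by
  by_cases h : ValidE N n
  · simp only [casL_eq h, map_sum, map_smul, tensor_left, tensor_right, BE_left, BF_right]
    exact casL_slide h ((tm (BE N n) (BF N n)).compl₁₂ (vE N n) (vF N n))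
      (fun a f g => tm_right (vE N n f) a (vF N n g)) _
  · have := tensor_subsingleton_left (BF N n) (BE_subsingleton h)
    exact Subsingleton.elim _ _

theorem casR_central (a : (H N (n + 2)).carrier) : (tensor (BF N n) (BE N n)).left a (casR N n) =
    (tensor (BF N n) (BE N n)).right a (casR N n) := by
  by_cases h : ValidE N n
  · simp only [casR_eq h, map_sum, map_smul, tensor_left, tensor_right, BF_left, BE_right]
    exact casR_slide h ((tm (BF N n) (BE N n)).compl₁₂ (vF N n) (vE N n))
      (fun a f g => tm_right (vF N n f) a (vE N n g)) _
  · have := tensor_subsingleton_left (BE N n) (BF_subsingleton h)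
    exact Subsingleton.elim _ _

theorem traceL_low (h : ValidE N n) (i : ℕ) (hi : i < N - kk N n - 1) :
    traceL N n (xi N n ^ i) = 0 := by
  rw [traceL_pow h, sX_neg]; omega

theorem traceL_top (h : ValidE N n) : traceL N n (xi N n ^ (N - kk N n - 1)) = 1 := by
  have := h.kk_lt
  rw [traceL_pow h, ← sX_zero]; congr 1; omega

theorem traceR_low (h : ValidE N n) (i : ℕ) (hi : i < kk N n) : traceR N n (xi N n ^ i) = 0 := by
  rw [traceR_pow h, sY_neg]; omega

theorem traceR_top (h : ValidE N n) : traceR N n (xi N n ^ kk N n) = 1 := by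
  rw [traceR_pow h, ← sY_zero]; congr 1; omega

theorem casL_trace (h : ValidE N n) (f : (HE N n).carrier) :
    ∑ j ∈ Finset.range (kk N n + 1),
      (-1 : ℚ) ^ j • (xE N n j * rHom N n (traceR N n (xi N n ^ (kk N n - j) * f))) = f :=
  casimir_trace (isFreeExt_rHom h) (x N (n + 2)) (xE N n) (map_one _) (rHom_x h)
    (xE_eq_zero (by omega)) xE_zero (traceR N n) traceR_mul (traceR_low h) (traceR_top h) f

theorem casR_trace (h : ValidE N n) (f : (HE N n).carrier) :
    ∑ j ∈ Finset.range (N - kk N n - 1 + 1),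
      (-1 : ℚ) ^ j • (yE N n j * lHom N n (traceL N n (xi N n ^ (N - kk N n - 1 - j) * f))) = f :=
  casimir_trace (isFreeExt_lHom h) (y N n) (yE N n) (map_one _) (lHom_y h)
    (yE_eq_zero (by omega)) yE_zero (traceL N n) traceL_mul (traceL_low h) (traceL_top h) f

end Cups

section BalancedTensor

/-- The universal commutative algebra over two algebras with a common subalgebra. -/
theorem exists_balanced {B R₁ R₂ : Type} [CommRing B] [Algebra ℚ B] [CommRing R₁] [Algebra ℚ R₁]
    [CommRing R₂] [Algebra ℚ R₂] (r : B →ₐ[ℚ] R₁) (l : B →ₐ[ℚ] R₂) :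
    ∃ (S : Type) (_ : CommRing S) (_ : Algebra ℚ S) (j₁ : R₁ →ₐ[ℚ] S) (j₂ : R₂ →ₐ[ℚ] S),
      (∀ b, j₁ (r b) = j₂ (l b)) ∧
      (∀ p : S → Prop, (∀ u v, p (j₁ u * j₂ v)) → (∀ s t, p s → p t → p (s + t)) → ∀ s, p s) ∧
      ∀ (X : Type) [AddCommGroup X] [Module ℚ X] (f : R₁ →ₗ[ℚ] R₂ →ₗ[ℚ] X),
        (∀ b u v, f (r b * u) v = f u (l b * v)) →
        ∃ g : S →ₗ[ℚ] X, ∀ u v, g (j₁ u * j₂ v) = f u v := by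
  let a1 : Algebra B R₁ := r.toRingHom.toAlgebra
  let a2 : Algebra B R₂ := l.toRingHom.toAlgebra
  have : IsScalarTower ℚ B R₁ := .of_algebraMap_eq fun q => (r.commutes q).symm
  have : IsScalarTower ℚ B R₂ := .of_algebraMap_eq fun q => (l.commutes q).symm
  have s1 : ∀ (b : B) (u : R₁), b • u = r b * u := fun _ _ => rfl
  have s2 : ∀ (b : B) (u : R₂), b • u = l b * u := fun _ _ => rfl
  refine ⟨R₁ ⊗[B] R₂, inferInstance, inferInstance,
    (Algebra.TensorProduct.includeLeft : R₁ →ₐ[B] R₁ ⊗[B] R₂).restrictScalars ℚ,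
    (Algebra.TensorProduct.includeRight : R₂ →ₐ[B] R₁ ⊗[B] R₂).restrictScalars ℚ,
    fun b => ?_, fun p hp hadd s => ?_, fun X _ _ f hf => ?_⟩
  · change r b ⊗ₜ[B] (1 : R₂) = (1 : R₁) ⊗ₜ[B] l b
    have := TensorProduct.smul_tmul (R := B) b (1 : R₁) (1 : R₂)
    rwa [s1, s2, mul_one, mul_one] at this
  · have hp' : ∀ u v, p (u ⊗ₜ v) := fun u v => by
      have := hp u v
      change p (u ⊗ₜ[B] (1 : R₂) * (1 : R₁) ⊗ₜ[B] v) at this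
      rwa [Algebra.TensorProduct.tmul_mul_tmul, mul_one, one_mul] at this
    induction s using TensorProduct.induction_on with
    | zero => have := hp' 0 0; rwa [TensorProduct.zero_tmul] at this
    | tmul u v => exact hp' u v
    | add s t hs ht => exact hadd _ _ hs ht
  · let g : R₁ ⊗[B] R₂ →+ X := TensorProduct.liftAddHom
      (AddMonoidHom.mk' (fun u => (f u).toAddMonoidHom) fun u u' => by ext v; simp)
      (fun b u v => (hf b u v))
    refine ⟨g.toRatLinearMap, fun u v => ?_⟩
    change g (u ⊗ₜ[B] (1 : R₂) * (1 : R₁) ⊗ₜ[B] v) = f u v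
    rw [Algebra.TensorProduct.tmul_mul_tmul, mul_one, one_mul]
    rfl

end BalancedTensor

section TwoStrands

/-- The coefficients of `(1 + ξ t) c(t)`. -/
def linMul {S : Type} [CommRing S] (ξ : S) (c : ℕ → S) : ℕ → S
  | 0 => c 0
  | j + 1 => c (j + 1) + ξ * c j

theorem linMul_comm {S : Type} [CommRing S] (ξ ζ : S) (c : ℕ → S) (j : ℕ) :
    linMul ξ (linMul ζ c) j = linMul ζ (linMul ξ c) j := by
  rcases j with - | - | j <;> simp only [linMul] <;> ring

theorem map_linMul {S S' : Type} [CommRing S] [CommRing S'] [Algebra ℚ S] [Algebra ℚ S']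
    (φ : S →ₐ[ℚ] S') (ξ : S) (c : ℕ → S) (j : ℕ) :
    φ (linMul ξ c j) = linMul (φ ξ) (fun j => φ (c j)) j := by
  cases j <;> simp [linMul]

/-- Polynomials in the Chern classes of a two-step flag. -/
abbrev FlagPoly : Type := MvPolynomial (ℕ ⊕ ℕ ⊕ Bool) ℚ

/-- The sequence of variables truncated after position `k`. -/
noncomputable def truncVar (e : ℕ → ℕ ⊕ ℕ ⊕ Bool) (k : ℕ) : ℕ → FlagPoly
  | 0 => 1
  | j + 1 => if j < k then MvPolynomial.X (e j) else 0

theorem truncVar_zero (e : ℕ → ℕ ⊕ ℕ ⊕ Bool) (k : ℕ) : truncVar e k 0 = 1 := rfl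

theorem truncVar_eq_zero (e : ℕ → ℕ ⊕ ℕ ⊕ Bool) {k j : ℕ} (h : k < j) : truncVar e k j = 0 := by
  cases j with
  | zero => omega
  | succ j => exact if_neg (by omega)

theorem linMul_truncVar_eq_zero (ξ : FlagPoly) (e : ℕ → ℕ ⊕ ℕ ⊕ Bool) {k j : ℕ} (h : k + 1 < j) :
    linMul ξ (truncVar e k) j = 0 := by
  cases j with
  | zero => omega
  | succ j => rw [linMul, truncVar_eq_zero _ (by omega), truncVar_eq_zero _ (by omega)]; ring

theorem aeval_truncVar {S : Type} [CommRing S] [Algebra ℚ S] (v : ℕ ⊕ ℕ ⊕ Bool → S)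
    (e : ℕ → ℕ ⊕ ℕ ⊕ Bool) (k : ℕ) (c : ℕ → S) (h0 : c 0 = 1) (hv : ∀ j, v (e j) = c (j + 1))
    (hc : ∀ j, k < j → c j = 0) (j : ℕ) : MvPolynomial.aeval v (truncVar e k j) = c j := by
  cases j with
  | zero => rw [truncVar_zero, map_one, h0]
  | succ j =>
    rw [truncVar]
    split_ifs with h
    · rw [MvPolynomial.aeval_X, hv]
    · rw [map_zero, hc _ (by omega)]

/-- The two line bundle classes. -/
noncomputable abbrev flagXi (b : Bool) : FlagPoly := MvPolynomial.X (.inr (.inr b))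

theorem flagXi_ne : (.inr (.inr false) : ℕ ⊕ ℕ ⊕ Bool) ≠ .inr (.inr true) := by simp

/-- The exchange of the two line bundle classes. -/
noncomputable abbrev flagSwap : FlagPoly →ₐ[ℚ] FlagPoly :=
  swapVars (.inr (.inr false)) (.inr (.inr true))

theorem flagSwap_false : flagSwap (flagXi false) = flagXi true := by
  rw [swapVars_X, Equiv.swap_apply_left]

theorem flagSwap_true : flagSwap (flagXi true) = flagXi false := by
  rw [swapVars_X, Equiv.swap_apply_right]

theorem flagSwap_truncVar {e : ℕ → ℕ ⊕ ℕ ⊕ Bool} (h : ∀ j b, e j ≠ .inr (.inr b)) (k j : ℕ) :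
    flagSwap (truncVar e k j) = truncVar e k j := by
  cases j with
  | zero => rw [truncVar_zero, map_one]
  | succ j =>
    rw [truncVar]
    split_ifs
    · rw [swapVars_X, Equiv.swap_apply_of_ne_of_ne (h j _) (h j _)]
    · rw [map_zero]

variable {N : ℕ} {n : ℤ}

noncomputable abbrev flagX (N : ℕ) (n : ℤ) : ℕ → FlagPoly := truncVar Sum.inl (kk N n)
noncomputable abbrev flagY (N : ℕ) (n : ℤ) : ℕ → FlagPoly :=
  truncVar (fun j => .inr (.inl j)) (N - kk N n - 2)

/-- The first step of a two-step flag. -/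
noncomputable def flagFst (h : ValidE N n) : (HE N n).carrier →ₐ[ℚ] FlagPoly :=
  HElift h (flagX N n) (flagXi false) (linMul (flagXi true) (flagY N n))

/-- The second step of a two-step flag. -/
noncomputable def flagSnd (h : ValidE N (n + 2)) : (HE N (n + 2)).carrier →ₐ[ℚ] FlagPoly :=
  HElift h (linMul (flagXi false) (flagX N n)) (flagXi true) (flagY N n)

theorem flagFst_xE (h : ValidE N n) (j : ℕ) : flagFst h (xE N n j) = flagX N n j :=
  HElift_xE h rfl (fun _ hj => truncVar_eq_zero _ hj) j

theorem flagFst_xi (h : ValidE N n) : flagFst h (xi N n) = flagXi false := HElift_xi h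

theorem flagFst_yE (h : ValidE N n) (h' : ValidE N (n + 2)) (j : ℕ) :
    flagFst h (yE N n j) = linMul (flagXi true) (flagY N n) j :=
  HElift_yE h rfl (fun _ hj => linMul_truncVar_eq_zero _ _ (by
    have := h.kk_succ; have := h'.kk_lt; omega)) j

theorem flagSnd_xE (h : ValidE N n) (h' : ValidE N (n + 2)) (j : ℕ) :
    flagSnd h' (xE N (n + 2) j) = linMul (flagXi false) (flagX N n) j :=
  HElift_xE h' rfl (fun _ hj => linMul_truncVar_eq_zero _ _ (by rw [← h.kk_succ]; exact hj)) j

theorem flagSnd_xi (h' : ValidE N (n + 2)) : flagSnd h' (xi N (n + 2)) = flagXi true := HElift_xi h'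

theorem flagSnd_yE (h : ValidE N n) (h' : ValidE N (n + 2)) (j : ℕ) :
    flagSnd h' (yE N (n + 2) j) = flagY N n j :=
  HElift_yE h' rfl (fun _ hj => truncVar_eq_zero _ (by have := h.kk_succ; omega)) j

theorem rHom_x_linMul (h : ValidE N n) (j : ℕ) :
    rHom N n (x N (n + 2) j) = linMul (xi N n) (xE N n) j := by
  cases j with
  | zero => rw [x_zero, map_one, linMul, xE_zero]
  | succ j => exact rHom_x h j

theorem lHom_y_linMul (h : ValidE N n) (j : ℕ) :
    lHom N n (y N n j) = linMul (xi N n) (yE N n) j := by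
  cases j with
  | zero => rw [y_zero, map_one, linMul, yE_zero]
  | succ j => exact lHom_y h j

theorem flagFst_rHom (h : ValidE N n) (h' : ValidE N (n + 2)) (b : (H N (n + 2)).carrier) :
    flagFst h (rHom N n b) = flagSnd h' (lHom N (n + 2) b) := by
  have : (flagFst h).comp (rHom N n) = (flagSnd h').comp (lHom N (n + 2)) := by
    refine H_hom_ext h.valid_succ (fun j => ?_) (fun j => ?_)
    · change flagFst h (rHom N n _) = flagSnd h' (lHom N (n + 2) _)
      rw [rHom_x_linMul h, map_linMul, lHom_x h', flagSnd_xE h h', flagFst_xi]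
      simp only [flagFst_xE]
    · change flagFst h (rHom N n _) = flagSnd h' (lHom N (n + 2) _)
      rw [lHom_y_linMul h', map_linMul, rHom_y h, flagFst_yE h h', flagSnd_xi]
      simp only [flagSnd_yE h h']
  exact AlgHom.congr_fun this b

theorem flagSwap_lHom (h : ValidE N n) (h' : ValidE N (n + 2)) (a : (H N n).carrier) :
    flagSwap (flagFst h (lHom N n a)) = flagFst h (lHom N n a) := by
  have : (flagSwap.comp (flagFst h)).comp (lHom N n) = (flagFst h).comp (lHom N n) := by
    refine H_hom_ext h.valid (fun j => ?_) (fun j => ?_)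
    · change flagSwap (flagFst h (lHom N n _)) = flagFst h (lHom N n _)
      rw [lHom_x h, flagFst_xE, flagSwap_truncVar (by simp)]
    · change flagSwap (flagFst h (lHom N n _)) = flagFst h (lHom N n _)
      rw [lHom_y_linMul h, map_linMul, flagFst_xi]
      simp only [flagFst_yE h h', map_linMul, flagSwap_true, flagSwap_false]
      rw [linMul_comm]
      simp only [flagSwap_truncVar (e := fun j => .inr (.inl j)) (by simp)]
  exact AlgHom.congr_fun this a

theorem flagSwap_rHom (h : ValidE N n) (h' : ValidE N (n + 2)) (a : (H N (n + 2 + 2)).carrier) :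
    flagSwap (flagSnd h' (rHom N (n + 2) a)) = flagSnd h' (rHom N (n + 2) a) := by
  have : (flagSwap.comp (flagSnd h')).comp (rHom N (n + 2)) =
      (flagSnd h').comp (rHom N (n + 2)) := by
    refine H_hom_ext h'.valid_succ (fun j => ?_) (fun j => ?_)
    · change flagSwap (flagSnd h' (rHom N (n + 2) _)) = flagSnd h' (rHom N (n + 2) _)
      rw [rHom_x_linMul h', map_linMul, flagSnd_xi]
      simp only [flagSnd_xE h h', map_linMul, flagSwap_true, flagSwap_false]
      rw [linMul_comm]
      simp only [flagSwap_truncVar (e := Sum.inl) (by simp)]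
    · change flagSwap (flagSnd h' (rHom N (n + 2) _)) = flagSnd h' (rHom N (n + 2) _)
      rw [rHom_y h', flagSnd_yE h h', flagSwap_truncVar (by simp)]
  exact AlgHom.congr_fun this a

/-- Balanced bilinear maps factor through `FlagPoly`. -/
theorem exists_flagDesc (h : ValidE N n) (h' : ValidE N (n + 2)) {X : Type} [AddCommGroup X]
    [Module ℚ X] (f : (HE N n).carrier →ₗ[ℚ] (HE N (n + 2)).carrier →ₗ[ℚ] X)
    (hf : ∀ b u v, f (rHom N n b * u) v = f u (lHom N (n + 2) b * v)) :
    ∃ g : FlagPoly →ₗ[ℚ] X, (∀ u v, g (flagFst h u * flagSnd h' v) = f u v) ∧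
      ∀ (L : X →ₗ[ℚ] X) w w', (∀ u v, L (f u v) = f (w * u) (w' * v)) →
        ∀ p, L (g p) = g (flagFst h w * flagSnd h' w' * p) := by
  obtain ⟨S, _, _, j₁, j₂, hj, hS, hg⟩ := exists_balanced (rHom N n) (lHom N (n + 2))
  obtain ⟨g, hg⟩ := hg X f hf
  let v : ℕ ⊕ ℕ ⊕ Bool → S := Sum.elim (fun j => j₁ (xE N n (j + 1)))
    (Sum.elim (fun j => j₂ (yE N (n + 2) (j + 1)))
      (fun b => if b then j₂ (xi N (n + 2)) else j₁ (xi N n)))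
  let β : FlagPoly →ₐ[ℚ] S := MvPolynomial.aeval v
  have βx : ∀ j, β (flagX N n j) = j₁ (xE N n j) := aeval_truncVar v _ _
    (fun j => j₁ (xE N n j)) (by rw [xE_zero, map_one]) (fun _ => rfl)
    (fun j hj => by rw [xE_eq_zero hj, map_zero])
  have βy : ∀ j, β (flagY N n j) = j₂ (yE N (n + 2) j) := aeval_truncVar v _ _
    (fun j => j₂ (yE N (n + 2) j)) (by rw [yE_zero, map_one]) (fun _ => rfl)
    (fun j hj => by rw [yE_eq_zero (by have := h.kk_succ; omega), map_zero])
  have β1 : β (flagXi false) = j₁ (xi N n) := MvPolynomial.aeval_X _ _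
  have β2 : β (flagXi true) = j₂ (xi N (n + 2)) := MvPolynomial.aeval_X _ _
  have e1 : β.comp (flagFst h) = j₁ := by
    refine HE_hom_ext h (fun j => ?_) ?_ (fun j => ?_)
    · exact (congrArg β (flagFst_xE h j)).trans (βx j)
    · exact (congrArg β (flagFst_xi h)).trans β1
    · refine (congrArg β (flagFst_yE h h' j)).trans ?_
      rw [map_linMul, β2, ← rHom_y h, hj, lHom_y_linMul h', map_linMul]
      simp only [βy]
  have e2 : β.comp (flagSnd h') = j₂ := by
    refine HE_hom_ext h' (fun j => ?_) ?_ (fun j => ?_)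
    · refine (congrArg β (flagSnd_xE h h' j)).trans ?_
      rw [map_linMul, β1, ← lHom_x h', ← hj, rHom_x_linMul h, map_linMul]
      simp only [βx]
    · exact (congrArg β (flagSnd_xi h')).trans β2
    · exact (congrArg β (flagSnd_yE h h' j)).trans (βy j)
  have e1' : ∀ u, β (flagFst h u) = j₁ u := AlgHom.congr_fun e1
  have e2' : ∀ u, β (flagSnd h' u) = j₂ u := AlgHom.congr_fun e2
  refine ⟨g ∘ₗ β.toLinearMap, fun u v => ?_, fun L w w' hL p => ?_⟩
  · change g (β _) = _
    rw [map_mul, e1', e2', hg]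
  · change L (g (β p)) = g (β _)
    rw [map_mul β, map_mul β, e1', e2']
    refine hS (fun s => L (g s) = g (j₁ w * j₂ w' * s)) (fun u v => ?_) (fun s t hs ht => ?_) _
    · rw [hg, hL, mul_mul_mul_comm, ← map_mul, ← map_mul, hg]
    · rw [map_add, map_add, hs, ht, mul_add, map_add]

/-- The divided difference acting on two-step flags. -/
noncomputable abbrev flagDiff : FlagPoly →ₗ[ℚ] FlagPoly := divDiff flagXi_ne

theorem exists_crossE (h : ValidE N n) (h' : ValidE N (n + 2)) :
    ∃ U : tensor (BE N n) (BE N (n + 2)) ⟶ tensor (BE N n) (BE N (n + 2)), ∀ a b : ℕ,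
    U.lin (tm _ _ (vE N n (xi N n ^ a)) (vE N (n + 2) (xi N (n + 2) ^ b))) =
      ∑ j ∈ Finset.range b,
        tm _ _ (vE N n (xi N n ^ (a + b - 1 - j))) (vE N (n + 2) (xi N (n + 2) ^ j)) -
      ∑ j ∈ Finset.range a,
        tm _ _ (vE N n (xi N n ^ (a + b - 1 - j))) (vE N (n + 2) (xi N (n + 2) ^ j)) := by
  obtain ⟨g, hg, hL⟩ := exists_flagDesc h h'
    ((tm (BE N n) (BE N (n + 2))).compl₁₂ (vE N n) (vE N (n + 2)))
    (fun b u v => tm_right (vE N n u) b (vE N (n + 2) v))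
  let F : (HE N n).carrier →ₗ[ℚ] (HE N (n + 2)).carrier →ₗ[ℚ]
      (tensor (BE N n) (BE N (n + 2))).carrier :=
    ((LinearMap.mul ℚ FlagPoly).compl₁₂ (flagFst h).toLinearMap
      (flagSnd h').toLinearMap).compr₂ (g ∘ₗ flagDiff)
  have hF : ∀ u v, F u v = g (flagDiff (flagFst h u * flagSnd h' v)) := fun _ _ => rfl
  refine ⟨tensorDesc (M := BE N n) (P := BE N (n + 2)) (Q := tensor (BE N n) (BE N (n + 2))) F
    (fun (m : (HE N n).carrier) b (p : (HE N (n + 2)).carrier) => ?_)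
    (fun a (m : (HE N n).carrier) (p : (HE N (n + 2)).carrier) => ?_) (fun c (m : (HE N n).carrier) (p : (HE N (n + 2)).carrier) => ?_), fun a b => ?_⟩
  · change F (rHom N n b * m) p = F m (lHom N (n + 2) b * p)
    rw [hF, hF, map_mul (flagFst h), map_mul (flagSnd h'), flagFst_rHom h h', mul_left_comm, mul_assoc]
  · change F (lHom N n a * m) p = (tensor (BE N n) (BE N (n + 2))).left a (g (flagDiff (flagFst h m * flagSnd h' p)))
    rw [hF, map_mul (flagFst h), mul_assoc, divDiff_mul _ (flagSwap_lHom h h' a)]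
    rw [hL ((tensor (BE N n) (BE N (n + 2))).left a) (lHom N n a) 1, map_one, mul_one]
    intro u v
    rw [one_mul]
    exact tensor_left a (vE N n u) (vE N (n + 2) v)
  · change F m (rHom N (n + 2) c * p) =
      (tensor (BE N n) (BE N (n + 2))).right c (g (flagDiff (flagFst h m * flagSnd h' p)))
    rw [hF, map_mul (flagSnd h'), mul_left_comm, divDiff_mul _ (flagSwap_rHom h h' c)]
    rw [hL ((tensor (BE N n) (BE N (n + 2))).right c) 1 (rHom N (n + 2) c), map_one, one_mul]
    intro u v
    rw [one_mul]
    exact tensor_right c (vE N n u) (vE N (n + 2) v)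
  · refine (tensorDesc_tm (M := BE N n) (P := BE N (n + 2))
      (Q := tensor (BE N n) (BE N (n + 2))) _ _ _ _ _ _).trans ?_
    refine (hF _ _).trans ?_
    have mono : ∀ i j : ℕ, g (flagXi false ^ i * flagXi true ^ j) =
        tm _ _ (vE N n (xi N n ^ i)) (vE N (n + 2) (xi N (n + 2) ^ j)) := fun i j => by
      rw [← flagFst_xi h, ← flagSnd_xi h', ← map_pow, ← map_pow]
      exact hg _ _
    have e : flagFst h (xi N n ^ a) * flagSnd h' (xi N (n + 2) ^ b) =
        flagXi false ^ a * flagXi true ^ b := by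
      rw [map_pow, map_pow, flagFst_xi, flagSnd_xi]
    refine (congrArg (fun z => g (flagDiff z)) e).trans ?_
    rw [divDiff_pow_mul_pow, map_sub, map_sum, map_sum]
    simp only [mono]

theorem exists_crossF (h : ValidE N n) (h' : ValidE N (n + 2)) :
    ∃ U : tensor (BF N (n + 2)) (BF N n) ⟶ tensor (BF N (n + 2)) (BF N n), ∀ a b : ℕ,
    U.lin (tm _ _ (vF N (n + 2) (xi N (n + 2) ^ a)) (vF N n (xi N n ^ b))) =
      ∑ j ∈ Finset.range a,
        tm _ _ (vF N (n + 2) (xi N (n + 2) ^ (a + b - 1 - j))) (vF N n (xi N n ^ j)) -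
      ∑ j ∈ Finset.range b,
        tm _ _ (vF N (n + 2) (xi N (n + 2) ^ (a + b - 1 - j))) (vF N n (xi N n ^ j)) := by
  obtain ⟨g, hg, hL⟩ := exists_flagDesc h h'
    ((tm (BF N (n + 2)) (BF N n)).compl₁₂ (vF N (n + 2)) (vF N n)).flip
    (fun b u v => (tm_right (vF N (n + 2) v) b (vF N n u)).symm)
  let F : (HE N (n + 2)).carrier →ₗ[ℚ] (HE N n).carrier →ₗ[ℚ]
      (tensor (BF N (n + 2)) (BF N n)).carrier :=
    (((LinearMap.mul ℚ FlagPoly).compl₁₂ (flagFst h).toLinearMap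
      (flagSnd h').toLinearMap).compr₂ (g ∘ₗ flagDiff)).flip
  have hF : ∀ u v, F u v = g (flagDiff (flagFst h v * flagSnd h' u)) := fun _ _ => rfl
  refine ⟨tensorDesc (M := BF N (n + 2)) (P := BF N n) (Q := tensor (BF N (n + 2)) (BF N n)) F
    (fun (m : (HE N (n + 2)).carrier) b (p : (HE N n).carrier) => ?_)
    (fun a (m : (HE N (n + 2)).carrier) (p : (HE N n).carrier) => ?_) (fun c (m : (HE N (n + 2)).carrier) (p : (HE N n).carrier) => ?_), fun a b => ?_⟩
  · change F (lHom N (n + 2) b * m) p = F m (rHom N n b * p)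
    rw [hF, hF, map_mul (flagFst h), map_mul (flagSnd h'), flagFst_rHom h h', mul_left_comm, mul_assoc]
  · change F (rHom N (n + 2) a * m) p =
      (tensor (BF N (n + 2)) (BF N n)).left a (g (flagDiff (flagFst h p * flagSnd h' m)))
    rw [hF, map_mul (flagSnd h'), mul_left_comm, divDiff_mul _ (flagSwap_rHom h h' a)]
    rw [hL ((tensor (BF N (n + 2)) (BF N n)).left a) 1 (rHom N (n + 2) a), map_one, one_mul]
    intro u v
    rw [one_mul]
    exact tensor_left a (vF N (n + 2) v) (vF N n u)
  · change F m (lHom N n c * p) = (tensor (BF N (n + 2)) (BF N n)).right c (g (flagDiff (flagFst h p * flagSnd h' m)))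
    rw [hF, map_mul (flagFst h), mul_assoc, divDiff_mul _ (flagSwap_lHom h h' c)]
    rw [hL ((tensor (BF N (n + 2)) (BF N n)).right c) (lHom N n c) 1, map_one, mul_one]
    intro u v
    rw [one_mul]
    exact tensor_right c (vF N (n + 2) v) (vF N n u)
  · refine (tensorDesc_tm (M := BF N (n + 2)) (P := BF N n)
      (Q := tensor (BF N (n + 2)) (BF N n)) _ _ _ _ _ _).trans ?_
    refine (hF _ _).trans ?_
    have mono : ∀ i j : ℕ, g (flagXi false ^ i * flagXi true ^ j) =
        tm _ _ (vF N (n + 2) (xi N (n + 2) ^ j)) (vF N n (xi N n ^ i)) := fun i j => by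
      rw [← flagFst_xi h, ← flagSnd_xi h', ← map_pow, ← map_pow]
      exact hg _ _
    have e : flagFst h (xi N n ^ b) * flagSnd h' (xi N (n + 2) ^ a) =
        flagXi false ^ b * flagXi true ^ a := by
      rw [map_pow, map_pow, flagFst_xi, flagSnd_xi]
    refine (congrArg (fun z => g (flagDiff z)) e).trans ?_
    rw [divDiff_pow_mul_pow', map_sub, map_sum, map_sum]
    simp only [mono]

end TwoStrands

section FlagMaps

theorem EE_subsingleton {N : ℕ} {n : ℤ} (h : ¬(ValidE N n ∧ ValidE N (n + 2))) :
    Subsingleton (tensor (BE N n) (BE N (n + 2))).carrier := by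
  by_cases h1 : ValidE N n
  · exact tensor_subsingleton_right _ (BE_subsingleton fun h2 => h ⟨h1, h2⟩)
  · exact tensor_subsingleton_left _ (BE_subsingleton h1)

theorem FF_subsingleton {N : ℕ} {n : ℤ} (h : ¬(ValidE N n ∧ ValidE N (n + 2))) :
    Subsingleton (tensor (BF N (n + 2)) (BF N n)).carrier := by
  by_cases h1 : ValidE N n
  · exact tensor_subsingleton_left _ (BF_subsingleton fun h2 => h ⟨h1, h2⟩)
  · exact tensor_subsingleton_right _ (BF_subsingleton h1)

open Classical in
/-- The bimodule maps attached to the generating 2-morphisms. -/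
noncomputable def flagMaps (N : ℕ) : GenMaps N where
  z n := mulE N n (xi N n)
  zh n := mulF N n (xi N n)
  U n := if h : ValidE N n ∧ ValidE N (n + 2) then (exists_crossE h.1 h.2).choose
    else BimHom.zero _ _
  Uh n := if h : ValidE N n ∧ ValidE N (n + 2) then (exists_crossF h.1 h.2).choose
    else BimHom.zero _ _
  eta n := ofCentral _ (casL N n) casL_central
  epsh n := ofCentral _ (casR N n) casR_central
  etah n := capL N n
  eps n := capR N n
  z_apply n a := by rw [mulE_apply, pow_succ']
  zh_apply n a := by rw [mulF_apply, pow_succ']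
  U_apply n a b := by
    split_ifs with h
    · exact (exists_crossE h.1 h.2).choose_spec a b
    · have := EE_subsingleton h
      exact Subsingleton.elim _ _
  Uh_apply n a b := by
    split_ifs with h
    · exact (exists_crossF h.1 h.2).choose_spec a b
    · have := FF_subsingleton h
      exact Subsingleton.elim _ _
  eta_apply n := ofCentral_one _ _ _
  epsh_apply n := ofCentral_one _ _ _
  etah_apply n h a b := by
    rw [capL_tm, ← pow_add, traceL_pow h, Nat.cast_add]
  eps_apply n h a b := by
    rw [capR_tm, ← pow_add, traceR_pow h, Nat.cast_add]

end FlagMaps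

section Generation

variable {A B C : GrAlg} {ι κ : Type}

/-- The family `g` generates the left module `M`. -/
def LeftGen (M : GrBimod A B) (g : ι → M.carrier) : Prop :=
  ∀ p : M.carrier → Prop, (∀ a i, p (M.left a (g i))) → (∀ m m', p m → p m' → p (m + m')) → ∀ m, p m

/-- The family `g` generates the right module `M`. -/
def RightGen (M : GrBimod A B) (g : ι → M.carrier) : Prop :=
  ∀ p : M.carrier → Prop, (∀ b i, p (M.right b (g i))) → (∀ m m', p m → p m' → p (m + m')) →
    ∀ m, p m

/-- The family `g` generates the bimodule `M`. -/
def BimGen (M : GrBimod A B) (g : ι → M.carrier) : Prop :=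
  ∀ p : M.carrier → Prop, (∀ a b i, p (M.left a (M.right b (g i)))) →
    (∀ m m', p m → p m' → p (m + m')) → ∀ m, p m

theorem BimGen.hom_ext {M P : GrBimod A B} {g : ι → M.carrier} (hg : BimGen M g) {φ ψ : M ⟶ P}
    (h : ∀ i, φ.lin (g i) = ψ.lin (g i)) : φ = ψ :=
  GrBimod.hom_ext (LinearMap.ext fun m => hg (fun m => φ.lin m = ψ.lin m)
    (fun a b i => by rw [φ.map_left, ψ.map_left, φ.map_right, ψ.map_right, h])
    (fun m m' h h' => by rw [map_add, map_add, h, h']) m)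

theorem BimGen.hasDegree {M P : GrBimod A B} {g : ι → M.carrier} (hg : BimGen M g) {φ : M ⟶ P}
    {d : ℤ} (e : ι → ℤ) (he : ∀ i, g i ∈ M.gr (e i)) (hφ : ∀ i, φ.lin (g i) ∈ P.gr (e i + d)) :
    φ.HasDegree d := by
  apply mem_gr_of_span M.internal
  refine hg _ (fun a b i => ?_) (fun m m' h h' => add_mem h h')
  induction a using homogeneous_induction A.internal with
  | hom j a ha =>
    induction b using homogeneous_induction B.internal with
    | hom l b hb =>
      refine Submodule.subset_span ⟨j + (l + e i), M.left_mem ha (M.right_mem hb (he i)), ?_⟩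
      rw [φ.map_left, φ.map_right, add_assoc, add_assoc]
      exact P.left_mem ha (P.right_mem hb (hφ i))
    | add x y hx hy => rw [map_add, LinearMap.add_apply, map_add]; exact add_mem hx hy
  | add x y hx hy => rw [map_add]; exact add_mem hx hy

theorem LeftGen.bimGen_tensor {M : GrBimod A B} {P : GrBimod B C} {g : ι → M.carrier}
    {u : P.carrier} (hg : LeftGen M g) (hu : IsCyclicGen P u) :
    BimGen (tensor M P) fun i => tm M P (g i) u := fun p hp hadd x => by
  induction x using tm_induction with
  | h m q =>
    refine hu (fun q => ∀ m, p (tm M P m q)) (fun b c m => ?_)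
      (fun q q' h h' m => by rw [map_add]; exact hadd _ _ (h m) (h' m)) q m
    rw [← tm_right]
    refine hg (fun m => p (tm M P m (P.right c u))) (fun a i => ?_)
      (fun m m' h h' => by rw [map_add, LinearMap.add_apply]; exact hadd _ _ h h') (M.right b m)
    rw [← tensor_left, ← tensor_right]
    exact hp a c i
  | hadd x y hx hy => exact hadd _ _ hx hy

theorem RightGen.bimGen_tensor {M : GrBimod A B} {P : GrBimod B C} {u : M.carrier}
    {g : ι → P.carrier} (hu : IsCyclicGen M u) (hg : RightGen P g) :
    BimGen (tensor M P) fun i => tm M P u (g i) := fun p hp hadd x => by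
  induction x using tm_induction with
  | h m q =>
    refine hu (fun m => ∀ q, p (tm M P m q)) (fun a b q => ?_)
      (fun m m' h h' q => by rw [map_add, LinearMap.add_apply]; exact hadd _ _ (h q) (h' q)) m q
    rw [M.left_right, tm_right]
    refine hg (fun q => p (tm M P (M.left a u) q)) (fun c i => ?_)
      (fun m m' h h' => by rw [map_add]; exact hadd _ _ h h') (P.left b q)
    rw [← tensor_right, ← tensor_left, ← (tensor M P).left_right]
    exact hp a c i
  | hadd x y hx hy => exact hadd _ _ hx hy

theorem LeftGen.tensor {M : GrBimod A B} {P : GrBimod B C} {g : ι → M.carrier} {u : κ → P.carrier}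
    (hg : LeftGen M g) (hu : LeftGen P u) :
    LeftGen (tensor M P) fun i : ι × κ => tm M P (g i.1) (u i.2) := fun p hp hadd x => by
  induction x using tm_induction with
  | h m q =>
    refine hu (fun q => ∀ m, p (tm M P m q)) (fun b j m => ?_)
      (fun q q' h h' m => by rw [map_add]; exact hadd _ _ (h m) (h' m)) q m
    rw [← tm_right]
    refine hg (fun m => p (tm M P m (u j))) (fun a i => ?_)
      (fun m m' h h' => by rw [map_add, LinearMap.add_apply]; exact hadd _ _ h h') (M.right b m)
    rw [← tensor_left]
    exact hp a (i, j)
  | hadd x y hx hy => exact hadd _ _ hx hy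

theorem sum_induction_fin {M : Type} [AddCommMonoid M] {m : ℕ} {p : M → Prop}
    (hadd : ∀ x y, p x → p y → p (x + y)) (f : Fin (m + 1) → M) (hf : ∀ i, p (f i)) :
    p (∑ i, f i) :=
  Finset.sum_induction_nonempty f p hadd ⟨0, Finset.mem_univ _⟩ fun i _ => hf i

variable {N : ℕ} {n : ℤ}

theorem BE_leftGen : LeftGen (BE N n) fun i : Fin (N - kk N n - 1 + 1) => vE N n (xi N n ^ (i : ℕ)) := by
  intro p hp hadd m
  by_cases h : ValidE N n
  · change p (vE N n m)
    rw [(isFreeExt_lHom h).coord_spec m, map_sum]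
    exact sum_induction_fin hadd _ fun i => hp ((isFreeExt_lHom h).coord m i) i
  · have := BE_subsingleton h
    rw [Subsingleton.elim m ((BE N n).left 0 (vE N n (xi N n ^ 0)))]
    exact hp 0 0

theorem BE_rightGen : RightGen (BE N n) fun i : Fin (kk N n + 1) => vE N n (xi N n ^ (i : ℕ)) := by
  intro p hp hadd m
  by_cases h : ValidE N n
  · change p (vE N n m)
    rw [(isFreeExt_rHom h).coord_spec m, map_sum]
    exact sum_induction_fin hadd _ fun i => hp ((isFreeExt_rHom h).coord m i) i
  · have := BE_subsingleton h
    rw [Subsingleton.elim m ((BE N n).right 0 (vE N n (xi N n ^ 0)))]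
    exact hp 0 0

theorem BF_leftGen : LeftGen (BF N n) fun i : Fin (kk N n + 1) => vF N n (xi N n ^ (i : ℕ)) := by
  intro p hp hadd m
  by_cases h : ValidE N n
  · change p (vF N n m)
    rw [(isFreeExt_rHom h).coord_spec m, map_sum]
    exact sum_induction_fin hadd _ fun i => hp ((isFreeExt_rHom h).coord m i) i
  · have := BF_subsingleton h
    rw [Subsingleton.elim m ((BF N n).left 0 (vF N n (xi N n ^ 0)))]
    exact hp 0 0

end Generation

section Degrees

variable {N : ℕ} {n : ℤ}

theorem x_mem (j : ℕ) : x N n j ∈ (H N n).gr (2 * j) := by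
  cases j with
  | zero => exact (H N n).one_mem
  | succ j =>
    intro _ _
    change (if h : j < kk N n then MvPolynomial.X (Sum.inl ⟨j, h⟩) else
      (0 : MvPolynomial (Var N n) ℚ)) ∈ _
    split_ifs with h
    · exact GrAlg.poly_X_mem _ _ (by push_cast; rfl)
    · exact zero_mem _

theorem y_mem (j : ℕ) : y N n j ∈ (H N n).gr (2 * j) := by
  cases j with
  | zero => exact (H N n).one_mem
  | succ j =>
    intro _ _
    change (if h : j < N - kk N n then MvPolynomial.X (Sum.inr ⟨j, h⟩) else
      (0 : MvPolynomial (Var N n) ℚ)) ∈ _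
    split_ifs with h
    · exact GrAlg.poly_X_mem _ _ (by push_cast; rfl)
    · exact zero_mem _

theorem neg_one_pow_mul_mem (A : GrAlg) {a : A.carrier} {d : ℤ} (h : a ∈ A.gr d) (j : ℕ) :
    (-1) ^ j * a ∈ A.gr d := by
  rcases neg_one_pow_eq_or A.carrier j with e | e <;> rw [e]
  · rwa [one_mul]
  · rw [neg_one_mul]; exact neg_mem h

theorem Xs_mem (j : ℕ) : Xs N n j ∈ (H N n).gr (2 * j) := by
  induction j using Nat.strong_induction_on with
  | _ j ih =>
    cases j with
    | zero => rw [Xs]; exact (H N n).one_mem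
    | succ j =>
      rw [Xs]
      refine neg_mem (sum_mem fun i _ => ?_)
      have := (H N n).mul_mem (y_mem (N := N) (n := n) (j + 1 - i)) (ih i i.2)
      rwa [show (2 * ((j + 1 - i : ℕ) : ℤ) + 2 * ((i : ℕ) : ℤ)) = 2 * ((j + 1 : ℕ) : ℤ) by
        have := i.2; omega] at this

theorem Ys_mem (j : ℕ) : Ys N n j ∈ (H N n).gr (2 * j) := by
  induction j using Nat.strong_induction_on with
  | _ j ih =>
    cases j with
    | zero => rw [Ys]; exact (H N n).one_mem
    | succ j =>
      rw [Ys]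
      refine neg_mem (sum_mem fun i _ => ?_)
      have := (H N n).mul_mem (x_mem (N := N) (n := n) (j + 1 - i)) (ih i i.2)
      rwa [show (2 * ((j + 1 - i : ℕ) : ℤ) + 2 * ((i : ℕ) : ℤ)) = 2 * ((j + 1 : ℕ) : ℤ) by
        have := i.2; omega] at this

theorem sX_mem (d : ℤ) : sX N n d ∈ (H N n).gr (2 * d) := by
  unfold sX
  split_ifs with h
  · exact zero_mem _
  · have := neg_one_pow_mul_mem (H N n) (Xs_mem (N := N) (n := n) d.toNat) d.toNat
    rwa [Int.toNat_of_nonneg (by omega)] at this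

theorem sY_mem (d : ℤ) : sY N n d ∈ (H N n).gr (2 * d) := by
  unfold sY
  split_ifs with h
  · exact zero_mem _
  · have := neg_one_pow_mul_mem (H N n) (Ys_mem (N := N) (n := n) d.toNat) d.toNat
    rwa [Int.toNat_of_nonneg (by omega)] at this

theorem xi_pow_mem (j : ℕ) : xi N n ^ j ∈ (HE N n).gr (2 * j) := by
  have := GrAlg.pow_mem _ (xi_mem N n) j
  rwa [mul_comm] at this

theorem vE_pow_mem (j : ℕ) : vE N n (xi N n ^ j) ∈ (BE N n).gr (2 * j + (1 - N + kk N n)) :=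
  vE_mem (xi_pow_mem j)

theorem vF_pow_mem (j : ℕ) : vF N n (xi N n ^ j) ∈ (BF N n).gr (2 * j + -kk N n) :=
  vF_mem (xi_pow_mem j)

theorem ValidE.eq (h : ValidE N n) : n = 2 * kk N n - N := by
  obtain ⟨k, hk, e⟩ := h
  rw [kk_eq e]; exact e

theorem mem_gr_cast {A B : GrAlg} {M : GrBimod A B} {m : M.carrier} {i j : ℤ} (h : m ∈ M.gr i)
    (e : i = j) : m ∈ M.gr j := e ▸ h

theorem flagMaps_hasGenDegrees (N : ℕ) : HasGenDegrees (flagMaps N) where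
  z n := fun i m hm => by
    have := (HE N n).mul_mem (xi_mem N n) (show m ∈ (HE N n).gr (i - (1 - N + kk N n)) from hm)
    rwa [show 2 + (i - (1 - N + kk N n)) = i + 2 - (1 - N + kk N n) by ring] at this
  zh n := fun i m hm => by
    have := (HE N n).mul_mem (xi_mem N n) (show m ∈ (HE N n).gr (i - -kk N n) from hm)
    rwa [show 2 + (i - -kk N n) = i + 2 - -kk N n by ring] at this
  U n := by
    refine (BE_leftGen.bimGen_tensor BE_isCyclicGen).hasDegree
      (fun i => 2 * (i : ℕ) + (1 - N + kk N n) + (2 * (0 : ℕ) + (1 - N + kk N (n + 2))))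
      (fun i => ?_) (fun i => ?_)
    · exact tm_mem (vE_pow_mem i) (vE_pow_mem 0)
    · have := (flagMaps N).U_apply n i 0
      rw [pow_zero] at this
      rw [this, Finset.sum_range_zero, zero_sub]
      refine neg_mem (sum_mem fun j hj => ?_)
      rw [Finset.mem_range] at hj
      refine mem_gr_cast (tm_mem (vE_pow_mem _) (vE_pow_mem j)) ?_
      omega
  Uh n := by
    refine (BF_leftGen.bimGen_tensor BF_isCyclicGen).hasDegree
      (fun i => 2 * (i : ℕ) + -kk N (n + 2) + (2 * (0 : ℕ) + -kk N n))
      (fun i => ?_) (fun i => ?_)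
    · exact tm_mem (vF_pow_mem i) (vF_pow_mem 0)
    · have := (flagMaps N).Uh_apply n i 0
      rw [pow_zero] at this
      rw [this, Finset.sum_range_zero, sub_zero]
      refine sum_mem fun j hj => ?_
      rw [Finset.mem_range] at hj
      refine mem_gr_cast (tm_mem (vF_pow_mem _) (vF_pow_mem j)) ?_
      omega
  eta n := by
    refine hasDegree_ofCentral _ casL_central ?_
    by_cases h : ValidE N n
    · refine sum_mem fun j hj => Submodule.smul_mem _ _ ?_
      rw [Finset.mem_range] at hj
      refine mem_gr_cast ((tensor (BE N n) (BF N n)).left_mem (x_mem j)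
        (tm_mem (vE_pow_mem 0) (vF_pow_mem (kk N n - j)))) ?_
      have := h.eq
      omega
    · have := tensor_subsingleton_left (BF N n) (BE_subsingleton h)
      rw [Subsingleton.elim (casL N n) 0]
      exact zero_mem _
  epsh n := by
    refine hasDegree_ofCentral _ casR_central ?_
    by_cases h : ValidE N n
    · refine sum_mem fun j hj => Submodule.smul_mem _ _ ?_
      rw [Finset.mem_range] at hj
      refine mem_gr_cast ((tensor (BF N n) (BE N n)).left_mem (y_mem j)
        (tm_mem (vF_pow_mem 0) (vE_pow_mem (N - kk N n - 1 - j)))) ?_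
      have := h.eq
      omega
    · have := tensor_subsingleton_left (BE N n) (BF_subsingleton h)
      rw [Subsingleton.elim (casR N n) 0]
      exact zero_mem _
  etah n := by
    by_cases h : ValidE N n
    · refine (BE_leftGen.bimGen_tensor BF_isCyclicGen).hasDegree
        (fun i => 2 * (i : ℕ) + (1 - N + kk N n) + (2 * (0 : ℕ) + -kk N n))
        (fun i => ?_) (fun i => ?_)
      · exact tm_mem (vE_pow_mem i) (vF_pow_mem 0)
      · have := (flagMaps N).etah_apply n h i 0
        rw [pow_zero] at this
        rw [this]
        refine mem_gr_cast (M := regular (H N n)) (sX_mem _) ?_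
        have := h.eq
        push_cast
        linarith
    · have := tensor_subsingleton_left (BF N n) (BE_subsingleton h)
      intro i m hm
      rw [Subsingleton.elim m 0, map_zero]
      exact zero_mem _
  eps n := by
    by_cases h : ValidE N n
    · refine (BF_leftGen.bimGen_tensor BE_isCyclicGen).hasDegree
        (fun i => 2 * (i : ℕ) + -kk N n + (2 * (0 : ℕ) + (1 - N + kk N n)))
        (fun i => ?_) (fun i => ?_)
      · exact tm_mem (vF_pow_mem i) (vE_pow_mem 0)
      · have := (flagMaps N).eps_apply n h i 0
        rw [pow_zero] at this
        rw [this]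
        refine mem_gr_cast (M := regular (H N (n + 2))) (sY_mem _) ?_
        have := h.eq
        push_cast
        linarith
    · have := tensor_subsingleton_left (BE N n) (BF_subsingleton h)
      intro i m hm
      rw [Subsingleton.elim m 0, map_zero]
      exact zero_mem _

end Degrees

section DualBases

variable {A R : Type} [CommRing A] [Algebra ℚ A] [CommRing R] [Algebra ℚ R]

theorem casimir_trace' {φ : A →ₐ[ℚ] R} {ξ : R} {m : ℕ} (hfree : IsFreeExt φ ξ (m + 1)) (c : ℕ → A)
    (d : ℕ → R) (h0 : φ (c 0) = d 0) (h : ∀ j, φ (c (j + 1)) = d (j + 1) + ξ * d j)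
    (hd : d (m + 1) = 0) (hd0 : d 0 = 1) (τ : R →ₗ[ℚ] A) (hτ : ∀ a f, τ (φ a * f) = a * τ f)
    (hlow : ∀ i < m, τ (ξ ^ i) = 0) (htop : τ (ξ ^ m) = 1) (f : R) :
    ∑ j ∈ Finset.range (m + 1), (-1 : ℚ) ^ j • (φ (τ (f * d j)) * ξ ^ (m - j)) = f := by
  have key := casimir_trace hfree c d h0 h hd hd0 τ hτ hlow htop
  rw [← sub_eq_zero]
  set e := ∑ j ∈ Finset.range (m + 1), (-1 : ℚ) ^ j • (φ (τ (f * d j)) * ξ ^ (m - j)) - f with he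
  have hz : ∀ g, τ (g * e) = 0 := by
    intro g
    rw [he, mul_sub, map_sub, Finset.mul_sum, map_sum, sub_eq_zero]
    conv_rhs => rw [← key g]
    rw [Finset.sum_mul, map_sum]
    refine Finset.sum_congr rfl fun j _ => ?_
    rw [mul_smul_comm, map_smul, smul_mul_assoc, map_smul, mul_left_comm, hτ,
      show d j * φ (τ (ξ ^ (m - j) * g)) * f = φ (τ (ξ ^ (m - j) * g)) * (f * d j) by ring, hτ,
      mul_comm g, mul_comm]
  rw [← key e]
  exact Finset.sum_eq_zero fun j _ => by rw [hz, map_zero, mul_zero, smul_zero]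

variable {N : ℕ} {n : ℤ}

theorem casL_trace' (h : ValidE N n) (f : (HE N n).carrier) :
    ∑ j ∈ Finset.range (kk N n + 1),
      (-1 : ℚ) ^ j • (rHom N n (traceR N n (f * xE N n j)) * xi N n ^ (kk N n - j)) = f :=
  casimir_trace' (isFreeExt_rHom h) (x N (n + 2)) (xE N n) (map_one _) (rHom_x h)
    (xE_eq_zero (by omega)) xE_zero (traceR N n) traceR_mul (traceR_low h) (traceR_top h) f

theorem casR_trace' (h : ValidE N n) (f : (HE N n).carrier) :
    ∑ j ∈ Finset.range (N - kk N n - 1 + 1),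
      (-1 : ℚ) ^ j • (lHom N n (traceL N n (f * yE N n j)) * xi N n ^ (N - kk N n - 1 - j)) = f :=
  casimir_trace' (isFreeExt_lHom h) (y N n) (yE N n) (map_one _) (lHom_y h)
    (yE_eq_zero (by omega)) yE_zero (traceL N n) traceL_mul (traceL_low h) (traceL_top h) f

end DualBases

section Evaluation

variable {N : ℕ} {n : ℤ}

theorem leftUnit_inv_lin {A B : GrAlg} (M : GrBimod A B) (m : M.carrier) :
    (leftUnit M).inv.lin m = tm (regular A) M (1 : A.carrier) m := rfl

theorem rightUnit_inv_lin {A B : GrAlg} (M : GrBimod A B) (m : M.carrier) :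
    (rightUnit M).inv.lin m = tm M (regular B) m (1 : B.carrier) := rfl

/- Instances of the evaluation rules at the regular bimodule, in the form seen by the simplifier. -/

section

variable {A B C : GrAlg}

theorem tensorWhiskerRight_regular {P : GrBimod A A} (φ : regular A ⟶ P) (Q : GrBimod A B)
    (a : A.carrier) (q : Q.carrier) :
    (tensorWhiskerRight φ Q).lin (tm (regular A) Q a q) = tm P Q (φ.lin a) q :=
  tensorWhiskerRight_tm φ Q a q

theorem tensorWhiskerLeft_regular (Q : GrBimod A B) {P : GrBimod B B} (φ : regular B ⟶ P)
    (b : B.carrier) (q : Q.carrier) :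
    (tensorWhiskerLeft Q φ).lin (tm Q (regular B) q b) = tm Q P q (φ.lin b) :=
  tensorWhiskerLeft_tm Q φ q b

theorem assocInv_regular_right (M : GrBimod A B) (P : GrBimod B C) (m : M.carrier) (p : P.carrier)
    (c : C.carrier) : (assocInv M P (regular C)).lin (tm M (tensor P (regular C)) m
      (tm P (regular C) p c)) = tm (tensor M P) (regular C) (tm M P m p) c :=
  assocInv_tm M P (regular C) m p c

theorem assocHom_regular_right (M : GrBimod A B) (P : GrBimod B C) (m : M.carrier) (p : P.carrier)
    (c : C.carrier) : (assocHom M P (regular C)).lin (tm (tensor M P) (regular C) (tm M P m p) c) =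
      tm M (tensor P (regular C)) m (tm P (regular C) p c) :=
  assocHom_tm M P (regular C) m p c

end

theorem eta_one : ((flagMaps N).eta n).lin (1 : (H N n).carrier) = casL N n :=
  ofCentral_one _ _ casL_central
theorem epsh_one : ((flagMaps N).epsh n).lin (1 : (H N (n + 2)).carrier) = casR N n :=
  ofCentral_one _ _ casR_central
theorem eta_lin (a : (H N n).carrier) : ((flagMaps N).eta n).lin a =
    (tensor (BE N n) (BF N n)).left a (casL N n) := rfl
theorem epsh_lin (a : (H N (n + 2)).carrier) : ((flagMaps N).epsh n).lin a =
    (tensor (BF N n) (BE N n)).left a (casR N n) := rfl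
theorem etah_tm (f g : (HE N n).carrier) : ((flagMaps N).etah n).lin (tm _ _ (vE N n f) (vF N n g)) =
    traceL N n (f * g) := capL_tm N n f g
theorem eps_tm (f g : (HE N n).carrier) : ((flagMaps N).eps n).lin (tm _ _ (vF N n f) (vE N n g)) =
    traceR N n (f * g) := capR_tm N n f g
theorem z_lin (f : (HE N n).carrier) : ((flagMaps N).z n).lin (vE N n f) = vE N n (xi N n * f) := rfl
theorem zh_lin (f : (HE N n).carrier) : ((flagMaps N).zh n).lin (vF N n f) = vF N n (xi N n * f) := rfl

theorem BE_hom_ext {P : GrBimod (H N n) (H N (n + 2))} {φ ψ : BE N n ⟶ P}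
    (h : ∀ f, φ.lin (vE N n f) = ψ.lin (vE N n f)) : φ = ψ := hom_ext (LinearMap.ext h)

theorem BF_hom_ext {P : GrBimod (H N (n + 2)) (H N n)} {φ ψ : BF N n ⟶ P}
    (h : ∀ f, φ.lin (vF N n f) = ψ.lin (vF N n f)) : φ = ψ := hom_ext (LinearMap.ext h)

end Evaluation

section Zigzag

variable (N : ℕ) (n : ℤ)

theorem zigzagE₁_rel : Γ₂ (flagMaps N)
    (Tm.id (Mor.E n) ⊚ (Tm.eta n ▹ Mor.E n) ⊚ (Mor.E n ◃ Tm.eps n) ⊚ Tm.id (Mor.E n)) =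
    Γ₂ (flagMaps N) (Tm.id (Mor.E n)) := by
  dsimp only [Tm.cc, Tm.Coh.tm, Γ₂, Γ₁]
  by_cases h : ValidE N n
  swap; · exact hom_eq_of_subsingleton (BE_subsingleton h) _ _
  refine BE_hom_ext fun f => ?_
  simp -index only [comp_lin, LinearMap.comp_apply, id_lin, LinearMap.id_apply, leftUnit_inv_lin,
    rightUnit_inv_lin]
  simp -index only [id_lin, LinearMap.id_apply,
    tensorWhiskerRight_regular, tensorWhiskerLeft_regular, tensorWhiskerRight_tm,
    tensorWhiskerLeft_tm, eta_one, epsh_one, casL_eq h, map_sum, map_smul, LinearMap.sum_apply,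
    LinearMap.smul_apply, assocHom_tm, assocInv_tm, eps_tm, etah_tm, rightUnit_tm, leftUnit_tm,
    BE_right, BE_left, BF_left, BF_right, z_lin, zh_lin]
  refine Eq.trans ?_ (congrArg (vE N n) (casL_trace h f))
  simp only [map_sum, map_smul, mul_comm (xE N n _)]

theorem zigzagE₂_rel : Γ₂ (flagMaps N)
    (Tm.id (Mor.E n) ⊚ (Mor.E n ◃ Tm.epsh n) ⊚ (Tm.etah n ▹ Mor.E n) ⊚ Tm.id (Mor.E n)) =
    Γ₂ (flagMaps N) (Tm.id (Mor.E n)) := by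
  dsimp only [Tm.cc, Tm.Coh.tm, Γ₂, Γ₁]
  by_cases h : ValidE N n
  swap; · exact hom_eq_of_subsingleton (BE_subsingleton h) _ _
  refine BE_hom_ext fun f => ?_
  simp -index only [comp_lin, LinearMap.comp_apply, id_lin, LinearMap.id_apply, leftUnit_inv_lin,
    rightUnit_inv_lin]
  simp -index only [id_lin, LinearMap.id_apply,
    tensorWhiskerRight_regular, tensorWhiskerLeft_regular, tensorWhiskerRight_tm,
    tensorWhiskerLeft_tm, eta_one, epsh_one, casR_eq h, map_sum, map_smul, LinearMap.sum_apply,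
    LinearMap.smul_apply, assocHom_tm, assocInv_tm, eps_tm, etah_tm, rightUnit_tm, leftUnit_tm,
    BE_right, BE_left, BF_left, BF_right, z_lin, zh_lin]
  refine Eq.trans ?_ (congrArg (vE N n) (casR_trace' h f))
  simp only [map_sum, map_smul]

theorem zigzagF₁_rel : Γ₂ (flagMaps N)
    (Tm.id (Mor.F n) ⊚ (Mor.F n ◃ Tm.eta n) ⊚ (Tm.eps n ▹ Mor.F n) ⊚ Tm.id (Mor.F n)) =
    Γ₂ (flagMaps N) (Tm.id (Mor.F n)) := by
  dsimp only [Tm.cc, Tm.Coh.tm, Γ₂, Γ₁]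
  by_cases h : ValidE N n
  swap; · exact hom_eq_of_subsingleton (BF_subsingleton h) _ _
  refine BF_hom_ext fun f => ?_
  simp -index only [comp_lin, LinearMap.comp_apply, id_lin, LinearMap.id_apply, leftUnit_inv_lin,
    rightUnit_inv_lin]
  simp -index only [id_lin, LinearMap.id_apply,
    tensorWhiskerRight_regular, tensorWhiskerLeft_regular, tensorWhiskerRight_tm,
    tensorWhiskerLeft_tm, eta_one, epsh_one, casL_eq h, map_sum, map_smul, LinearMap.sum_apply,
    LinearMap.smul_apply, assocHom_tm, assocInv_tm, eps_tm, etah_tm, rightUnit_tm, leftUnit_tm,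
    BE_right, BE_left, BF_left, BF_right, z_lin, zh_lin]
  refine Eq.trans ?_ (congrArg (vF N n) (casL_trace' h f))
  simp only [map_sum, map_smul]

theorem zigzagF₂_rel : Γ₂ (flagMaps N)
    (Tm.id (Mor.F n) ⊚ (Tm.epsh n ▹ Mor.F n) ⊚ (Mor.F n ◃ Tm.etah n) ⊚ Tm.id (Mor.F n)) =
    Γ₂ (flagMaps N) (Tm.id (Mor.F n)) := by
  dsimp only [Tm.cc, Tm.Coh.tm, Γ₂, Γ₁]
  by_cases h : ValidE N n
  swap; · exact hom_eq_of_subsingleton (BF_subsingleton h) _ _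
  refine BF_hom_ext fun f => ?_
  simp -index only [comp_lin, LinearMap.comp_apply, id_lin, LinearMap.id_apply, leftUnit_inv_lin,
    rightUnit_inv_lin]
  simp -index only [id_lin, LinearMap.id_apply,
    tensorWhiskerRight_regular, tensorWhiskerLeft_regular, tensorWhiskerRight_tm,
    tensorWhiskerLeft_tm, eta_one, epsh_one, casR_eq h, map_sum, map_smul, LinearMap.sum_apply,
    LinearMap.smul_apply, assocHom_tm, assocInv_tm, eps_tm, etah_tm, rightUnit_tm, leftUnit_tm,
    BE_right, BE_left, BF_left, BF_right, z_lin, zh_lin]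
  refine Eq.trans ?_ (congrArg (vF N n) (casR_trace h f))
  simp only [map_sum, map_smul, mul_comm (yE N n _)]

theorem dotCyclic₁_rel : Γ₂ (flagMaps N)
    (Tm.id (Mor.F n) ⊚ (Tm.epsh n ▹ Mor.F n) ⊚ (Mor.F n ◃ (Tm.z n ▹ Mor.F n)) ⊚
      (Mor.F n ◃ Tm.etah n) ⊚ Tm.id (Mor.F n)) =
    Γ₂ (flagMaps N) (Tm.zh n) := by
  dsimp only [Tm.cc, Tm.Coh.tm, Γ₂, Γ₁]
  by_cases h : ValidE N n
  swap; · exact hom_eq_of_subsingleton (BF_subsingleton h) _ _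
  refine BF_hom_ext fun f => ?_
  simp -index only [comp_lin, LinearMap.comp_apply, id_lin, LinearMap.id_apply, leftUnit_inv_lin,
    rightUnit_inv_lin]
  simp -index only [id_lin, LinearMap.id_apply,
    tensorWhiskerRight_regular, tensorWhiskerLeft_regular, tensorWhiskerRight_tm,
    tensorWhiskerLeft_tm, eta_one, epsh_one, casR_eq h, map_sum, map_smul, LinearMap.sum_apply,
    LinearMap.smul_apply, assocHom_tm, assocInv_tm, eps_tm, etah_tm, rightUnit_tm, leftUnit_tm,
    BE_right, BE_left, BF_left, BF_right, z_lin, zh_lin]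
  refine Eq.trans ?_ (congrArg (vF N n) (casR_trace h (xi N n * f)))
  simp only [map_sum, map_smul, mul_comm (yE N n _), mul_assoc, mul_left_comm (xi N n)]

theorem dotCyclic₂_rel : Γ₂ (flagMaps N)
    (Tm.id (Mor.F n) ⊚ (Mor.F n ◃ Tm.eta n) ⊚ (Mor.F n ◃ (Tm.z n ▹ Mor.F n)) ⊚
      (Tm.eps n ▹ Mor.F n) ⊚ Tm.id (Mor.F n)) =
    Γ₂ (flagMaps N) (Tm.zh n) := by
  dsimp only [Tm.cc, Tm.Coh.tm, Γ₂, Γ₁]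
  by_cases h : ValidE N n
  swap; · exact hom_eq_of_subsingleton (BF_subsingleton h) _ _
  refine BF_hom_ext fun f => ?_
  simp -index only [comp_lin, LinearMap.comp_apply, id_lin, LinearMap.id_apply, leftUnit_inv_lin,
    rightUnit_inv_lin]
  simp -index only [id_lin, LinearMap.id_apply,
    tensorWhiskerRight_regular, tensorWhiskerLeft_regular, tensorWhiskerRight_tm,
    tensorWhiskerLeft_tm, eta_one, epsh_one, casL_eq h, map_sum, map_smul, LinearMap.sum_apply,
    LinearMap.smul_apply, assocHom_tm, assocInv_tm, eps_tm, etah_tm, rightUnit_tm, leftUnit_tm,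
    BE_right, BE_left, BF_left, BF_right, z_lin, zh_lin]
  refine Eq.trans ?_ (congrArg (vF N n) (casL_trace' h (xi N n * f)))
  simp only [map_sum, map_smul, mul_assoc, mul_left_comm (xi N n)]

end Zigzag

section Bubbles

variable {N : ℕ} {n : ℤ}

theorem Γ₂_pow_z (m : ℕ) (f : (HE N n).carrier) :
    (Γ₂ (flagMaps N) ((Tm.z n).pow m)).lin (vE N n f) = vE N n (xi N n ^ m * f) := by
  induction m generalizing f with
  | zero => rw [pow_zero, one_mul]; rfl
  | succ m ih =>
    change (Γ₂ (flagMaps N) (Tm.z n)).lin ((Γ₂ (flagMaps N) ((Tm.z n).pow m)).lin (vE N n f)) = _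
    rw [ih, pow_succ', mul_assoc]; rfl

theorem Γ₂_pow_z_eq (m : ℕ) :
    Γ₂ (flagMaps N) ((Tm.z n).pow m) = (mulE N n (xi N n ^ m) : BE N n ⟶ BE N n) :=
  BE_hom_ext fun f => Γ₂_pow_z m f

theorem mulE_lin (a f : (HE N n).carrier) : (mulE N n a).lin (vE N n f) = vE N n (a * f) := rfl

theorem Γ₂_sum (G : GenMaps N) {n m : ℤ} {f g : Mor n m} (k : ℕ) (t : Fin k → Tm f g)
    (v : (Γ₁ N f).carrier) :
    (Γ₂ G (Tm.sum k t)).lin v = ∑ i, (Γ₂ G (t i)).lin v := by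
  induction k with
  | zero => rfl
  | succ k ih =>
    rw [Fin.sum_univ_castSucc, ← ih]; rfl

theorem Γ₂_neg (G : GenMaps N) {n m : ℤ} {f g : Mor n m} (t : Tm f g) (v : (Γ₁ N f).carrier) :
    (Γ₂ G t.neg).lin v = -(Γ₂ G t).lin v :=
  (neg_one_smul ℚ ((Γ₂ G t).lin v) :)

theorem regular_lin {A : GrAlg} {M : GrBimod A A} (φ : regular A ⟶ M) (a : A.carrier) :
    φ.lin a = M.left a (φ.lin (1 : A.carrier)) := by
  have := φ.map_left a (1 : A.carrier)
  rw [← this]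
  change φ.lin a = φ.lin (a * 1 : A.carrier)
  rw [mul_one]

theorem regular_lin_regular {A : GrAlg} (φ : regular A ⟶ regular A) (a : A.carrier) :
    φ.lin a = (a * (show A.carrier from φ.lin (1 : A.carrier)) : A.carrier) :=
  regular_lin φ a

theorem regular_hom_ext {A : GrAlg} {M : GrBimod A A} {φ ψ : regular A ⟶ M}
    (h : φ.lin (1 : A.carrier) = ψ.lin (1 : A.carrier)) : φ = ψ :=
  hom_ext (LinearMap.ext fun a => by rw [regular_lin φ, regular_lin ψ, h])

/-- The value of a closed diagram. -/
noncomputable def bubVal {n : ℤ} (t : Tm (Mor.id n) (Mor.id n)) : (H N n).carrier :=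
  (Γ₂ (flagMaps N) t).lin (1 : (H N n).carrier)

theorem Γ₂_closed {n : ℤ} (t : Tm (Mor.id n) (Mor.id n)) (a : (H N n).carrier) :
    (Γ₂ (flagMaps N) t).lin a = (a * bubVal t : (H N n).carrier) :=
  regular_lin_regular _ a

theorem bubVal_comp {n : ℤ} (s t : Tm (Mor.id n) (Mor.id n)) :
    bubVal (N := N) (s.comp t) = bubVal s * bubVal t :=
  Γ₂_closed t (bubVal s)

theorem bubVal_neg {n : ℤ} (t : Tm (Mor.id n) (Mor.id n)) :
    bubVal (N := N) t.neg = -bubVal t := Γ₂_neg _ _ _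

theorem bubVal_sum {n : ℤ} (k : ℕ) (t : Fin k → Tm (Mor.id n) (Mor.id n)) :
    bubVal (N := N) (Tm.sum k t) = ∑ i, bubVal (t i) := Γ₂_sum _ _ _ _

variable (N n) in
/-- The generating series of clockwise bubbles. -/
noncomputable def bubC : PowerSeries (H N n).carrier := altSeries (y N n) * altSeries (Ys N n)

variable (N n) in
/-- The generating series of counter-clockwise bubbles. -/
noncomputable def bubCC : PowerSeries (H N n).carrier := altSeries (x N n) * altSeries (Xs N n)

theorem bubC_mul_bubCC : bubC N n * bubCC N n = 1 := by
  unfold bubC bubCC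
  rw [mul_mul_mul_comm, mul_comm (altSeries (Ys N n)), ← mul_mul_mul_comm, y_mul_Xs, x_mul_Ys,
    one_mul]

theorem coeff_zero_bubC : PowerSeries.coeff 0 (bubC N n) = 1 := by
  simp [bubC, PowerSeries.coeff_mul, y_zero, Ys]

theorem coeff_zero_bubCC : PowerSeries.coeff 0 (bubCC N n) = 1 := by
  simp [bubCC, PowerSeries.coeff_mul, x_zero, Xs]

theorem neg_one_pow_smul {A : Type} [CommRing A] [Algebra ℚ A] (j : ℕ) (a : A) :
    (-1 : ℚ) ^ j • a = (-1) ^ j * a := by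
  rw [Algebra.smul_def, map_pow, map_neg, map_one]

theorem bubVal_ccbub (h : ValidE N n) (m : ℕ) :
    bubVal (ccbub n m) = zcoeff (bubCC N n) (n + m + 1) := by
  have hn := h.eq
  have e : Γ₂ (flagMaps N) (ccbub n m) = ((flagMaps N).eta n ≫
      tensorWhiskerRight (mulE N n (xi N n ^ m)) (BF N n)) ≫ (flagMaps N).etah n := by
    rw [← Γ₂_pow_z_eq]; rfl
  unfold bubVal
  rw [e]
  change ((flagMaps N).etah n).lin ((tensorWhiskerRight (mulE N n (xi N n ^ m)) (BF N n)).lin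
    (((flagMaps N).eta n).lin (1 : (H N n).carrier))) = _
  simp -index only [eta_one, casL_eq h, map_sum, map_smul,
    tensorWhiskerRight_tm, mulE_lin, etah_tm]
  unfold bubCC
  rw [← sum_coeff_mul_zcoeff _ _ _ (kk N n + 1)
    (fun j hj => .inl (by rw [coeff_altSeries, x_eq_zero (by omega), mul_zero]))]
  refine (@Finset.sum_congr ℕ (H N n).carrier _ _ _ _ _ rfl fun j hj => ?_ :)
  have := Finset.mem_range.1 hj
  rw [show xi N n ^ m * xE N n j * xi N n ^ (kk N n - j) =
      lHom N n (x N n j) * xi N n ^ (m + (kk N n - j)) by rw [lHom_x h, pow_add]; ring,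
    traceL_mul, traceL_pow h, coeff_altSeries, ← sX_eq, mul_assoc, ← neg_one_pow_smul]
  have e : ((m + (kk N n - j) : ℕ) : ℤ) + 1 + kk N n - N = n + m + 1 - j := by
    push_cast [show j ≤ kk N n by omega]; omega
  rw [e]

theorem bubVal_cbub (h : ValidE N n) (m : ℕ) :
    bubVal (cbub n m) = zcoeff (bubC N (n + 2)) (m - n - 1) := by
  have hn := h.eq
  have hk := h.kk_lt
  have hk' := h.kk_succ
  have e : Γ₂ (flagMaps N) (cbub n m) = ((flagMaps N).epsh n ≫
      tensorWhiskerLeft (BF N n) (mulE N n (xi N n ^ m))) ≫ (flagMaps N).eps n := by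
    rw [← Γ₂_pow_z_eq]; rfl
  unfold bubVal
  rw [e]
  change ((flagMaps N).eps n).lin ((tensorWhiskerLeft (BF N n) (mulE N n (xi N n ^ m))).lin
    (((flagMaps N).epsh n).lin (1 : (H N (n + 2)).carrier))) = _
  simp -index only [epsh_one, casR_eq h, map_sum, map_smul,
    tensorWhiskerLeft_tm, mulE_lin, eps_tm]
  unfold bubC
  rw [← sum_coeff_mul_zcoeff _ _ _ (N - kk N n - 1 + 1)
    (fun j hj => .inl (by rw [coeff_altSeries, y_eq_zero (by omega), mul_zero]))]
  refine (@Finset.sum_congr ℕ (H N (n + 2)).carrier _ _ _ _ _ rfl fun j hj => ?_ :)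
  have := Finset.mem_range.1 hj
  rw [coeff_altSeries, ← sY_eq, mul_assoc, ← neg_one_pow_smul,
    show yE N n j * (xi N n ^ m * xi N n ^ (N - kk N n - 1 - j)) =
      rHom N n (y N (n + 2) j) * xi N n ^ (m + (N - kk N n - 1 - j)) by rw [rHom_y h, pow_add],
    traceR_mul, traceR_pow h]
  have e : ((m + (N - kk N n - 1 - j) : ℕ) : ℤ) - kk N n = m - n - 1 - j := by omega
  rw [e]

theorem validE_of_pos (h : Valid N (n + 2)) (hn : 0 < n + 2) : ValidE N n := by
  obtain ⟨k, hk, e⟩ := h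
  exact ⟨k - 1, by omega, by omega⟩

theorem validE_of_neg (h : Valid N n) (hn : n < 0) : ValidE N n := by
  obtain ⟨k, hk, e⟩ := h
  exact ⟨k, by omega, by omega⟩

theorem coeff_succ_of_mul_eq_one {A : Type} [CommRing A] {p q : PowerSeries A} (h : p * q = 1)
    (h0 : PowerSeries.coeff 0 p = 1) (j : ℕ) : PowerSeries.coeff (j + 1) q =
    -∑ i : Fin (j + 1), PowerSeries.coeff (j + 1 - i) p * PowerSeries.coeff (i : ℕ) q := by
  have := congrArg (PowerSeries.coeff (j + 1)) h
  rw [mul_comm, PowerSeries.coeff_mul, Finset.Nat.sum_antidiagonal_eq_sum_range_succ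
      (f := fun i l => PowerSeries.coeff i q * PowerSeries.coeff l p), Finset.sum_range_succ,
    Nat.sub_self, h0, mul_one, PowerSeries.coeff_one, if_neg (by omega)] at this
  rw [Finset.sum_fin_eq_sum_range, eq_neg_iff_add_eq_zero, ← this, add_comm]
  congr 1
  refine Finset.sum_congr rfl fun i hi => ?_
  rw [dif_pos (Finset.mem_range.1 hi), mul_comm]

theorem bubVal_fakeCC (h : Valid N (n + 2)) (j : ℕ) (hj : (j : ℤ) ≤ n + 2) :
    bubVal (fakeCC n j) = PowerSeries.coeff j (bubCC N (n + 2)) := by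
  induction j using Nat.strong_induction_on with
  | _ j ih =>
    cases j with
    | zero => rw [coeff_zero_bubCC, fakeCC]; rfl
    | succ j =>
      have hE := validE_of_pos h (by omega)
      rw [fakeCC, bubVal_neg, bubVal_sum, coeff_succ_of_mul_eq_one bubC_mul_bubCC coeff_zero_bubC]
      refine congrArg Neg.neg (Finset.sum_congr rfl fun i _ => ?_)
      rw [bubVal_comp, ih i (by omega) (by omega), bubVal_cbub hE, ← zcoeff_natCast (bubC N (n + 2)) (j + 1 - i)]
      have := i.2
      congr 2
      omega

theorem bubVal_fakeC (h : Valid N (n + 2)) (j : ℕ) (hj : (j : ℤ) ≤ -(n + 2)) :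
    bubVal (fakeC n j) = PowerSeries.coeff j (bubC N (n + 2)) := by
  induction j using Nat.strong_induction_on with
  | _ j ih =>
    cases j with
    | zero => rw [coeff_zero_bubC, fakeC]; rfl
    | succ j =>
      have hE := validE_of_neg h (by omega)
      rw [fakeC, bubVal_neg, bubVal_sum,
        coeff_succ_of_mul_eq_one (by rw [mul_comm]; exact bubC_mul_bubCC) coeff_zero_bubCC]
      refine congrArg Neg.neg (Finset.sum_congr rfl fun i _ => ?_)
      rw [bubVal_comp, ih i (by omega) (by omega), bubVal_ccbub hE, ← zcoeff_natCast (bubCC N (n + 2)) (j + 1 - i)]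
      have := i.2
      congr 2
      omega

theorem closed_eq_of_bubVal_eq {n : ℤ} {s t : Tm (Mor.id n) (Mor.id n)}
    (h : Valid N n → bubVal (N := N) s = bubVal t) : Γ₂ (flagMaps N) s = Γ₂ (flagMaps N) t := by
  by_cases hv : Valid N n
  · exact regular_hom_ext (h hv)
  · exact hom_eq_of_subsingleton (H_subsingleton hv) _ _

theorem bubVal_zero {n : ℤ} : bubVal (N := N) (Tm.zero (Mor.id n) (Mor.id n)) = 0 := rfl
theorem bubVal_id {n : ℤ} : bubVal (N := N) (Tm.id (Mor.id n)) = 1 := rfl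

theorem cbub_zero_rel (N : ℕ) (n : ℤ) (m : ℕ) (h : (m : ℤ) < (n + 2) - 1) :
    Γ₂ (flagMaps N) (cbub n m) = Γ₂ (flagMaps N) (Tm.zero _ _) :=
  closed_eq_of_bubVal_eq fun hv => by
    rw [bubVal_cbub (validE_of_pos hv (by omega)), bubVal_zero, zcoeff_neg _ (by omega)]

theorem cbub_one_rel (N : ℕ) (n : ℤ) (m : ℕ) (h : (m : ℤ) = (n + 2) - 1) :
    Γ₂ (flagMaps N) (cbub n m) = Γ₂ (flagMaps N) (Tm.id _) :=
  closed_eq_of_bubVal_eq fun hv => by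
    rw [bubVal_cbub (validE_of_pos hv (by omega)), bubVal_id, show (m : ℤ) - n - 1 = (0 : ℕ) by omega,
      zcoeff_natCast, coeff_zero_bubC]

theorem ccbub_zero_rel (N : ℕ) (n : ℤ) (m : ℕ) (h : (m : ℤ) < -n - 1) :
    Γ₂ (flagMaps N) (ccbub n m) = Γ₂ (flagMaps N) (Tm.zero _ _) :=
  closed_eq_of_bubVal_eq fun hv => by
    rw [bubVal_ccbub (validE_of_neg hv (by omega)), bubVal_zero, zcoeff_neg _ (by omega)]

theorem ccbub_one_rel (N : ℕ) (n : ℤ) (m : ℕ) (h : (m : ℤ) = -n - 1) :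
    Γ₂ (flagMaps N) (ccbub n m) = Γ₂ (flagMaps N) (Tm.id _) :=
  closed_eq_of_bubVal_eq fun hv => by
    rw [bubVal_ccbub (validE_of_neg hv (by omega)), bubVal_id, show n + m + 1 = (0 : ℕ) by omega,
      zcoeff_natCast, coeff_zero_bubCC]

end Bubbles

section NilHecke

theorem tensorWhiskerRight_id_lin {A B C : GrAlg} (M : GrBimod A B) (Q : GrBimod B C)
    (v : (tensor M Q).carrier) : (tensorWhiskerRight (𝟙 M) Q).lin v = v :=
  congrArg (fun φ : tensor M Q ⟶ tensor M Q => φ.lin v) (tensor_hom_ext (ψ := 𝟙 _) fun m q => by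
    rw [tensorWhiskerRight_tm]; rfl)

theorem tensorWhiskerLeft_id_lin {A B C : GrAlg} (M : GrBimod A B) (Q : GrBimod B C)
    (v : (tensor M Q).carrier) : (tensorWhiskerLeft M (𝟙 Q)).lin v = v :=
  congrArg (fun φ : tensor M Q ⟶ tensor M Q => φ.lin v) (tensor_hom_ext (ψ := 𝟙 _) fun m q => by
    rw [tensorWhiskerLeft_tm]; rfl)

open MvPolynomial

theorem linearMap_ext_fin_two {V : Type} [AddCommGroup V] [Module ℚ V]
    {φ ψ : MvPolynomial (Fin 2) ℚ →ₗ[ℚ] V}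
    (h : ∀ a b : ℕ, φ (X 0 ^ a * X 1 ^ b) = ψ (X 0 ^ a * X 1 ^ b)) : φ = ψ :=
  (basisMonomials (Fin 2) ℚ).ext fun s => by
    rw [coe_basisMonomials]
    beta_reduce
    rw [monomial_eq, Finsupp.prod_fintype _ _ (fun _ => pow_zero _),
      Fin.prod_univ_two, C_1, one_mul, h]

theorem linearMap_ext_fin_three {V : Type} [AddCommGroup V] [Module ℚ V]
    {φ ψ : MvPolynomial (Fin 3) ℚ →ₗ[ℚ] V}
    (h : ∀ a b c : ℕ, φ (X 0 ^ a * X 1 ^ b * X 2 ^ c) = ψ (X 0 ^ a * X 1 ^ b * X 2 ^ c)) : φ = ψ :=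
  (basisMonomials (Fin 3) ℚ).ext fun s => by
    rw [coe_basisMonomials]
    beta_reduce
    rw [monomial_eq, Finsupp.prod_fintype _ _ (fun _ => pow_zero _),
      Fin.prod_univ_three, C_1, one_mul, h]

variable (N : ℕ) (n : ℤ)

/-- Polynomials in the dots on two upward strands. -/
noncomputable def dotsEE :
    MvPolynomial (Fin 2) ℚ →ₗ[ℚ] (tensor (BE N n) (BE N (n + 2))).carrier :=
  (basisMonomials (Fin 2) ℚ).constr ℚ fun s =>
    tm _ _ (vE N n (xi N n ^ s 0)) (vE N (n + 2) (xi N (n + 2) ^ s 1))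

/-- Polynomials in the dots on three upward strands. -/
noncomputable def dotsEEE : MvPolynomial (Fin 3) ℚ →ₗ[ℚ]
    (tensor (tensor (BE N n) (BE N (n + 2))) (BE N (n + 2 + 2))).carrier :=
  (basisMonomials (Fin 3) ℚ).constr ℚ fun s =>
    tm _ _ (tm _ _ (vE N n (xi N n ^ s 0)) (vE N (n + 2) (xi N (n + 2) ^ s 1)))
      (vE N (n + 2 + 2) (xi N (n + 2 + 2) ^ s 2))

variable {N n}

theorem dotsEE_apply (a b : ℕ) : dotsEE N n (X 0 ^ a * X 1 ^ b) =
    tm _ _ (vE N n (xi N n ^ a)) (vE N (n + 2) (xi N (n + 2) ^ b)) := by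
  have := (basisMonomials (Fin 2) ℚ).constr_basis ℚ (fun s =>
    tm _ _ (vE N n (xi N n ^ s 0)) (vE N (n + 2) (xi N (n + 2) ^ s 1)))
    (Finsupp.single 0 a + Finsupp.single 1 b)
  rw [coe_basisMonomials] at this
  beta_reduce at this
  rw [← one_mul (1 : ℚ), ← monomial_mul, ← X_pow_eq_monomial,
    ← X_pow_eq_monomial] at this
  simpa [dotsEE] using this

theorem dotsEEE_apply (a b c : ℕ) : dotsEEE N n (X 0 ^ a * X 1 ^ b * X 2 ^ c) =
    tm _ _ (tm _ _ (vE N n (xi N n ^ a)) (vE N (n + 2) (xi N (n + 2) ^ b)))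
      (vE N (n + 2 + 2) (xi N (n + 2 + 2) ^ c)) := by
  have := (basisMonomials (Fin 3) ℚ).constr_basis ℚ (fun s =>
    tm _ _ (tm _ _ (vE N n (xi N n ^ s 0)) (vE N (n + 2) (xi N (n + 2) ^ s 1)))
      (vE N (n + 2 + 2) (xi N (n + 2 + 2) ^ s 2)))
    (Finsupp.single 0 a + Finsupp.single 1 b + Finsupp.single 2 c)
  rw [coe_basisMonomials] at this
  beta_reduce at this
  rw [← one_mul (1 : ℚ), ← monomial_mul, ← one_mul (1 : ℚ), ← monomial_mul, one_mul,
    ← X_pow_eq_monomial,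
    ← X_pow_eq_monomial, ← X_pow_eq_monomial] at this
  simpa [dotsEEE] using this

theorem U_dotsEE (p : MvPolynomial (Fin 2) ℚ) :
    ((flagMaps N).U n).lin (dotsEE N n p) = dotsEE N n (divDiff Fin.zero_ne_one p) :=
  LinearMap.congr_fun (f := ((flagMaps N).U n).lin ∘ₗ dotsEE N n)
    (g := dotsEE N n ∘ₗ divDiff Fin.zero_ne_one) (linearMap_ext_fin_two fun a b => by
      rw [LinearMap.comp_apply, LinearMap.comp_apply, dotsEE_apply, (flagMaps N).U_apply,
        divDiff_pow_mul_pow, map_sub, map_sum, map_sum]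
      simp only [dotsEE_apply]) p

theorem z_left_dotsEE (p : MvPolynomial (Fin 2) ℚ) :
    (tensorWhiskerRight ((flagMaps N).z n) (BE N (n + 2))).lin (dotsEE N n p) =
      dotsEE N n (X 0 * p) :=
  LinearMap.congr_fun (f := (tensorWhiskerRight ((flagMaps N).z n) (BE N (n + 2))).lin ∘ₗ dotsEE N n)
    (g := dotsEE N n ∘ₗ LinearMap.mulLeft ℚ (X 0)) (linearMap_ext_fin_two fun a b => by
      rw [LinearMap.comp_apply, LinearMap.comp_apply, dotsEE_apply, tensorWhiskerRight_tm, z_lin,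
        LinearMap.mulLeft_apply, ← mul_assoc, ← pow_succ', ← pow_succ', dotsEE_apply]) p

theorem z_right_dotsEE (p : MvPolynomial (Fin 2) ℚ) :
    (tensorWhiskerLeft (BE N n) ((flagMaps N).z (n + 2))).lin (dotsEE N n p) =
      dotsEE N n (X 1 * p) :=
  LinearMap.congr_fun
    (f := (tensorWhiskerLeft (BE N n) ((flagMaps N).z (n + 2))).lin ∘ₗ dotsEE N n)
    (g := dotsEE N n ∘ₗ LinearMap.mulLeft ℚ (X 1)) (linearMap_ext_fin_two fun a b => by
      rw [LinearMap.comp_apply, LinearMap.comp_apply, dotsEE_apply, tensorWhiskerLeft_tm, z_lin,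
        LinearMap.mulLeft_apply, mul_left_comm, ← pow_succ', ← pow_succ', dotsEE_apply]) p

theorem EE_hom_ext {P : GrBimod (H N n) (H N (n + 2 + 2))}
    {φ ψ : tensor (BE N n) (BE N (n + 2)) ⟶ P}
    (h : ValidE N n → ValidE N (n + 2) → ∀ p, φ.lin (dotsEE N n p) = ψ.lin (dotsEE N n p)) :
    φ = ψ := by
  by_cases hv : ValidE N n ∧ ValidE N (n + 2)
  · refine (BE_leftGen.bimGen_tensor (BE_isCyclicGen (n := n + 2))).hom_ext fun i => ?_
    have := h hv.1 hv.2 (X 0 ^ (i : ℕ) * X 1 ^ 0)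
    rwa [dotsEE_apply, pow_zero] at this
  · exact hom_eq_of_subsingleton (EE_subsingleton hv) _ _

theorem EEE_hom_ext {P : GrBimod (H N n) (H N (n + 2 + 2 + 2))}
    {φ ψ : tensor (tensor (BE N n) (BE N (n + 2))) (BE N (n + 2 + 2)) ⟶ P}
    (h : ∀ p, φ.lin (dotsEEE N n p) = ψ.lin (dotsEEE N n p)) :
    φ = ψ := by
  refine ((BE_leftGen.tensor (BE_leftGen (n := n + 2))).bimGen_tensor
    (BE_isCyclicGen (n := n + 2 + 2))).hom_ext fun i => ?_
  have := h (X 0 ^ (i.1 : ℕ) * X 1 ^ (i.2 : ℕ) * X 2 ^ 0)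
  rwa [dotsEEE_apply, pow_zero] at this

variable (N n)

theorem cross_sq_rel :
    Γ₂ (flagMaps N) ((Tm.U n).comp (Tm.U n)) = Γ₂ (flagMaps N) (Tm.zero _ _) := by
  dsimp only [Γ₂, Γ₁]
  refine EE_hom_ext fun _ _ p => ?_
  rw [comp_lin, LinearMap.comp_apply, U_dotsEE, U_dotsEE, divDiff_divDiff, map_zero]
  rfl

theorem nilHecke₁_rel : Γ₂ (flagMaps N)
    (((Mor.E n ◃ Tm.z (n + 2)).comp (Tm.U n)).sub ((Tm.U n).comp (Tm.z n ▹ Mor.E (n + 2)))) =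
    Γ₂ (flagMaps N) (Tm.id _) := by
  dsimp only [Tm.sub, Tm.neg, Γ₂, Γ₁]
  refine EE_hom_ext fun _ _ p => ?_
  rw [BimHom.add_lin, BimHom.smul_lin, LinearMap.add_apply, LinearMap.smul_apply, comp_lin, comp_lin,
    LinearMap.comp_apply, LinearMap.comp_apply, U_dotsEE, z_right_dotsEE, z_left_dotsEE, U_dotsEE,
    divDiff_X_right_mul, id_lin, LinearMap.id_apply, map_add, neg_one_smul]
  abel

theorem nilHecke₂_rel : Γ₂ (flagMaps N)
    (((Tm.U n).comp (Mor.E n ◃ Tm.z (n + 2))).sub ((Tm.z n ▹ Mor.E (n + 2)).comp (Tm.U n))) =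
    Γ₂ (flagMaps N) (Tm.id _) := by
  dsimp only [Tm.sub, Tm.neg, Γ₂, Γ₁]
  refine EE_hom_ext fun _ _ p => ?_
  rw [BimHom.add_lin, BimHom.smul_lin, LinearMap.add_apply, LinearMap.smul_apply, comp_lin, comp_lin,
    LinearMap.comp_apply, LinearMap.comp_apply, U_dotsEE, z_right_dotsEE, z_left_dotsEE, U_dotsEE,
    divDiff_X_left_mul, id_lin, LinearMap.id_apply, map_sub, neg_one_smul]
  abel

variable {N n}

theorem U_left_dotsEEE {h : (0 : Fin 3) ≠ 1} (p : MvPolynomial (Fin 3) ℚ) :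
    (tensorWhiskerRight ((flagMaps N).U n) (BE N (n + 2 + 2))).lin (dotsEEE N n p) =
      dotsEEE N n (divDiff h p) := by
  have key : (tensorWhiskerRight ((flagMaps N).U n) (BE N (n + 2 + 2))).lin ∘ₗ dotsEEE N n =
      dotsEEE N n ∘ₗ divDiff h := by
    refine linearMap_ext_fin_three fun a b c => ?_
    have e : divDiff h (X 0 ^ a * X 1 ^ b * X 2 ^ c) = _ :=
      (congrArg (divDiff h) (mul_comm _ _)).trans (divDiff_mul h (c := X 2 ^ c) (by
        rw [map_pow, swapVars_X, Equiv.swap_apply_of_ne_of_ne (by decide) (by decide)]) _)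
    rw [LinearMap.comp_apply, LinearMap.comp_apply, dotsEEE_apply, tensorWhiskerRight_tm,
      (flagMaps N).U_apply, e, divDiff_pow_mul_pow, mul_comm (X 2 ^ c), sub_mul, Finset.sum_mul,
      Finset.sum_mul]
    simp only [map_sub, map_sum, LinearMap.sub_apply, LinearMap.sum_apply, dotsEEE_apply]
  exact LinearMap.congr_fun key p

theorem U_right_dotsEEE {h : (1 : Fin 3) ≠ 2} (p : MvPolynomial (Fin 3) ℚ) :
    (assocInv (BE N n) (BE N (n + 2)) (BE N (n + 2 + 2))).lin
      ((tensorWhiskerLeft (BE N n) ((flagMaps N).U (n + 2))).lin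
        ((assocHom (BE N n) (BE N (n + 2)) (BE N (n + 2 + 2))).lin (dotsEEE N n p))) =
      dotsEEE N n (divDiff h p) := by
  have key : (assocInv (BE N n) (BE N (n + 2)) (BE N (n + 2 + 2))).lin ∘ₗ
      (tensorWhiskerLeft (BE N n) ((flagMaps N).U (n + 2))).lin ∘ₗ
      (assocHom (BE N n) (BE N (n + 2)) (BE N (n + 2 + 2))).lin ∘ₗ dotsEEE N n =
      dotsEEE N n ∘ₗ divDiff h := by
    refine linearMap_ext_fin_three fun a b c => ?_
    have e : divDiff h (X 0 ^ a * X 1 ^ b * X 2 ^ c) = _ :=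
      (congrArg (divDiff h) (mul_assoc _ _ _)).trans (divDiff_mul h (c := X 0 ^ a) (by
        rw [map_pow, swapVars_X, Equiv.swap_apply_of_ne_of_ne (by decide) (by decide)]) _)
    simp only [LinearMap.comp_apply]
    rw [dotsEEE_apply, assocHom_tm, tensorWhiskerLeft_tm,
      (flagMaps N).U_apply, e, divDiff_pow_mul_pow, mul_sub, Finset.mul_sum, Finset.mul_sum]
    simp only [map_sub, map_sum, assocInv_tm, ← mul_assoc, dotsEEE_apply]
  exact LinearMap.congr_fun key p

variable (N n)

theorem braid_rel : Γ₂ (flagMaps N)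
    ((Tm.U n ▹ Mor.E (n + 2 + 2)) ⊚ (Mor.E n ◃ Tm.U (n + 2)) ⊚ (Tm.U n ▹ Mor.E (n + 2 + 2))) =
    Γ₂ (flagMaps N)
      (Tm.id ((Mor.E n ⬝ Mor.E (n + 2)) ⬝ Mor.E (n + 2 + 2)) ⊚ (Mor.E n ◃ Tm.U (n + 2)) ⊚
        (Tm.U n ▹ Mor.E (n + 2 + 2)) ⊚ (Mor.E n ◃ Tm.U (n + 2)) ⊚ Tm.id _) := by
  dsimp only [Tm.cc, Tm.Coh.tm, Γ₂, Γ₁]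
  refine EEE_hom_ext fun p => ?_
  simp only [comp_lin, LinearMap.comp_apply, id_lin, LinearMap.id_apply, tensorWhiskerRight_id_lin]
  have h : (0 : Fin 3) ≠ 1 := by decide
  have h' : (1 : Fin 3) ≠ 2 := by decide
  rw [U_left_dotsEEE (h := h), U_right_dotsEEE (h := h'), U_left_dotsEEE (h := h),
    U_right_dotsEEE (h := h'), U_left_dotsEEE (h := h), U_right_dotsEEE (h := h'),
    divDiff_braid _ _ (by decide)]

end NilHecke

section Curls

theorem sum_range_eq_of_zero {M : Type} [AddCommMonoid M] {f : ℕ → M} (A B : ℕ)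
    (hA : ∀ j, A ≤ j → f j = 0) (hB : ∀ j, B ≤ j → f j = 0) :
    ∑ j ∈ Finset.range A, f j = ∑ j ∈ Finset.range B, f j := by
  rcases le_total A B with h | h
  · exact Finset.sum_subset (Finset.range_mono h) fun j _ hj => hA j (by simpa using hj)
  · exact (Finset.sum_subset (Finset.range_mono h) fun j _ hj => hB j (by simpa using hj)).symm

/-- Division of a power series by `1 - u t`. -/
theorem zcoeff_eq_geom_sum {A : Type} [CommRing A] {p q : PowerSeries A} {u : A}
    (h : p * (1 - PowerSeries.C u * PowerSeries.X) = q) (d : ℤ) :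
    zcoeff p d = ∑ j ∈ Finset.range (d + 1).toNat, u ^ (d - j).toNat * PowerSeries.coeff j q := by
  rcases lt_or_ge d 0 with hd | hd
  · rw [zcoeff_neg _ hd, show (d + 1).toNat = 0 by omega]; rfl
  · lift d to ℕ using hd
    rw [show ((d : ℤ) + 1).toNat = d + 1 by omega]
    induction d with
    | zero =>
      have := zcoeff_mul_linear p u 0
      rw [h, zcoeff_neg p (show (0 : ℤ) - 1 < 0 by omega), mul_zero, sub_zero] at this
      rw [Finset.sum_range_one, ← zcoeff_natCast]
      simp [← this]
    | succ d ih =>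
      have := zcoeff_mul_linear p u (d + 1 : ℕ)
      rw [h, show ((d + 1 : ℕ) : ℤ) - 1 = d by push_cast; ring, ih] at this
      rw [Finset.sum_range_succ, ← sub_eq_iff_eq_add', sub_self, Int.toNat_zero, pow_zero, one_mul,
        ← zcoeff_natCast, this, Finset.mul_sum]
      congr 1
      refine Finset.sum_congr rfl fun j hj => ?_
      have := Finset.mem_range.1 hj
      rw [← mul_assoc, ← pow_succ']
      congr 2
      omega

variable {N : ℕ} {n : ℤ}

theorem altSeries_xE (h : ValidE N n) : PowerSeries.map (rHom N n : _ →+* _) (altSeries (x N (n + 2))) =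
    altSeries (xE N n) * (1 - PowerSeries.C (xi N n) * PowerSeries.X) := by
  rw [map_altSeries]
  exact altSeries_factor _ _ _ (map_one _) (rHom_x h)

theorem altSeries_yE (h : ValidE N n) : PowerSeries.map (lHom N n : _ →+* _) (altSeries (y N n)) =
    altSeries (yE N n) * (1 - PowerSeries.C (xi N n) * PowerSeries.X) := by
  rw [map_altSeries]
  exact altSeries_factor _ _ _ (map_one _) (lHom_y h)

theorem sum_xi_bubCC (h : ValidE N n) (d : ℤ) :
    ∑ j ∈ Finset.range (d + 1).toNat,
      xi N n ^ (d - j).toNat * rHom N n (PowerSeries.coeff j (bubCC N (n + 2))) =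
    ∑ i ∈ Finset.range (kk N n + 1), (-1) ^ i * xE N n i * rHom N n (sX N (n + 2) (d - i)) := by
  have := zcoeff_eq_geom_sum (p := altSeries (xE N n) * PowerSeries.map (rHom N n : _ →+* _)
    (altSeries (Xs N (n + 2)))) (u := xi N n) (q := PowerSeries.map (rHom N n : _ →+* _)
    (bubCC N (n + 2))) (by rw [bubCC, map_mul, altSeries_xE h]; ring) d
  simp only [PowerSeries.coeff_map] at this
  refine this.symm.trans ?_
  rw [← sum_coeff_mul_zcoeff _ _ _ (kk N n + 1)
    (fun j hj => .inl (by rw [coeff_altSeries, xE_eq_zero (by omega), mul_zero]))]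
  refine Finset.sum_congr rfl fun i _ => ?_
  rw [coeff_altSeries, zcoeff_map, sX_eq]; rfl

theorem sum_xi_bubC (h : ValidE N n) (d : ℤ) :
    ∑ j ∈ Finset.range (d + 1).toNat,
      xi N n ^ (d - j).toNat * lHom N n (PowerSeries.coeff j (bubC N n)) =
    ∑ i ∈ Finset.range (N - kk N n - 1 + 1), (-1) ^ i * yE N n i * lHom N n (sY N n (d - i)) := by
  have := zcoeff_eq_geom_sum (p := altSeries (yE N n) * PowerSeries.map (lHom N n : _ →+* _)
    (altSeries (Ys N n))) (u := xi N n) (q := PowerSeries.map (lHom N n : _ →+* _)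
    (bubC N n)) (by rw [bubC, map_mul, altSeries_yE h]; ring) d
  simp only [PowerSeries.coeff_map] at this
  refine this.symm.trans ?_
  rw [← sum_coeff_mul_zcoeff _ _ _ (N - kk N n - 1 + 1)
    (fun j hj => .inl (by rw [coeff_altSeries, yE_eq_zero (by omega), mul_zero]))]
  refine Finset.sum_congr rfl fun i _ => ?_
  rw [coeff_altSeries, zcoeff_map, sY_eq]; rfl

theorem sX_eq_zero_of_kk_eq (h : kk N n = N) {d : ℤ} (hd : d ≠ 0) : sX N n d = 0 := by
  have : altSeries (y N n) = 1 := by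
    ext j
    cases j with
    | zero => simp [y_zero]
    | succ j => rw [coeff_altSeries, y_eq_zero (by omega), mul_zero, PowerSeries.coeff_one,
        if_neg (by omega)]
  have e := y_mul_Xs (N := N) (n := n)
  rw [this, one_mul] at e
  rw [sX_eq, e, zcoeff_one, if_neg hd]

theorem sY_eq_zero_of_kk_eq (h : kk N n = 0) {d : ℤ} (hd : d ≠ 0) : sY N n d = 0 := by
  have : altSeries (x N n) = 1 := by
    ext j
    cases j with
    | zero => simp [x_zero]
    | succ j => rw [coeff_altSeries, x_eq_zero (by omega), mul_zero, PowerSeries.coeff_one,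
        if_neg (by omega)]
  have e := x_mul_Ys (N := N) (n := n)
  rw [this, one_mul] at e
  rw [sY_eq, e, zcoeff_one, if_neg hd]

theorem Γ₂_leftBubble (t : Tm (Mor.id n) (Mor.id n)) (s : Tm (Mor.E n) (Mor.E n))
    (v : (BE N n).carrier) : (Γ₂ (flagMaps N) (Tm.id (Mor.E n) ⊚ (t ▹ Mor.E n) ⊚ s)).lin v =
      (Γ₂ (flagMaps N) s).lin ((BE N n).left (bubVal t) v) := by
  refine congrArg (Γ₂ (flagMaps N) s).lin ?_
  exact leftUnit_tm (BE N n) (bubVal t) v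

theorem Γ₂_rightBubble (t : Tm (Mor.id (n + 2)) (Mor.id (n + 2))) (s : Tm (Mor.E n) (Mor.E n))
    (v : (BE N n).carrier) :
    (Γ₂ (flagMaps N) (s ⊚ (Mor.E n ◃ t) ⊚ Tm.id (Mor.E n))).lin v =
      (BE N n).right (bubVal t) ((Γ₂ (flagMaps N) s).lin v) :=
  rightUnit_tm (BE N n) (bubVal t) ((Γ₂ (flagMaps N) s).lin v)

theorem Γ₂_sum_eq (G : GenMaps N) {n m : ℤ} {f g : Mor n m} (k : ℕ) (t : Fin k → Tm f g)
    (v : (Γ₁ N f).carrier) (F : ℕ → (Γ₁ N g).carrier) (h : ∀ i, (Γ₂ G (t i)).lin v = F i) :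
    (Γ₂ G (Tm.sum k t)).lin v = ∑ i ∈ Finset.range k, F i :=
  (Γ₂_sum G k t v).trans ((Finset.sum_congr rfl fun i _ => h i).trans
    (Fin.sum_univ_eq_sum_range F k))

theorem curl₁_rhs (h : ValidE N (n + 2)) : (Γ₂ (flagMaps N)
    (Tm.sum (-(n + 2) + 1).toNat fun l =>
        Tm.id (Mor.E (n + 2)) ⊚ (fakeC n l ▹ Mor.E (n + 2)) ⊚
          (Tm.z (n + 2)).pow (-(n + 2) - (l : ℕ)).toNat).neg).lin (vE N (n + 2) 1) =
    vE N (n + 2) (-∑ j ∈ Finset.range (-(n + 2) + 1).toNat, xi N (n + 2) ^ (-(n + 2) - (j : ℤ)).toNat *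
      lHom N (n + 2) (PowerSeries.coeff j (bubC N (n + 2)))) := by
  rw [map_neg, map_sum]
  refine (Γ₂_neg _ _ _).trans (congrArg Neg.neg (Γ₂_sum_eq (f := Mor.E (n + 2)) (g := Mor.E (n + 2)) (flagMaps N) _ _ (vE N (n + 2) 1) _ fun i => ?_))
  refine (Γ₂_leftBubble _ _ _).trans ?_
  rw [bubVal_fakeC h.valid i (by omega), BE_left, mul_one]
  exact Γ₂_pow_z _ _

theorem curl₂_rhs (h : ValidE N n) : (Γ₂ (flagMaps N)
    (Tm.sum ((n + 2) + 1).toNat fun j =>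
        (Tm.z n).pow ((n + 2) - (j : ℕ)).toNat ⊚ (Mor.E n ◃ fakeCC n j) ⊚ Tm.id (Mor.E n))).lin
      (vE N n 1) =
    vE N n (∑ j ∈ Finset.range ((n + 2) + 1).toNat, xi N n ^ ((n + 2) - (j : ℤ)).toNat *
      rHom N n (PowerSeries.coeff j (bubCC N (n + 2)))) := by
  rw [map_sum]
  refine Γ₂_sum_eq (f := Mor.E n) (g := Mor.E n) (flagMaps N) _ _ (vE N n 1) _ fun i => ?_
  refine (Γ₂_rightBubble _ _ _).trans ?_
  rw [bubVal_fakeCC h.valid_succ i (by omega)]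
  refine (congrArg _ (Γ₂_pow_z _ _)).trans (by rw [mul_one, BE_right, mul_comm])

theorem U_pow_left (a : ℕ) :
    ((flagMaps N).U n).lin (tm _ _ (vE N n (xi N n ^ a)) (vE N (n + 2) 1)) =
      -∑ j ∈ Finset.range a,
        tm _ _ (vE N n (xi N n ^ (a - 1 - j))) (vE N (n + 2) (xi N (n + 2) ^ j)) := by
  have := (flagMaps N).U_apply n a 0
  rwa [pow_zero, Finset.range_zero, Finset.sum_empty, zero_sub] at this

theorem U_one_xE (h : ValidE N n) (h2 : ValidE N (n + 2)) (i : ℕ) :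
    ((flagMaps N).U n).lin (tm _ _ (vE N n 1) (vE N (n + 2) (xE N (n + 2) (i + 1)))) =
      -tm _ _ (vE N n (xE N n i)) (vE N (n + 2) 1) := by
  have h0 := U_pow_left (N := N) (n := n) 0
  have h1 := U_pow_left (N := N) (n := n) 1
  rw [pow_zero, Finset.range_zero, Finset.sum_empty, neg_zero] at h0
  rw [pow_one, Finset.sum_range_one, pow_zero, pow_zero] at h1
  have e : tm _ _ (vE N n 1) (vE N (n + 2) (xE N (n + 2) (i + 1))) =
      (tensor (BE N n) (BE N (n + 2))).left (x N n (i + 1)) (tm _ _ (vE N n 1) (vE N (n + 2) 1)) +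
      (tensor (BE N n) (BE N (n + 2))).left (x N n i) (tm _ _ (vE N n (xi N n)) (vE N (n + 2) 1)) := by
    rw [← mul_one (xE N (n + 2) (i + 1)), ← lHom_x h2, ← BE_left, ← tm_right, BE_right, rHom_x h,
      tensor_left, tensor_left, BE_left, BE_left, lHom_x h, lHom_x h, mul_one, mul_one, map_add,
      map_add, LinearMap.add_apply, mul_comm (xi N n)]
  rw [e, map_add, BimHom.map_left, BimHom.map_left, h0, h1, map_zero, zero_add, map_neg, tensor_left,
    BE_left, lHom_x h, mul_one]

theorem casR_eq_zero (h : ¬ValidE N n) : casR N n = 0 :=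
  have := tensor_subsingleton_left (BE N n) (BF_subsingleton h)
  Subsingleton.elim _ _

theorem casL_eq_zero (h : ¬ValidE N n) : casL N n = 0 :=
  have := tensor_subsingleton_left (BF N n) (BE_subsingleton h)
  Subsingleton.elim _ _

variable (N n)

theorem curl₁_rel : Γ₂ (flagMaps N)
    (Tm.id (Mor.E (n + 2)) ⊚ (Tm.epsh n ▹ Mor.E (n + 2)) ⊚ (Mor.F n ◃ Tm.U n) ⊚
        (Tm.eps n ▹ Mor.E (n + 2)) ⊚ Tm.id (Mor.E (n + 2))) =
    Γ₂ (flagMaps N) (Tm.sum (-(n + 2) + 1).toNat fun l =>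
        Tm.id (Mor.E (n + 2)) ⊚ (fakeC n l ▹ Mor.E (n + 2)) ⊚
          (Tm.z (n + 2)).pow (-(n + 2) - (l : ℕ)).toNat).neg := by
  by_cases h2 : ValidE N (n + 2)
  swap; · exact hom_eq_of_subsingleton (BE_subsingleton h2) _ _
  have hn2 := h2.eq
  have hR := curl₁_rhs h2
  generalize Γ₂ (flagMaps N) (Tm.neg _) = R at hR ⊢
  dsimp only [Tm.cc, Tm.Coh.tm, Γ₂, Γ₁]
  refine BE_isCyclicGen.hom_ext (Eq.trans ?_ hR.symm)
  simp -index only [comp_lin, LinearMap.comp_apply, id_lin, LinearMap.id_apply, leftUnit_inv_lin,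
    rightUnit_inv_lin]
  by_cases h : ValidE N n
  swap
  · simp -index only [id_lin, LinearMap.id_apply,
      tensorWhiskerRight_regular, epsh_one, casR_eq_zero h, map_zero, LinearMap.zero_apply]
    rw [sum_xi_bubC h2, ← map_zero (vE N (n + 2))]
    congr 1
    rw [Finset.sum_eq_zero, neg_zero]
    intro i hi
    have h0 : kk N (n + 2) = 0 := by
      by_contra h0
      exact h ⟨kk N (n + 2) - 1, by have := h2.kk_lt; omega, by omega⟩
    have := Finset.mem_range.1 hi
    have := h2.kk_lt
    rw [sY_eq_zero_of_kk_eq h0 (by omega), map_zero, mul_zero]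
  simp -index only [id_lin, LinearMap.id_apply, U_pow_left,
    tensorWhiskerRight_regular, tensorWhiskerLeft_regular, tensorWhiskerRight_tm,
    tensorWhiskerLeft_tm, eta_one, epsh_one, casR_eq h, map_sum, map_smul, map_neg, LinearMap.sum_apply,
    LinearMap.smul_apply, assocHom_tm, assocInv_tm, eps_tm, etah_tm, rightUnit_tm, leftUnit_tm,
    BE_right, BE_left, BF_left, BF_right, z_lin, zh_lin, tensorWhiskerRight_id_lin,
    tensorWhiskerLeft_id_lin]
  have hk := h.kk_lt
  have hk2 := h.kk_succ
  conv_rhs => rw [← Finset.sum_range_reflect]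
  rw [Finset.sum_congr rfl (g := fun i => -∑ j ∈
    Finset.range (-(n + 2) + 1).toNat, vE N (n + 2) (xi N (n + 2) ^ j * lHom N (n + 2)
      (PowerSeries.coeff i (altSeries (y N (n + 2))) *
        zcoeff (altSeries (Ys N (n + 2))) (-(n + 2) - j - i))))]
  · rw [Finset.sum_neg_distrib, Finset.sum_comm]
    refine congrArg Neg.neg (Finset.sum_congr rfl fun j hj => ?_)
    have := Finset.mem_range.1 hj
    rw [← map_sum, ← Finset.mul_sum, ← map_sum, sum_coeff_mul_zcoeff _ _ _ (N - kk N n - 1 + 1)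
      (fun j hj => .inl (by rw [coeff_altSeries, y_eq_zero (by omega), mul_zero])),
      ← zcoeff_natCast (bubC N (n + 2))]
    congr 3
    · omega
    · unfold bubC
      congr 1
      omega
  · intro i hi
    have := Finset.mem_range.1 hi
    rw [smul_neg, Finset.smul_sum]
    refine congrArg Neg.neg ((Finset.sum_congr rfl fun j hj => ?_).trans
      (sum_range_eq_of_zero (N - kk N n - 1 - i) _ (fun j hj => ?_) fun j hj => ?_))
    · have := Finset.mem_range.1 hj
      rw [← rHom_y h, traceR_mul, traceR_pow h, ← map_smul, ← smul_mul_assoc, ← map_smul,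
        ← smul_mul_assoc, neg_one_pow_smul, ← coeff_altSeries, mul_comm, sY_eq]
      congr 5
      omega
    · rw [zcoeff_neg _ (by omega), mul_zero, map_zero, mul_zero, map_zero]
    · rw [zcoeff_neg _ (by omega), mul_zero, map_zero, mul_zero, map_zero]

theorem curl₂_rel : Γ₂ (flagMaps N)
    (Tm.id (Mor.E n) ⊚ (Mor.E n ◃ Tm.eta (n + 2)) ⊚ (Tm.U n ▹ Mor.F (n + 2)) ⊚
        (Mor.E n ◃ Tm.etah (n + 2)) ⊚ Tm.id (Mor.E n)) =
    Γ₂ (flagMaps N) (Tm.sum ((n + 2) + 1).toNat fun j =>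
        (Tm.z n).pow ((n + 2) - (j : ℕ)).toNat ⊚ (Mor.E n ◃ fakeCC n j) ⊚ Tm.id (Mor.E n)) := by
  by_cases h : ValidE N n
  swap; · exact hom_eq_of_subsingleton (BE_subsingleton h) _ _
  have hn := h.eq
  have hR := curl₂_rhs h
  generalize Γ₂ (flagMaps N) (Tm.sum _ _) = R at hR ⊢
  dsimp only [Tm.cc, Tm.Coh.tm, Γ₂, Γ₁]
  refine BE_isCyclicGen.hom_ext (Eq.trans ?_ hR.symm)
  simp -index only [comp_lin, LinearMap.comp_apply, id_lin, LinearMap.id_apply, leftUnit_inv_lin,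
    rightUnit_inv_lin]
  rw [sum_xi_bubCC h]
  by_cases h2 : ValidE N (n + 2)
  swap
  · simp -index only [id_lin, LinearMap.id_apply,
      tensorWhiskerLeft_regular, eta_one, casL_eq_zero h2, map_zero, LinearMap.zero_apply]
    rw [← map_zero (vE N n)]
    congr 1
    rw [Finset.sum_eq_zero]
    intro i hi
    have hk := h.kk_lt
    have h0 : kk N (n + 2) = N := by
      by_contra h0
      rw [h.kk_succ] at h0
      exact h2 ⟨kk N n + 1, by omega, by omega⟩
    have := Finset.mem_range.1 hi
    rw [h.kk_succ] at h0
    rw [sX_eq_zero_of_kk_eq (by rw [h.kk_succ, h0]) (by omega), map_zero, mul_zero]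
  have hs : kk N (n + 2) + 1 = kk N n + 1 + 1 := by rw [h.kk_succ]
  simp -index only [id_lin, LinearMap.id_apply, tensorWhiskerLeft_regular, eta_one, casL_eq h2, map_sum,
    map_smul, assocInv_tm, tensorWhiskerRight_tm, tensorWhiskerRight_id_lin]
  have h0 := U_pow_left (N := N) (n := n) 0
  rw [pow_zero, Finset.range_zero, Finset.sum_empty, neg_zero] at h0
  rw [hs, Finset.sum_range_succ', xE_zero, h0, map_zero, LinearMap.zero_apply, map_zero, map_zero,
    map_zero, smul_zero, add_zero]
  refine Finset.sum_congr rfl fun i hi => ?_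
  have := Finset.mem_range.1 hi
  rw [U_one_xE h h2, map_neg, LinearMap.neg_apply, map_neg, map_neg, map_neg]
  simp -index only [assocHom_tm, tensorWhiskerLeft_tm, etah_tm, rightUnit_tm, BE_right, one_mul]
  rw [traceL_pow h2, pow_succ, mul_neg_one, neg_smul, smul_neg, neg_neg, ← map_smul,
    neg_one_pow_smul, mul_assoc, mul_comm (rHom N n _), h.kk_succ]
  congr 5
  have := h2.kk_lt
  rw [h.kk_succ] at this
  omega

end Curls

section Sideways

variable {N : ℕ} {n : ℤ}

/-- Pairing the first factor of `E E` with a vector of `F`. -/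
noncomputable def pairLeft (g : (HE N n).carrier) :
    (tensor (BE N n) (BE N (n + 2))).carrier →ₗ[ℚ] (BE N (n + 2)).carrier :=
  (leftUnit (BE N (n + 2))).hom.lin ∘ₗ (tensorWhiskerRight ((flagMaps N).eps n) (BE N (n + 2))).lin ∘ₗ
    (assocInv (BF N n) (BE N n) (BE N (n + 2))).lin ∘ₗ tm _ _ (vF N n g)

/-- Pairing the second factor of `E E` with a vector of `F`. -/
noncomputable def pairRight (g : (HE N (n + 2)).carrier) :
    (tensor (BE N n) (BE N (n + 2))).carrier →ₗ[ℚ] (BE N n).carrier :=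
  (rightUnit (BE N n)).hom.lin ∘ₗ (tensorWhiskerLeft (BE N n) ((flagMaps N).etah (n + 2))).lin ∘ₗ
    (assocHom (BE N n) (BE N (n + 2)) (BF N (n + 2))).lin ∘ₗ
    (tm (tensor (BE N n) (BE N (n + 2))) (BF N (n + 2))).flip (vF N (n + 2) g)

theorem pairLeft_apply (g : (HE N n).carrier) (a : (BE N n).carrier) (b : (BE N (n + 2)).carrier) :
    pairLeft g (tm _ _ a b) =
      (BE N (n + 2)).left (((flagMaps N).eps n).lin (tm _ _ (vF N n g) a)) b := by
  unfold pairLeft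
  simp -index only [LinearMap.comp_apply, assocInv_tm, tensorWhiskerRight_tm, leftUnit_tm]

theorem pairRight_apply (g : (HE N (n + 2)).carrier) (a : (BE N n).carrier)
    (b : (BE N (n + 2)).carrier) : pairRight g (tm _ _ a b) =
      (BE N n).right (((flagMaps N).etah (n + 2)).lin (tm _ _ b (vF N (n + 2) g))) a := by
  unfold pairRight
  simp -index only [LinearMap.comp_apply, LinearMap.flip_apply, assocHom_tm, tensorWhiskerLeft_tm,
    rightUnit_tm]

theorem pairLeft_tm (g f : (HE N n).carrier) (f' : (HE N (n + 2)).carrier) :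
    pairLeft g (tm _ _ (vE N n f) (vE N (n + 2) f')) =
      vE N (n + 2) (lHom N (n + 2) (traceR N n (g * f)) * f') := by
  rw [pairLeft_apply, eps_tm, BE_left]

theorem pairRight_tm (f : (HE N n).carrier) (f' g : (HE N (n + 2)).carrier) :
    pairRight g (tm _ _ (vE N n f) (vE N (n + 2) f')) =
      vE N n (rHom N n (traceL N (n + 2) (f' * g)) * f) := by
  rw [pairRight_apply, etah_tm, BE_right]

theorem pairLeft_dot (g : (HE N n).carrier) (u : (tensor (BE N n) (BE N (n + 2))).carrier) :
    pairLeft g ((tensorWhiskerLeft (BE N n) ((flagMaps N).z (n + 2))).lin u) =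
      ((flagMaps N).z (n + 2)).lin (pairLeft g u) := by
  induction u using tm_induction with
  | h a b => rw [tensorWhiskerLeft_tm, pairLeft_apply, pairLeft_apply, BimHom.map_left]
  | hadd u v hu hv => simp only [map_add, hu, hv]

theorem pairRight_dot (g : (HE N (n + 2)).carrier) (u : (tensor (BE N n) (BE N (n + 2))).carrier) :
    pairRight g ((tensorWhiskerRight ((flagMaps N).z n) (BE N (n + 2))).lin u) =
      ((flagMaps N).z n).lin (pairRight g u) := by
  induction u using tm_induction with
  | h a b => rw [tensorWhiskerRight_tm, pairRight_apply, pairRight_apply, BimHom.map_right]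
  | hadd u v hu hv => simp only [map_add, hu, hv]

theorem U_xi_left (f : (HE N n).carrier) (f' : (HE N (n + 2)).carrier) :
    ((flagMaps N).U n).lin (tm _ _ (vE N n (xi N n * f)) (vE N (n + 2) f')) =
      (tensorWhiskerLeft (BE N n) ((flagMaps N).z (n + 2))).lin
        (((flagMaps N).U n).lin (tm _ _ (vE N n f) (vE N (n + 2) f'))) -
      tm _ _ (vE N n f) (vE N (n + 2) f') := by
  have := congrArg (fun φ : tensor (BE N n) (BE N (n + 2)) ⟶ tensor (BE N n) (BE N (n + 2)) =>
    φ.lin (tm _ _ (vE N n f) (vE N (n + 2) f'))) (nilHecke₂_rel N n)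
  change (tensorWhiskerLeft (BE N n) ((flagMaps N).z (n + 2))).lin (((flagMaps N).U n).lin
    (tm _ _ (vE N n f) (vE N (n + 2) f'))) +
    (-1 : ℚ) • ((flagMaps N).U n).lin ((tensorWhiskerRight ((flagMaps N).z n) (BE N (n + 2))).lin
    (tm _ _ (vE N n f) (vE N (n + 2) f'))) = tm _ _ (vE N n f) (vE N (n + 2) f') at this
  rw [tensorWhiskerRight_tm, z_lin, neg_one_smul, ← sub_eq_add_neg] at this
  exact eq_sub_of_add_eq (sub_eq_iff_eq_add'.1 this).symm

theorem U_xi_right (f : (HE N n).carrier) (f' : (HE N (n + 2)).carrier) :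
    ((flagMaps N).U n).lin (tm _ _ (vE N n f) (vE N (n + 2) (xi N (n + 2) * f'))) =
      (tensorWhiskerRight ((flagMaps N).z n) (BE N (n + 2))).lin
        (((flagMaps N).U n).lin (tm _ _ (vE N n f) (vE N (n + 2) f'))) +
      tm _ _ (vE N n f) (vE N (n + 2) f') := by
  have := congrArg (fun φ : tensor (BE N n) (BE N (n + 2)) ⟶ tensor (BE N n) (BE N (n + 2)) =>
    φ.lin (tm _ _ (vE N n f) (vE N (n + 2) f'))) (nilHecke₁_rel N n)
  change ((flagMaps N).U n).lin ((tensorWhiskerLeft (BE N n) ((flagMaps N).z (n + 2))).lin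
    (tm _ _ (vE N n f) (vE N (n + 2) f'))) + (-1 : ℚ) •
    (tensorWhiskerRight ((flagMaps N).z n) (BE N (n + 2))).lin (((flagMaps N).U n).lin
      (tm _ _ (vE N n f) (vE N (n + 2) f'))) =
    tm _ _ (vE N n f) (vE N (n + 2) f') at this
  rw [tensorWhiskerLeft_tm, z_lin, neg_one_smul, ← sub_eq_add_neg] at this
  exact sub_eq_iff_eq_add'.1 this

theorem tensorWhiskerRight_id {A B C : GrAlg} (M : GrBimod A B) (Q : GrBimod B C) :
    tensorWhiskerRight (𝟙 M) Q = 𝟙 (tensor M Q) :=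
  GrBimod.hom_ext (LinearMap.ext fun v => tensorWhiskerRight_id_lin M Q v)

variable (N n) in
/-- The map of bimodules attached to the sideways crossing `E F ⟶ F E`. -/
noncomputable def sideEF : tensor (BF N n) (BE N n) ⟶ tensor (BE N (n + 2)) (BF N (n + 2)) :=
  Γ₂ (flagMaps N) (efToFe n)

variable (N n) in
/-- The map of bimodules attached to the sideways crossing `F E ⟶ E F`. -/
noncomputable def sideFE : tensor (BE N (n + 2)) (BF N (n + 2)) ⟶ tensor (BF N n) (BE N n) :=
  Γ₂ (flagMaps N) (feToEf n)

theorem sideEF_tm (h2 : ValidE N (n + 2)) (g f : (HE N n).carrier) :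
    (sideEF N n).lin (tm _ _ (vF N n g) (vE N n f)) =
    ∑ i ∈ Finset.range (kk N (n + 2) + 1), (-1 : ℚ) ^ i • tm _ _
      (pairLeft g (((flagMaps N).U n).lin (tm _ _ (vE N n f) (vE N (n + 2) (xE N (n + 2) i)))))
      (vF N (n + 2) (xi N (n + 2) ^ (kk N (n + 2) - i))) := by
  have e : sideEF N n = Γ₂ (flagMaps N) (efToFe n) := rfl
  dsimp only [efToFe, Tm.cc, Tm.Coh.tm, Γ₂, Γ₁] at e
  simp only [tensorWhiskerRight_id, Category.id_comp, Category.comp_id] at e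
  rw [e]
  simp -index only [comp_lin, LinearMap.comp_apply, id_lin, LinearMap.id_apply, leftUnit_inv_lin,
    rightUnit_inv_lin]
  simp -index only [id_lin, LinearMap.id_apply, tensorWhiskerRight_id_lin, tensorWhiskerLeft_id_lin,
    tensorWhiskerRight_regular, tensorWhiskerLeft_regular, tensorWhiskerRight_tm,
    tensorWhiskerLeft_tm, eta_one, epsh_one, casL_eq h2, map_sum, map_smul, LinearMap.sum_apply,
    LinearMap.smul_apply, assocHom_tm, assocInv_tm, assocInv_regular_right, assocHom_regular_right,
    rightUnit_inv_lin]
  refine Finset.sum_congr rfl fun i _ => congrArg _ ?_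
  generalize ((flagMaps N).U n).lin _ = u
  induction u using tm_induction with
  | h a b =>
    simp -index only [assocHom_tm, tensorWhiskerLeft_tm, assocInv_tm, tensorWhiskerRight_tm, eps_tm, etah_tm,
      leftUnit_tm, rightUnit_tm, pairLeft_apply, pairRight_apply, tensor_left, BE_left, BE_right,
      assocHom_regular_right, tensorWhiskerLeft_regular]
  | hadd u v hu hv => simp only [map_add, LinearMap.add_apply] at hu hv ⊢; rw [hu, hv]

theorem sideFE_tm (h : ValidE N n) (f g : (HE N (n + 2)).carrier) :
    (sideFE N n).lin (tm _ _ (vE N (n + 2) f) (vF N (n + 2) g)) =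
    ∑ i ∈ Finset.range (N - kk N n - 1 + 1), (-1 : ℚ) ^ i • tm _ _ (vF N n (yE N n i))
      (pairRight g (((flagMaps N).U n).lin
        (tm _ _ (vE N n (xi N n ^ (N - kk N n - 1 - i))) (vE N (n + 2) f)))) := by
  have e : sideFE N n = Γ₂ (flagMaps N) (feToEf n) := rfl
  dsimp only [feToEf, Tm.cc, Tm.Coh.tm, Γ₂, Γ₁] at e
  simp only [tensorWhiskerRight_id, Category.id_comp, Category.comp_id] at e
  rw [e]
  simp -index only [comp_lin, LinearMap.comp_apply, id_lin, LinearMap.id_apply, leftUnit_inv_lin,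
    rightUnit_inv_lin]
  simp -index only [id_lin, LinearMap.id_apply, tensorWhiskerRight_id_lin, tensorWhiskerLeft_id_lin,
    tensorWhiskerRight_regular, tensorWhiskerLeft_regular, tensorWhiskerRight_tm,
    tensorWhiskerLeft_tm, eta_one, epsh_one, casR_eq h, map_sum, map_smul, LinearMap.sum_apply,
    LinearMap.smul_apply, assocHom_tm, assocInv_tm, assocInv_regular_right, assocHom_regular_right,
    rightUnit_inv_lin]
  refine Finset.sum_congr rfl fun i _ => congrArg _ ?_
  generalize ((flagMaps N).U n).lin _ = u
  induction u using tm_induction with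
  | h a b =>
    simp -index only [assocHom_tm, tensorWhiskerLeft_tm, assocInv_tm, tensorWhiskerRight_tm, eps_tm, etah_tm,
      leftUnit_tm, rightUnit_tm, pairLeft_apply, pairRight_apply, tensor_left, BE_left, BE_right,
      assocHom_regular_right, tensorWhiskerLeft_regular]
  | hadd u v hu hv => simp only [map_add, LinearMap.add_apply] at hu hv ⊢; rw [hu, hv]

theorem sideEF_xi (h2 : ValidE N (n + 2)) (g f : (HE N n).carrier) :
    (sideEF N n).lin (tm _ _ (vF N n g) (vE N n (xi N n * f))) =
      (tensorWhiskerRight ((flagMaps N).z (n + 2)) (BF N (n + 2))).lin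
        ((sideEF N n).lin (tm _ _ (vF N n g) (vE N n f))) -
      (tensor (BE N (n + 2)) (BF N (n + 2))).left (traceR N n (g * f)) (casL N (n + 2)) := by
  rw [sideEF_tm h2, sideEF_tm h2, casL_eq h2, map_sum, map_sum, ← Finset.sum_sub_distrib]
  refine Finset.sum_congr rfl fun i _ => ?_
  rw [map_smul, map_smul, ← smul_sub, U_xi_left, map_sub, pairLeft_dot, pairLeft_tm, map_sub,
    LinearMap.sub_apply, tensorWhiskerRight_tm, tensor_left, BE_left]

theorem sideFE_xi (h : ValidE N n) (f g : (HE N (n + 2)).carrier) :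
    (sideFE N n).lin (tm _ _ (vE N (n + 2) (xi N (n + 2) * f)) (vF N (n + 2) g)) =
      (tensorWhiskerLeft (BF N n) ((flagMaps N).z n)).lin
        ((sideFE N n).lin (tm _ _ (vE N (n + 2) f) (vF N (n + 2) g))) +
      (tensor (BF N n) (BE N n)).right (traceL N (n + 2) (f * g)) (casR N n) := by
  rw [sideFE_tm h, sideFE_tm h, casR_eq h, map_sum, map_sum, ← Finset.sum_add_distrib]
  refine Finset.sum_congr rfl fun i _ => ?_
  rw [map_smul, map_smul, ← smul_add, U_xi_right, map_add, pairRight_dot, pairRight_tm, map_add,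
    tensorWhiskerLeft_tm, tensor_right, BE_right]

theorem traceR_pow_mul_xE_low (h : ValidE N n) (j a : ℕ) (ha : a + j < kk N n) :
    traceR N n (xi N n ^ a * xE N n j) = 0 := by
  induction j generalizing a with
  | zero => rw [xE_zero, mul_one, traceR_low h _ (by omega)]
  | succ j ih =>
    rw [← add_sub_cancel_right (xE N n (j + 1)) (xi N n * xE N n j), ← rHom_x h, mul_sub, map_sub,
      mul_comm, traceR_mul, traceR_low h _ (by omega), mul_zero, ← mul_assoc, ← pow_succ,
      ih _ (by omega), sub_zero]

theorem traceR_pow_mul_xE_top (h : ValidE N n) (j a : ℕ) (ha : a + j = kk N n) :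
    traceR N n (xi N n ^ a * xE N n j) = (-1) ^ j := by
  induction j generalizing a with
  | zero => rw [xE_zero, mul_one, show a = kk N n by omega, traceR_top h, pow_zero]
  | succ j ih =>
    rw [← add_sub_cancel_right (xE N n (j + 1)) (xi N n * xE N n j), ← rHom_x h, mul_sub, map_sub,
      mul_comm, traceR_mul, traceR_low h _ (by omega), mul_zero, ← mul_assoc, ← pow_succ,
      ih _ (by omega), zero_sub, pow_succ, mul_neg_one]

theorem sideEF_one (h : ValidE N n) (h2 : ValidE N (n + 2)) :
    (sideEF N n).lin (tm _ _ (vF N n 1) (vE N n 1)) = tm _ _ (vE N (n + 2) 1) (vF N (n + 2) 1) := by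
  have h0 := U_pow_left (N := N) (n := n) 0
  rw [pow_zero, Finset.range_zero, Finset.sum_empty, neg_zero] at h0
  rw [sideEF_tm h2, h.kk_succ, Finset.sum_range_succ', xE_zero, h0, map_zero, map_zero,
    LinearMap.zero_apply, smul_zero, add_zero, Finset.sum_range_succ, Finset.sum_eq_zero, zero_add,
    U_one_xE h h2, map_neg, pairLeft_tm, one_mul, ← one_mul (xE N n _), ← pow_zero (xi N n),
    traceR_pow_mul_xE_top h _ _ (by omega), map_pow, map_neg (lHom N (n + 2)), map_one, mul_one,
    map_neg, LinearMap.neg_apply, smul_neg, pow_succ, mul_neg_one, neg_smul, neg_neg, Nat.sub_self,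
    pow_zero, ← LinearMap.smul_apply, ← map_smul, ← map_smul, neg_one_pow_smul, ← mul_pow,
    neg_one_mul, neg_neg, one_pow]
  · intro i hi
    have := Finset.mem_range.1 hi
    rw [U_one_xE h h2, map_neg, pairLeft_tm, one_mul, ← one_mul (xE N n _), ← pow_zero (xi N n),
      traceR_pow_mul_xE_low h _ _ (by omega), map_zero, zero_mul, map_zero, neg_zero, map_zero,
      LinearMap.zero_apply, smul_zero]

theorem sideFE_one (h : ValidE N n) (h2 : ValidE N (n + 2)) :
    (sideFE N n).lin (tm _ _ (vE N (n + 2) 1) (vF N (n + 2) 1)) = -tm _ _ (vF N n 1) (vE N n 1) := by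
  have hM : N - kk N n - 1 = N - kk N (n + 2) - 1 + 1 := by
    have := h2.kk_lt
    rw [h.kk_succ] at this ⊢
    omega
  rw [sideFE_tm h, Finset.sum_range_succ', Finset.sum_eq_zero, zero_add, U_pow_left, Nat.sub_zero, hM,
    map_neg, map_sum, Finset.sum_range_succ, Finset.sum_eq_zero, zero_add, pairRight_tm, mul_one, traceL_top h2,
    map_one, one_mul, Nat.add_sub_cancel, Nat.sub_self, pow_zero, pow_zero, yE_zero, one_smul, map_neg]
  · intro j hj
    have := Finset.mem_range.1 hj
    rw [pairRight_tm, mul_one, traceL_low h2 _ (by omega), map_zero, zero_mul, map_zero]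
  · intro i hi
    have := Finset.mem_range.1 hi
    rw [U_pow_left, map_neg, map_sum, Finset.sum_eq_zero, neg_zero, map_zero, smul_zero]
    intro j hj
    have := Finset.mem_range.1 hj
    rw [pairRight_tm, mul_one, traceL_low h2 _ (by omega), map_zero, zero_mul, map_zero]

end Sideways

section Decomposition

variable {N : ℕ} {n : ℤ}

variable (N n) in
/-- Multiplication by `ξ^m` on the upward strand of `F E`. -/
noncomputable def dotFE (m : ℕ) : tensor (BE N n) (BF N n) ⟶ tensor (BE N n) (BF N n) :=
  tensorWhiskerRight (mulE N n (xi N n ^ m)) (BF N n)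

variable (N n) in
/-- Multiplication by `ξ^m` on the upward strand of `E F`. -/
noncomputable def dotEF (m : ℕ) : tensor (BF N n) (BE N n) ⟶ tensor (BF N n) (BE N n) :=
  tensorWhiskerLeft (BF N n) (mulE N n (xi N n ^ m))

theorem dotFE_tm (m : ℕ) (f g : (HE N n).carrier) :
    (dotFE N n m).lin (tm _ _ (vE N n f) (vF N n g)) = tm _ _ (vE N n (xi N n ^ m * f)) (vF N n g) :=
  tensorWhiskerRight_tm _ _ _ _

theorem dotEF_tm (m : ℕ) (f g : (HE N n).carrier) :
    (dotEF N n m).lin (tm _ _ (vF N n f) (vE N n g)) = tm _ _ (vF N n f) (vE N n (xi N n ^ m * g)) :=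
  tensorWhiskerLeft_tm _ _ _ _

theorem z_dotFE (m : ℕ) (v : (tensor (BE N n) (BF N n)).carrier) :
    (tensorWhiskerRight ((flagMaps N).z n) (BF N n)).lin ((dotFE N n m).lin v) =
      (dotFE N n (m + 1)).lin v := by
  have : mulE N n (xi N n ^ m) ≫ (flagMaps N).z n = mulE N n (xi N n ^ (m + 1)) :=
    BE_hom_ext fun f => by
      rw [comp_lin, LinearMap.comp_apply, mulE_lin, mulE_lin, z_lin, ← mul_assoc, ← pow_succ']
  unfold dotFE
  rw [← this]
  induction v using tm_induction with
  | h a b => simp only [tensorWhiskerRight_tm, comp_lin, LinearMap.comp_apply]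
  | hadd u v hu hv => rw [map_add, map_add, map_add, hu, hv]

theorem z_dotEF (m : ℕ) (v : (tensor (BF N n) (BE N n)).carrier) :
    (tensorWhiskerLeft (BF N n) ((flagMaps N).z n)).lin ((dotEF N n m).lin v) =
      (dotEF N n (m + 1)).lin v := by
  have : mulE N n (xi N n ^ m) ≫ (flagMaps N).z n = mulE N n (xi N n ^ (m + 1)) :=
    BE_hom_ext fun f => by
      rw [comp_lin, LinearMap.comp_apply, mulE_lin, mulE_lin, z_lin, ← mul_assoc, ← pow_succ']
  unfold dotEF
  rw [← this]
  induction v using tm_induction with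
  | h a b => simp only [tensorWhiskerLeft_tm, comp_lin, LinearMap.comp_apply]
  | hadd u v hu hv => rw [map_add, map_add, map_add, hu, hv]

theorem dotFE_zero (v : (tensor (BE N n) (BF N n)).carrier) : (dotFE N n 0).lin v = v := by
  have : mulE N n (xi N n ^ 0) = 𝟙 _ := BE_hom_ext fun f => by
    rw [mulE_lin, pow_zero, one_mul]; rfl
  unfold dotFE
  rw [this, tensorWhiskerRight_id_lin]

theorem dotEF_zero (v : (tensor (BF N n) (BE N n)).carrier) : (dotEF N n 0).lin v = v := by
  have : mulE N n (xi N n ^ 0) = 𝟙 _ := BE_hom_ext fun f => by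
    rw [mulE_lin, pow_zero, one_mul]; rfl
  unfold dotEF
  rw [this, tensorWhiskerLeft_id_lin]

theorem sideEF_pow (h : ValidE N n) (h2 : ValidE N (n + 2)) (b : ℕ) :
    (sideEF N n).lin (tm _ _ (vF N n 1) (vE N n (xi N n ^ b))) =
      tm _ _ (vE N (n + 2) (xi N (n + 2) ^ b)) (vF N (n + 2) 1) -
      ∑ c ∈ Finset.range b, (tensor (BE N (n + 2)) (BF N (n + 2))).left
        (sY N (n + 2) (b - 1 - c - kk N n)) ((dotFE N (n + 2) c).lin (casL N (n + 2))) := by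
  induction b with
  | zero => rw [pow_zero, pow_zero, sideEF_one h h2, Finset.range_zero, Finset.sum_empty, sub_zero]
  | succ b ih =>
    rw [pow_succ', sideEF_xi h2, ih, one_mul, traceR_pow h, map_sub, tensorWhiskerRight_tm, z_lin,
      ← pow_succ', sub_sub, map_sum, Finset.sum_range_succ', dotFE_zero]
    congr 2
    · refine Finset.sum_congr rfl fun c _ => ?_
      rw [BimHom.map_left, z_dotFE]
      congr 3
      push_cast; ring
    · congr 3
      push_cast; ring

theorem sideFE_pow (h : ValidE N n) (h2 : ValidE N (n + 2)) (b : ℕ) :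
    (sideFE N n).lin (tm _ _ (vE N (n + 2) (xi N (n + 2) ^ b)) (vF N (n + 2) 1)) =
      -tm _ _ (vF N n 1) (vE N n (xi N n ^ b)) +
      ∑ c ∈ Finset.range b, (tensor (BF N n) (BE N n)).left
        (sX N (n + 2) (b - c + kk N (n + 2) - N)) ((dotEF N n c).lin (casR N n)) := by
  induction b with
  | zero => rw [pow_zero, pow_zero, sideFE_one h h2, Finset.range_zero, Finset.sum_empty, add_zero]
  | succ b ih =>
    rw [pow_succ', sideFE_xi h, ih, mul_one, traceL_pow h2, map_add, map_neg, tensorWhiskerLeft_tm,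
      z_lin, ← pow_succ', add_assoc, map_sum, Finset.sum_range_succ', dotEF_zero, ← casR_central]
    congr 2
    · refine Finset.sum_congr rfl fun c _ => ?_
      rw [BimHom.map_left, z_dotEF]
      congr 3
      push_cast; ring

theorem Γ₂_bubbleEF (a m : ℕ) (t : Tm (Mor.id (n + 2)) (Mor.id (n + 2))) (f : (HE N n).carrier) :
    (Γ₂ (flagMaps N) (((((Mor.F n ◃ (Tm.z n).pow a).comp (Tm.eps n)).comp t).comp
      (Tm.epsh n)).comp (Mor.F n ◃ (Tm.z n).pow m))).lin (tm _ _ (vF N n 1) (vE N n f)) =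
    (tensor (BF N n) (BE N n)).left (traceR N n (xi N n ^ a * f) * bubVal t)
      ((dotEF N n m).lin (casR N n)) := by
  have e : Γ₂ (flagMaps N) (((((Mor.F n ◃ (Tm.z n).pow a).comp (Tm.eps n)).comp t).comp
      (Tm.epsh n)).comp (Mor.F n ◃ (Tm.z n).pow m)) = (((dotEF N n a ≫ (flagMaps N).eps n) ≫
        Γ₂ (flagMaps N) t) ≫ (flagMaps N).epsh n) ≫ dotEF N n m := by
    unfold dotEF
    rw [← Γ₂_pow_z_eq, ← Γ₂_pow_z_eq]; rfl
  rw [e]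
  change (dotEF N n m).lin (((flagMaps N).epsh n).lin ((Γ₂ (flagMaps N) t).lin
    (((flagMaps N).eps n).lin ((dotEF N n a).lin (tm _ _ (vF N n 1) (vE N n f)))))) = _
  rw [dotEF_tm, eps_tm, one_mul, Γ₂_closed, epsh_lin, BimHom.map_left]

theorem Γ₂_bubbleFE (a m : ℕ) (t : Tm (Mor.id n) (Mor.id n)) (f : (HE N n).carrier) :
    (Γ₂ (flagMaps N) ((((((Tm.z n).pow a ▹ Mor.F n).comp (Tm.etah n)).comp t).comp
      (Tm.eta n)).comp ((Tm.z n).pow m ▹ Mor.F n))).lin (tm _ _ (vE N n f) (vF N n 1)) =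
    (tensor (BE N n) (BF N n)).left (traceL N n (xi N n ^ a * f) * bubVal t)
      ((dotFE N n m).lin (casL N n)) := by
  have e : Γ₂ (flagMaps N) ((((((Tm.z n).pow a ▹ Mor.F n).comp (Tm.etah n)).comp t).comp
      (Tm.eta n)).comp ((Tm.z n).pow m ▹ Mor.F n)) = (((dotFE N n a ≫ (flagMaps N).etah n) ≫
        Γ₂ (flagMaps N) t) ≫ (flagMaps N).eta n) ≫ dotFE N n m := by
    unfold dotFE
    rw [← Γ₂_pow_z_eq, ← Γ₂_pow_z_eq]; rfl
  rw [e]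
  change (dotFE N n m).lin (((flagMaps N).eta n).lin ((Γ₂ (flagMaps N) t).lin
    (((flagMaps N).etah n).lin ((dotFE N n a).lin (tm _ _ (vE N n f) (vF N n 1)))))) = _
  rw [dotFE_tm, etah_tm, mul_one, Γ₂_closed, eta_lin, BimHom.map_left]

theorem sum_sY_mul_bubCC (h : ValidE N n) (l b : ℕ) (hl : (l : ℤ) < n + 2) (hb : b ≤ kk N n) :
    ∑ j ∈ Finset.range (l + 1), traceR N n (xi N n ^ (l - j) * xi N n ^ b) * bubVal (fakeCC n j) =
      sX N (n + 2) (l + b - kk N n) := by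
  have e : bubCC N (n + 2) * altSeries (Ys N (n + 2)) = altSeries (Xs N (n + 2)) := by
    rw [bubCC, mul_right_comm, x_mul_Ys, one_mul]
  rw [sX_eq, ← e, ← sum_coeff_mul_zcoeff _ _ _ (l + 1) (fun j hj => .inr (by omega))]
  refine Finset.sum_congr rfl fun j hj => ?_
  have := Finset.mem_range.1 hj
  rw [← pow_add, traceR_pow h, bubVal_fakeCC h.valid_succ j (by omega), mul_comm, sY_eq]
  congr 2
  omega

theorem sum_sX_mul_bubC (h : ValidE N (n + 2)) (l b : ℕ) (hl : (l : ℤ) < -(n + 2))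
    (hb : b ≤ N - kk N (n + 2) - 1) :
    ∑ j ∈ Finset.range (l + 1),
      traceL N (n + 2) (xi N (n + 2) ^ (l - j) * xi N (n + 2) ^ b) * bubVal (fakeC n j) =
      sY N (n + 2) (l + b + 1 + kk N (n + 2) - N) := by
  have hk := h.kk_lt
  have e : bubC N (n + 2) * altSeries (Xs N (n + 2)) = altSeries (Ys N (n + 2)) := by
    rw [bubC, mul_right_comm, y_mul_Xs, one_mul]
  rw [sY_eq, ← e, ← sum_coeff_mul_zcoeff _ _ _ (l + 1) (fun j hj => .inr (by omega))]
  refine Finset.sum_congr rfl fun j hj => ?_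
  have := Finset.mem_range.1 hj
  rw [← pow_add, traceL_pow h, bubVal_fakeC h.valid j (by omega), mul_comm, sX_eq]
  congr 2
  omega

theorem decompEF_bubbles (h : ValidE N n) (b : ℕ) (hb : b ≤ kk N n) : (Γ₂ (flagMaps N)
    (Tm.sum (n + 2).toNat fun l => Tm.sum ((l : ℕ) + 1) fun j =>
      ((((Mor.F n ◃ (Tm.z n).pow ((l : ℕ) - j)).comp (Tm.eps n)).comp (fakeCC n j)).comp
        (Tm.epsh n)).comp (Mor.F n ◃ (Tm.z n).pow ((n + 2) - 1 - (l : ℕ)).toNat))).lin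
      (tm _ _ (vF N n 1) (vE N n (xi N n ^ b))) =
    ∑ c ∈ Finset.range (n + 2).toNat, (tensor (BF N n) (BE N n)).left
        (sX N (n + 2) (b - c + kk N (n + 2) - N)) ((dotEF N n c).lin (casR N n)) := by
  have hn := h.eq
  rw [← Finset.sum_range_reflect]
  refine Γ₂_sum_eq (f := Mor.F n ⬝ Mor.E n) (g := Mor.F n ⬝ Mor.E n) (flagMaps N) _ _ _ _ fun l => ?_
  refine (Γ₂_sum_eq (f := Mor.F n ⬝ Mor.E n) (g := Mor.F n ⬝ Mor.E n) (flagMaps N) _ _ _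
    (fun j => (tensor (BF N n) (BE N n)).left
      (traceR N n (xi N n ^ ((l : ℕ) - j) * xi N n ^ b) * bubVal (fakeCC n j))
      ((dotEF N n ((n + 2) - 1 - (l : ℕ)).toNat).lin (casR N n))) fun j => Γ₂_bubbleEF _ _ _ _).trans ?_
  have key := congrArg (fun a => (tensor (BF N n) (BE N n)).left a
    ((dotEF N n ((n + 2) - 1 - (l : ℕ)).toNat).lin (casR N n)))
    (sum_sY_mul_bubCC h l b (by omega) hb)
  simp only [map_sum, LinearMap.sum_apply] at key
  refine key.trans ?_
  have := l.2
  have hk := h.kk_succ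
  rw [show (n + 2).toNat - 1 - (l : ℕ) = ((n + 2) - 1 - (l : ℕ)).toNat by omega,
    show (b : ℤ) - ((n + 2) - 1 - (l : ℕ)).toNat + kk N (n + 2) - N = l + b - kk N n by omega]

theorem decompFE_bubbles (h : ValidE N (n + 2)) (b : ℕ) (hb : b ≤ N - kk N (n + 2) - 1) :
    (Γ₂ (flagMaps N) (Tm.sum (-(n + 2)).toNat fun l => Tm.sum ((l : ℕ) + 1) fun j =>
          (((((Tm.z (n + 2)).pow ((l : ℕ) - j) ▹ Mor.F (n + 2)).comp (Tm.etah (n + 2))).comp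
            (fakeC n j)).comp (Tm.eta (n + 2))).comp
            ((Tm.z (n + 2)).pow (-(n + 2) - 1 - (l : ℕ)).toNat ▹ Mor.F (n + 2)))).lin
      (tm _ _ (vE N (n + 2) (xi N (n + 2) ^ b)) (vF N (n + 2) 1)) =
    ∑ c ∈ Finset.range (-(n + 2)).toNat, (tensor (BE N (n + 2)) (BF N (n + 2))).left
        (sY N (n + 2) (b - c - kk N (n + 2))) ((dotFE N (n + 2) c).lin (casL N (n + 2))) := by
  have hn := h.eq
  rw [← Finset.sum_range_reflect]
  refine Γ₂_sum_eq (f := Mor.E (n + 2) ⬝ Mor.F (n + 2)) (g := Mor.E (n + 2) ⬝ Mor.F (n + 2))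
    (flagMaps N) _ _ _ _ fun l => ?_
  refine (Γ₂_sum_eq (f := Mor.E (n + 2) ⬝ Mor.F (n + 2)) (g := Mor.E (n + 2) ⬝ Mor.F (n + 2))
    (flagMaps N) _ _ _ (fun j => (tensor (BE N (n + 2)) (BF N (n + 2))).left
      (traceL N (n + 2) (xi N (n + 2) ^ ((l : ℕ) - j) * xi N (n + 2) ^ b) * bubVal (fakeC n j))
      ((dotFE N (n + 2) (-(n + 2) - 1 - (l : ℕ)).toNat).lin (casL N (n + 2))))
      fun j => Γ₂_bubbleFE _ _ _ _).trans ?_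
  have key := congrArg (fun a => (tensor (BE N (n + 2)) (BF N (n + 2))).left a
    ((dotFE N (n + 2) (-(n + 2) - 1 - (l : ℕ)).toNat).lin (casL N (n + 2))))
    (sum_sX_mul_bubC h l b (by omega) hb)
  simp only [map_sum, LinearMap.sum_apply] at key
  refine key.trans ?_
  have := l.2
  rw [show (-(n + 2)).toNat - 1 - (l : ℕ) = (-(n + 2) - 1 - (l : ℕ)).toNat by omega,
    show (b : ℤ) - (-(n + 2) - 1 - (l : ℕ)).toNat - kk N (n + 2) =
      l + b + 1 + kk N (n + 2) - N by omega]

theorem Γ₂_decomp {n m : ℤ} {f g : Mor n m} (s : Tm f g) (s' : Tm g f) (t : Tm f f) (v : (Γ₁ N f).carrier) :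
    (Γ₂ (flagMaps N) ((s.comp s').neg.add t)).lin v =
      -(Γ₂ (flagMaps N) s').lin ((Γ₂ (flagMaps N) s).lin v) + (Γ₂ (flagMaps N) t).lin v :=
  congrArg (· + (Γ₂ (flagMaps N) t).lin v) (Γ₂_neg (flagMaps N) (s.comp s') v)

variable (N n)

theorem decompEF_rel : Γ₂ (flagMaps N) (Tm.id (Mor.F n ⬝ Mor.E n)) = Γ₂ (flagMaps N)
      (((efToFe n).comp (feToEf n)).neg.add
        (Tm.sum (n + 2).toNat fun l => Tm.sum ((l : ℕ) + 1) fun j =>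
          ((((Mor.F n ◃ (Tm.z n).pow ((l : ℕ) - j)).comp (Tm.eps n)).comp (fakeCC n j)).comp
            (Tm.epsh n)).comp (Mor.F n ◃ (Tm.z n).pow ((n + 2) - 1 - (l : ℕ)).toNat))) := by
  by_cases h : ValidE N n
  swap; · exact hom_eq_of_subsingleton (tensor_subsingleton_left _ (BF_subsingleton h)) _ _
  have hn := h.eq
  have hk := h.kk_lt
  refine (RightGen.bimGen_tensor BF_isCyclicGen BE_rightGen).hom_ext fun b => ?_
  refine Eq.trans ?_ ((Γ₂_decomp _ _ _ _).trans
    (congrArg (_ + ·) (decompEF_bubbles h b (by omega)))).symm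
  change tm _ _ (vF N n 1) (vE N n (xi N n ^ (b : ℕ))) = -(sideFE N n).lin ((sideEF N n).lin
    (tm _ _ (vF N n 1) (vE N n (xi N n ^ (b : ℕ))))) +
      ∑ c ∈ Finset.range (n + 2).toNat, (tensor (BF N n) (BE N n)).left
        (sX N (n + 2) (b - c + kk N (n + 2) - N)) ((dotEF N n c).lin (casR N n))
  have hb := b.2
  have hk2 := h.kk_succ
  by_cases h2 : ValidE N (n + 2)
  · have hk' := h2.kk_lt
    rw [sideEF_pow h h2, Finset.sum_eq_zero, sub_zero, sideFE_pow h h2, neg_add_rev, neg_neg,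
      add_right_comm, sum_range_eq_of_zero (n + 2).toNat b, neg_add_cancel, zero_add]
    · intro j hj
      rw [sX_neg (by omega), map_zero, LinearMap.zero_apply]
    · intro j hj
      rw [sX_neg (by omega), map_zero, LinearMap.zero_apply]
    · intro c hc
      rw [sY_neg (by omega), map_zero, LinearMap.zero_apply]
  · have hM : kk N n + 1 = N := by
      by_contra h0
      exact h2 ⟨kk N n + 1, by omega, by omega⟩
    have hz : (sideEF N n).lin (tm _ _ (vF N n 1) (vE N n (xi N n ^ (b : ℕ)))) = 0 :=
      have := tensor_subsingleton_left (BF N (n + 2)) (BE_subsingleton h2)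
      Subsingleton.elim _ _
    rw [hz, map_zero, neg_zero, zero_add, Finset.sum_eq_single_of_mem (b : ℕ)
      (Finset.mem_range.2 (by omega)), show (b : ℤ) - (b : ℕ) + kk N (n + 2) - N = 0 by omega, sX_zero,
      map_one (tensor (BF N n) (BE N n)).left, casR_eq h, show N - kk N n - 1 + 1 = 1 by omega, Finset.sum_range_one, pow_zero, one_smul,
      yE_zero, Module.End.one_apply, dotEF_tm, ← pow_add]
    · congr 3; omega
    · intro c _ hc
      rw [sX_eq_zero_of_kk_eq (by omega) (by omega), map_zero, LinearMap.zero_apply]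

theorem decompFE_rel : Γ₂ (flagMaps N) (Tm.id (Mor.E (n + 2) ⬝ Mor.F (n + 2))) = Γ₂ (flagMaps N)
      (((feToEf n).comp (efToFe n)).neg.add
        (Tm.sum (-(n + 2)).toNat fun l => Tm.sum ((l : ℕ) + 1) fun j =>
          (((((Tm.z (n + 2)).pow ((l : ℕ) - j) ▹ Mor.F (n + 2)).comp (Tm.etah (n + 2))).comp
            (fakeC n j)).comp (Tm.eta (n + 2))).comp
            ((Tm.z (n + 2)).pow (-(n + 2) - 1 - (l : ℕ)).toNat ▹ Mor.F (n + 2)))) := by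
  by_cases h2 : ValidE N (n + 2)
  swap; · exact hom_eq_of_subsingleton (tensor_subsingleton_left _ (BE_subsingleton h2)) _ _
  have hn := h2.eq
  have hk := h2.kk_lt
  refine (BE_leftGen.bimGen_tensor BF_isCyclicGen).hom_ext fun b => ?_
  refine Eq.trans ?_ ((Γ₂_decomp _ _ _ _).trans
    (congrArg (_ + ·) (decompFE_bubbles h2 b (by omega)))).symm
  change tm _ _ (vE N (n + 2) (xi N (n + 2) ^ (b : ℕ))) (vF N (n + 2) 1) =
    -(sideEF N n).lin ((sideFE N n).lin
    (tm _ _ (vE N (n + 2) (xi N (n + 2) ^ (b : ℕ))) (vF N (n + 2) 1))) +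
      ∑ c ∈ Finset.range (-(n + 2)).toNat, (tensor (BE N (n + 2)) (BF N (n + 2))).left
        (sY N (n + 2) (b - c - kk N (n + 2))) ((dotFE N (n + 2) c).lin (casL N (n + 2)))
  have hb := b.2
  by_cases h : ValidE N n
  · have hk2 := h.kk_succ
    rw [sideFE_pow h h2, Finset.sum_eq_zero, add_zero, map_neg, sideEF_pow h h2, neg_neg, sub_add,
      sum_range_eq_of_zero (-(n + 2)).toNat b, sub_eq_self.2]
    · rw [sub_eq_zero]
      refine Finset.sum_congr rfl fun c _ => ?_
      congr 3; omega
    · intro j hj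
      rw [sY_neg (by omega), map_zero, LinearMap.zero_apply]
    · intro j hj
      rw [sY_neg (by omega), map_zero, LinearMap.zero_apply]
    · intro c hc
      rw [sX_neg (by omega), map_zero, LinearMap.zero_apply]
  · have hM : kk N (n + 2) = 0 := by
      by_contra h0
      exact h ⟨kk N (n + 2) - 1, by omega, by omega⟩
    have hz : (sideFE N n).lin (tm _ _ (vE N (n + 2) (xi N (n + 2) ^ (b : ℕ))) (vF N (n + 2) 1)) = 0 :=
      have := tensor_subsingleton_left (BE N n) (BF_subsingleton h)
      Subsingleton.elim _ _
    rw [hz, map_zero, neg_zero, zero_add, Finset.sum_eq_single_of_mem (b : ℕ)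
      (Finset.mem_range.2 (by omega)), show (b : ℤ) - (b : ℕ) - kk N (n + 2) = 0 by omega, sY_zero,
      map_one (tensor (BE N (n + 2)) (BF N (n + 2))).left, casL_eq h2, show kk N (n + 2) + 1 = 1 by omega, Finset.sum_range_one, pow_zero, one_smul,
      xE_zero, Module.End.one_apply, dotFE_tm, mul_one, Nat.sub_zero,
      show xi N (n + 2) ^ kk N (n + 2) = 1 by rw [hM, pow_zero]]
    · intro c _ hc
      rw [sY_eq_zero_of_kk_eq (by omega) (by omega), map_zero, LinearMap.zero_apply]

end Decomposition

section CrossCyclic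

open MvPolynomial

theorem swapVars_divDiff_mul_sub {σ : Type} [DecidableEq σ] {i j : σ} (h : i ≠ j)
    (p q : MvPolynomial σ ℚ) : swapVars i j (divDiff h p * q - p * divDiff h q) =
      divDiff h p * q - p * divDiff h q := by
  apply mul_left_cancel₀ (X_sub_X_ne_zero h)
  rw [map_sub, map_mul, map_mul, swapVars_divDiff, swapVars_divDiff]
  linear_combination (swapVars i j q - q) * mul_divDiff h p - (swapVars i j p - p) * mul_divDiff h q

/-- Divided differences are self-adjoint for an alternating functional. -/
theorem alternating_divDiff {V : Type} [AddCommGroup V] [Module ℚ V]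
    {L : MvPolynomial (Fin 2) ℚ →ₗ[ℚ] V} {h : (0 : Fin 2) ≠ 1}
    (hL : ∀ a b : ℕ, L (X 0 ^ a * X 1 ^ b) = -L (X 0 ^ b * X 1 ^ a)) (p q : MvPolynomial (Fin 2) ℚ) :
    L (divDiff h p * q) = L (p * divDiff h q) := by
  have hs : L ∘ₗ (swapVars 0 1).toLinearMap = -L := linearMap_ext_fin_two fun a b => by
    rw [LinearMap.comp_apply, AlgHom.toLinearMap_apply, map_mul, map_pow, map_pow, swapVars_X,
      swapVars_X, Equiv.swap_apply_left, Equiv.swap_apply_right, mul_comm, LinearMap.neg_apply, hL b a]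
  have := LinearMap.congr_fun hs (divDiff h p * q - p * divDiff h q)
  rw [LinearMap.comp_apply, AlgHom.toLinearMap_apply, swapVars_divDiff_mul_sub, LinearMap.neg_apply,
    eq_neg_iff_add_eq_zero, ← two_smul ℚ, smul_eq_zero_iff_right two_ne_zero, map_sub,
    sub_eq_zero] at this
  exact this

variable (N : ℕ) (n : ℤ)

/-- Polynomials in the dots on two downward strands. -/
noncomputable def dotsFF :
    MvPolynomial (Fin 2) ℚ →ₗ[ℚ] (tensor (BF N (n + 2)) (BF N n)).carrier :=
  (basisMonomials (Fin 2) ℚ).constr ℚ fun s =>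
    tm _ _ (vF N (n + 2) (xi N (n + 2) ^ s 1)) (vF N n (xi N n ^ s 0))

variable {N n}

theorem constr_fin_two {V : Type} [AddCommGroup V] [Module ℚ V] (F : ℕ → ℕ → V) (a b : ℕ) :
    (basisMonomials (Fin 2) ℚ).constr ℚ (fun s => F (s 0) (s 1)) (X 0 ^ a * X 1 ^ b) = F a b := by
  have := (basisMonomials (Fin 2) ℚ).constr_basis ℚ (fun s => F (s 0) (s 1))
    (Finsupp.single 0 a + Finsupp.single 1 b)
  rw [coe_basisMonomials] at this
  beta_reduce at this
  rw [← one_mul (1 : ℚ), ← monomial_mul, ← X_pow_eq_monomial, ← X_pow_eq_monomial] at this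
  simpa using this

theorem dotsFF_apply (a b : ℕ) : dotsFF N n (X 0 ^ a * X 1 ^ b) =
    tm _ _ (vF N (n + 2) (xi N (n + 2) ^ b)) (vF N n (xi N n ^ a)) :=
  constr_fin_two (fun a b => tm _ _ (vF N (n + 2) (xi N (n + 2) ^ b)) (vF N n (xi N n ^ a))) a b

theorem Uh_dotsFF (p : MvPolynomial (Fin 2) ℚ) :
    ((flagMaps N).Uh n).lin (dotsFF N n p) = dotsFF N n (divDiff Fin.zero_ne_one p) :=
  LinearMap.congr_fun (f := ((flagMaps N).Uh n).lin ∘ₗ dotsFF N n)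
    (g := dotsFF N n ∘ₗ divDiff Fin.zero_ne_one) (linearMap_ext_fin_two fun a b => by
      rw [LinearMap.comp_apply, LinearMap.comp_apply, dotsFF_apply, (flagMaps N).Uh_apply,
        divDiff_pow_mul_pow', map_sub, map_sum, map_sum]
      simp only [dotsFF_apply]) p

theorem LeftGen.hom_ext {A B : GrAlg} {ι : Type} {M P : GrBimod A B} {g : ι → M.carrier}
    (hg : LeftGen M g) {φ ψ : M ⟶ P} (h : ∀ i, φ.lin (g i) = ψ.lin (g i)) : φ = ψ :=
  GrBimod.hom_ext (LinearMap.ext fun m => hg (fun m => φ.lin m = ψ.lin m)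
    (fun a i => by rw [φ.map_left, ψ.map_left, h])
    (fun m m' h h' => by rw [map_add, map_add, h, h']) m)

theorem FF_hom_ext {P : GrBimod (H N (n + 2 + 2)) (H N n)}
    {φ ψ : tensor (BF N (n + 2)) (BF N n) ⟶ P}
    (h : ValidE N n → ValidE N (n + 2) → ∀ a b : ℕ,
      φ.lin (tm _ _ (vF N (n + 2) (xi N (n + 2) ^ b)) (vF N n (xi N n ^ a))) =
      ψ.lin (tm _ _ (vF N (n + 2) (xi N (n + 2) ^ b)) (vF N n (xi N n ^ a)))) : φ = ψ := by
  by_cases hv : ValidE N n ∧ ValidE N (n + 2)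
  · exact ((BF_leftGen (n := n + 2)).tensor BF_leftGen).hom_ext fun i => h hv.1 hv.2 _ _
  · exact hom_eq_of_subsingleton (FF_subsingleton hv) _ _

variable (N n)

/-- The iterated trace of a polynomial in two dots, closed up on the right. -/
noncomputable def traceLL : MvPolynomial (Fin 2) ℚ →ₗ[ℚ] (H N n).carrier :=
  (basisMonomials (Fin 2) ℚ).constr ℚ fun s =>
    traceL N n (rHom N n (traceL N (n + 2) (xi N (n + 2) ^ s 1)) * xi N n ^ s 0)

/-- The iterated trace of a polynomial in two dots, closed up on the left. -/
noncomputable def traceRR : MvPolynomial (Fin 2) ℚ →ₗ[ℚ] (H N (n + 2 + 2)).carrier :=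
  (basisMonomials (Fin 2) ℚ).constr ℚ fun s =>
    traceR N (n + 2) (lHom N (n + 2) (traceR N n (xi N n ^ s 0)) * xi N (n + 2) ^ s 1)

variable {N n}

theorem traceLL_apply (a b : ℕ) : traceLL N n (X 0 ^ a * X 1 ^ b) =
    traceL N n (rHom N n (traceL N (n + 2) (xi N (n + 2) ^ b)) * xi N n ^ a) :=
  constr_fin_two (fun a b => traceL N n (rHom N n (traceL N (n + 2) (xi N (n + 2) ^ b)) * xi N n ^ a)) a b

theorem traceRR_apply (a b : ℕ) : traceRR N n (X 0 ^ a * X 1 ^ b) =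
    traceR N (n + 2) (lHom N (n + 2) (traceR N n (xi N n ^ a)) * xi N (n + 2) ^ b) :=
  constr_fin_two (fun a b => traceR N (n + 2) (lHom N (n + 2) (traceR N n (xi N n ^ a)) * xi N (n + 2) ^ b)) a b

theorem rHom_sX (h : ValidE N n) (d : ℤ) :
    rHom N n (sX N (n + 2) d) = lHom N n (sX N n d) - xi N n * lHom N n (sX N n (d - 1)) := by
  have e1 : PowerSeries.map (rHom N n : (H N (n + 2)).carrier →+* (HE N n).carrier) (altSeries (Xs N (n + 2))) =
      PowerSeries.map (lHom N n : (H N n).carrier →+* (HE N n).carrier) (altSeries (Xs N n)) *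
        (1 - PowerSeries.C (xi N n) * PowerSeries.X) := by
    have hy : altSeries (yE N n) * PowerSeries.map (rHom N n : (H N (n + 2)).carrier →+* (HE N n).carrier) (altSeries (Xs N (n + 2))) = 1 := by
      have := congrArg (PowerSeries.map (rHom N n : (H N (n + 2)).carrier →+* (HE N n).carrier)) (y_mul_Xs (N := N) (n := n + 2))
      rw [map_mul, map_one, map_altSeries] at this
      convert this using 2
      ext j; rw [coeff_altSeries, coeff_altSeries]; exact congrArg _ (rHom_y h j).symm
    have hy' := congrArg (PowerSeries.map (lHom N n : (H N n).carrier →+* (HE N n).carrier)) (y_mul_Xs (N := N) (n := n))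
    rw [map_mul, map_one, altSeries_yE h] at hy'
    linear_combination -(PowerSeries.map (rHom N n : (H N (n + 2)).carrier →+* (HE N n).carrier) (altSeries (Xs N (n + 2)))) * hy' +
      (1 - PowerSeries.C (xi N n) * PowerSeries.X) *
        PowerSeries.map (lHom N n : (H N n).carrier →+* (HE N n).carrier) (altSeries (Xs N n)) * hy
  have := congrArg (zcoeff · d) e1
  simp only [zcoeff_mul_linear, zcoeff_map] at this
  rw [sX_eq, sX_eq, sX_eq]
  exact this

theorem lHom_sY (h : ValidE N n) (d : ℤ) :
    lHom N n (sY N n d) = rHom N n (sY N (n + 2) d) - xi N n * rHom N n (sY N (n + 2) (d - 1)) := by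
  have e1 : PowerSeries.map (lHom N n : (H N n).carrier →+* (HE N n).carrier) (altSeries (Ys N n)) =
      PowerSeries.map (rHom N n : (H N (n + 2)).carrier →+* (HE N n).carrier) (altSeries (Ys N (n + 2))) *
        (1 - PowerSeries.C (xi N n) * PowerSeries.X) := by
    have hy : altSeries (xE N n) * PowerSeries.map (lHom N n : (H N n).carrier →+* (HE N n).carrier) (altSeries (Ys N n)) = 1 := by
      have := congrArg (PowerSeries.map (lHom N n : (H N n).carrier →+* (HE N n).carrier)) (x_mul_Ys (N := N) (n := n))
      rw [map_mul, map_one, map_altSeries] at this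
      convert this using 2
      ext j; rw [coeff_altSeries, coeff_altSeries]; exact congrArg _ (lHom_x h j).symm
    have hy' := congrArg (PowerSeries.map (rHom N n : (H N (n + 2)).carrier →+* (HE N n).carrier)) (x_mul_Ys (N := N) (n := n + 2))
    rw [map_mul, map_one, altSeries_xE h] at hy'
    linear_combination -(PowerSeries.map (lHom N n : (H N n).carrier →+* (HE N n).carrier) (altSeries (Ys N n))) * hy' +
      (1 - PowerSeries.C (xi N n) * PowerSeries.X) *
        PowerSeries.map (rHom N n : (H N (n + 2)).carrier →+* (HE N n).carrier) (altSeries (Ys N (n + 2))) * hy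
  have := congrArg (zcoeff · d) e1
  simp only [zcoeff_mul_linear, zcoeff_map] at this
  rw [sY_eq, sY_eq, sY_eq]
  exact this

theorem traceLL_eq (h : ValidE N n) (h2 : ValidE N (n + 2)) (a b : ℕ) :
    traceLL N n (X 0 ^ a * X 1 ^ b) =
      sX N n (b + 2 + kk N n - N) * sX N n (a + 1 + kk N n - N) -
      sX N n (b + 1 + kk N n - N) * sX N n (a + 2 + kk N n - N) := by
  rw [traceLL_apply, traceL_pow h2, rHom_sX h, sub_mul, map_sub, traceL_mul, traceL_pow h,
    mul_assoc, mul_left_comm, traceL_mul, ← pow_succ', traceL_pow h, h.kk_succ]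
  push_cast
  ring_nf

theorem traceRR_eq (h : ValidE N n) (h2 : ValidE N (n + 2)) (a b : ℕ) :
    traceRR N n (X 0 ^ a * X 1 ^ b) =
      sY N (n + 2 + 2) (a - kk N n) * sY N (n + 2 + 2) (b - 1 - kk N n) -
      sY N (n + 2 + 2) (a - 1 - kk N n) * sY N (n + 2 + 2) (b - kk N n) := by
  rw [traceRR_apply, traceR_pow h, lHom_sY h2, sub_mul, map_sub, traceR_mul, traceR_pow h2,
    mul_assoc, mul_left_comm, traceR_mul, ← pow_succ', traceR_pow h2, h.kk_succ]
  push_cast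
  ring_nf

theorem traceLL_alternating (h : ValidE N n) (h2 : ValidE N (n + 2)) (a b : ℕ) :
    traceLL N n (X 0 ^ a * X 1 ^ b) = -traceLL N n (X 0 ^ b * X 1 ^ a) := by
  rw [traceLL_eq h h2, traceLL_eq h h2]; ring

theorem traceRR_alternating (h : ValidE N n) (h2 : ValidE N (n + 2)) (a b : ℕ) :
    traceRR N n (X 0 ^ a * X 1 ^ b) = -traceRR N n (X 0 ^ b * X 1 ^ a) := by
  rw [traceRR_eq h h2, traceRR_eq h h2]; ring

theorem etah_pairRight (p : MvPolynomial (Fin 2) ℚ) (a b : ℕ) :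
    ((flagMaps N).etah n).lin (tm _ _ (pairRight (xi N (n + 2) ^ b) (dotsEE N n p)) (vF N n (xi N n ^ a))) =
      traceLL N n (p * (X 0 ^ a * X 1 ^ b)) := by
  have key : ((flagMaps N).etah n).lin ∘ₗ (tm (BE N n) (BF N n)).flip (vF N n (xi N n ^ a)) ∘ₗ
      pairRight (xi N (n + 2) ^ b) ∘ₗ dotsEE N n =
      traceLL N n ∘ₗ LinearMap.mulRight ℚ (X 0 ^ a * X 1 ^ b) := by
    refine linearMap_ext_fin_two fun c d => ?_
    rw [LinearMap.comp_apply, LinearMap.comp_apply, LinearMap.comp_apply, LinearMap.comp_apply,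
      LinearMap.mulRight_apply, dotsEE_apply]
    have e : ((flagMaps N).etah n).lin (tm _ _ (pairRight (xi N (n + 2) ^ b)
        (tm _ _ (vE N n (xi N n ^ c)) (vE N (n + 2) (xi N (n + 2) ^ d)))) (vF N n (xi N n ^ a))) =
        traceLL N n (X 0 ^ (c + a) * X 1 ^ (d + b)) := by
      rw [pairRight_tm, etah_tm, ← pow_add, traceLL_apply, pow_add (xi N n)]
      congr 1; ring
    refine Eq.trans e ?_
    congr 1; ring
  exact LinearMap.congr_fun key p

theorem eps_pairLeft (p : MvPolynomial (Fin 2) ℚ) (a b : ℕ) :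
    ((flagMaps N).eps (n + 2)).lin (tm _ _ (vF N (n + 2) (xi N (n + 2) ^ b))
      (pairLeft (xi N n ^ a) (dotsEE N n p))) = traceRR N n (p * (X 0 ^ a * X 1 ^ b)) := by
  have key : ((flagMaps N).eps (n + 2)).lin ∘ₗ
      tm (BF N (n + 2)) (BE N (n + 2)) (vF N (n + 2) (xi N (n + 2) ^ b)) ∘ₗ
      pairLeft (xi N n ^ a) ∘ₗ dotsEE N n =
      traceRR N n ∘ₗ LinearMap.mulRight ℚ (X 0 ^ a * X 1 ^ b) := by
    refine linearMap_ext_fin_two fun c d => ?_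
    rw [LinearMap.comp_apply, LinearMap.comp_apply, LinearMap.comp_apply, LinearMap.comp_apply,
      LinearMap.mulRight_apply, dotsEE_apply]
    have e : ((flagMaps N).eps (n + 2)).lin (tm _ _ (vF N (n + 2) (xi N (n + 2) ^ b))
        (pairLeft (xi N n ^ a) (tm _ _ (vE N n (xi N n ^ c)) (vE N (n + 2) (xi N (n + 2) ^ d))))) =
        traceRR N n (X 0 ^ (a + c) * X 1 ^ (b + d)) := by
      rw [pairLeft_tm, eps_tm, ← pow_add, traceRR_apply, pow_add (xi N (n + 2))]
      congr 1; ring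
    refine Eq.trans e ?_
    congr 1; ring
  exact LinearMap.congr_fun key p

theorem casL_eq' (h : ValidE N n) : casL N n = ∑ j ∈ Finset.range (kk N n + 1), (-1 : ℚ) ^ j •
    tm _ _ (vE N n (xi N n ^ (kk N n - j))) (vF N n (xE N n j)) := by
  rw [casL_eq h]
  have e1 : ∀ j, tm (BE N n) (BF N n) (vE N n (xE N n j)) (vF N n (xi N n ^ (kk N n - j))) =
      ∑ i ∈ Finset.range (kk N n + 1), (-1 : ℚ) ^ i • tm _ _ (vE N n (xi N n ^ (kk N n - i)))
        (vF N n (rHom N n (traceR N n (xE N n i * xE N n j)) * xi N n ^ (kk N n - j))) := by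
    intro j
    conv_lhs => rw [← casL_trace' h (xE N n j)]
    rw [map_sum, map_sum, LinearMap.sum_apply]
    refine Finset.sum_congr rfl fun i _ => ?_
    rw [map_smul, map_smul, LinearMap.smul_apply, ← BE_right, tm_right, BF_left, mul_comm (xE N n j)]
  simp only [e1, Finset.smul_sum]
  rw [Finset.sum_comm]
  refine Finset.sum_congr rfl fun i _ => ?_
  conv_rhs => rw [← casL_trace' h (xE N n i)]
  rw [map_sum, map_sum, Finset.smul_sum]
  refine Finset.sum_congr rfl fun j _ => ?_
  rw [map_smul, map_smul, smul_comm]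

end CrossCyclic

section CrossCyclic

open MvPolynomial

variable (N : ℕ) (n : ℤ)

/-- The crossing of upward strands rotated clockwise. -/
noncomputable def rotCW : tensor (BF N (n + 2)) (BF N n) ⟶ tensor (BF N (n + 2)) (BF N n) :=
  Γ₂ (flagMaps N) (Tm.id (Mor.F (n + 2) ⬝ Mor.F n) ⊚
        (Tm.epsh (n + 2) ▹ (Mor.F (n + 2) ⬝ Mor.F n)) ⊚
        (Mor.F (n + 2) ◃ (Tm.epsh n ▹ (Mor.E (n + 2) ⬝ Mor.F (n + 2) ⬝ Mor.F n))) ⊚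
        ((Mor.F (n + 2) ⬝ Mor.F n) ◃ (Tm.U n ▹ (Mor.F (n + 2) ⬝ Mor.F n))) ⊚
        ((Mor.F (n + 2) ⬝ Mor.F n ⬝ Mor.E n) ◃ (Tm.etah (n + 2) ▹ Mor.F n)) ⊚
        ((Mor.F (n + 2) ⬝ Mor.F n) ◃ Tm.etah n) ⊚ Tm.id (Mor.F (n + 2) ⬝ Mor.F n))

variable {N n}

set_option maxHeartbeats 2000000 in
theorem rotCW_tm (h : ValidE N n) (h2 : ValidE N (n + 2)) (f' : (HE N (n + 2)).carrier) (f : (HE N n).carrier) :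
    (rotCW N n).lin (tm _ _ (vF N (n + 2) f') (vF N n f)) =
    ∑ i ∈ Finset.range (N - kk N (n + 2) - 1 + 1), (-1 : ℚ) ^ i •
      ∑ j ∈ Finset.range (N - kk N n - 1 + 1), (-1 : ℚ) ^ j •
        tm _ _ (vF N (n + 2) (yE N (n + 2) i))
          (vF N n (lHom N n (((flagMaps N).etah n).lin (tm _ _ (pairRight f'
            (((flagMaps N).U n).lin
        (tm _ _ (vE N n (xi N n ^ (N - kk N n - 1 - j))) (vE N (n + 2) (xi N (n + 2) ^ (N - kk N (n + 2) - 1 - i))))))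
        (vF N n f))) * yE N n j)) := by
  obtain ⟨φ, e⟩ : ∃ φ, φ = rotCW N n := ⟨_, rfl⟩
  rw [← e]
  unfold rotCW at e
  dsimp only [Tm.cc, Tm.Coh.tm, Γ₂, Γ₁] at e
  simp only [tensorWhiskerRight_id, Category.id_comp, Category.comp_id] at e
  rw [e]
  clear e
  simp -index only [comp_lin, LinearMap.comp_apply, id_lin, LinearMap.id_apply, leftUnit_inv_lin,
    rightUnit_inv_lin]
  simp -index only [id_lin, LinearMap.id_apply, tensorWhiskerRight_id_lin, tensorWhiskerLeft_id_lin,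
    tensorWhiskerRight_regular, tensorWhiskerLeft_regular, tensorWhiskerRight_tm,
    tensorWhiskerLeft_tm, eta_one, epsh_one, casR_eq h, casR_eq h2, map_sum, map_smul, LinearMap.sum_apply,
    LinearMap.smul_apply, assocHom_tm, assocInv_tm, assocInv_regular_right, assocHom_regular_right,
    rightUnit_inv_lin]
  refine Finset.sum_congr rfl fun i _ => congrArg _ ?_
  simp -index only [comp_lin, LinearMap.comp_apply, id_lin, LinearMap.id_apply, leftUnit_inv_lin,
    rightUnit_inv_lin]
  simp -index only [id_lin, LinearMap.id_apply, tensorWhiskerRight_id_lin, tensorWhiskerLeft_id_lin,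
    tensorWhiskerRight_regular, tensorWhiskerLeft_regular, tensorWhiskerRight_tm,
    tensorWhiskerLeft_tm, eta_one, epsh_one, casR_eq h, map_sum, map_smul, LinearMap.sum_apply,
    LinearMap.smul_apply, assocHom_tm, assocInv_tm, assocInv_regular_right, assocHom_regular_right,
    comp_lin, LinearMap.comp_apply]
  refine Finset.sum_congr rfl fun j _ => congrArg _ ?_
  generalize ((flagMaps N).U n).lin _ = u
  induction u using tm_induction with
  | h a b =>
    simp -index only [comp_lin, LinearMap.comp_apply, assocHom_tm, tensorWhiskerLeft_tm, assocInv_tm, tensorWhiskerRight_tm,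
      leftUnit_tm, rightUnit_tm, pairLeft_apply, pairRight_apply, tensor_left, BE_left, BE_right,
      assocHom_regular_right, tensorWhiskerLeft_regular]
    rw [BF_right, tm_right]
  | hadd u v hu hv =>
    simp only [map_add, LinearMap.add_apply, add_mul] at hu hv ⊢
    rw [hu, hv]

variable (N n) in
/-- The crossing of upward strands rotated counterclockwise. -/
noncomputable def rotCCW : tensor (BF N (n + 2)) (BF N n) ⟶ tensor (BF N (n + 2)) (BF N n) :=
  Γ₂ (flagMaps N) (Tm.id (Mor.F (n + 2) ⬝ Mor.F n) ⊚
        ((Mor.F (n + 2) ⬝ Mor.F n) ◃ Tm.eta n) ⊚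
        ((Mor.F (n + 2) ⬝ Mor.F n ⬝ Mor.E n) ◃ (Tm.eta (n + 2) ▹ Mor.F n)) ⊚
        ((Mor.F (n + 2) ⬝ Mor.F n) ◃ (Tm.U n ▹ (Mor.F (n + 2) ⬝ Mor.F n))) ⊚
        (Mor.F (n + 2) ◃ (Tm.eps n ▹ (Mor.E (n + 2) ⬝ Mor.F (n + 2) ⬝ Mor.F n))) ⊚
        (Tm.eps (n + 2) ▹ (Mor.F (n + 2) ⬝ Mor.F n)) ⊚ Tm.id (Mor.F (n + 2) ⬝ Mor.F n))

set_option maxHeartbeats 2000000 in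
theorem rotCCW_tm (h : ValidE N n) (h2 : ValidE N (n + 2)) (f' : (HE N (n + 2)).carrier) (f : (HE N n).carrier) :
    (rotCCW N n).lin (tm _ _ (vF N (n + 2) f') (vF N n f)) =
    ∑ j ∈ Finset.range (kk N n + 1), (-1 : ℚ) ^ j •
      ∑ i ∈ Finset.range (kk N (n + 2) + 1), (-1 : ℚ) ^ i •
        tm _ _ (vF N (n + 2) (rHom N (n + 2) (((flagMaps N).eps (n + 2)).lin (tm _ _ (vF N (n + 2) f')
          (pairLeft f (((flagMaps N).U n).lin
        (tm _ _ (vE N n (xi N n ^ (kk N n - j))) (vE N (n + 2) (xi N (n + 2) ^ (kk N (n + 2) - i)))))))) *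
         xE N (n + 2) i)) (vF N n (xE N n j)) := by
  obtain ⟨φ, e⟩ : ∃ φ, φ = rotCCW N n := ⟨_, rfl⟩
  rw [← e]
  unfold rotCCW at e
  dsimp only [Tm.cc, Tm.Coh.tm, Γ₂, Γ₁] at e
  simp only [tensorWhiskerRight_id, Category.id_comp, Category.comp_id] at e
  rw [e]
  clear e
  simp -index only [comp_lin, LinearMap.comp_apply, id_lin, LinearMap.id_apply, leftUnit_inv_lin,
    rightUnit_inv_lin]
  simp -index only [id_lin, LinearMap.id_apply, tensorWhiskerRight_id_lin, tensorWhiskerLeft_id_lin,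
    tensorWhiskerRight_regular, tensorWhiskerLeft_regular, tensorWhiskerRight_tm,
    tensorWhiskerLeft_tm, eta_one, epsh_one, casL_eq' h, casL_eq' h2, map_sum, map_smul, LinearMap.sum_apply,
    LinearMap.smul_apply, assocHom_tm, assocInv_tm, assocInv_regular_right, assocHom_regular_right,
    comp_lin, LinearMap.comp_apply, leftUnit_inv_lin, rightUnit_inv_lin]
  refine Finset.sum_congr rfl fun i _ => congrArg _ ?_
  refine Finset.sum_congr rfl fun j _ => congrArg _ ?_
  generalize ((flagMaps N).U n).lin _ = u
  induction u using tm_induction with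
  | h a b =>
    simp -index only [comp_lin, LinearMap.comp_apply, assocHom_tm, tensorWhiskerLeft_tm, assocInv_tm, tensorWhiskerRight_tm,
      leftUnit_tm, rightUnit_tm, pairLeft_apply, pairRight_apply, tensor_left, BE_left, BE_right,
      assocHom_regular_right, tensorWhiskerLeft_regular]
    rw [BF_left]
  | hadd u v hu hv =>
    simp only [map_add, LinearMap.add_apply, add_mul] at hu hv ⊢
    rw [hu, hv]
end CrossCyclic

section CrossCyclic

open MvPolynomial

variable {N : ℕ} {n : ℤ}

theorem dual_dotsFF_right (h : ValidE N n) (h2 : ValidE N (n + 2)) (q : MvPolynomial (Fin 2) ℚ) :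
    ∑ i ∈ Finset.range (N - kk N (n + 2) - 1 + 1), (-1 : ℚ) ^ i •
      ∑ j ∈ Finset.range (N - kk N n - 1 + 1), (-1 : ℚ) ^ j •
        tm _ _ (vF N (n + 2) (yE N (n + 2) i)) (vF N n (lHom N n (traceLL N n
          (X 0 ^ (N - kk N n - 1 - j) * X 1 ^ (N - kk N (n + 2) - 1 - i) * q)) * yE N n j)) =
      dotsFF N n q := by
  have key : ∑ i ∈ Finset.range (N - kk N (n + 2) - 1 + 1), (-1 : ℚ) ^ i •
      ∑ j ∈ Finset.range (N - kk N n - 1 + 1), (-1 : ℚ) ^ j •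
        (tm (BF N (n + 2)) (BF N n) (vF N (n + 2) (yE N (n + 2) i)) ∘ₗ vF N n ∘ₗ
          LinearMap.mulRight ℚ (yE N n j) ∘ₗ (lHom N n).toLinearMap ∘ₗ traceLL N n ∘ₗ
            LinearMap.mulLeft ℚ (X 0 ^ (N - kk N n - 1 - j) * X 1 ^ (N - kk N (n + 2) - 1 - i))) =
      dotsFF N n := by
    refine linearMap_ext_fin_two fun a b => ?_
    rw [dotsFF_apply]
    simp only [LinearMap.sum_apply, LinearMap.smul_apply]
    have e : ∀ i, ∑ j ∈ Finset.range (N - kk N n - 1 + 1), (-1 : ℚ) ^ j •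
        tm _ _ (vF N (n + 2) (yE N (n + 2) i)) (vF N n (lHom N n (traceLL N n
          (X 0 ^ (N - kk N n - 1 - j) * X 1 ^ (N - kk N (n + 2) - 1 - i) * (X 0 ^ a * X 1 ^ b))) *
            yE N n j)) =
        tm _ _ (vF N (n + 2) (yE N (n + 2) i * lHom N (n + 2) (traceL N (n + 2)
          (xi N (n + 2) ^ (N - kk N (n + 2) - 1 - i) * xi N (n + 2) ^ b)))) (vF N n (xi N n ^ a)) := by
      intro i
      have := casR_trace h (rHom N n (traceL N (n + 2)
        (xi N (n + 2) ^ (N - kk N (n + 2) - 1 - i) * xi N (n + 2) ^ b)) * xi N n ^ a)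
      rw [mul_comm (yE N (n + 2) i), ← BF_right, tm_right, BF_left]
      conv_rhs => rw [← this]
      rw [map_sum, map_sum]
      refine Finset.sum_congr rfl fun j _ => ?_
      rw [map_smul, map_smul, mul_mul_mul_comm, ← pow_add, ← pow_add, traceLL_apply,
        ← pow_add, mul_comm (yE N n j), mul_left_comm, ← pow_add]
    refine (Finset.sum_congr rfl fun i _ => congrArg _ (e i)).trans ?_
    conv_rhs => rw [← casR_trace h2 (xi N (n + 2) ^ b)]
    rw [map_sum, map_sum, LinearMap.sum_apply]
    refine Finset.sum_congr rfl fun j _ => ?_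
    rw [map_smul, map_smul, LinearMap.smul_apply]
  have := LinearMap.congr_fun key q
  simp only [LinearMap.sum_apply, LinearMap.smul_apply] at this
  exact this

theorem dual_dotsFF_left (h : ValidE N n) (h2 : ValidE N (n + 2)) (q : MvPolynomial (Fin 2) ℚ) :
    ∑ j ∈ Finset.range (kk N n + 1), (-1 : ℚ) ^ j •
      ∑ i ∈ Finset.range (kk N (n + 2) + 1), (-1 : ℚ) ^ i •
        tm _ _ (vF N (n + 2) (rHom N (n + 2) (traceRR N n
          (X 0 ^ (kk N n - j) * X 1 ^ (kk N (n + 2) - i) * q)) * xE N (n + 2) i))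
          (vF N n (xE N n j)) = dotsFF N n q := by
  have key : ∑ j ∈ Finset.range (kk N n + 1), (-1 : ℚ) ^ j •
      ∑ i ∈ Finset.range (kk N (n + 2) + 1), (-1 : ℚ) ^ i •
        ((tm (BF N (n + 2)) (BF N n)).flip (vF N n (xE N n j)) ∘ₗ vF N (n + 2) ∘ₗ
          LinearMap.mulRight ℚ (xE N (n + 2) i) ∘ₗ (rHom N (n + 2)).toLinearMap ∘ₗ traceRR N n ∘ₗ
            LinearMap.mulLeft ℚ (X 0 ^ (kk N n - j) * X 1 ^ (kk N (n + 2) - i))) =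
      dotsFF N n := by
    refine linearMap_ext_fin_two fun a b => ?_
    rw [dotsFF_apply]
    simp only [LinearMap.sum_apply, LinearMap.smul_apply]
    have e : ∀ j, ∑ i ∈ Finset.range (kk N (n + 2) + 1), (-1 : ℚ) ^ i •
        tm _ _ (vF N (n + 2) (rHom N (n + 2) (traceRR N n
          (X 0 ^ (kk N n - j) * X 1 ^ (kk N (n + 2) - i) * (X 0 ^ a * X 1 ^ b))) *
            xE N (n + 2) i)) (vF N n (xE N n j)) =
        tm _ _ (vF N (n + 2) (xi N (n + 2) ^ b)) (vF N n (xE N n j * rHom N n (traceR N n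
          (xi N n ^ (kk N n - j) * xi N n ^ a)))) := by
      intro j
      have := casL_trace h2 (lHom N (n + 2) (traceR N n
        (xi N n ^ (kk N n - j) * xi N n ^ a)) * xi N (n + 2) ^ b)
      rw [mul_comm (xE N n j), ← BF_left, ← tm_right, BF_right]
      conv_rhs => rw [← this]
      rw [map_sum, map_sum, LinearMap.sum_apply]
      refine Finset.sum_congr rfl fun i _ => ?_
      rw [map_smul, map_smul, LinearMap.smul_apply, mul_mul_mul_comm, ← pow_add, ← pow_add,
        traceRR_apply, ← pow_add, mul_comm (xE N (n + 2) i), mul_left_comm, ← pow_add]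
    refine (Finset.sum_congr rfl fun i _ => congrArg _ (e i)).trans ?_
    conv_rhs => rw [← casL_trace h (xi N n ^ a)]
    rw [map_sum, map_sum]
    refine Finset.sum_congr rfl fun j _ => ?_
    rw [map_smul, map_smul]
  have := LinearMap.congr_fun key q
  simp only [LinearMap.sum_apply, LinearMap.smul_apply] at this
  exact this

theorem rotCW_eq : rotCW N n = (flagMaps N).Uh n := by
  refine FF_hom_ext fun h h2 a b => ?_
  have e := Uh_dotsFF (N := N) (n := n) (X 0 ^ a * X 1 ^ b)
  rw [dotsFF_apply, ← dual_dotsFF_right h h2] at e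
  refine (rotCW_tm h h2 _ _).trans (Eq.trans ?_ e.symm)
  refine Finset.sum_congr rfl fun i _ => congrArg _ (Finset.sum_congr rfl fun j _ => ?_)
  rw [← dotsEE_apply, U_dotsEE, etah_pairRight, alternating_divDiff (traceLL_alternating h h2)]

theorem rotCCW_eq : rotCCW N n = (flagMaps N).Uh n := by
  refine FF_hom_ext fun h h2 a b => ?_
  have e := Uh_dotsFF (N := N) (n := n) (X 0 ^ a * X 1 ^ b)
  rw [dotsFF_apply, ← dual_dotsFF_left h h2] at e
  refine (rotCCW_tm h h2 _ _).trans (Eq.trans ?_ e.symm)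
  refine Finset.sum_congr rfl fun i _ => congrArg _ (Finset.sum_congr rfl fun j _ => ?_)
  rw [← dotsEE_apply, U_dotsEE, eps_pairLeft, alternating_divDiff (traceRR_alternating h h2)]

end CrossCyclic

theorem flagMaps_basicRel (N : ℕ) {a b : ℤ} {f g : Mor a b} {s t : Tm f g} (h : BasicRel s t) :
    Γ₂ (flagMaps N) s = Γ₂ (flagMaps N) t := by
  induction h with
  | zigzagE₁ n => exact zigzagE₁_rel N n
  | zigzagE₂ n => exact zigzagE₂_rel N n
  | zigzagF₁ n => exact zigzagF₁_rel N n
  | zigzagF₂ n => exact zigzagF₂_rel N n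
  | dotCyclic₁ n => exact dotCyclic₁_rel N n
  | dotCyclic₂ n => exact dotCyclic₂_rel N n
  | crossCyclic₁ n => exact rotCW_eq
  | crossCyclic₂ n => exact rotCCW_eq
  | cbub_zero n m h => exact cbub_zero_rel N n m h
  | cbub_one n m h => exact cbub_one_rel N n m h
  | ccbub_zero n m h => exact ccbub_zero_rel N n m h
  | ccbub_one n m h => exact ccbub_one_rel N n m h
  | cross_sq n => exact cross_sq_rel N n
  | nilHecke₁ n => exact nilHecke₁_rel N n
  | nilHecke₂ n => exact nilHecke₂_rel N n
  | braid n => exact braid_rel N n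
  | curl₁ n => exact curl₁_rel N n
  | curl₂ n => exact curl₂_rel N n
  | decompEF n => exact decompEF_rel N n
  | decompFE n => exact decompFE_rel N n

theorem isRep_flagMaps (N : ℕ) : IsRep (flagMaps N) where
  rel := rel_of_basicRel fun _ _ h => flagMaps_basicRel N h
  deg := (flagMaps_hasGenDegrees N).hasDegree

section KaroubiExtension

open Idempotents Kar

universe w₁ w₂ v₁ v₂ u₁ u₂

variable {B : Type u₁} [Bicategory.{w₁, v₁} B] {C : Type u₂} [Bicategory.{w₂, v₂} C]

theorem hc_id_left {a b c : C} (f : a ⟶ b) {g h : b ⟶ c} (η : g ⟶ h) : f ◁ η = hc (𝟙 f) η := by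
  simp [hc]

theorem hc_id_right {a b c : C} {f g : a ⟶ b} (η : f ⟶ g) (h : b ⟶ c) : η ▷ h = hc η (𝟙 h) := by
  simp [hc]

theorem hc_comp_assoc {a b c : C} {f f' f'' : a ⟶ b} {g g' g'' : b ⟶ c} (η : f ⟶ f') (η' : f' ⟶ f'')
    (θ : g ⟶ g') (θ' : g' ⟶ g'') {h : a ⟶ c} (κ : f'' ≫ g'' ⟶ h) :
    hc η θ ≫ hc η' θ' ≫ κ = hc (η ≫ η') (θ ≫ θ') ≫ κ := by
  rw [← Category.assoc, hc_comp]

theorem map₂_hc (Γ : Pseudofunctor B C) {a b c : B} {f f' : a ⟶ b} {g g' : b ⟶ c} (η : f ⟶ f')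
    (θ : g ⟶ g') : Γ.map₂ (hc η θ) =
      (Γ.mapComp f g).hom ≫ hc (Γ.map₂ η) (Γ.map₂ θ) ≫ (Γ.mapComp f' g').inv := by
  simp [hc, Γ.map₂_whisker_left, Γ.map₂_whisker_right]

/-- A choice of splittings of the images of all idempotent 2-morphisms. -/
structure LocalSplitting (Γ : Pseudofunctor B C) where
  /-- the image of the idempotent -/
  img : ∀ {a b : B}, Karoubi (a ⟶ b) → (Γ.obj a ⟶ Γ.obj b)
  /-- the inclusion of the image -/
  inc : ∀ {a b : B} (P : Karoubi (a ⟶ b)), img P ⟶ Γ.map P.X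
  /-- the projection to the image -/
  proj : ∀ {a b : B} (P : Karoubi (a ⟶ b)), Γ.map P.X ⟶ img P
  inc_proj : ∀ {a b : B} (P : Karoubi (a ⟶ b)), inc P ≫ proj P = 𝟙 _
  proj_inc : ∀ {a b : B} (P : Karoubi (a ⟶ b)), proj P ≫ inc P = Γ.map₂ P.p

theorem exists_localSplitting (Γ : Pseudofunctor B C)
    (h : ∀ a b : C, IsIdempotentComplete (a ⟶ b)) : Nonempty (LocalSplitting Γ) := by
  choose Y i e h₁ h₂ using fun (q : Σ (a b : B), Karoubi (a ⟶ b)) =>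
    (h (Γ.obj q.1) (Γ.obj q.2.1)).idempotents_split (Γ.map q.2.2.X) (Γ.map₂ q.2.2.p)
      (by rw [← Γ.map₂_comp, q.2.2.idem])
  exact ⟨⟨fun P => Y ⟨_, _, P⟩, fun P => i ⟨_, _, P⟩, fun P => e ⟨_, _, P⟩,
    fun P => h₁ ⟨_, _, P⟩, fun P => h₂ ⟨_, _, P⟩⟩⟩

namespace LocalSplitting

variable {Γ : Pseudofunctor B C} (S : LocalSplitting Γ) {a b c d : B}

theorem inc_p (P : Karoubi (a ⟶ b)) : S.inc P ≫ Γ.map₂ P.p = S.inc P := by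
  rw [← S.proj_inc, ← Category.assoc, S.inc_proj, Category.id_comp]

theorem p_proj (P : Karoubi (a ⟶ b)) : Γ.map₂ P.p ≫ S.proj P = S.proj P := by
  rw [← S.proj_inc, Category.assoc, S.inc_proj, Category.comp_id]

theorem inc_p_assoc (P : Karoubi (a ⟶ b)) {Z : Γ.obj a ⟶ Γ.obj b} (h : Γ.map P.X ⟶ Z) :
    S.inc P ≫ Γ.map₂ P.p ≫ h = S.inc P ≫ h := by rw [← Category.assoc, inc_p]

theorem proj_inc_assoc (P : Karoubi (a ⟶ b)) {Z : Γ.obj a ⟶ Γ.obj b} (h : Γ.map P.X ⟶ Z) :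
    S.proj P ≫ S.inc P ≫ h = Γ.map₂ P.p ≫ h := by rw [← Category.assoc, proj_inc]

/-- The composite of two 1-morphisms of the Karoubi envelope. -/
abbrev kcomp (P : Karoubi (a ⟶ b)) (Q : Karoubi (b ⟶ c)) : Karoubi (a ⟶ c) :=
  ⟨P.X ≫ Q.X, hc P.p Q.p, by rw [hc_comp, P.idem, Q.idem]⟩

/-- The identity 1-morphism of the Karoubi envelope. -/
abbrev kid (a : B) : Karoubi (a ⟶ a) := ⟨𝟙 a, 𝟙 _, Category.id_comp _⟩

/-- The extension of `Γ` on 2-morphisms. -/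
def ext₂ {P Q : Karoubi (a ⟶ b)} (η : P.X ⟶ Q.X) : S.img P ⟶ S.img Q :=
  S.inc P ≫ Γ.map₂ η ≫ S.proj Q

theorem ext₂_comp {P Q R : Karoubi (a ⟶ b)} (η : P.X ⟶ Q.X) (θ : Q.X ⟶ R.X) :
    S.ext₂ (P := P) (Q := Q) η ≫ S.ext₂ (Q := R) θ = S.ext₂ (P := P) (Q := R) (η ≫ Q.p ≫ θ) := by
  simp only [ext₂, Category.assoc, S.proj_inc_assoc, Γ.map₂_comp]

/-- The unit constraint of the extension. -/
def extId (a : B) : S.img (kid a) ≅ 𝟙 (Γ.obj a) where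
  hom := S.inc (kid a) ≫ (Γ.mapId a).hom
  inv := (Γ.mapId a).inv ≫ S.proj (kid a)
  hom_inv_id := by simp [S.inc_proj]
  inv_hom_id := by simp [S.proj_inc_assoc]

/-- The composition constraint of the extension. -/
def extComp (P : Karoubi (a ⟶ b)) (Q : Karoubi (b ⟶ c)) : S.img (kcomp P Q) ≅ S.img P ≫ S.img Q where
  hom := S.inc (kcomp P Q) ≫ (Γ.mapComp P.X Q.X).hom ≫ hc (S.proj P) (S.proj Q)
  inv := hc (S.inc P) (S.inc Q) ≫ (Γ.mapComp P.X Q.X).inv ≫ S.proj (kcomp P Q)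
  hom_inv_id := by
    have e := map₂_hc Γ P.p Q.p
    simp only [Category.assoc, hc_comp_assoc, S.proj_inc]
    rw [← reassoc_of% e, S.inc_p_assoc, S.inc_proj]
  inv_hom_id := by
    have e := map₂_hc Γ P.p Q.p
    simp only [Category.assoc, S.proj_inc_assoc, e, Iso.inv_hom_id_assoc, hc_comp, S.inc_p_assoc, S.inc_proj,
      hc_id]

theorem ext₂_hc {P P' : Karoubi (a ⟶ b)} {Q Q' : Karoubi (b ⟶ c)} (η : P.X ⟶ P'.X)
    (hη : P.p ≫ η ≫ P'.p = η) (θ : Q.X ⟶ Q'.X) (hθ : Q.p ≫ θ ≫ Q'.p = θ) :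
    S.ext₂ (P := kcomp P Q) (Q := kcomp P' Q') (hc η θ) =
      (S.extComp P Q).hom ≫ hc (S.ext₂ (P := P) (Q := P') η) (S.ext₂ (P := Q) (Q := Q') θ) ≫
        (S.extComp P' Q').inv := by
  simp only [ext₂, extComp, Category.assoc, hc_comp_assoc, S.proj_inc_assoc, S.proj_inc, ← Γ.map₂_comp, hη, hθ]
  rw [map₂_hc]
  simp only [Category.assoc]

theorem ext₂_p (P : Karoubi (a ⟶ b)) : S.ext₂ (P := P) (Q := P) P.p = 𝟙 _ := by
  simp only [ext₂, S.p_proj, S.inc_proj]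

theorem p_comp_proj (P : Karoubi (a ⟶ b)) (Q : Karoubi (b ⟶ c)) :
    Γ.map₂ (hc P.p Q.p) ≫ (Γ.mapComp P.X Q.X).hom ≫ hc (S.proj P) (S.proj Q) =
      (Γ.mapComp P.X Q.X).hom ≫ hc (S.proj P) (S.proj Q) := by
  rw [map₂_hc]
  simp only [Category.assoc, Iso.inv_hom_id_assoc, hc_comp, S.p_proj]

theorem inc_comp_p (P : Karoubi (a ⟶ b)) (Q : Karoubi (b ⟶ c)) :
    hc (S.inc P) (S.inc Q) ≫ (Γ.mapComp P.X Q.X).inv ≫ Γ.map₂ (hc P.p Q.p) =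
      hc (S.inc P) (S.inc Q) ≫ (Γ.mapComp P.X Q.X).inv := by
  rw [map₂_hc]
  simp only [Iso.inv_hom_id_assoc, hc_comp_assoc, S.inc_p]

theorem ext₂_assoc (P : Karoubi (a ⟶ b)) (Q : Karoubi (b ⟶ c)) (R : Karoubi (c ⟶ d)) :
    S.ext₂ (P := kcomp (kcomp P Q) R) (Q := kcomp P (kcomp Q R))
        (hc (hc P.p Q.p) R.p ≫ (α_ P.X Q.X R.X).hom) =
      (S.extComp (kcomp P Q) R).hom ≫ hc (S.extComp P Q).hom (𝟙 (S.img R)) ≫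
        (α_ (S.img P) (S.img Q) (S.img R)).hom ≫ hc (𝟙 (S.img P)) (S.extComp Q R).inv ≫
          (S.extComp P (kcomp Q R)).inv := by
  have e1 : S.inc (kcomp (kcomp P Q) R) ≫ Γ.map₂ (hc (hc P.p Q.p) R.p) = S.inc _ := S.inc_p _
  have e2 : hc (Γ.map₂ P.p) (hc (Γ.map₂ Q.p) (Γ.map₂ R.p) ≫ (Γ.mapComp Q.X R.X).inv) ≫
      (Γ.mapComp P.X (Q.X ≫ R.X)).inv = hc (𝟙 _) (Γ.mapComp Q.X R.X).inv ≫
      (Γ.mapComp P.X (Q.X ≫ R.X)).inv ≫ Γ.map₂ (hc P.p (hc Q.p R.p)) := by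
    rw [map₂_hc, map₂_hc]
    simp only [hc_comp_assoc, Iso.inv_hom_id_assoc, Category.comp_id, Category.id_comp]
  have e3 : Γ.map₂ (hc P.p (hc Q.p R.p)) ≫ S.proj (kcomp P (kcomp Q R)) =
      S.proj (kcomp P (kcomp Q R)) := S.p_proj (kcomp P (kcomp Q R))
  simp only [ext₂, extComp, Category.assoc, hc_comp_assoc, S.proj_inc_assoc, S.proj_inc, Γ.map₂_comp,
    reassoc_of% e1, Category.comp_id, Category.id_comp, S.p_comp_proj, S.inc_comp_p, Γ.map₂_associator]
  have e4 : hc ((Γ.mapComp P.X Q.X).hom ≫ hc (S.proj P) (S.proj Q)) (S.proj R) =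
      hc (Γ.mapComp P.X Q.X).hom (𝟙 _) ≫ hc (hc (S.proj P) (S.proj Q)) (S.proj R) := by
    rw [hc_comp, Category.id_comp]
  have e5 : hc (S.inc P) (hc (S.inc Q) (S.inc R) ≫ (Γ.mapComp Q.X R.X).inv) =
      hc (S.inc P) (hc (S.inc Q) (S.inc R)) ≫ hc (𝟙 _) (Γ.mapComp Q.X R.X).inv := by
    rw [hc_comp, Category.comp_id]
  have e6 := hc_assoc (S.proj P) (S.proj Q) (S.proj R)
  rw [e4, e5]
  simp only [Category.assoc, reassoc_of% e6]
  simp only [hc_comp_assoc, hc_comp, S.proj_inc, Category.comp_id,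
    reassoc_of% e2, e3, hc_id_left, hc_id_right]

theorem ext₂_leftUnit (P : Karoubi (a ⟶ b)) :
    S.ext₂ (P := kcomp (kid a) P) (Q := P) (hc (𝟙 _) P.p ≫ (λ_ P.X).hom) =
      (S.extComp (kid a) P).hom ≫ hc (S.extId a).hom (𝟙 (S.img P)) ≫ (λ_ (S.img P)).hom := by
  have e1 : S.inc (kcomp (kid a) P) ≫ Γ.map₂ (hc (𝟙 _) P.p) = S.inc _ := S.inc_p _
  have e2 := hc_leftUnit (S.proj P)
  have e3 : hc (S.proj (kid a) ≫ S.inc (kid a) ≫ (Γ.mapId a).hom) (S.proj P) =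
      hc (Γ.mapId a).hom (𝟙 _) ≫ hc (𝟙 _) (S.proj P) := by
    rw [S.proj_inc_assoc, hc_comp]
    simp
  simp only [ext₂, extComp, extId, Category.assoc, hc_comp_assoc, Γ.map₂_comp, reassoc_of% e1, Category.comp_id, e3, e2,
    Γ.map₂_left_unitor, hc_id_right]

theorem ext₂_rightUnit (P : Karoubi (a ⟶ b)) :
    S.ext₂ (P := kcomp P (kid b)) (Q := P) (hc P.p (𝟙 _) ≫ (ρ_ P.X).hom) =
      (S.extComp P (kid b)).hom ≫ hc (𝟙 (S.img P)) (S.extId b).hom ≫ (ρ_ (S.img P)).hom := by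
  have e1 : S.inc (kcomp P (kid b)) ≫ Γ.map₂ (hc P.p (𝟙 _)) = S.inc _ := S.inc_p _
  have e2 := hc_rightUnit (S.proj P)
  have e3 : hc (S.proj P) (S.proj (kid b) ≫ S.inc (kid b) ≫ (Γ.mapId b).hom) =
      hc (𝟙 _) (Γ.mapId b).hom ≫ hc (S.proj P) (𝟙 _) := by
    rw [S.proj_inc_assoc, hc_comp]
    simp
  simp only [ext₂, extComp, extId, Category.assoc, hc_comp_assoc, Γ.map₂_comp, reassoc_of% e1, Category.comp_id, e3, e2,
    Γ.map₂_right_unitor, hc_id_left]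

/-- The extension of a pseudofunctor along the local Karoubi envelope. -/
def extend : Pseudofunctor (Kar B) C where
  obj a := Γ.obj a.as
  map {a b} (P : Karoubi (a.as ⟶ b.as)) := S.img P
  map₂ {a b P Q} η := S.ext₂ (P := P) (Q := Q) η.f
  mapId a := S.extId a.as
  mapComp {a b c} P Q := S.extComp P Q
  map₂_id P := S.ext₂_p P
  map₂_comp {a b P Q R} η θ := by
    rw [ext₂_comp]
    congr 1
    exact congrArg (η.f ≫ ·) (Karoubi.p_comp θ).symm
  map₂_whisker_left {a b c} P {Q R} η := by
    have e := S.ext₂_hc (a := a.as) (b := b.as) (c := c.as) (P := P) (P' := P) (Q := Q) (Q' := R)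
      P.p (by rw [P.idem, P.idem]) η.f η.comm
    rw [S.ext₂_p P, ← hc_id_left] at e
    exact e
  map₂_whisker_right {a b c P Q} η R := by
    have e := S.ext₂_hc (a := a.as) (b := b.as) (c := c.as) (P := P) (P' := Q) (Q := R) (Q' := R)
      η.f η.comm R.p (by rw [R.idem, R.idem])
    rw [S.ext₂_p R, ← hc_id_right] at e
    exact e
  map₂_associator {a b c d} P Q R := by
    have e := S.ext₂_assoc (a := a.as) (b := b.as) (c := c.as) (d := d.as) P Q R
    rw [← hc_id_left, ← hc_id_right] at e
    exact e
  map₂_left_unitor {a b} P := by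
    have e := S.ext₂_leftUnit (a := a.as) (b := b.as) P
    rw [← hc_id_right] at e
    exact e
  map₂_right_unitor {a b} P := by
    have e := S.ext₂_rightUnit (a := a.as) (b := b.as) P
    rw [← hc_id_left] at e
    exact e

/-- The idempotent `𝟙 f`, an object of the Karoubi envelope. -/
abbrev kincl (f : a ⟶ b) : Karoubi (a ⟶ b) := ⟨f, 𝟙 f, Category.comp_id _⟩

/-- The splitting of an identity 2-morphism. -/
def imgIncl (f : a ⟶ b) : S.img (kincl f) ≅ Γ.map f where
  hom := S.inc (kincl f)
  inv := S.proj (kincl f)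
  hom_inv_id := S.inc_proj _
  inv_hom_id := (S.proj_inc _).trans (Γ.map₂_id f)

/-- The extension restricts to `Γ`, up to the identity on objects. -/
def extendIncl : Pseudofunctor.StrongTrans ((Kar.incl B).comp S.extend) Γ where
  app a := 𝟙 (Γ.obj a)
  naturality {a b} f := (ρ_ (S.img (kincl f))) ≪≫ S.imgIncl f ≪≫ (λ_ (Γ.map f)).symm
  naturality_naturality {a b f g} η := by
    change S.ext₂ (P := kincl f) (Q := kincl g) η ▷ 𝟙 (Γ.obj b) ≫ (ρ_ (S.img (kincl g))).hom ≫
      S.inc (kincl g) ≫ (λ_ (Γ.map g)).inv = ((ρ_ (S.img (kincl f))).hom ≫ S.inc (kincl f) ≫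
        (λ_ (Γ.map f)).inv) ≫ 𝟙 (Γ.obj a) ◁ Γ.map₂ η
    have e := S.proj_inc (kincl g)
    simp [ext₂, reassoc_of% e]
  naturality_id a := by
    change ((ρ_ (S.img (kid a))).hom ≫ S.inc (kid a) ≫ (λ_ (Γ.map (𝟙 a))).inv) ≫
      𝟙 (Γ.obj a) ◁ (Γ.mapId a).hom = (S.ext₂ (P := kid a) (Q := kid a) (𝟙 _) ≫ S.inc (kid a) ≫ (Γ.mapId a).hom) ▷ 𝟙 (Γ.obj a) ≫
        (λ_ (𝟙 (Γ.obj a))).hom ≫ (ρ_ (𝟙 (Γ.obj a))).inv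
    have e := S.ext₂_p (kid a)
    rw [e]
    simp
  naturality_comp {a b c} f g := by
    change ((ρ_ (S.img (kincl (f ≫ g)))).hom ≫ S.inc (kincl (f ≫ g)) ≫ (λ_ (Γ.map (f ≫ g))).inv) ≫
      𝟙 (Γ.obj a) ◁ (Γ.mapComp f g).hom = 
      (S.ext₂ (P := kincl (f ≫ g)) (Q := kcomp (kincl f) (kincl g)) (𝟙 (f ≫ g) ≫ 𝟙 _) ≫ S.inc (kcomp (kincl f) (kincl g)) ≫
        (Γ.mapComp f g).hom ≫ hc (S.proj (kincl f)) (S.proj (kincl g))) ▷ 𝟙 (Γ.obj c) ≫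
      (α_ _ _ _).hom ≫ S.img (kincl f) ◁ ((ρ_ (S.img (kincl g))).hom ≫ S.inc (kincl g) ≫ (λ_ (Γ.map g)).inv) ≫
        (α_ _ _ _).inv ≫ ((ρ_ (S.img (kincl f))).hom ≫ S.inc (kincl f) ≫ (λ_ (Γ.map f)).inv) ▷ Γ.map g ≫ (α_ _ _ _).hom
    have e : S.ext₂ (P := kincl (f ≫ g)) (Q := kcomp (kincl f) (kincl g)) (𝟙 (f ≫ g) ≫ 𝟙 _) ≫
        S.inc (kcomp (kincl f) (kincl g)) = S.inc (kincl (f ≫ g)) := by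
      simp only [ext₂, Category.assoc, S.proj_inc, Category.id_comp, Γ.map₂_id, hc_id]
      exact Category.comp_id _
    have e1 : S.proj (kincl f) ≫ S.inc (kincl f) = 𝟙 _ := (S.imgIncl f).inv_hom_id
    have e2 : S.proj (kincl g) ≫ S.inc (kincl g) = 𝟙 _ := (S.imgIncl g).inv_hom_id
    have e3 : S.img (kincl f) ◁ S.proj (kincl g) ≫ S.img (kincl f) ◁ S.inc (kincl g) = 𝟙 _ := by
      rw [← Bicategory.whiskerLeft_comp, e2, Bicategory.whiskerLeft_id]
    have e4 : S.proj (kincl f) ▷ Γ.map g ≫ S.inc (kincl f) ▷ Γ.map g = 𝟙 _ := by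
      rw [← Bicategory.comp_whiskerRight, e1, Bicategory.id_whiskerRight]
    have e' : ∀ {Z} (h : _ ⟶ Z), S.ext₂ (P := kincl (f ≫ g)) (Q := kcomp (kincl f) (kincl g))
        (𝟙 (f ≫ g) ≫ 𝟙 _) ≫ S.inc (kcomp (kincl f) (kincl g)) ≫ h = S.inc (kincl (f ≫ g)) ≫ h :=
      fun h => by rw [← Category.assoc, e]
    rw [e']
    simp [hc, reassoc_of% e3, reassoc_of% e4]

theorem isIcon_extendIncl : IsIcon S.extendIncl := fun _ => ⟨rfl, rfl⟩

section Lift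

/-- A 1-morphism of `B`, seen in the Karoubi envelope. -/
def kin {a b : Kar B} (f : a.as ⟶ b.as) : a ⟶ b := kincl f

/-- A 2-morphism of `B`, seen in the Karoubi envelope. -/
def kin₂ {a b : Kar B} {f g : a.as ⟶ b.as} (η : f ⟶ g) : kin (a := a) (b := b) f ⟶ kin g :=
  (⟨η, by simp⟩ : Karoubi.Hom (kincl f) (kincl g))

/-- The identification of two versions of the identity. -/
def kinId (a : Kar B) : kin (𝟙 a.as) ⟶ 𝟙 a := 𝟙 (𝟙 a)

/-- The identification of two versions of a composite. -/
def kinComp {a b c : Kar B} (f : a.as ⟶ b.as) (g : b.as ⟶ c.as) :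
    kin (a := a) (b := c) (f ≫ g) ⟶ kin (b := b) f ≫ kin g :=
  ((Kar.incl B).mapComp f g).hom

/-- The inclusion of a 1-morphism of the Karoubi envelope in the ambient 1-morphism. -/
def kinc {a b : Kar B} (P : a ⟶ b) : P ⟶ kin P.X :=
  (⟨P.p, by change P.p ≫ P.p ≫ 𝟙 _ = P.p; rw [Category.comp_id, P.idem]⟩ :
    Karoubi.Hom (C := a.as ⟶ b.as) P (kincl P.X))

/-- The projection to a 1-morphism of the Karoubi envelope. -/
def kproj {a b : Kar B} (P : a ⟶ b) : kin P.X ⟶ P :=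
  (⟨P.p, by change 𝟙 _ ≫ P.p ≫ P.p = P.p; rw [Category.id_comp, P.idem]⟩ :
    Karoubi.Hom (C := a.as ⟶ b.as) (kincl P.X) P)

/-- A transformation from a pseudofunctor on the Karoubi envelope to a pseudofunctor on `B`. -/
structure LiftData (F : Pseudofunctor (Kar B) C) (Γ : Pseudofunctor B C) where
  /-- the components -/
  app : ∀ a : Kar B, F.obj a ⟶ Γ.obj a.as
  /-- the naturality constraint -/
  nat : ∀ {a b : Kar B} (f : a.as ⟶ b.as), F.map (kin (b := b) f) ≫ app b ≅ app a ≫ Γ.map f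
  nat_nat : ∀ {a b : Kar B} {f g : a.as ⟶ b.as} (η : f ⟶ g),
    F.map₂ (kin₂ (b := b) η) ▷ app b ≫ (nat g).hom = (nat f).hom ≫ app a ◁ Γ.map₂ η
  nat_id : ∀ a : Kar B, (nat (𝟙 a.as)).hom ≫ app a ◁ (Γ.mapId a.as).hom =
    (F.map₂ (kinId a) ≫ (F.mapId a).hom) ▷ app a ≫ (λ_ (app a)).hom ≫ (ρ_ (app a)).inv
  nat_comp : ∀ {a b c : Kar B} (f : a.as ⟶ b.as) (g : b.as ⟶ c.as),
    (nat (b := c) (f ≫ g)).hom ≫ app a ◁ (Γ.mapComp f g).hom =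
      (F.map₂ (kinComp f g) ≫ (F.mapComp (kin (b := b) f) (kin g)).hom) ▷ app c ≫ (α_ _ _ _).hom ≫
      F.map (kin f) ◁ (nat g).hom ≫ (α_ _ _ _).inv ≫ (nat f).hom ▷ Γ.map g ≫ (α_ _ _ _).hom

/-- A transformation of restrictions to `B`, as data on the Karoubi envelope. -/
def LiftData.ofStrongTrans {F : Pseudofunctor (Kar B) C}
    (σ : Pseudofunctor.StrongTrans ((Kar.incl B).comp F) Γ) : LiftData F Γ where
  app a := σ.app a.as
  nat f := σ.naturality f
  nat_nat η := σ.naturality_naturality η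
  nat_id a := σ.naturality_id a.as
  nat_comp f g := σ.naturality_comp f g

variable {F : Pseudofunctor (Kar B) C} (σ : LiftData F Γ)

/-- The naturality constraint of a lift to the Karoubi envelope. -/
def liftIso {a b : Kar B} (P : a ⟶ b) : F.map P ≫ σ.app b ≅ σ.app a ≫ S.img P where
  hom := F.map₂ (kinc P) ▷ σ.app b ≫ (σ.nat P.X).hom ≫ σ.app a ◁ S.proj P
  inv := σ.app a ◁ S.inc P ≫ (σ.nat P.X).inv ≫ F.map₂ (kproj P) ▷ σ.app b
  hom_inv_id := by
    have e1 : σ.app a ◁ S.proj P ≫ σ.app a ◁ S.inc P = σ.app a ◁ Γ.map₂ P.p := by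
      rw [← Bicategory.whiskerLeft_comp, S.proj_inc]
    have e2 : kinc P ≫ kin₂ P.p ≫ kproj P = 𝟙 P := Karoubi.hom_ext _ _ (by
      change P.p ≫ P.p ≫ P.p = P.p
      rw [P.idem, P.idem])
    have e3 := σ.nat_nat (a := a) (b := b) P.p
    simp only [Category.assoc, reassoc_of% e1]
    rw [← reassoc_of% e3, Iso.hom_inv_id_assoc, ← comp_whiskerRight,
      ← comp_whiskerRight, ← F.map₂_comp, ← F.map₂_comp, e2, F.map₂_id, id_whiskerRight]
  inv_hom_id := by
    have e2 : kproj P ≫ kinc P = kin₂ P.p := Karoubi.hom_ext _ _ P.idem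
    have e1 : F.map₂ (kproj P) ▷ σ.app b ≫ F.map₂ (kinc P) ▷ σ.app b =
        F.map₂ (kin₂ P.p) ▷ σ.app b := by
      rw [← comp_whiskerRight, ← F.map₂_comp, e2]
    have e3 := σ.nat_nat (a := a) (b := b) P.p
    simp only [Category.assoc, reassoc_of% e1]
    rw [reassoc_of% e3, Iso.inv_hom_id_assoc, ← Bicategory.whiskerLeft_comp,
      ← Bicategory.whiskerLeft_comp, S.p_proj, S.inc_proj, Bicategory.whiskerLeft_id]

theorem lift_coherence {a a' b b' c c' : C} {f f' : a ⟶ b} {g g' : b ⟶ c} (u : f ⟶ f') (v : g ⟶ g')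
    {x : a ⟶ a'} {y : b ⟶ b'} {z : c ⟶ c'} {h h' : a' ⟶ b'} {k k' : b' ⟶ c'} (s : f' ≫ y ⟶ x ≫ h)
    (t : g' ≫ z ⟶ y ≫ k) (p : h ⟶ h') (q : k ⟶ k') :
    hc u v ▷ z ≫ (α_ _ _ _).hom ≫ f' ◁ t ≫ (α_ _ _ _).inv ≫ s ▷ k ≫ (α_ _ _ _).hom ≫
      x ◁ hc p q = (α_ _ _ _).hom ≫ f ◁ (v ▷ z ≫ t ≫ y ◁ q) ≫ (α_ _ _ _).inv ≫
        (u ▷ y ≫ s ≫ x ◁ p) ▷ k' ≫ (α_ _ _ _).hom := by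
  have h1 : (α_ f g' z).inv ≫ u ▷ g' ▷ z ≫ (α_ f' g' z).hom ≫ f' ◁ t ≫ f' ◁ y ◁ q ≫
      (α_ f' y k').inv = f ◁ t ≫ f ◁ y ◁ q ≫ (α_ f y k').inv ≫ u ▷ y ▷ k' := by
    have := whisker_exchange u (t ≫ y ◁ q)
    simp only [whiskerRight_comp, Category.assoc, Bicategory.whiskerLeft_comp] at this
    rw [← reassoc_of% this]
    simp
  have h2 : s ▷ k ≫ (α_ x h k).hom ≫ x ◁ h ◁ q = (f' ≫ y) ◁ q ≫ s ▷ k' ≫ (α_ x h k').hom := by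
    rw [whisker_exchange_assoc]
    simp
  simp [hc, ← whisker_exchange_assoc, ← whisker_exchange, reassoc_of% h1, reassoc_of% h2]

/-- A transformation of restrictions to `B` extends to the Karoubi envelope. -/
def lift : Pseudofunctor.StrongTrans F S.extend where
  app a := σ.app a
  naturality P := S.liftIso σ P
  naturality_naturality {a b P Q} η := by
    have e : η ≫ kinc Q = kinc P ≫ kin₂ (a := a) (b := b) (P.p ≫ η.f) :=
      Karoubi.hom_ext _ _ (by
        change η.f ≫ Q.p = P.p ≫ P.p ≫ η.f
        rw [Karoubi.comp_p, P.idem_assoc, Karoubi.p_comp])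
    have e3 := σ.nat_nat (a := a) (b := b) (P.p ≫ η.f)
    change F.map₂ η ▷ σ.app b ≫ F.map₂ (kinc Q) ▷ σ.app b ≫ (σ.nat Q.X).hom ≫
      σ.app a ◁ S.proj Q = (F.map₂ (kinc P) ▷ σ.app b ≫ (σ.nat P.X).hom ≫
      σ.app a ◁ S.proj P) ≫ σ.app a ◁ (S.inc P ≫ Γ.map₂ η.f ≫ S.proj Q)
    rw [← comp_whiskerRight_assoc, ← F.map₂_comp, e, F.map₂_comp, comp_whiskerRight_assoc,
      reassoc_of% e3]
    simp only [Category.assoc, ← Bicategory.whiskerLeft_comp, S.proj_inc_assoc, Γ.map₂_comp]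
  naturality_id a := by
    have e := σ.nat_id a
    have e1 : kinc (𝟙 a) ≫ kinId a = 𝟙 _ := Karoubi.hom_ext _ _ (by
      change 𝟙 _ ≫ 𝟙 _ = 𝟙 (𝟙 a.as)
      simp)
    change (F.map₂ (kinc (𝟙 a)) ▷ σ.app a ≫ (σ.nat (𝟙 a.as)).hom ≫
      σ.app a ◁ S.proj (kid a.as)) ≫ σ.app a ◁ (S.inc (kid a.as) ≫ (Γ.mapId a.as).hom) = _
    simp only [Category.assoc, ← Bicategory.whiskerLeft_comp]
    rw [S.proj_inc_assoc, Γ.map₂_id, Category.id_comp, e, ← comp_whiskerRight_assoc,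
      ← Category.assoc (F.map₂ _), ← F.map₂_comp, e1, F.map₂_id, Category.id_comp]
    rfl
  naturality_comp {a b c} P Q := by
    have e := σ.nat_comp (a := a) (b := b) (c := c) P.X Q.X
    have e1 : kinc (P ≫ Q) ≫ kinComp P.X Q.X = hc (kinc P) (kinc Q) := Karoubi.hom_ext _ _ (by
      change hc P.p Q.p ≫ 𝟙 _ ≫ 𝟙 _ = hc P.p Q.p ≫ hc (𝟙 _) Q.p
      rw [hc_comp, Q.idem]
      simp)
    have e2 := map₂_hc F (kinc P) (kinc Q)
    change (F.map₂ (kinc (P ≫ Q)) ▷ σ.app c ≫ (σ.nat (P.X ≫ Q.X)).hom ≫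
      σ.app a ◁ S.proj (kcomp P Q)) ≫ σ.app a ◁ (S.inc (kcomp P Q) ≫ (Γ.mapComp P.X Q.X).hom ≫
        hc (S.proj P) (S.proj Q)) = (F.mapComp P Q).hom ▷ σ.app c ≫ (α_ _ _ _).hom ≫
        F.map P ◁ (F.map₂ (kinc Q) ▷ σ.app c ≫ (σ.nat Q.X).hom ≫
      σ.app b ◁ S.proj Q) ≫ (α_ _ _ _).inv ≫ (F.map₂ (kinc P) ▷ σ.app b ≫ (σ.nat P.X).hom ≫
      σ.app a ◁ S.proj P) ▷ S.img Q ≫ (α_ _ _ _).hom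
    have e3 := S.p_comp_proj (a := a.as) (b := b.as) (c := c.as) P Q
    rw [← lift_coherence]
    simp only [Category.assoc, ← Bicategory.whiskerLeft_comp]
    rw [S.proj_inc_assoc, e3, Bicategory.whiskerLeft_comp, reassoc_of% e, ← comp_whiskerRight_assoc,
      ← Category.assoc (F.map₂ _), ← F.map₂_comp, e1, e2]
    simp

theorem isIcon_lift {σ : Pseudofunctor.StrongTrans ((Kar.incl B).comp F) Γ} (hσ : IsIcon σ) :
    IsIcon (S.lift (LiftData.ofStrongTrans σ)) := fun a => hσ a.as

end Lift

end LocalSplitting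

end KaroubiExtension

section Retracts

variable {A B C : GrAlg}

theorem BimHom.HasDegree.mem {M P : GrBimod A B} {φ : M ⟶ P} (h : φ.HasDegree 0) {i : ℤ}
    {m : M.carrier} (hm : m ∈ M.gr i) : φ.lin m ∈ P.gr i := by
  have := h i m hm
  rwa [add_zero] at this

theorem BimHom.HasDegree.of_mem {M P : GrBimod A B} {φ : M ⟶ P}
    (h : ∀ i, ∀ m ∈ M.gr i, φ.lin m ∈ P.gr i) : φ.HasDegree 0 := fun i m hm => by
  rw [add_zero]; exact h i m hm

theorem BimHom.HasDegree.comp_zero {M P Q : GrBimod A B} {φ : M ⟶ P} {ψ : P ⟶ Q}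
    (h : φ.HasDegree 0) (h' : ψ.HasDegree 0) : (φ ≫ ψ).HasDegree 0 :=
  .of_mem fun _ _ hm => h'.mem (h.mem hm)

theorem BimHom.HasDegree.components {M P : GrBimod A B} {φ : M ⟶ P} (h : φ.HasDegree 0)
    (m : M.carrier) (i : ℤ) :
    CatVN.components P.internal (φ.lin m) i = φ.lin (CatVN.components M.internal m i) := by
  have : (CatVN.components P.internal) ∘ₗ φ.lin =
      (Finsupp.mapRange.linearMap φ.lin) ∘ₗ (CatVN.components M.internal) := by
    refine hom_ext_of_homogeneous M.internal fun i m hm => ?_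
    simp [components_of_mem M.internal hm, components_of_mem P.internal (h.mem hm)]
  have := DFunLike.congr_fun (LinearMap.congr_fun this m) i
  simpa using this

/-- The image of an idempotent endomorphism of degree zero. -/
noncomputable def GrBimod.image {M : GrBimod A B} (p : M ⟶ M) (hp : p.HasDegree 0) (h : p ≫ p = p) :
    GrBimod A B where
  carrier := LinearMap.range p.lin
  left :=
    { toFun := fun a => (M.left a).restrict (by
        rintro _ ⟨m, rfl⟩; exact ⟨M.left a m, p.map_left a m⟩)
      map_one' := by ext; simp
      map_mul' := fun a b => by ext; simp
      map_zero' := by ext; simp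
      map_add' := fun a b => by ext; simp
      commutes' := fun r => by ext; simp }
  right :=
    { toFun := fun a => (M.right a).restrict (by
        rintro _ ⟨m, rfl⟩; exact ⟨M.right a m, p.map_right a m⟩)
      map_one' := by ext; simp
      map_mul' := fun a b => by ext; simp
      map_zero' := by ext; simp
      map_add' := fun a b => by ext; simp
      commutes' := fun r => by ext; simp }
  left_right a b m := Subtype.ext (M.left_right a b m)
  gr i := (M.gr i).comap (LinearMap.range p.lin).subtype
  internal := by
    refine isInternal_of_components _ ((Finsupp.mapRange.linearMap p.lin.rangeRestrict) ∘ₗ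
      components M.internal ∘ₗ (LinearMap.range p.lin).subtype) ?_ ?_ ?_
    · intro m i
      exact hp.mem (components_mem M.internal m.1 i)
    · rintro ⟨_, m, rfl⟩
      rw [LinearMap.comp_apply, GrAlg.total_mapRange, LinearMap.comp_apply, components_sum]
      exact Subtype.ext (LinearMap.congr_fun (congrArg BimHom.lin h) m)
    · rintro i ⟨_, m, rfl⟩ hm
      rw [LinearMap.comp_apply, LinearMap.comp_apply]
      refine (congrArg _ (components_of_mem M.internal hm)).trans ?_
      rw [Finsupp.mapRange.linearMap_apply, Finsupp.mapRange_single]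
      exact congrArg _ (Subtype.ext (LinearMap.congr_fun (congrArg BimHom.lin h) m))
  left_mem ha hm := M.left_mem ha hm
  right_mem ha hm := M.right_mem ha hm

theorem exists_splitting {M : GrBimod A B} (p : M ⟶ M) (hp : p.HasDegree 0) (h : p ≫ p = p) :
    ∃ (P : GrBimod A B) (i : P ⟶ M) (r : M ⟶ P), i.HasDegree 0 ∧ r.HasDegree 0 ∧ i ≫ r = 𝟙 P ∧
      r ≫ i = p := by
  let i : GrBimod.image p hp h ⟶ M :=
    (⟨(LinearMap.range p.lin).subtype, fun _ _ => rfl, fun _ _ => rfl⟩ : BimHom _ _)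
  let r : M ⟶ GrBimod.image p hp h :=
    (⟨p.lin.rangeRestrict, fun a m => Subtype.ext (p.map_left a m),
      fun a m => Subtype.ext (p.map_right a m)⟩ : BimHom _ _)
  refine ⟨GrBimod.image p hp h, i, r, .of_mem fun _ _ hm => hm, .of_mem fun _ _ hm => hp.mem hm, ?_, ?_⟩
  · refine GrBimod.hom_ext (LinearMap.ext ?_)
    rintro ⟨_, m, rfl⟩
    exact Subtype.ext (LinearMap.congr_fun (congrArg BimHom.lin h) m)
  · exact GrBimod.hom_ext (LinearMap.ext fun m => rfl)

theorem isIdempotentComplete_eqFlag (N : ℕ) (a b : EqFlag N) : IsIdempotentComplete (a ⟶ b) where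
  idempotents_split X p hp := by
    obtain ⟨P, i, r, hi, hr, h1, h2⟩ := exists_splitting p.val p.prop (congrArg Sub.Hom₂.val hp)
    exact ⟨⟨P, .retract i r hi hr h1 X.prop⟩, (⟨i, hi⟩ : Sub.Hom₂ _ _), (⟨r, hr⟩ : Sub.Hom₂ _ _),
      Sub.Hom₂.ext h1, Sub.Hom₂.ext h2⟩

/-- `M` is a direct summand of `P`. -/
def GrRet (M P : GrBimod A B) : Prop :=
  ∃ (i : M ⟶ P) (r : P ⟶ M), i.HasDegree 0 ∧ r.HasDegree 0 ∧ i ≫ r = 𝟙 M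

theorem GrIso.refl (M : GrBimod A B) : GrIso M M :=
  ⟨𝟙 M, 𝟙 M, BimHom.hasDegree_id M, BimHom.hasDegree_id M, Category.id_comp _, Category.id_comp _⟩

theorem GrIso.symm {M P : GrBimod A B} (h : GrIso M P) : GrIso P M := by
  obtain ⟨φ, ψ, h1, h2, h3, h4⟩ := h
  exact ⟨ψ, φ, h2, h1, h4, h3⟩

theorem GrIso.trans {M P Q : GrBimod A B} (h : GrIso M P) (h' : GrIso P Q) : GrIso M Q := by
  obtain ⟨φ, ψ, h1, h2, h3, h4⟩ := h
  obtain ⟨φ', ψ', h1', h2', h3', h4'⟩ := h'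
  refine ⟨φ ≫ φ', ψ' ≫ ψ, h1.comp_zero h1', h2'.comp_zero h2, ?_, ?_⟩
  · rw [Category.assoc, reassoc_of% h3', h3]
  · rw [Category.assoc, reassoc_of% h4, h4']

theorem GrIso.ret {M P : GrBimod A B} (h : GrIso M P) : GrRet M P := by
  obtain ⟨φ, ψ, h1, h2, h3, -⟩ := h
  exact ⟨φ, ψ, h1, h2, h3⟩

theorem grIso_of_subsingleton {M P : GrBimod A B} (h : Subsingleton M.carrier)
    (h' : Subsingleton P.carrier) : GrIso M P :=
  ⟨BimHom.zero M P, BimHom.zero P M, BimHom.hasDegree_zero _ _ _, BimHom.hasDegree_zero _ _ _,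
    hom_eq_of_subsingleton h _ _, hom_eq_of_subsingleton h' _ _⟩

/-- An isomorphism of bimodules given by an invertible linear map. -/
theorem grIso_of_equiv {M P : GrBimod A B} (e : M.carrier ≃ₗ[ℚ] P.carrier)
    (hl : ∀ a m, e (M.left a m) = P.left a (e m)) (hr : ∀ b m, e (M.right b m) = P.right b (e m))
    (h : ∀ i, ∀ m ∈ M.gr i, e m ∈ P.gr i) (h' : ∀ i, ∀ m ∈ P.gr i, e.symm m ∈ M.gr i) :
    GrIso M P :=
  ⟨(⟨e, hl, hr⟩ : BimHom _ _), (⟨e.symm,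
      fun a m => e.symm_apply_eq.2 ((congrArg (P.left a) (e.apply_symm_apply m)).symm.trans (hl a (e.symm m)).symm),
      fun a m => e.symm_apply_eq.2 ((congrArg (P.right a) (e.apply_symm_apply m)).symm.trans (hr a (e.symm m)).symm)⟩ : BimHom _ _), .of_mem h, .of_mem h',
    GrBimod.hom_ext (LinearMap.ext fun m => e.symm_apply_apply m),
    GrBimod.hom_ext (LinearMap.ext fun m => e.apply_symm_apply m)⟩

section Additive

variable {M P : GrBimod A B}

instance : Zero (M ⟶ P) := ⟨BimHom.zero M P⟩
instance : Add (M ⟶ P) := ⟨BimHom.add⟩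
instance : Neg (M ⟶ P) := ⟨fun φ => BimHom.smul (-1) φ⟩
instance : _root_.Sub (M ⟶ P) := ⟨fun φ ψ => BimHom.add φ (BimHom.smul (-1) ψ)⟩
instance : SMul ℕ (M ⟶ P) := ⟨fun c φ => BimHom.smul c φ⟩
instance : SMul ℤ (M ⟶ P) := ⟨fun c φ => BimHom.smul c φ⟩

noncomputable instance : AddCommGroup (M ⟶ P) :=
  Function.Injective.addCommGroup (fun φ : M ⟶ P => φ.lin) (fun _ _ => GrBimod.hom_ext) rfl
    (fun _ _ => rfl) (fun φ => neg_one_smul ℚ φ.lin)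
    (fun φ ψ => by
      change φ.lin + (-1 : ℚ) • ψ.lin = φ.lin - ψ.lin
      rw [neg_one_smul, sub_eq_add_neg])
    (fun φ c => Nat.cast_smul_eq_nsmul ℚ c φ.lin) (fun φ c => Int.cast_smul_eq_zsmul ℚ c φ.lin)

noncomputable instance : Preadditive (GrBimod A B) where
  homGroup _ _ := inferInstance
  add_comp _ _ _ f f' g := GrBimod.hom_ext (LinearMap.ext fun m => map_add g.lin (f.lin m) (f'.lin m))
  comp_add _ _ _ _ _ _ := rfl

theorem lin_zero : (0 : M ⟶ P).lin = 0 := rfl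

theorem BimHom.HasDegree.sub {φ ψ : M ⟶ P} {d : ℤ} (h : φ.HasDegree d) (h' : ψ.HasDegree d) :
    (φ - ψ).HasDegree d := BimHom.HasDegree.add h (h'.smul _)

theorem inl_fst : BimHom.inl M P ≫ BimHom.fst M P = 𝟙 M := rfl
theorem inr_snd : BimHom.inr M P ≫ BimHom.snd M P = 𝟙 P := rfl
theorem inl_snd : BimHom.inl M P ≫ BimHom.snd M P = 0 := rfl
theorem inr_fst : BimHom.inr M P ≫ BimHom.fst M P = 0 := rfl
theorem fst_inl_add : BimHom.fst M P ≫ BimHom.inl M P + BimHom.snd M P ≫ BimHom.inr M P =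
    𝟙 (M.sum P) :=
  GrBimod.hom_ext (LinearMap.ext fun _ => Prod.ext (add_zero _) (zero_add _))

theorem inl_fst_assoc {Q : GrBimod A B} (φ : M ⟶ Q) : BimHom.inl M P ≫ BimHom.fst M P ≫ φ = φ := rfl
theorem inr_snd_assoc {Q : GrBimod A B} (φ : P ⟶ Q) : BimHom.inr M P ≫ BimHom.snd M P ≫ φ = φ := rfl
theorem inl_snd_assoc {Q : GrBimod A B} (φ : P ⟶ Q) :
    BimHom.inl M P ≫ BimHom.snd M P ≫ φ = (0 : M ⟶ P) ≫ φ := rfl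
theorem inr_fst_assoc {Q : GrBimod A B} (φ : M ⟶ Q) :
    BimHom.inr M P ≫ BimHom.fst M P ≫ φ = (0 : P ⟶ M) ≫ φ := rfl

/-- A direct sum decomposition. -/
theorem grIso_sum {X : GrBimod A B} {i₁ : M ⟶ X} {p₁ : X ⟶ M} {i₂ : P ⟶ X} {p₂ : X ⟶ P}
    (hi₁ : i₁.HasDegree 0) (hp₁ : p₁.HasDegree 0) (hi₂ : i₂.HasDegree 0) (hp₂ : p₂.HasDegree 0)
    (h₁₁ : i₁ ≫ p₁ = 𝟙 M) (h₂₂ : i₂ ≫ p₂ = 𝟙 P) (h₁₂ : i₁ ≫ p₂ = 0) (h₂₁ : i₂ ≫ p₁ = 0)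
    (h : p₁ ≫ i₁ + p₂ ≫ i₂ = 𝟙 X) : GrIso X (M.sum P) := by
  refine ⟨p₁ ≫ BimHom.inl M P + p₂ ≫ BimHom.inr M P, BimHom.fst M P ≫ i₁ + BimHom.snd M P ≫ i₂,
    .add (hp₁.comp_zero (BimHom.hasDegree_inl M P)) (hp₂.comp_zero (BimHom.hasDegree_inr M P)),
    .add ((BimHom.hasDegree_fst M P).comp_zero hi₁) ((BimHom.hasDegree_snd M P).comp_zero hi₂), ?_, ?_⟩
  · simp only [Preadditive.add_comp, Preadditive.comp_add, Category.assoc, inl_fst_assoc,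
      inl_snd_assoc, inr_fst_assoc, inr_snd_assoc, Limits.zero_comp, Limits.comp_zero, add_zero,
      zero_add, h]
  · simp only [Preadditive.add_comp, Preadditive.comp_add, Category.assoc, reassoc_of% h₁₁,
      reassoc_of% h₁₂, reassoc_of% h₂₁, reassoc_of% h₂₂, Limits.zero_comp, Limits.comp_zero, add_zero,
      zero_add, fst_inl_add]

end Additive

/-- The direct sum of two maps. -/
noncomputable def sumMap {M M' P P' : GrBimod A B} (φ : M ⟶ P) (ψ : M' ⟶ P') :
    M.sum M' ⟶ P.sum P' :=
  BimHom.fst M M' ≫ φ ≫ BimHom.inl P P' + BimHom.snd M M' ≫ ψ ≫ BimHom.inr P P'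

theorem hasDegree_sumMap {M M' P P' : GrBimod A B} {φ : M ⟶ P} {ψ : M' ⟶ P'} (h : φ.HasDegree 0)
    (h' : ψ.HasDegree 0) : (sumMap φ ψ).HasDegree 0 :=
  .add ((BimHom.hasDegree_fst M M').comp_zero (h.comp_zero (BimHom.hasDegree_inl P P')))
    ((BimHom.hasDegree_snd M M').comp_zero (h'.comp_zero (BimHom.hasDegree_inr P P')))

theorem sumMap_comp {M M' P P' Q Q' : GrBimod A B} (φ : M ⟶ P) (ψ : M' ⟶ P') (φ' : P ⟶ Q)
    (ψ' : P' ⟶ Q') : sumMap φ ψ ≫ sumMap φ' ψ' = sumMap (φ ≫ φ') (ψ ≫ ψ') := by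
  simp only [sumMap, Preadditive.add_comp, Preadditive.comp_add, Category.assoc, inl_fst_assoc,
    inl_snd_assoc, inr_fst_assoc, inr_snd_assoc, Limits.zero_comp, Limits.comp_zero, add_zero,
    zero_add]

theorem sumMap_id (M M' : GrBimod A B) : sumMap (𝟙 M) (𝟙 M') = 𝟙 (M.sum M') := by
  simp only [sumMap, Category.id_comp, fst_inl_add]

theorem GrIso.sum {M M' P P' : GrBimod A B} (h : GrIso M P) (h' : GrIso M' P') :
    GrIso (M.sum M') (P.sum P') := by
  obtain ⟨i, r, h1, h2, h3, h4⟩ := h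
  obtain ⟨i', r', h1', h2', h3', h4'⟩ := h'
  exact ⟨sumMap i i', sumMap r r', hasDegree_sumMap h1 h1', hasDegree_sumMap h2 h2', by
    rw [sumMap_comp, h3, h3', sumMap_id], by rw [sumMap_comp, h4, h4', sumMap_id]⟩

theorem grIso_shift_shift (M : GrBimod A B) (s t : ℤ) :
    GrIso ((M.shift s).shift t) (M.shift (s + t)) :=
  grIso_of_equiv (LinearEquiv.refl ℚ M.carrier) (fun _ _ => rfl) (fun _ _ => rfl)
    (fun i m h => by
      change m ∈ M.gr (i - t - s) at h
      change m ∈ M.gr (i - (s + t))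
      rwa [sub_sub, add_comm t] at h)
    (fun i m h => by
      change m ∈ M.gr (i - t - s)
      change m ∈ M.gr (i - (s + t)) at h
      rwa [sub_sub, add_comm t])

theorem grIso_shift_zero (M : GrBimod A B) : GrIso (M.shift 0) M :=
  grIso_of_equiv (LinearEquiv.refl ℚ M.carrier) (fun _ _ => rfl) (fun _ _ => rfl)
    (fun i m h => by
      change m ∈ M.gr (i - 0) at h
      rwa [sub_zero] at h)
    (fun i m h => by
      change m ∈ M.gr (i - 0)
      rwa [sub_zero])

theorem whiskerRight_comp_bim {M P Q : GrBimod A B} (φ : M ⟶ P) (ψ : P ⟶ Q) (R : GrBimod B C) :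
    tensorWhiskerRight φ R ≫ tensorWhiskerRight ψ R = tensorWhiskerRight (φ ≫ ψ) R :=
  tensor_hom_ext fun m r => by simp

theorem whiskerLeft_comp_bim (R : GrBimod A B) {M P Q : GrBimod B C} (φ : M ⟶ P) (ψ : P ⟶ Q) :
    tensorWhiskerLeft R φ ≫ tensorWhiskerLeft R ψ = tensorWhiskerLeft R (φ ≫ ψ) :=
  tensor_hom_ext fun m r => by simp

theorem whiskerRight_id_bim (M : GrBimod A B) (R : GrBimod B C) :
    tensorWhiskerRight (𝟙 M) R = 𝟙 (tensor M R) := tensor_hom_ext fun m r => by simp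

theorem whiskerLeft_id_bim (R : GrBimod A B) (M : GrBimod B C) :
    tensorWhiskerLeft R (𝟙 M) = 𝟙 (tensor R M) := tensor_hom_ext fun m r => by simp

theorem GrRet.tensor_right {M P : GrBimod A B} (h : GrRet M P) (R : GrBimod B C) :
    GrRet (tensor M R) (tensor P R) := by
  obtain ⟨i, r, h1, h2, h3⟩ := h
  exact ⟨tensorWhiskerRight i R, tensorWhiskerRight r R, h1.right R, h2.right R, by
    rw [whiskerRight_comp_bim, h3, whiskerRight_id_bim]⟩

theorem GrIso.tensor_right {M P : GrBimod A B} (h : GrIso M P) (R : GrBimod B C) :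
    GrIso (tensor M R) (tensor P R) := by
  obtain ⟨i, r, h1, h2, h3, h4⟩ := h
  exact ⟨tensorWhiskerRight i R, tensorWhiskerRight r R, h1.right R, h2.right R, by
    rw [whiskerRight_comp_bim, h3, whiskerRight_id_bim], by
    rw [whiskerRight_comp_bim, h4, whiskerRight_id_bim]⟩

theorem GrIso.tensor_left (R : GrBimod A B) {M P : GrBimod B C} (h : GrIso M P) :
    GrIso (tensor R M) (tensor R P) := by
  obtain ⟨i, r, h1, h2, h3, h4⟩ := h
  exact ⟨tensorWhiskerLeft R i, tensorWhiskerLeft R r, h1.left R, h2.left R, by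
    rw [whiskerLeft_comp_bim, h3, whiskerLeft_id_bim], by
    rw [whiskerLeft_comp_bim, h4, whiskerLeft_id_bim]⟩

theorem grIso_tensor_sum (M P : GrBimod A B) (R : GrBimod B C) :
    GrIso (tensor (M.sum P) R) ((tensor M R).sum (tensor P R)) := by
  have hz : ∀ {M P : GrBimod A B}, tensorWhiskerRight (0 : M ⟶ P) R = 0 := fun {M P} =>
    tensor_hom_ext fun m r => by rw [tensorWhiskerRight_tm, lin_zero, lin_zero]; simp
  refine grIso_sum (i₁ := tensorWhiskerRight (BimHom.inl M P) R)
    (i₂ := tensorWhiskerRight (BimHom.inr M P) R) (p₁ := tensorWhiskerRight (BimHom.fst M P) R)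
    (p₂ := tensorWhiskerRight (BimHom.snd M P) R) ((BimHom.hasDegree_inl M P).right R)
    ((BimHom.hasDegree_fst M P).right R) ((BimHom.hasDegree_inr M P).right R)
    ((BimHom.hasDegree_snd M P).right R) ?_ ?_ ?_ ?_ ?_
  · rw [whiskerRight_comp_bim, inl_fst, whiskerRight_id_bim]
  · rw [whiskerRight_comp_bim, inr_snd, whiskerRight_id_bim]
  · rw [whiskerRight_comp_bim, inl_snd, hz]
  · rw [whiskerRight_comp_bim, inr_fst, hz]
  · rw [whiskerRight_comp_bim, whiskerRight_comp_bim, ← whiskerRight_id_bim, ← fst_inl_add]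
    exact (add_whiskerRight_bim R _ _).symm

theorem grIso_tensor_shift (M : GrBimod A B) (R : GrBimod B C) (s : ℤ) :
    GrIso (tensor (M.shift s) R) ((tensor M R).shift s) := by
  refine ⟨tensorWhiskerRight (BimHom.ofShift M s) R ≫ BimHom.toShift (tensor M R) s,
    BimHom.ofShift (tensor M R) s ≫ tensorWhiskerRight (BimHom.toShift M s) R, ?_, ?_, ?_, ?_⟩
  · have := ((BimHom.hasDegree_ofShift M s).right R).comp (BimHom.hasDegree_toShift (tensor M R) s)
    rwa [neg_add_cancel] at this
  · have := (BimHom.hasDegree_ofShift (tensor M R) s).comp ((BimHom.hasDegree_toShift M s).right R)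
    rwa [neg_add_cancel] at this
  · have e : BimHom.toShift (tensor M R) s ≫ BimHom.ofShift (tensor M R) s = 𝟙 _ := rfl
    have e' : BimHom.ofShift M s ≫ BimHom.toShift M s = 𝟙 _ := rfl
    rw [Category.assoc, reassoc_of% e, whiskerRight_comp_bim, e', whiskerRight_id_bim]
  · have e : BimHom.ofShift (tensor M R) s ≫ BimHom.toShift (tensor M R) s = 𝟙 _ := rfl
    have e' : BimHom.toShift M s ≫ BimHom.ofShift M s = 𝟙 _ := rfl
    rw [Category.assoc, ← Category.assoc (tensorWhiskerRight _ _), whiskerRight_comp_bim, e',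
      whiskerRight_id_bim, Category.id_comp, e]

end Retracts

section FreeModules

variable {A B C : GrAlg}

theorem ground_left (M : GrMod A) (c : ℚ) (m : M.carrier) : M.left c m = c • m :=
  LinearMap.congr_fun (M.left.commutes c) m

theorem right_algebraMap (M : GrBimod A B) (c : ℚ) (m : M.carrier) :
    M.right (algebraMap ℚ B.carrier c) m = c • m :=
  LinearMap.congr_fun (M.right.commutes c) m

/-- The generator of a free module of rank one. -/
def freeGen (A : GrAlg) (s : ℤ) : (freeMod A s).carrier := (1 : A.carrier)

theorem freeGen_mem (A : GrAlg) (s : ℤ) : freeGen A s ∈ (freeMod A s).gr s := by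
  change (1 : A.carrier) ∈ A.gr (s - s)
  rw [sub_self]
  exact A.one_mem

/-- The map of modules out of a free module of rank one with a given value on the generator. -/
def freeHom {M : GrMod A} (s : ℤ) (m : M.carrier) : freeMod A s ⟶ M :=
  (⟨(LinearMap.applyₗ m).comp M.right.toLinearMap, fun c a => by
      rw [ground_left, ground_left, map_smul], fun b a =>
      LinearMap.congr_fun (map_mul M.right b a) m⟩ : BimHom _ _)

theorem freeHom_gen {M : GrMod A} (s : ℤ) (m : M.carrier) : (freeHom s m).lin (freeGen A s) = m := by
  change M.right 1 m = m
  rw [map_one]; rfl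

theorem hasDegree_freeHom {M : GrMod A} {s : ℤ} {m : M.carrier} (h : m ∈ M.gr s) :
    (freeHom s m).HasDegree 0 := .of_mem fun i a ha => by
  have := M.right_mem (i := i - s) ha h
  rwa [sub_add_cancel] at this

theorem freeMod_hom_ext {M : GrMod A} {s : ℤ} {φ ψ : freeMod A s ⟶ M}
    (h : φ.lin (freeGen A s) = ψ.lin (freeGen A s)) : φ = ψ := by
  have e : ∀ a : A.carrier, (freeMod A s).right a (freeGen A s) = a := fun a => mul_one a
  refine GrBimod.hom_ext (LinearMap.ext fun a => ?_)
  exact (congrArg φ.lin (e a)).symm.trans ((φ.map_right _ _).trans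
    ((congrArg _ h).trans ((ψ.map_right _ _).symm.trans (congrArg ψ.lin (e a)))))

theorem freeMod_endo (hA : A.gr 0 = Submodule.span ℚ {1}) {s : ℤ} {φ : freeMod A s ⟶ freeMod A s}
    (hφ : φ.HasDegree 0) : ∃ c : ℚ, φ = BimHom.smul c (𝟙 _) := by
  have h : ∀ a ∈ A.gr (s - s), ∃ c : ℚ, c • (1 : A.carrier) = a := fun a ha => by
    rwa [sub_self, hA, Submodule.mem_span_singleton] at ha
  obtain ⟨c, hc⟩ := h _ (hφ.mem (freeGen_mem A s))
  exact ⟨c, freeMod_hom_ext hc.symm⟩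

theorem freeSum_nil (A : GrAlg) : Subsingleton (freeSum A []).carrier :=
  inferInstanceAs (Subsingleton PUnit)

/-- The Krull–Schmidt property of graded free modules. -/
theorem exists_grIso_freeSum_of_ret (hA : A.gr 0 = Submodule.span ℚ {1}) (l : List ℤ) :
    ∀ {M : GrMod A}, GrRet M (freeSum A l) → ∃ l', GrIso M (freeSum A l') := by
  induction l with
  | nil =>
    rintro M ⟨i, r, -, -, h⟩
    have : Subsingleton M.carrier := ⟨fun m m' =>
      have e := LinearMap.congr_fun (congrArg BimHom.lin h)
      (e m).symm.trans ((congrArg r.lin (Subsingleton.elim (α := PUnit) _ _)).trans (e m'))⟩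
    exact ⟨[], grIso_of_subsingleton this (freeSum_nil A)⟩
  | cons s l ih =>
    intro M hM
    obtain ⟨i, r, hi, hr, h⟩ : GrRet M ((freeMod A s).sum (freeSum A l)) := hM
    let iS := i ≫ BimHom.fst (freeMod A s) (freeSum A l)
    let iF := i ≫ BimHom.snd (freeMod A s) (freeSum A l)
    let rS := BimHom.inl (freeMod A s) (freeSum A l) ≫ r
    let rF := BimHom.inr (freeMod A s) (freeSum A l) ≫ r
    have hiS : iS.HasDegree 0 := hi.comp_zero (BimHom.hasDegree_fst _ _)
    have hiF : iF.HasDegree 0 := hi.comp_zero (BimHom.hasDegree_snd _ _)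
    have hrS : rS.HasDegree 0 := (BimHom.hasDegree_inl _ _).comp_zero hr
    have hrF : rF.HasDegree 0 := (BimHom.hasDegree_inr _ _).comp_zero hr
    have hone : iS ≫ rS + iF ≫ rF = 𝟙 M := by
      have e := fst_inl_add (M := freeMod A s) (P := freeSum A l)
      calc _ = i ≫ (BimHom.fst (freeMod A s) (freeSum A l) ≫ BimHom.inl (freeMod A s) (freeSum A l) +
            BimHom.snd (freeMod A s) (freeSum A l) ≫ BimHom.inr (freeMod A s) (freeSum A l)) ≫ r := by
            simp only [iS, iF, rS, rF, Preadditive.add_comp, Preadditive.comp_add, Category.assoc]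
        _ = 𝟙 M := by rw [e, Category.id_comp]; exact h
    clear_value iS iF rS rF
    obtain ⟨c, hc⟩ := freeMod_endo hA (hrS.comp_zero hiS)
    by_cases c0 : c = 0
    · have hz : rS ≫ iS = 0 := by
        rw [hc, c0]
        exact GrBimod.hom_ext (zero_smul ℚ _)
      refine ih ⟨iS ≫ rS ≫ iF + iF, rF, .add (hiS.comp_zero (hrS.comp_zero hiF)) hiF, hrF, ?_⟩
      have e : rS ≫ iF ≫ rF = rS := by
        have := congrArg (rS ≫ ·) hone
        simp only [Preadditive.comp_add, reassoc_of% hz, Limits.zero_comp, zero_add, Category.comp_id] at this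
        exact this
      rw [Preadditive.add_comp, Category.assoc, Category.assoc, e, hone]
    · let jS := BimHom.smul c⁻¹ rS
      have hjS : jS.HasDegree 0 := hrS.smul _
      have e1 : jS ≫ iS = 𝟙 _ := by
        rw [smul_comp_bim, hc]
        refine GrBimod.hom_ext ?_
        change c⁻¹ • c • LinearMap.id = LinearMap.id
        rw [smul_smul, inv_mul_cancel₀ c0, one_smul]
      have e1' : rS ≫ iS ≫ jS = rS := by
        rw [← Category.assoc, hc, smul_comp_bim, Category.id_comp]
        refine GrBimod.hom_ext ?_
        change c • c⁻¹ • rS.lin = rS.lin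
        rw [smul_smul, mul_inv_cancel₀ c0, one_smul]
      clear_value jS
      obtain ⟨M', j, t, hj, ht, hjt, htj⟩ := exists_splitting (𝟙 M - iS ≫ jS)
        ((BimHom.hasDegree_id M).sub (hiS.comp_zero hjS)) (by
          simp only [Preadditive.sub_comp, Preadditive.comp_sub, Category.id_comp, Category.comp_id,
            Category.assoc, reassoc_of% e1, sub_self, sub_zero])
      have e2 : jS ≫ t = 0 := by
        calc jS ≫ t = jS ≫ t ≫ j ≫ t := by rw [hjt, Category.comp_id]
          _ = 0 := by
            rw [reassoc_of% htj]
            simp only [Preadditive.sub_comp, Preadditive.comp_sub, Category.id_comp,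
              Category.assoc, reassoc_of% e1, sub_self]
      have e3 : j ≫ iS = 0 := by
        calc j ≫ iS = j ≫ t ≫ j ≫ iS := by rw [reassoc_of% hjt]
          _ = 0 := by
            rw [reassoc_of% htj]
            simp only [Preadditive.sub_comp, Preadditive.comp_sub, Category.id_comp, Category.comp_id,
              Category.assoc, e1, sub_self, Limits.comp_zero]
      obtain ⟨l', hl'⟩ := ih (M := M') ⟨j ≫ iF, rF ≫ t, hj.comp_zero hiF, hrF.comp_zero ht, by
        have e4 : iF ≫ rF = 𝟙 M - iS ≫ rS := by rw [← hone, add_sub_cancel_left]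
        rw [Category.assoc, reassoc_of% e4]
        simp only [Preadditive.sub_comp, Preadditive.comp_sub, Category.id_comp, Category.assoc,
          reassoc_of% e3, Limits.zero_comp, sub_zero, hjt]⟩
      refine ⟨s :: l', (grIso_sum hjS hiS hj ht e1 hjt e2 e3 ?_).trans (.sum (.refl _) hl')⟩
      rw [htj, add_sub_cancel]

theorem grIso_freeMod_shift (s t : ℤ) : GrIso ((freeMod A s).shift t) (freeMod A (s + t)) :=
  grIso_shift_shift _ s t

theorem grIso_sum_assoc (M P Q : GrBimod A B) : GrIso ((M.sum P).sum Q) (M.sum (P.sum Q)) :=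
  grIso_of_equiv (LinearEquiv.prodAssoc ℚ M.carrier P.carrier Q.carrier) (fun _ _ => rfl)
    (fun _ _ => rfl) (fun _ _ h => ⟨h.1.1, h.1.2, h.2⟩) (fun _ _ h => ⟨⟨h.1, h.2.1⟩, h.2.2⟩)

theorem grIso_sum_zero_left {M P : GrBimod A B} (h : Subsingleton M.carrier) : GrIso (M.sum P) P := by
  refine ⟨BimHom.snd M P, BimHom.inr M P, BimHom.hasDegree_snd M P, BimHom.hasDegree_inr M P, ?_, inr_snd⟩
  rw [← fst_inl_add, hom_eq_of_subsingleton' h (BimHom.fst M P) 0, Limits.zero_comp, zero_add]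

theorem grIso_sum_zero_right {M P : GrBimod A B} (h : Subsingleton P.carrier) : GrIso (M.sum P) M := by
  refine ⟨BimHom.fst M P, BimHom.inl M P, BimHom.hasDegree_fst M P, BimHom.hasDegree_inl M P, ?_, inl_fst⟩
  rw [← fst_inl_add, hom_eq_of_subsingleton' h (BimHom.snd M P) 0, Limits.zero_comp, add_zero]

theorem grIso_freeSum_append (l l' : List ℤ) :
    GrIso ((freeSum A l).sum (freeSum A l')) (freeSum A (l ++ l')) := by
  induction l with
  | nil => exact grIso_sum_zero_left (freeSum_nil A)
  | cons s l ih => exact (grIso_sum_assoc _ _ _).trans (.sum (.refl _) ih)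

end FreeModules

section GradedProjectives

variable {A B C : GrAlg}

theorem components_left (M : GrBimod A B) {i : ℤ} {a : A.carrier} (ha : a ∈ A.gr i) (m : M.carrier)
    (j : ℤ) : components M.internal (M.left a m) (i + j) = M.left a (components M.internal m j) := by
  induction m using homogeneous_induction M.internal with
  | add x y hx hy => simp [hx, hy]
  | hom d m hm =>
    rw [components_of_mem _ hm, components_of_mem _ (M.left_mem ha hm), Finsupp.single_apply,
      Finsupp.single_apply]
    by_cases h : d = j
    · simp [h]
    · rw [if_neg h, if_neg (by omega), map_zero]

theorem components_right (M : GrBimod A B) {i : ℤ} {b : B.carrier} (hb : b ∈ B.gr i) (m : M.carrier)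
    (j : ℤ) : components M.internal (M.right b m) (i + j) = M.right b (components M.internal m j) := by
  induction m using homogeneous_induction M.internal with
  | add x y hx hy => simp [hx, hy]
  | hom d m hm =>
    rw [components_of_mem _ hm, components_of_mem _ (M.right_mem hb hm), Finsupp.single_apply,
      Finsupp.single_apply]
    by_cases h : d = j
    · simp [h]
    · rw [if_neg h, if_neg (by omega), map_zero]

/-- The degree zero part of a linear map. -/
noncomputable def degreeZeroLin (M P : GrBimod A B) (f : M.carrier →ₗ[ℚ] P.carrier) :
    M.carrier →ₗ[ℚ] P.carrier :=
  (Finsupp.lsum ℚ fun d => (Finsupp.lapply d).comp ((components P.internal).comp f)).comp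
    (components M.internal)

theorem degreeZeroLin_of_mem {M P : GrBimod A B} (f : M.carrier →ₗ[ℚ] P.carrier) {d : ℤ}
    {m : M.carrier} (hm : m ∈ M.gr d) :
    degreeZeroLin M P f m = components P.internal (f m) d := by
  simp [degreeZeroLin, components_of_mem _ hm]

/-- The degree zero part of a map of bimodules. -/
noncomputable def degreeZero {M P : GrBimod A B} (φ : M ⟶ P) : M ⟶ P :=
  (⟨degreeZeroLin M P φ.lin, fun a m => by
    induction a using homogeneous_induction A.internal with
    | add x y hx hy => simp [hx, hy]
    | hom i a ha =>
    induction m using homogeneous_induction M.internal with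
    | add x y hx hy => simp [hx, hy]
    | hom j m hm =>
      rw [degreeZeroLin_of_mem _ hm, degreeZeroLin_of_mem _ (M.left_mem ha hm), φ.map_left,
        components_left P ha], fun b m => by
    induction b using homogeneous_induction B.internal with
    | add x y hx hy => simp [hx, hy]
    | hom i b hb =>
    induction m using homogeneous_induction M.internal with
    | add x y hx hy => simp [hx, hy]
    | hom j m hm =>
      rw [degreeZeroLin_of_mem _ hm, degreeZeroLin_of_mem _ (M.right_mem hb hm), φ.map_right,
        components_right P hb]⟩ : BimHom M P)

theorem hasDegree_degreeZero {M P : GrBimod A B} (φ : M ⟶ P) : (degreeZero φ).HasDegree 0 :=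
  .of_mem fun i m hm => by
    change degreeZeroLin M P φ.lin m ∈ _
    rw [degreeZeroLin_of_mem _ hm]
    exact components_mem _ _ _

theorem degreeZero_comp {M P Q : GrBimod A B} (φ : M ⟶ P) {ψ : P ⟶ Q} (hψ : ψ.HasDegree 0) :
    degreeZero φ ≫ ψ = degreeZero (φ ≫ ψ) := by
  refine GrBimod.hom_ext (hom_ext_of_homogeneous M.internal fun i m hm => ?_)
  change ψ.lin (degreeZeroLin M P φ.lin m) = degreeZeroLin M Q (φ ≫ ψ).lin m
  rw [degreeZeroLin_of_mem _ hm, degreeZeroLin_of_mem _ hm, comp_lin, LinearMap.comp_apply]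
  exact (hψ.components _ _).symm

theorem degreeZero_id (M : GrBimod A B) : degreeZero (𝟙 M) = 𝟙 M := by
  refine GrBimod.hom_ext (hom_ext_of_homogeneous M.internal fun i m hm => ?_)
  change degreeZeroLin M M (𝟙 M : M ⟶ M).lin m = m
  rw [degreeZeroLin_of_mem _ hm, id_lin, LinearMap.id_apply, components_of_mem _ hm, Finsupp.single_eq_same]

/-- The underlying module of a graded module. -/
abbrev modOf (P : GrMod A) : Module A.carrier P.carrier := Module.compHom P.carrier P.right.toRingHom

attribute [local instance] modOf

/-- A map of graded modules as a map of modules. -/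
def toModHom {M P : GrMod A} (φ : M ⟶ P) : M.carrier →ₗ[A.carrier] P.carrier where
  toFun := φ.lin
  map_add' := map_add _
  map_smul' := φ.map_right

/-- A map of modules as a map of graded modules, not necessarily of degree zero. -/
def ofModHom {M P : GrMod A} (f : M.carrier →ₗ[A.carrier] P.carrier) : M ⟶ P :=
  have h : ∀ (c : ℚ) (m : M.carrier), f (c • m) = c • f m := fun c m => by
    rw [← right_algebraMap M, ← right_algebraMap P]; exact f.map_smul _ _
  (⟨⟨⟨f, map_add f⟩, h⟩, fun c m => by rw [ground_left, ground_left]; exact h c m,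
    fun a m => f.map_smul a m⟩ : BimHom M P)

theorem isPmod_of_ret {M P : GrMod A} (h : GrRet M P) (hP : IsPmod P) : IsPmod M := by
  obtain ⟨i, r, -, -, h⟩ := h
  have h' : (toModHom r).comp (toModHom i) = LinearMap.id :=
    LinearMap.ext fun m => LinearMap.congr_fun (congrArg BimHom.lin h) m
  have := hP.1
  have := hP.2
  exact ⟨Module.Finite.of_surjective (toModHom r) fun m => ⟨i.lin m, LinearMap.congr_fun h' m⟩,
    Module.Projective.of_split (toModHom i) (toModHom r) h'⟩

theorem isPmod_of_iso {M P : GrMod A} (h : GrIso M P) (hM : IsPmod M) : IsPmod P :=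
  isPmod_of_ret h.symm.ret hM

theorem isPmod_freeMod (s : ℤ) : IsPmod (freeMod A s) :=
  ⟨inferInstanceAs (Module.Finite A.carrier A.carrier),
    inferInstanceAs (Module.Projective A.carrier A.carrier)⟩

theorem isPmod_sum {M P : GrMod A} (hM : IsPmod M) (hP : IsPmod P) : IsPmod (M.sum P) := by
  have := hM.1
  have := hM.2
  have := hP.1
  have := hP.2
  let e : (M.carrier × P.carrier) ≃ₗ[A.carrier] (M.sum P).carrier :=
    { (Equiv.refl _ : (M.carrier × P.carrier) ≃ (M.sum P).carrier) with
      map_add' := fun _ _ => rfl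
      map_smul' := fun _ _ => rfl }
  exact ⟨Module.Finite.equiv e, Module.Projective.of_equiv e⟩

theorem isPmod_of_subsingleton {M : GrMod A} (h : Subsingleton M.carrier) : IsPmod M :=
  isPmod_of_ret ⟨0, 0, BimHom.hasDegree_zero _ _ _, BimHom.hasDegree_zero _ _ _,
    hom_eq_of_subsingleton h _ _⟩ (isPmod_freeMod 0)

theorem isPmod_freeSum (l : List ℤ) : IsPmod (freeSum A l) := by
  induction l with
  | nil => exact isPmod_of_subsingleton (freeSum_nil A)
  | cons s l ih => exact isPmod_sum (isPmod_freeMod s) ih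

theorem exists_freeSum_range {M : GrMod A} {l₁ l₂ : List ℤ} {φ₁ : freeSum A l₁ ⟶ M}
    {φ₂ : freeSum A l₂ ⟶ M} (h₁ : φ₁.HasDegree 0) (h₂ : φ₂.HasDegree 0) :
    ∃ (l : List ℤ) (φ : freeSum A l ⟶ M), φ.HasDegree 0 ∧
      (∀ x, φ₁.lin x ∈ LinearMap.range φ.lin) ∧ ∀ x, φ₂.lin x ∈ LinearMap.range φ.lin := by
  obtain ⟨f, g, hf, hg, hfg, -⟩ := grIso_freeSum_append (A := A) l₁ l₂
  let φ : (freeSum A l₁).sum (freeSum A l₂) ⟶ M := BimHom.fst _ _ ≫ φ₁ + BimHom.snd _ _ ≫ φ₂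
  have hφ : φ.HasDegree 0 := .add ((BimHom.hasDegree_fst _ _).comp_zero h₁)
    ((BimHom.hasDegree_snd _ _).comp_zero h₂)
  have e₁ : (BimHom.inl _ _ ≫ f) ≫ g ≫ φ = φ₁ := by
    rw [Category.assoc, reassoc_of% hfg]
    simp only [φ, Preadditive.comp_add, inl_fst_assoc, inl_snd_assoc, Limits.zero_comp, add_zero]
  have e₂ : (BimHom.inr _ _ ≫ f) ≫ g ≫ φ = φ₂ := by
    rw [Category.assoc, reassoc_of% hfg]
    simp only [φ, Preadditive.comp_add, inr_fst_assoc, inr_snd_assoc, Limits.zero_comp, zero_add]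
  exact ⟨_, g ≫ φ, hg.comp_zero hφ,
    fun x => ⟨_, LinearMap.congr_fun (congrArg BimHom.lin e₁) x⟩,
    fun x => ⟨_, LinearMap.congr_fun (congrArg BimHom.lin e₂) x⟩⟩

theorem exists_freeSum_mem_range {M : GrMod A} (m : M.carrier) :
    ∃ (l : List ℤ) (φ : freeSum A l ⟶ M), φ.HasDegree 0 ∧ m ∈ LinearMap.range φ.lin := by
  induction m using homogeneous_induction M.internal with
  | hom i m hm =>
    obtain ⟨f, g, hf, hg, hfg, -⟩ : GrIso (freeMod A i) (freeSum A [i]) :=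
      (grIso_sum_zero_right (freeSum_nil A)).symm
    refine ⟨[i], g ≫ freeHom i m, hg.comp_zero (hasDegree_freeHom hm), f.lin (freeGen A i), ?_⟩
    have := congrArg (· ≫ freeHom i m) hfg
    rw [Category.id_comp, Category.assoc] at this
    exact (LinearMap.congr_fun (congrArg BimHom.lin this) (freeGen A i)).trans (freeHom_gen i m)
  | add x y hx hy =>
    obtain ⟨l₁, φ₁, h₁, x, rfl⟩ := hx
    obtain ⟨l₂, φ₂, h₂, y, rfl⟩ := hy
    obtain ⟨l, φ, h, hx, hy⟩ := exists_freeSum_range h₁ h₂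
    exact ⟨l, φ, h, add_mem (hx x) (hy y)⟩

theorem exists_freeSum_surjective {M : GrMod A} (hM : IsPmod M) :
    ∃ (l : List ℤ) (φ : freeSum A l ⟶ M), φ.HasDegree 0 ∧ Function.Surjective φ.lin := by
  classical
  obtain ⟨t, ht⟩ := hM.1.fg_top
  suffices h : ∃ (l : List ℤ) (φ : freeSum A l ⟶ M), φ.HasDegree 0 ∧
      ∀ m ∈ t, m ∈ LinearMap.range φ.lin by
    obtain ⟨l, φ, hφ, h⟩ := h
    refine ⟨l, φ, hφ, fun m => ?_⟩
    have : Submodule.span A.carrier (t : Set M.carrier) ≤ LinearMap.range (toModHom φ) :=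
      Submodule.span_le.2 h
    rw [ht] at this
    exact this trivial
  clear ht
  induction t using Finset.induction_on with
  | empty => exact ⟨[], 0, BimHom.hasDegree_zero _ _ _, by simp⟩
  | insert m t _ ih =>
    obtain ⟨l₁, φ₁, h₁, ht⟩ := ih
    obtain ⟨l₂, φ₂, h₂, y, rfl⟩ := exists_freeSum_mem_range m
    obtain ⟨l, φ, h, hx, hy⟩ := exists_freeSum_range h₁ h₂
    refine ⟨l, φ, h, fun m hm => ?_⟩
    rcases Finset.mem_insert.1 hm with rfl | hm
    · exact hy y
    · obtain ⟨x, rfl⟩ := ht m hm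
      exact hx x

theorem isPmod_iff_ret {M : GrMod A} : IsPmod M ↔ ∃ l, GrRet M (freeSum A l) := by
  refine ⟨fun hM => ?_, fun ⟨l, h⟩ => isPmod_of_ret h (isPmod_freeSum l)⟩
  obtain ⟨l, φ, hφ, h⟩ := exists_freeSum_surjective hM
  have := hM.2
  obtain ⟨σ, hσ⟩ := Module.projective_lifting_property (toModHom φ) LinearMap.id h
  refine ⟨l, degreeZero (ofModHom σ), φ, hasDegree_degreeZero _, hφ, ?_⟩
  rw [degreeZero_comp _ hφ, show ofModHom σ ≫ φ = 𝟙 M from GrBimod.hom_ext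
    (LinearMap.ext fun m => LinearMap.congr_fun hσ m), degreeZero_id]

theorem isPmod_shift {M : GrMod A} (hM : IsPmod M) (s : ℤ) : IsPmod (M.shift s) := hM

theorem exists_grIso_freeSum (hA : A.gr 0 = Submodule.span ℚ {1}) {M : GrMod A} (hM : IsPmod M) :
    ∃ l, GrIso M (freeSum A l) := by
  obtain ⟨l, h⟩ := isPmod_iff_ret.1 hM
  exact exists_grIso_freeSum_of_ret hA l h

theorem isIndecomposable_freeMod (hA : A.gr 0 = Submodule.span ℚ {1}) (hA' : Nontrivial A.carrier)
    (s : ℤ) : IsIndecomposable (freeMod A s) := by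
  refine ⟨hA', fun Q R ⟨f, g, hf, hg, hfg, hgf⟩ => ?_⟩
  obtain ⟨c, hc⟩ := freeMod_endo hA
    (hf.comp_zero ((BimHom.hasDegree_fst Q R).comp_zero ((BimHom.hasDegree_inl Q R).comp_zero hg)))
  have e : BimHom.fst Q R ≫ BimHom.inl Q R = BimHom.smul c (𝟙 _) := by
    have := congrArg (fun φ => g ≫ φ ≫ f) hc
    simp only [Category.assoc, hgf, Category.comp_id, smul_comp_bim, comp_smul_bim, Category.id_comp,
      reassoc_of% hgf] at this
    exact this
  have key : ∀ (q : Q.carrier) (r : R.carrier), q = c • q ∧ 0 = c • r := fun q r =>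
    Prod.ext_iff.1 (LinearMap.congr_fun (congrArg BimHom.lin e) (q, r))
  by_cases c0 : c = 0
  · exact .inl ⟨fun q q' => by rw [(key q 0).1, (key q' 0).1, c0, zero_smul, zero_smul]⟩
  · have h0 : ∀ r : R.carrier, r = 0 := fun r => by
      simpa [c0] using (key 0 r).2.symm
    exact .inr ⟨fun r r' => by rw [h0 r, h0 r']⟩

theorem GrIso.subsingleton {M P : GrBimod A B} (h : GrIso M P) (hM : Subsingleton M.carrier) :
    Subsingleton P.carrier := by
  obtain ⟨f, g, -, -, -, h⟩ := h
  have e := LinearMap.congr_fun (congrArg BimHom.lin h)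
  exact ⟨fun p p' => (e p).symm.trans ((congrArg f.lin (Subsingleton.elim _ _)).trans (e p'))⟩

theorem exists_grIso_freeMod (hA : A.gr 0 = Submodule.span ℚ {1}) (hA' : Nontrivial A.carrier)
    {M : GrMod A} (hM : IsPmod M) (hM' : IsIndecomposable M) : ∃ s, GrIso M (freeMod A s) := by
  obtain ⟨l, hl⟩ := exists_grIso_freeSum hA hM
  cases l with
  | nil => exact absurd (hl.symm.subsingleton (freeSum_nil A)) (not_subsingleton_iff_nontrivial.2 hM'.1)
  | cons s l =>
    rcases hM'.2 _ _ hl with h | h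
    · exact absurd (h : Subsingleton A.carrier) (not_subsingleton_iff_nontrivial.2 hA')
    · exact ⟨s, hl.trans (grIso_sum_zero_right h)⟩

end GradedProjectives

section GradedLocal

theorem exists_weight_eq {σ : Type} [Fintype σ] {w : σ → ℤ} {v : σ → ℕ} (hw : ∀ i, w i = 2 * (v i + 1))
    (d : σ →₀ ℕ) : ∃ k : ℕ, Finsupp.weight w d = 2 * k ∧ (k = 0 → d = 0) := by
  refine ⟨∑ i, d i * (v i + 1), ?_, fun h => ?_⟩
  · rw [Finsupp.weight_eq_sum]
    push_cast
    rw [Finset.mul_sum]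
    refine Finset.sum_congr rfl fun i _ => ?_
    rw [hw, nsmul_eq_mul]; ring
  · ext i
    have := (Finset.sum_eq_zero_iff.1 h) i (Finset.mem_univ i)
    simpa using this

theorem poly_gr_eq_bot {σ : Type} [Fintype σ] {w : σ → ℤ} {v : σ → ℕ}
    (hw : ∀ i, w i = 2 * (v i + 1)) {d : ℤ} (hd : ∀ k : ℕ, d ≠ 2 * k) :
    (GrAlg.poly σ w).gr d = ⊥ := by
  refine (Submodule.eq_bot_iff _).2 fun p hp => ?_
  refine MvPolynomial.ext _ _ fun e => ?_
  obtain ⟨k, hk, -⟩ := exists_weight_eq hw e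
  exact MvPolynomial.IsWeightedHomogeneous.coeff_eq_zero hp e fun h => hd k (h.symm.trans hk)

theorem poly_gr_zero {σ : Type} [Fintype σ] {w : σ → ℤ} {v : σ → ℕ}
    (hw : ∀ i, w i = 2 * (v i + 1)) {p : MvPolynomial σ ℚ} (hp : p ∈ (GrAlg.poly σ w).gr 0) :
    p = MvPolynomial.coeff 0 p • 1 := by
  classical
  refine MvPolynomial.ext _ _ fun e => ?_
  obtain ⟨k, hk, hk0⟩ := exists_weight_eq hw e
  rw [MvPolynomial.coeff_smul, MvPolynomial.coeff_one]
  split_ifs with h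
  · rw [← h]; simp
  · rw [smul_zero]
    refine MvPolynomial.IsWeightedHomogeneous.coeff_eq_zero hp e fun h' => h (hk0 ?_).symm
    rw [hk] at h'; omega

theorem var_weight (N : ℕ) (n : ℤ) (i : Var N n) :
    (Sum.elim (fun j : Fin (kk N n) => 2 * ((j : ℤ) + 1))
        (fun j : Fin (N - kk N n) => 2 * ((j : ℤ) + 1)) i : ℤ) =
      2 * ((Sum.elim (fun j : Fin (kk N n) => (j : ℕ)) (fun j : Fin (N - kk N n) => (j : ℕ)) i : ℕ) + 1) := by
  rcases i with i | i <;> simp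

theorem H_gr_eq_bot (N : ℕ) (n : ℤ) {d : ℤ} (hd : ∀ k : ℕ, d ≠ 2 * k) : (H N n).gr d = ⊥ := by
  refine (Submodule.eq_bot_iff _).2 fun p hp => funext fun h => ?_
  have h' := hp h trivial
  have e := poly_gr_eq_bot (var_weight N n) hd
  exact (Submodule.mem_bot ℚ).1 (e.le h')

theorem H_gr_zero (N : ℕ) (n : ℤ) : (H N n).gr 0 = Submodule.span ℚ {1} := by
  refine le_antisymm (fun p hp => ?_) ((Submodule.span_singleton_le_iff_mem _ _).2 (H N n).one_mem)
  by_cases hn : Valid N n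
  · refine Submodule.mem_span_singleton.2
      ⟨MvPolynomial.coeff 0 (p ⟨hn⟩ : MvPolynomial (Var N n) ℚ), funext fun h => ?_⟩
    exact (poly_gr_zero (var_weight N n) (hp ⟨hn⟩ trivial)).symm
  · have := H_subsingleton hn
    rw [Subsingleton.elim p 0]
    exact zero_mem _

/-- The augmentation `H_k → ℚ`. -/
noncomputable def augmentation {N : ℕ} {n : ℤ} (h : Valid N n) : (H N n).carrier →ₐ[ℚ] ℚ :=
  (MvPolynomial.aeval fun _ => (0 : ℚ)).comp (Hpoly h).toAlgHom

theorem augmentation_of_mem {N : ℕ} {n : ℤ} (h : Valid N n) {d : ℤ} (hd : d ≠ 0)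
    {a : (H N n).carrier} (ha : a ∈ (H N n).gr d) : augmentation h a = 0 := by
  have h' := ha ⟨h⟩ trivial
  change MvPolynomial.aeval (fun _ => (0 : ℚ)) (a ⟨h⟩ : MvPolynomial (Var N n) ℚ) = 0
  have : (MvPolynomial.aeval fun _ => (0 : ℚ)) (a ⟨h⟩ : MvPolynomial (Var N n) ℚ) =
      MvPolynomial.coeff 0 (a ⟨h⟩ : MvPolynomial (Var N n) ℚ) :=
    (MvPolynomial.aeval_zero' _).trans rfl
  rw [this]
  refine MvPolynomial.IsWeightedHomogeneous.coeff_eq_zero h' 0 ?_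
  rw [map_zero]; exact hd.symm

theorem augmentation_components {N : ℕ} {n : ℤ} (h : Valid N n) (a : (H N n).carrier) :
    augmentation h (components (H N n).internal a 0) = augmentation h a := by
  induction a using homogeneous_induction (H N n).internal with
  | add x y hx hy => simp [hx, hy]
  | hom i a ha =>
    rw [components_of_mem _ ha, Finsupp.single_apply]
    split_ifs with hi
    · rfl
    · rw [augmentation_of_mem h hi ha, map_zero]

theorem isGradedLocal_H {N : ℕ} {n : ℤ} (h : Valid N n) : IsGradedLocal (H N n) where
  nontrivial := H_nontrivial h
  gr_neg d hd := H_gr_eq_bot N n fun k hk => by omega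
  gr_odd d hd := H_gr_eq_bot N n fun k hk => by
    obtain ⟨m, hm⟩ := hd
    omega
  gr_zero := H_gr_zero N n
  isLocal := by
    refine ⟨RingHom.ker (augmentation h), fun a ha d => ?_, RingHom.ker_ne_top _, fun J hJ hJ' a ha => ?_⟩
    · by_cases hd : d = 0
      · rw [hd, RingHom.mem_ker, augmentation_components]
        exact ha
      · exact augmentation_of_mem h hd (components_mem _ _ _)
    · have h0 := components_mem (H N n).internal a 0
      rw [H_gr_zero, Submodule.mem_span_singleton] at h0
      obtain ⟨c, hc⟩ := h0
      rw [RingHom.mem_ker, ← augmentation_components, ← hc]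
      by_cases c0 : c = 0
      · rw [c0, zero_smul, map_zero]
      · refine absurd (J.eq_top_iff_one.2 ?_) hJ'
        have := hJ a ha 0
        rw [← hc] at this
        have := J.mul_mem_left (algebraMap ℚ _ c⁻¹) this
        rwa [← Algebra.smul_def, smul_smul, inv_mul_cancel₀ c0, one_smul] at this

theorem graded_projectives_H {N : ℕ} {n : ℤ} (h : Valid N n) :
    IsGradedLocal (H N n) ∧
      (∀ M : GrMod (H N n), IsPmod M → ∃ l : List ℤ, GrIso M (freeSum (H N n) l)) ∧
      (IsPmod (freeMod (H N n) 0) ∧ IsIndecomposable (freeMod (H N n) 0)) ∧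
      ∀ M : GrMod (H N n), IsPmod M → IsIndecomposable M → ∃ s : ℤ, GrIso M (freeMod (H N n) s) :=
  ⟨isGradedLocal_H h, fun _ => exists_grIso_freeSum (H_gr_zero N n),
    ⟨isPmod_freeMod 0, isIndecomposable_freeMod (H_gr_zero N n) (H_nontrivial h) 0⟩,
    fun _ => exists_grIso_freeMod (H_gr_zero N n) (H_nontrivial h)⟩

end GradedLocal

section Restriction

variable {A B C : GrAlg}

/-- The right module underlying a bimodule. -/
def res (M : GrBimod A B) : GrMod B where
  carrier := M.carrier
  left := Algebra.ofId ℚ _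
  right := M.right
  left_right c b m := (map_smul (M.right b) c m).symm
  gr := M.gr
  internal := M.internal
  left_mem {i j c m} hc hm := by
    by_cases hi : i = 0
    · subst hi
      rw [zero_add]
      exact (M.gr j).smul_mem c hm
    · have : c = 0 := by simpa [hi] using hc
      rw [this, map_zero]
      exact zero_mem _
  right_mem := M.right_mem

/-- The map of right modules underlying a map of bimodules. -/
def resMap {M P : GrBimod A B} (φ : M ⟶ P) : res M ⟶ res P :=
  (⟨φ.lin, fun c m => map_smul φ.lin c m, φ.map_right⟩ : BimHom (res M) (res P))

theorem GrRet.res {M P : GrBimod A B} (h : GrRet M P) : GrRet (res M) (res P) := by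
  obtain ⟨i, r, hi, hr, h⟩ := h
  exact ⟨resMap i, resMap r, hi, hr, GrBimod.hom_ext (congrArg BimHom.lin h :)⟩

theorem grIso_freeMod_tensor (M : GrBimod A B) (s : ℤ) :
    GrIso (tensor (freeMod A s) M) ((res M).shift s) := by
  have h1 : ∀ (a b : A.carrier) (m : M.carrier), M.left (b * a) m = M.left a (M.left b m) := fun a b m => by
    rw [mul_comm, map_mul]; rfl
  let f : (freeMod A s).carrier →ₗ[ℚ] M.carrier →ₗ[ℚ] ((res M).shift s).carrier := M.left.toLinearMap
  let φ : tensor (freeMod A s) M ⟶ (res M).shift s := tensorDesc f (fun a b m => h1 a b m)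
    (fun c a m => by
      rw [ground_left, ground_left, map_smul]; rfl)
    (fun b a m => M.left_right a b m)
  let ψ : (res M).shift s ⟶ tensor (freeMod A s) M :=
    (⟨tm (freeMod A s) M (freeGen A s), fun c m => by
        rw [ground_left, ground_left]
        exact map_smul _ c m,
      fun b m => (tensor_right b _ _).symm⟩ : BimHom _ _)
  refine ⟨φ, ψ, ?_, ?_, ?_, ?_⟩
  · refine BimHom.hasDegree_tensor fun i j a ha m hm => ?_
    have := M.left_mem (show _ ∈ A.gr (i - s) from ha) hm
    rw [show i - s + j = i + j + 0 - s by ring] at this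
    exact (congrArg (· ∈ _) (tensorDesc_tm f _ _ _ a m)).mpr this
  · refine .of_mem fun i m hm => ?_
    have := tm_mem (freeGen_mem A s) (show m ∈ M.gr (i - s) from hm)
    rwa [add_sub_cancel] at this
  · refine tensor_hom_ext fun a m => ?_
    have e : ∀ a : A.carrier, (freeMod A s).right a (freeGen A s) = a := fun a => mul_one a
    refine (congrArg ψ.lin (tensorDesc_tm f _ _ _ a m)).trans ?_
    refine (tm_right (freeGen A s) _ m).symm.trans ?_
    exact congrArg (fun b => tm (freeMod A s) M b m) (e a)
  · refine GrBimod.hom_ext (LinearMap.ext fun m => ?_)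
    have e : φ.lin (tm (freeMod A s) M (freeGen A s) m) = f (freeGen A s) m := tensorDesc_tm f _ _ _ _ _
    exact e.trans (LinearMap.congr_fun (map_one M.left) m)

theorem grIso_res_tensor (M : GrBimod A B) (P : GrBimod B C) :
    GrIso (res (tensor M P)) (tensor (res M) P) :=
  grIso_of_equiv (LinearEquiv.refl ℚ (Tensor M P)) (fun c m => by
    rw [ground_left, ground_left]; rfl) (fun b m => rfl) (fun _ _ h => h) (fun _ _ h => h)

theorem isPmod_tensor {Q : GrMod A} {M : GrBimod A B} (hQ : IsPmod Q) (hM : IsPmod (res M)) :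
    IsPmod (tensor Q M) := by
  obtain ⟨l, hl⟩ := isPmod_iff_ret.1 hQ
  refine isPmod_of_ret (hl.tensor_right M) ?_
  clear hl
  induction l with
  | nil => exact isPmod_of_subsingleton (tensor_subsingleton_left _ (freeSum_nil A))
  | cons s l ih =>
    exact isPmod_of_iso (grIso_tensor_sum _ _ M).symm
      (isPmod_sum (isPmod_of_iso (grIso_freeMod_tensor M s).symm (isPmod_shift hM s)) ih)

/-- The list of the first `r` terms of a sequence, in reverse order. -/
def revTake (d : ℕ → ℤ) : ℕ → List ℤ
  | 0 => []
  | r + 1 => d r :: revTake d r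

/-- The vector with given coordinates in a graded free module. -/
def ofCoords (d : ℕ → ℤ) (f : ℕ → A.carrier) : (r : ℕ) → (freeSum A (revTake d r)).carrier
  | 0 => PUnit.unit
  | r + 1 => ((f r, ofCoords d f r) : A.carrier × (freeSum A (revTake d r)).carrier)

theorem ofCoords_congr (d : ℕ → ℤ) {f g : ℕ → A.carrier} (r : ℕ) (h : ∀ i < r, f i = g i) :
    ofCoords d f r = ofCoords d g r := by
  induction r with
  | zero => rfl
  | succ r ih => exact Prod.ext (h r r.lt_succ_self) (ih fun i hi => h i (hi.trans r.lt_succ_self))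

theorem ofCoords_surjective (d : ℕ → ℤ) (r : ℕ) (x : (freeSum A (revTake d r)).carrier) :
    ∃ f, ofCoords d f r = x := by
  induction r with
  | zero => exact ⟨0, rfl⟩
  | succ r ih =>
    obtain ⟨f, hf⟩ := ih (x : A.carrier × (freeSum A (revTake d r)).carrier).2
    refine ⟨Function.update f r (x : A.carrier × (freeSum A (revTake d r)).carrier).1, Prod.ext ?_ ?_⟩
    · exact Function.update_self r _ f
    · exact (ofCoords_congr d r fun i hi => Function.update_of_ne hi.ne _ f).trans hf

/-- The map out of a graded free module with given values on the generators. -/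
def freeSumHom {M : GrMod A} (d : ℕ → ℤ) (m : ℕ → M.carrier) : (r : ℕ) → (freeSum A (revTake d r) ⟶ M)
  | 0 => 0
  | r + 1 => BimHom.fst (freeMod A (d r)) (freeSum A (revTake d r)) ≫ freeHom (d r) (m r) +
      BimHom.snd (freeMod A (d r)) (freeSum A (revTake d r)) ≫ freeSumHom d m r

theorem hasDegree_freeSumHom {M : GrMod A} {d : ℕ → ℤ} {m : ℕ → M.carrier} (r : ℕ)
    (h : ∀ i < r, m i ∈ M.gr (d i)) : (freeSumHom d m r).HasDegree 0 := by
  induction r with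
  | zero => exact BimHom.hasDegree_zero _ _ _
  | succ r ih =>
    exact .add ((BimHom.hasDegree_fst _ _).comp_zero (hasDegree_freeHom (h r r.lt_succ_self)))
      ((BimHom.hasDegree_snd _ _).comp_zero (ih fun i hi => h i (hi.trans r.lt_succ_self)))

theorem freeSumHom_ofCoords {M : GrMod A} (d : ℕ → ℤ) (m : ℕ → M.carrier) (f : ℕ → A.carrier) (r : ℕ) :
    (freeSumHom d m r).lin (ofCoords d f r) = ∑ i ∈ Finset.range r, M.right (f i) (m i) := by
  induction r with
  | zero => rfl
  | succ r ih =>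
    rw [Finset.sum_range_succ, ← ih]
    exact add_comm _ _

theorem grIso_of_bijective {M P : GrBimod A B} {φ : M ⟶ P} (h : φ.HasDegree 0)
    (hb : Function.Bijective φ.lin) : GrIso M P := by
  refine grIso_of_equiv (LinearEquiv.ofBijective φ.lin hb) φ.map_left φ.map_right (fun i m hm => h.mem hm)
    fun i p hp => ?_
  obtain ⟨m, rfl⟩ := hb.2 p
  rw [show (LinearEquiv.ofBijective φ.lin hb).symm (φ.lin m) = m from
    (LinearEquiv.ofBijective φ.lin hb).symm_apply_apply m]
  have := h.components m i
  rw [components_of_mem _ hp, Finsupp.single_eq_same] at this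
  rw [hb.1 this]
  exact components_mem _ _ _

/-- A graded module with a homogeneous basis is graded free. -/
theorem grIso_freeSum_of_basis {M : GrMod A} {d : ℕ → ℤ} {m : ℕ → M.carrier} {r : ℕ}
    (hm : ∀ i < r, m i ∈ M.gr (d i))
    (hs : ∀ x, ∃ f : ℕ → A.carrier, x = ∑ i ∈ Finset.range r, M.right (f i) (m i))
    (hi : ∀ f : ℕ → A.carrier, ∑ i ∈ Finset.range r, M.right (f i) (m i) = 0 → ∀ i < r, f i = 0) :
    GrIso M (freeSum A (revTake d r)) := by
  refine (grIso_of_bijective (hasDegree_freeSumHom r hm) ⟨?_, fun x => ?_⟩).symm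
  · refine (injective_iff_map_eq_zero _).2 fun x hx => ?_
    obtain ⟨f, rfl⟩ := ofCoords_surjective d r x
    obtain ⟨g, hg⟩ := ofCoords_surjective d r (0 : (freeSum A (revTake d r)).carrier)
    rw [freeSumHom_ofCoords] at hx
    have hg0 : ∑ i ∈ Finset.range r, M.right (g i) (m i) = 0 := by
      rw [← freeSumHom_ofCoords d, hg, map_zero]
    rw [← hg]
    exact ofCoords_congr d r fun i h => (hi f hx i h).trans (hi g hg0 i h).symm
  · obtain ⟨f, rfl⟩ := hs x
    exact ⟨_, freeSumHom_ofCoords d m f r⟩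

end Restriction

open LaurentPolynomial

section FlagModules

variable {N : ℕ} {n : ℤ}

theorem grIso_res_of_isFreeExt {A B C : GrAlg} {l : A.carrier →ₐ[ℚ] C.carrier}
    {r : B.carrier →ₐ[ℚ] C.carrier} {hl : ∀ d, ∀ a ∈ A.gr d, l a ∈ C.gr d}
    {hr : ∀ d, ∀ b ∈ B.gr d, r b ∈ C.gr d} {ξ : C.carrier} {m : ℕ} (hξ : ξ ∈ C.gr 2)
    (h : IsFreeExt r ξ m) (s : ℤ) :
    GrIso (res ((ofHoms l r hl hr).shift s)) (freeSum B (revTake (fun i => 2 * i + s) m)) := by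
  have hcast : ∀ f : ℕ → B.carrier, ∑ i ∈ Finset.range m, r (f i) * ξ ^ i =
      ∑ i : Fin m, r (f i) * ξ ^ (i : ℕ) := fun f => Finset.sum_range _
  refine grIso_freeSum_of_basis (M := res ((ofHoms l r hl hr).shift s)) (m := fun i => ξ ^ i)
    (fun i _ => ?_) (fun x => ?_) fun f hf => ?_
  · change ξ ^ i ∈ C.gr (2 * i + s - s)
    rw [add_sub_cancel_right, mul_comm]
    exact C.pow_mem hξ i
  · obtain ⟨g, hg, -⟩ := h x
    refine ⟨fun i => if hi : i < m then g ⟨i, hi⟩ else 0, hg.trans (.trans ?_ (hcast _).symm)⟩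
    simp
  · replace hf : ∑ i : Fin m, r (f i) * ξ ^ (i : ℕ) = 0 := (hcast f).symm.trans hf
    have h1 := h.coord_eq (f := 0) (g := fun i => f i) hf.symm
    have h2 := h.coord_eq (f := 0) (g := fun _ => 0) (by simp)
    intro i hi
    exact congrFun (h1.symm.trans h2) ⟨i, hi⟩

theorem grIso_res_BE (h : ValidE N n) : GrIso (res (BE N n))
    (freeSum (H N (n + 2)) (revTake (fun i => 2 * i + (1 - N + kk N n)) (kk N n + 1))) :=
  grIso_res_of_isFreeExt (xi_mem N n) (isFreeExt_rHom h) _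

theorem grIso_res_BF (h : ValidE N n) : GrIso (res (BF N n))
    (freeSum (H N n) (revTake (fun i => 2 * i + -kk N n) (N - kk N n - 1 + 1))) :=
  grIso_res_of_isFreeExt (xi_mem N n) (isFreeExt_lHom h) _

theorem isPmod_res_of_isEqFlag {n m : ℤ} {M : GrBimod (H N n) (H N m)} (h : IsEqFlag N M) :
    IsPmod (res M) := by
  induction h with
  | id n =>
    exact isPmod_of_iso (M := freeMod (H N n) 0) (P := res (regular (H N n))) (
      grIso_of_equiv (LinearEquiv.refl ℚ (H N n).carrier) (fun c m => by
          rw [ground_left, ground_left]; rfl) (fun _ _ => rfl)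
        (fun i m hm => by
          have hm : m ∈ (H N n).gr (i - 0) := hm
          rwa [sub_zero] at hm)
        (fun i m hm => by
          change _ ∈ (H N n).gr (i - 0)
          rw [sub_zero]
          exact hm)) (isPmod_freeMod 0)
  | E n =>
    by_cases h : ValidE N n
    · exact isPmod_of_iso (grIso_res_BE h).symm (isPmod_freeSum _)
    · exact isPmod_of_subsingleton (M := res (BE N n)) (HE_subsingleton h)
  | F n =>
    by_cases h : ValidE N n
    · exact isPmod_of_iso (grIso_res_BF h).symm (isPmod_freeSum _)
    · exact isPmod_of_subsingleton (M := res (BF N n)) (HE_subsingleton h)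
  | comp _ _ ih ih' => exact isPmod_of_iso (grIso_res_tensor _ _).symm (isPmod_tensor ih ih')
  | shift s _ ih => exact ih
  | zero n m =>
    exact isPmod_of_subsingleton (M := res (GrBimod.zero _ _)) (inferInstanceAs (Subsingleton PUnit))
  | sum _ _ ih ih' =>
    exact isPmod_of_iso (grIso_of_equiv (LinearEquiv.refl ℚ _) (fun c m => by
          rw [ground_left, ground_left]; rfl) (fun _ _ => rfl)
        (fun i m hm => hm) (fun i m hm => hm)) (isPmod_sum ih ih')
  | retract i r hi hr h _ ih => exact isPmod_of_ret (GrRet.res ⟨i, r, hi, hr, h⟩) ih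

end FlagModules

section Grothendieck

variable {A B : GrAlg}

theorem K0.mk_single (P : Pmod A) (c : ℤ[T;T⁻¹]) :
    (Submodule.Quotient.mk (Finsupp.single P c) : K0 A) =
      c • (Submodule.Quotient.mk (Finsupp.single P 1) : K0 A) := by
  rw [← Submodule.Quotient.mk_smul, Finsupp.smul_single, smul_eq_mul, mul_one]

theorem K0.cls_sum {R P Q : GrMod A} (hR : IsPmod R) (hP : IsPmod P) (hQ : IsPmod Q)
    (h : GrIso R (P.sum Q)) : K0.cls R hR = K0.cls P hP + K0.cls Q hQ := by
  have := (Submodule.Quotient.mk_eq_zero _).2 (Submodule.subset_span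
    (s := {r | K0Rel A r}) (R := ℤ[T;T⁻¹]) (K0Rel.sum ⟨P, hP⟩ ⟨Q, hQ⟩ ⟨R, hR⟩ h))
  rw [Submodule.Quotient.mk_sub, Submodule.Quotient.mk_sub, sub_sub, sub_eq_zero] at this
  exact this

theorem K0.cls_shift {R P : GrMod A} (hR : IsPmod R) (hP : IsPmod P) {s : ℤ}
    (h : GrIso R (P.shift s)) : K0.cls R hR = (T s : ℤ[T;T⁻¹]) • K0.cls P hP := by
  have := (Submodule.Quotient.mk_eq_zero _).2 (Submodule.subset_span
    (s := {r | K0Rel A r}) (R := ℤ[T;T⁻¹]) (K0Rel.shift ⟨P, hP⟩ ⟨R, hR⟩ s h))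
  rw [Submodule.Quotient.mk_sub, sub_eq_zero] at this
  exact this.trans (K0.mk_single _ _)

theorem K0.cls_iso {R P : GrMod A} (hR : IsPmod R) (hP : IsPmod P) (h : GrIso R P) :
    K0.cls R hR = K0.cls P hP := by
  rw [K0.cls_shift hR hP (h.trans (grIso_shift_zero P).symm), T_zero, one_smul]

theorem K0.hom_ext {V : Type*} [AddCommGroup V] [Module ℤ[T;T⁻¹] V] {f g : K0 A →ₗ[ℤ[T;T⁻¹]] V}
    (h : ∀ P (hP : IsPmod P), f (K0.cls P hP) = g (K0.cls P hP)) : f = g := by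
  refine Submodule.linearMap_qext _ (Finsupp.lhom_ext' fun P => LinearMap.ext_ring ?_)
  exact h P.1 P.2

/-- Additive invariants of graded projective modules factor through the Grothendieck group. -/
noncomputable def K0.lift {V : Type*} [AddCommGroup V] [Module ℤ[T;T⁻¹] V] (f : Pmod A → V)
    (hsum : ∀ P Q R : Pmod A, GrIso R.1 (P.1.sum Q.1) → f R = f P + f Q)
    (hshift : ∀ (P R : Pmod A) (s : ℤ), GrIso R.1 (P.1.shift s) → f R = (T s : ℤ[T;T⁻¹]) • f P) :
    K0 A →ₗ[ℤ[T;T⁻¹]] V :=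
  Submodule.liftQ _ (Finsupp.linearCombination ℤ[T;T⁻¹] f) (by
    refine Submodule.span_le.2 fun r hr => ?_
    change Finsupp.linearCombination ℤ[T;T⁻¹] f r = 0
    cases hr with
    | sum P Q R h => simp [hsum P Q R h, sub_sub]
    | shift P R s h => simp [hshift P R s h])

theorem K0.lift_cls {V : Type*} [AddCommGroup V] [Module ℤ[T;T⁻¹] V] {f : Pmod A → V}
    (hsum : ∀ P Q R : Pmod A, GrIso R.1 (P.1.sum Q.1) → f R = f P + f Q)
    (hshift : ∀ (P R : Pmod A) (s : ℤ), GrIso R.1 (P.1.shift s) → f R = (T s : ℤ[T;T⁻¹]) • f P)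
    (P : GrMod A) (hP : IsPmod P) : K0.lift f hsum hshift (K0.cls P hP) = f ⟨P, hP⟩ := by
  exact (Finsupp.linearCombination_single ℤ[T;T⁻¹] 1 _).trans (one_smul _ _)

/-- The map on Grothendieck groups given by tensoring with a bimodule. -/
noncomputable def K0.map (M : GrBimod A B) (hM : IsPmod (res M)) : K0 A →ₗ[ℤ[T;T⁻¹]] K0 B :=
  K0.lift (fun P => K0.cls (tensor P.1 M) (isPmod_tensor P.2 hM))
    (fun P Q _ h => K0.cls_sum _ _ _ ((h.tensor_right M).trans (grIso_tensor_sum P.1 Q.1 M)))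
    (fun P _ s h => K0.cls_shift _ _ ((h.tensor_right M).trans (grIso_tensor_shift P.1 M s)))

theorem K0.map_cls (M : GrBimod A B) (hM : IsPmod (res M)) (P : GrMod A) (hP : IsPmod P) :
    K0.map M hM (K0.cls P hP) = K0.cls (tensor P M) (isPmod_tensor hP hM) := K0.lift_cls _ _ P hP

theorem K0.map_iso {M M' : GrBimod A B} (hM : IsPmod (res M)) (hM' : IsPmod (res M')) (h : GrIso M M') :
    K0.map M hM = K0.map M' hM' :=
  K0.hom_ext fun P hP => by
    rw [K0.map_cls, K0.map_cls]
    exact K0.cls_iso _ _ (h.tensor_left P)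

theorem K0.map_regular (h : IsPmod (res (regular A))) : K0.map (regular A) h = LinearMap.id :=
  K0.hom_ext fun P hP => by
    rw [K0.map_cls]
    exact K0.cls_iso _ _ ⟨(rightUnit P).hom, (rightUnit P).inv, (BimHom.hasDegree_rightUnit P).1,
      (BimHom.hasDegree_rightUnit P).2, (rightUnit P).hom_inv_id, (rightUnit P).inv_hom_id⟩

theorem K0.cls_freeMod (s : ℤ) : K0.cls (freeMod A s) (isPmod_freeMod s) =
    (T s : ℤ[T;T⁻¹]) • K0.cls (freeMod A 0) (isPmod_freeMod 0) := by
  refine K0.cls_shift _ _ ?_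
  have := grIso_freeMod_shift (A := A) 0 s
  rw [zero_add] at this
  exact this.symm

theorem K0.cls_freeSum (l : List ℤ) : K0.cls (freeSum A l) (isPmod_freeSum l) =
    (l.map fun s => (T s : ℤ[T;T⁻¹])).sum • K0.cls (freeMod A 0) (isPmod_freeMod 0) := by
  induction l with
  | nil =>
    have := K0.cls_sum (isPmod_freeSum []) (isPmod_freeSum []) (isPmod_freeSum []) (A := A)
      (grIso_of_subsingleton (freeSum_nil A) (M := freeSum A []) (P := (freeSum A []).sum (freeSum A []))
        (inferInstanceAs (Subsingleton (PUnit × PUnit))))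
    rw [left_eq_add] at this
    rw [this, List.map_nil, List.sum_nil, zero_smul]
  | cons s l ih =>
    rw [List.map_cons, List.sum_cons, add_smul, ← ih, ← K0.cls_freeMod]
    exact K0.cls_sum _ _ _ (.refl _)

theorem sum_revTake (d : ℕ → ℤ) (r : ℕ) : ((revTake d r).map fun s => (T s : ℤ[T;T⁻¹])).sum =
    ∑ i ∈ Finset.range r, T (d i) := by
  induction r with
  | zero => rfl
  | succ r ih => rw [revTake, List.map_cons, List.sum_cons, ih, Finset.sum_range_succ, add_comm]

/-- The action of a bimodule that is graded free on the right. -/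
theorem K0.map_freeMod (M : GrBimod A B) (hM : IsPmod (res M)) {d : ℕ → ℤ} {r : ℕ}
    (h : GrIso (res M) (freeSum B (revTake d r))) :
    K0.map M hM (K0.cls (freeMod A 0) (isPmod_freeMod 0)) =
      (∑ i ∈ Finset.range r, T (d i) : ℤ[T;T⁻¹]) • K0.cls (freeMod B 0) (isPmod_freeMod 0) := by
  rw [K0.map_cls, ← sum_revTake, ← K0.cls_freeSum]
  exact K0.cls_iso _ _ ((grIso_freeMod_tensor M 0).trans ((grIso_shift_zero _).trans h))

theorem K0.exists_smul (hA : A.gr 0 = Submodule.span ℚ {1}) (x : K0 A) :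
    ∃ c : ℤ[T;T⁻¹], x = c • K0.cls (freeMod A 0) (isPmod_freeMod 0) := by
  obtain ⟨x, rfl⟩ := Submodule.Quotient.mk_surjective _ x
  induction x using Finsupp.induction_linear with
  | zero => exact ⟨0, by simp⟩
  | add x y hx hy =>
    obtain ⟨c, hc⟩ := hx
    obtain ⟨d, hd⟩ := hy
    exact ⟨c + d, by rw [Submodule.Quotient.mk_add, hc, hd, add_smul]⟩
  | single P c =>
    obtain ⟨l, hl⟩ := exists_grIso_freeSum hA P.2
    have e := (K0.cls_iso P.2 (isPmod_freeSum l) hl).trans (K0.cls_freeSum l)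
    refine ⟨c * (l.map fun s => (T s : ℤ[T;T⁻¹])).sum, ?_⟩
    rw [mul_smul, ← e]
    exact K0.mk_single P c

theorem K0.subsingleton (hA : Subsingleton A.carrier) : Subsingleton (K0 A) := by
  have hP : ∀ P : GrMod A, Subsingleton P.carrier := fun P => subsingleton_of_forall_eq 0 fun p => by
    have h1 : P.right 1 p = p := LinearMap.congr_fun (map_one P.right) p
    rw [← h1, Subsingleton.elim (1 : A.carrier) 0, map_zero, LinearMap.zero_apply]
  have : (LinearMap.id : K0 A →ₗ[ℤ[T;T⁻¹]] K0 A) = 0 := K0.hom_ext fun P h => by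
    have hs : Subsingleton (P.sum P).carrier := by
      have := hP P
      exact inferInstanceAs (Subsingleton (P.carrier × P.carrier))
    have := K0.cls_sum h h h (grIso_of_subsingleton (hP P) hs)
    rw [left_eq_add] at this
    exact this
  exact subsingleton_of_forall_eq 0 fun x => LinearMap.congr_fun this x

end Grothendieck

section Rank

theorem T_mul_coeff (s : ℤ) (p : ℤ[T;T⁻¹]) (d : ℤ) : (T s * p).coeff d = p.coeff (d - s) := by
  rw [T, AddMonoidAlgebra.coeff_single_mul_apply, one_mul, neg_add_eq_sub]

variable {A B : GrAlg}

/-- The homogeneous parts of `M` are finite-dimensional, with dimensions given by `p`. -/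
def HasHilbert (M : GrBimod A B) (p : ℤ[T;T⁻¹]) : Prop :=
  ∀ d, Module.Finite ℚ (M.gr d) ∧ (Module.finrank ℚ (M.gr d) : ℤ) = p.coeff d

theorem HasHilbert.unique {M : GrBimod A B} {p q : ℤ[T;T⁻¹]} (hp : HasHilbert M p)
    (hq : HasHilbert M q) : p = q :=
  LaurentPolynomial.ext fun d => (hp d).2.symm.trans (hq d).2

theorem HasHilbert.iso {M P : GrBimod A B} {p : ℤ[T;T⁻¹]} (hp : HasHilbert M p) (h : GrIso M P) :
    HasHilbert P p := fun d => by
  obtain ⟨f, g, hf, hg, hfg, hgf⟩ := h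
  let e : M.gr d ≃ₗ[ℚ] P.gr d := LinearEquiv.ofLinearMap
    (f.lin.restrict fun m hm => hf.mem hm) (g.lin.restrict fun m hm => hg.mem hm)
    (LinearMap.ext fun m => Subtype.ext (LinearMap.congr_fun (congrArg BimHom.lin hgf) m.1))
    (LinearMap.ext fun m => Subtype.ext (LinearMap.congr_fun (congrArg BimHom.lin hfg) m.1))
  have := (hp d).1
  exact ⟨Module.Finite.equiv e, e.finrank_eq ▸ (hp d).2⟩

theorem HasHilbert.sum {M P : GrBimod A B} {p q : ℤ[T;T⁻¹]} (hp : HasHilbert M p)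
    (hq : HasHilbert P q) : HasHilbert (M.sum P) (p + q) := fun d => by
  let e : (M.gr d × P.gr d) ≃ₗ[ℚ] (M.sum P).gr d :=
    { toFun := fun x => ⟨((x.1 : M.carrier), (x.2 : P.carrier)), x.1.2, x.2.2⟩
      invFun := fun x => (⟨x.1.1, x.2.1⟩, ⟨x.1.2, x.2.2⟩)
      map_add' := fun _ _ => rfl
      map_smul' := fun _ _ => rfl
      left_inv := fun _ => rfl
      right_inv := fun _ => rfl }
  have := (hp d).1
  have := (hq d).1
  refine ⟨Module.Finite.equiv e, ?_⟩
  rw [← e.finrank_eq, Module.finrank_prod, Nat.cast_add, (hp d).2, (hq d).2]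
  rfl

theorem HasHilbert.shift {M : GrBimod A B} {p : ℤ[T;T⁻¹]} (hp : HasHilbert M p) (s : ℤ) :
    HasHilbert (M.shift s) (T s * p) := fun d => by
  rw [T_mul_coeff]
  exact hp (d - s)

theorem hasHilbert_freeMod_ground : HasHilbert (freeMod ground 0) 1 := fun d => by
  rw [← T_zero, T_apply]
  change Module.Finite ℚ (ground.gr (d - 0)) ∧ (Module.finrank ℚ (ground.gr (d - 0)) : ℤ) = _
  rw [sub_zero]
  by_cases hd : d = 0
  · have e : ground.gr d = (⊤ : Submodule ℚ ℚ) := if_pos hd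
    rw [e, if_pos hd.symm]
    exact ⟨inferInstance, by simp⟩
  · have e : ground.gr d = (⊥ : Submodule ℚ ℚ) := if_neg hd
    rw [e, if_neg (Ne.symm hd)]
    exact ⟨inferInstance, by simp⟩

theorem ground_gr_zero : ground.gr 0 = Submodule.span ℚ {1} := by
  have e : ∀ d, d = 0 → ground.gr d = (⊤ : Submodule ℚ ℚ) := fun d hd => if_pos hd
  rw [e 0 rfl]
  exact Eq.symm ((Submodule.eq_top_iff').2 fun x => Submodule.mem_span_singleton.2 ⟨x, mul_one x⟩)

theorem hasHilbert_freeSum_ground (l : List ℤ) :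
    HasHilbert (freeSum ground l) (l.map fun s => (T s : ℤ[T;T⁻¹])).sum := by
  induction l with
  | nil =>
    intro d
    have : Subsingleton ((freeSum ground []).gr d) :=
      ⟨fun x y => Subtype.ext (Subsingleton.elim (α := PUnit) _ _)⟩
    exact ⟨inferInstance, by rw [Module.finrank_zero_of_subsingleton]; rfl⟩
  | cons s l ih =>
    refine HasHilbert.sum ?_ ih
    have := (hasHilbert_freeMod_ground.shift s).iso (grIso_freeMod_shift 0 s)
    rwa [zero_add, mul_one] at this

theorem exists_hasHilbert {P : GrMod ground} (hP : IsPmod P) : ∃ p, HasHilbert P p := by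
  obtain ⟨l, hl⟩ := exists_grIso_freeSum ground_gr_zero hP
  exact ⟨_, (hasHilbert_freeSum_ground l).iso hl.symm⟩

/-- The graded dimension on the Grothendieck group of graded vector spaces. -/
noncomputable def gradedDim : K0 ground →ₗ[ℤ[T;T⁻¹]] ℤ[T;T⁻¹] :=
  K0.lift (fun P => (exists_hasHilbert P.2).choose)
    (fun P Q R h => (exists_hasHilbert R.2).choose_spec.unique
      (((exists_hasHilbert P.2).choose_spec.sum (exists_hasHilbert Q.2).choose_spec).iso h.symm))
    (fun P R s h => (exists_hasHilbert R.2).choose_spec.unique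
      (((exists_hasHilbert P.2).choose_spec.shift s).iso h.symm))

theorem gradedDim_freeMod : gradedDim (K0.cls (freeMod ground 0) (isPmod_freeMod 0)) = 1 :=
  (K0.lift_cls _ _ _ _).trans ((exists_hasHilbert (isPmod_freeMod 0)).choose_spec.unique hasHilbert_freeMod_ground)

variable {N : ℕ} {n : ℤ}

/-- The residue field of `H_k`. -/
noncomputable def residue (h : Valid N n) : GrBimod (H N n) ground :=
  ofHoms (C := ground) (augmentation h) (AlgHom.id ℚ ℚ) (fun d a ha => by
    by_cases hd : d = 0
    · have e : ground.gr d = (⊤ : Submodule ℚ ℚ) := if_pos hd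
      rw [e]; trivial
    · rw [augmentation_of_mem h hd ha]; exact zero_mem _) (fun _ _ hb => hb)

theorem grIso_res_residue (h : Valid N n) :
    GrIso (res (residue h)) (freeSum ground (revTake (fun _ => 0) 1)) :=
  (grIso_of_equiv (P := freeMod ground 0) (LinearEquiv.refl ℚ ℚ) (fun c m => by
      rw [ground_left, ground_left]; rfl) (fun _ _ => rfl)
    (fun i m hm => by
      change m ∈ ground.gr (i - 0)
      rw [sub_zero]
      exact hm)
    (fun i m hm => by
      have hm : m ∈ ground.gr (i - 0) := hm
      rw [sub_zero] at hm
      exact hm)).trans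
    (grIso_sum_zero_right (freeSum_nil ground)).symm

theorem K0_smul_injective (h : Valid N n) {c : ℤ[T;T⁻¹]}
    (hc : c • K0.cls (freeMod (H N n) 0) (isPmod_freeMod 0) = 0) : c = 0 := by
  have hr : IsPmod (res (residue h)) := isPmod_of_iso (grIso_res_residue h).symm (isPmod_freeSum _)
  have := congrArg (fun x => gradedDim (K0.map (residue h) hr x)) hc
  simpa [K0.map_freeMod _ hr (grIso_res_residue h), gradedDim_freeMod, -LinearMap.map_smul_of_tower] using this

end Rank

section QuantumIntegers

theorem T_sub_mul_qnat (m : ℕ) : (T 1 - T (-1)) * qnat m = T m - T (-m) := by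
  rw [qnat, Finset.mul_sum]
  have : ∀ i ∈ Finset.range m, (T 1 - T (-1) : ℤ[T;T⁻¹]) * T ((m : ℤ) - 1 - 2 * i) =
      (fun i : ℕ => T ((m : ℤ) - 2 * i)) i - (fun i : ℕ => T ((m : ℤ) - 2 * i)) (i + 1) := fun i _ => by
    rw [sub_mul, ← T_add, ← T_add]
    congr 2 <;> (push_cast; ring)
  rw [Finset.sum_congr rfl this, Finset.sum_range_sub']
  congr 2
  ring

theorem T_sub_ne_zero {m : ℤ} (hm : 0 < m) : (T m - T (-m) : ℤ[T;T⁻¹]) ≠ 0 := fun h => by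
  have := congrArg (fun p => p.coeff m) h
  have h1 : ¬(-m = m) := by omega
  have h2 : (T m - T (-m) : ℤ[T;T⁻¹]).coeff m = 1 := by
    rw [AddMonoidAlgebra.coeff_sub, Finsupp.sub_apply, T_apply, T_apply, if_pos rfl, if_neg h1, sub_zero]
  exact one_ne_zero (h2.symm.trans this)

theorem qnat_ne_zero {m : ℕ} (hm : 0 < m) : qnat m ≠ 0 := fun h => by
  have := T_sub_mul_qnat m
  rw [h, mul_zero] at this
  exact T_sub_ne_zero (by exact_mod_cast hm) this.symm

theorem T_sub_mul_qint (n : ℤ) : (T 1 - T (-1)) * qint n = T n - T (-n) := by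
  rw [qint, mul_sub, T_sub_mul_qnat, T_sub_mul_qnat]
  rcases le_total 0 n with h | h
  · rw [Int.toNat_of_nonneg h, Int.toNat_of_nonpos (by omega : -n ≤ 0)]
    simp
  · rw [Int.toNat_of_nonneg (by omega : 0 ≤ -n), Int.toNat_of_nonpos h]
    simp

theorem qnat_eq_of_T_sub {a b : ℤ[T;T⁻¹]} (h : (T 1 - T (-1)) * a = (T 1 - T (-1)) * b) : a = b :=
  mul_left_cancel₀ (T_sub_ne_zero one_pos) h

theorem qnat_add (m n : ℕ) : qnat (m + n) = T n * qnat m + T (-m) * qnat n := by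
  refine qnat_eq_of_T_sub ?_
  rw [mul_add, mul_left_comm, mul_left_comm _ (T (-(m : ℤ))), T_sub_mul_qnat, T_sub_mul_qnat,
    T_sub_mul_qnat, mul_sub, mul_sub, ← T_add, ← T_add, ← T_add, ← T_add]
  rw [show (n : ℤ) + m = (m + n : ℕ) by push_cast; ring, show -(m : ℤ) + -n = -((m + n : ℕ) : ℤ) by
    push_cast; ring, show (n : ℤ) + -m = -m + n by ring]
  ring

theorem qnat_comm {N k : ℕ} (hk : k ≤ N) : qnat k * qnat (N - k + 1) =
    qnat (k + 1) * qnat (N - k) + qint (2 * k - N) := by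
  refine qnat_eq_of_T_sub (qnat_eq_of_T_sub ?_)
  have e : ∀ a b : ℕ, (T 1 - T (-1)) * ((T 1 - T (-1)) * (qnat a * qnat b)) =
      (T a - T (-a)) * (T b - T (-b)) := fun a b => by
    rw [← T_sub_mul_qnat, ← T_sub_mul_qnat]; ring
  rw [mul_add, mul_add, e, e, T_sub_mul_qint]
  push_cast [Nat.cast_sub hk]
  simp only [mul_sub, sub_mul, ← T_add]
  ring_nf

/-- The product `[m+1] [m+2] ⋯ [m+a]`. -/
noncomputable def qasc (m a : ℕ) : ℤ[T;T⁻¹] := ∏ i ∈ Finset.range a, qnat (m + 1 + i)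

theorem qasc_succ (m a : ℕ) : qasc m (a + 1) = qasc m a * qnat (m + 1 + a) := Finset.prod_range_succ _ _

theorem qasc_shift (m a : ℕ) : qasc m (a + 1) = qnat (m + 1) * qasc (m + 1) a := by
  rw [qasc, Finset.prod_range_succ', mul_comm, add_zero, qasc]
  congr 1
  exact Finset.prod_congr rfl fun i _ => by congr 1; omega

/-- Quantum binomial coefficients are Laurent polynomials. -/
theorem qfact_dvd_qasc (a m : ℕ) : qfact a ∣ qasc m a := by
  induction a generalizing m with
  | zero => exact one_dvd _
  | succ a iha =>
    have hf : qfact (a + 1) = qfact a * qnat (a + 1) := Finset.prod_range_succ _ _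
    induction m with
    | zero =>
      refine dvd_of_eq (Finset.prod_congr rfl fun i _ => ?_)
      congr 1; omega
    | succ m ihm =>
      rw [qasc_succ, show m + 1 + 1 + a = (m + 1) + (a + 1) by omega, qnat_add, mul_add]
      refine dvd_add ?_ ?_
      · rw [mul_left_comm, mul_comm (qasc (m + 1) a), ← qasc_shift]
        exact ihm.mul_left _
      · rw [mul_left_comm, hf]
        exact (mul_dvd_mul_right (iha (m + 1)) _).mul_left _

end QuantumIntegers

section Representations

variable {R : Type*} [CommRing R] [Algebra ℤ[T;T⁻¹] R] {V : Type*} [AddCommGroup V] [Module R V] {N : ℕ}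

/-- The vector `v_k`, which is zero if `k > N`. -/
noncomputable def weightVec (B : Module.Basis (Fin (N + 1)) R V) (k : ℕ) : V :=
  if h : k < N + 1 then B ⟨k, h⟩ else 0

theorem weightVec_val (B : Module.Basis (Fin (N + 1)) R V) (k : Fin (N + 1)) : weightVec B k = B k :=
  dif_pos k.2

theorem weightVec_of_lt (B : Module.Basis (Fin (N + 1)) R V) {k : ℕ} (h : N < k) : weightVec B k = 0 :=
  dif_neg (by omega)

theorem weightVec_ext {B : Module.Basis (Fin (N + 1)) R V} {W : Type*} [AddCommGroup W] [Module R W]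
    {f g : V →ₗ[R] W} (h : ∀ k ≤ N, f (weightVec B k) = g (weightVec B k)) : f = g :=
  B.ext fun k => by
    rw [← weightVec_val]
    exact h k (by omega)

/-- The operators act on the basis by the formulas defining `V_N`. -/
structure IsVN (B : Module.Basis (Fin (N + 1)) R V) (one E F : ℤ → Module.End R V) : Prop where
  one_apply : ∀ n k, one n (weightVec B k) = if n = 2 * k - N then weightVec B k else 0
  E_apply : ∀ n k, E n (weightVec B k) =
    if n = 2 * k - N then algebraMap ℤ[T;T⁻¹] R (qnat (k + 1)) • weightVec B (k + 1) else 0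
  F_apply : ∀ n k, F n (weightVec B (k + 1)) =
    if n = 2 * k - N then algebraMap ℤ[T;T⁻¹] R (qnat (N - k)) • weightVec B k else 0
  F_zero : ∀ n, F n (weightVec B 0) = 0

namespace IsVN

variable {B : Module.Basis (Fin (N + 1)) R V} {one E F : ℤ → Module.End R V}

theorem isUdotRep (h : IsVN B one E F) : IsUdotRep one E F where
  one_mul_self n := weightVec_ext (B := B) fun k _ => by
    rw [Module.End.mul_apply, h.one_apply]
    split_ifs with hn
    · rw [h.one_apply, if_pos hn]
    · rw [map_zero]
  one_mul n m hnm := weightVec_ext (B := B) fun k _ => by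
    rw [Module.End.mul_apply, h.one_apply]
    split_ifs with hn
    · rw [h.one_apply, if_neg (by omega)]; rfl
    · rw [map_zero]; rfl
  E_weight n := weightVec_ext (B := B) fun k _ => by
    rw [Module.End.mul_apply, Module.End.mul_apply, h.one_apply, h.E_apply]
    split_ifs with hn
    · rw [h.E_apply, if_pos hn, map_smul, h.one_apply, if_pos (by push_cast; omega)]
    · rw [map_zero, map_zero]
  F_weight n := weightVec_ext (B := B) fun k _ => by
    rw [Module.End.mul_apply, Module.End.mul_apply, h.one_apply]
    cases k with
    | zero => split_ifs <;> simp [h.F_zero]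
    | succ k =>
      rw [h.F_apply]
      split_ifs with h1 h2 h2
      · rw [h.F_apply, if_pos h2, map_smul, h.one_apply, if_pos h2]
      · push_cast at h1; omega
      · push_cast at h1; omega
      · rw [map_zero, map_zero]
  comm n := weightVec_ext (B := B) fun k hk => by
    rw [LinearMap.add_apply, LinearMap.smul_apply, Module.End.mul_apply, Module.End.mul_apply,
      h.one_apply, h.E_apply]
    by_cases hn : n + 2 = 2 * k - N
    · rw [if_pos hn, if_pos hn, map_smul, h.F_apply, if_pos hn, smul_smul, ← add_smul, hn, ← map_mul,
        ← map_add, ← qnat_comm hk]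
      cases k with
      | zero => rw [h.F_zero]; simp [qnat]
      | succ k =>
        rw [h.F_apply, if_pos (by push_cast at hn; omega), map_smul, h.E_apply,
          if_pos (by push_cast at hn; omega), smul_smul, ← map_mul, mul_comm,
          show N - (k + 1) + 1 = N - k by omega]
    · rw [if_neg hn, if_neg hn, map_zero, smul_zero, add_zero]
      cases k with
      | zero => rw [h.F_zero, map_zero]
      | succ k => rw [h.F_apply, if_neg (by push_cast at hn; omega), map_zero]
  unital := by
    refine eq_top_iff.2 (B.span_eq ▸ Submodule.span_le.2 ?_)
    rintro _ ⟨k, rfl⟩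
    refine Submodule.mem_iSup_of_mem (2 * ((k : ℕ) : ℤ) - N) ⟨B k, ?_⟩
    rw [← weightVec_val, h.one_apply, if_pos rfl]

theorem Epow_apply (h : IsVN B one E F) (n : ℤ) (a k : ℕ) : Epow one E n a (weightVec B k) =
    if n = 2 * k - N then algebraMap ℤ[T;T⁻¹] R (qasc k a) • weightVec B (k + a) else 0 := by
  induction a with
  | zero => simp [Epow, h.one_apply, qasc]
  | succ a ih =>
    rw [Epow, Module.End.mul_apply, ih]
    split_ifs with hn
    · rw [map_smul, h.E_apply, if_pos (by push_cast; omega), smul_smul, ← map_mul, qasc_succ,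
        show k + a + 1 = k + 1 + a by omega, show k + (a + 1) = k + 1 + a by omega]
    · rw [map_zero]

theorem Fpow_apply (h : IsVN B one E F) (n : ℤ) (a k : ℕ) (hk : k ≤ N) : Fpow one F n a (weightVec B k) =
    if n = 2 * k - N ∧ a ≤ k then algebraMap ℤ[T;T⁻¹] R (qasc (N - k) a) • weightVec B (k - a) else 0 := by
  induction a with
  | zero => simp [Fpow, h.one_apply, qasc]
  | succ a ih =>
    rw [Fpow, Module.End.mul_apply, ih]
    by_cases hn : n = 2 * k - N
    · by_cases ha : a + 1 ≤ k
      · rw [if_pos ⟨hn, by omega⟩, if_pos ⟨hn, ha⟩, map_smul, show k - a = (k - (a + 1)) + 1 by omega,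
          h.F_apply, if_pos (by push_cast [Nat.cast_sub ha]; omega), smul_smul, ← map_mul, qasc_succ,
          show N - (k - (a + 1)) = N - k + 1 + a by omega]
      · rw [if_neg (fun h => ha h.2 : ¬(n = 2 * k - N ∧ a + 1 ≤ k))]
        split_ifs with h'
        · rw [map_smul, show k - a = 0 by omega, h.F_zero, smul_zero]
        · rw [map_zero]
    · rw [if_neg (fun h => hn h.1), if_neg (fun h => hn h.1), map_zero]

end IsVN

/-- The canonical isomorphism between two modules with bases as in `V_N` is equivariant. -/
theorem IsVN.equiv_apply {W : Type*} [AddCommGroup W] [Module R W]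
    {B : Module.Basis (Fin (N + 1)) R V} {one E F : ℤ → Module.End R V} (h : IsVN B one E F)
    {B' : Module.Basis (Fin (N + 1)) R W} {one' E' F' : ℤ → Module.End R W} (h' : IsVN B' one' E' F')
    (n : ℤ) (v : V) : B.equiv B' (Equiv.refl _) (one n v) = one' n (B.equiv B' (Equiv.refl _) v) ∧
      B.equiv B' (Equiv.refl _) (E n v) = E' n (B.equiv B' (Equiv.refl _) v) ∧
      B.equiv B' (Equiv.refl _) (F n v) = F' n (B.equiv B' (Equiv.refl _) v) := by
  set e := B.equiv B' (Equiv.refl _) with he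
  have hb : ∀ k, e (weightVec B k) = weightVec B' k := fun k => by
    rw [weightVec, weightVec]
    split_ifs
    · rw [he, Module.Basis.equiv_apply]; rfl
    · rw [map_zero]
  have key : ∀ f : Module.End R V, ∀ f' : Module.End R W,
      (∀ k, e (f (weightVec B k)) = f' (weightVec B' k)) → e (f v) = f' (e v) := fun f f' hf =>
    LinearMap.congr_fun (weightVec_ext (B := B) (f := e.toLinearMap ∘ₗ f) (g := f' ∘ₗ e.toLinearMap)
      fun k _ => (hf k).trans (congrArg f' (hb k).symm)) v
  refine ⟨key _ _ fun k => ?_, key _ _ fun k => ?_, key _ _ fun k => ?_⟩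
  · rw [h.one_apply, h'.one_apply]
    split_ifs
    · exact hb k
    · exact map_zero e
  · rw [h.E_apply, h'.E_apply]
    split_ifs
    · rw [map_smul, hb]
    · exact map_zero e
  · cases k with
    | zero => rw [h.F_zero, h'.F_zero, map_zero]
    | succ k =>
      rw [h.F_apply, h'.F_apply]
      split_ifs
      · rw [map_smul, hb]
      · exact map_zero e

theorem existsUnique_smul_eq {V : Type*} [AddCommGroup V] [Module ℤ[T;T⁻¹] V]
    (B : Module.Basis (Fin (N + 1)) ℤ[T;T⁻¹] V) {c : ℤ[T;T⁻¹]} (hc : c ≠ 0)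
    (f : Module.End ℤ[T;T⁻¹] V) (hf : ∀ k ≤ N, ∃ v, f (weightVec B k) = c • v) :
    ∃! D : Module.End ℤ[T;T⁻¹] V, algebraMap ℤ[T;T⁻¹] ℤ[T;T⁻¹] c • D = f := by
  choose! g hg using hf
  refine ⟨B.constr ℤ[T;T⁻¹] fun k => g k, weightVec_ext (B := B) fun k hk => ?_, fun D hD => ?_⟩
  · rw [hg k hk, LinearMap.smul_apply, weightVec, dif_pos (by omega), Module.Basis.constr_basis]
    rfl
  · refine B.ext fun k => B.repr.injective (Finsupp.ext fun i => mul_left_cancel₀ hc ?_)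
    have h1 := congrArg (fun f => B.repr (f (B k)) i) hD
    have h2 := hg k (by omega)
    rw [weightVec_val] at h2
    rw [Module.Basis.constr_basis]
    refine Eq.trans ?_ (h1.trans ?_)
    · simp
    · simp [h2]

theorem qfact_ne_zero (a : ℕ) : qfact a ≠ 0 :=
  Finset.prod_ne_zero_iff.2 fun i _ => qnat_ne_zero i.succ_pos

theorem IsVN.hasDividedPowers {V : Type*} [AddCommGroup V] [Module ℤ[T;T⁻¹] V]
    {B : Module.Basis (Fin (N + 1)) ℤ[T;T⁻¹] V} {one E F : ℤ → Module.End ℤ[T;T⁻¹] V}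
    (h : IsVN B one E F) : HasDividedPowers one E F := fun n a =>
  ⟨existsUnique_smul_eq B (qfact_ne_zero a) _ fun k hk => by
      obtain ⟨d, hd⟩ := qfact_dvd_qasc a k
      rw [h.Epow_apply]
      split_ifs
      · exact ⟨d • weightVec B (k + a), by rw [hd, smul_smul]; rfl⟩
      · exact ⟨0, (smul_zero _).symm⟩,
    existsUnique_smul_eq B (qfact_ne_zero a) _ fun k hk => by
      obtain ⟨d, hd⟩ := qfact_dvd_qasc a (N - k)
      rw [h.Fpow_apply n a k hk]
      split_ifs
      · exact ⟨d • weightVec B (k - a), by rw [hd, smul_smul]; rfl⟩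
      · exact ⟨0, (smul_zero _).symm⟩⟩

theorem IsVN.isIrred {V : Type*} [AddCommGroup V] [Module Kq V]
    {B : Module.Basis (Fin (N + 1)) Kq V} {one E F : ℤ → Module.End Kq V}
    (h : IsVN B one E F) : IsIrred one E F := by
  have hq : ∀ m : ℕ, 0 < m → algebraMap ℤ[T;T⁻¹] Kq (qnat m) ≠ 0 := fun m hm =>
    (map_ne_zero_iff _ (IsFractionRing.injective ℤ[T;T⁻¹] Kq)).2 (qnat_ne_zero hm)
  have hdiv : ∀ (W : Submodule Kq V) (c : Kq) (v : V), c ≠ 0 → c • v ∈ W → v ∈ W :=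
    fun W c v hc hv => (W.smul_mem_iff hc).1 hv
  refine ⟨⟨B 0, 0, B.ne_zero 0⟩, fun W hW => or_iff_not_imp_left.2 fun hne => ?_⟩
  obtain ⟨w, hw, hw0⟩ := W.ne_bot_iff.1 hne
  obtain ⟨k, hk⟩ : ∃ k, B.repr w k ≠ 0 := by
    by_contra! hall
    exact hw0 (B.repr.map_eq_zero_iff.1 (Finsupp.ext hall))
  have hone : one (2 * ((k : ℕ) : ℤ) - N) w = B.repr w k • B k := by
    conv_lhs => rw [← B.sum_repr w]
    rw [map_sum, Finset.sum_eq_single k]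
    · rw [map_smul, ← weightVec_val, h.one_apply, if_pos rfl]
    · intro j _ hj
      rw [map_smul, ← weightVec_val, h.one_apply, if_neg, smul_zero]
      intro e
      exact hj (Fin.ext (by omega))
    · simp
  have h0 : weightVec B k ∈ W := by
    refine hdiv W _ _ hk ?_
    rw [weightVec_val, ← hone]
    exact (hW _ w hw).1
  have up : ∀ i, weightVec B (k + i) ∈ W := fun i => by
    induction i with
    | zero => exact h0
    | succ i ih =>
      have := (hW (2 * ((k + i : ℕ) : ℤ) - N) _ ih).2.1
      rw [h.E_apply, if_pos rfl] at this
      exact hdiv W _ _ (hq _ (Nat.succ_pos _)) this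
  have down : ∀ i, i ≤ N → weightVec B (N - i) ∈ W := fun i => by
    induction i with
    | zero => 
      intro _
      have := up (N - k)
      rwa [show (k : ℕ) + (N - k) = N - 0 by omega] at this
    | succ i ih =>
      intro hi
      have := (hW (2 * ((N - (i + 1) : ℕ) : ℤ) - N) _ (ih (by omega))).2.2
      rw [show N - i = N - (i + 1) + 1 by omega, h.F_apply, if_pos rfl] at this
      exact hdiv W _ _ (hq _ (by omega)) this
  refine eq_top_iff.2 (B.span_eq ▸ Submodule.span_le.2 ?_)
  rintro _ ⟨j, rfl⟩
  have := down (N - j) (by omega)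
  rwa [show N - (N - (j : ℕ)) = j by omega, weightVec_val] at this

/-- The defining matrices of `V_N`. -/
theorem isVN_vOne (R : Type*) [CommRing R] [Algebra ℤ[T;T⁻¹] R] (N : ℕ) :
    IsVN (Pi.basisFun R (Fin (N + 1))) (vOne R N) (vEE R N) (vFF R N) := by
  have hw : ∀ (k : ℕ) (i : Fin (N + 1)), weightVec (Pi.basisFun R (Fin (N + 1))) k i =
      if (i : ℕ) = k then 1 else 0 := fun k i => by
    rw [weightVec]
    split_ifs with h1 h2 h2
    · rw [Pi.basisFun_apply, show i = ⟨k, h1⟩ from Fin.ext h2, Pi.single_eq_same]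
    · rw [Pi.basisFun_apply, Pi.single_eq_of_ne fun h => h2 (congrArg Fin.val h)]
    · omega
    · rfl
  have hmat : ∀ (M : Matrix (Fin (N + 1)) (Fin (N + 1)) R) (k : ℕ) (i : Fin (N + 1)),
      Matrix.toLin' M (weightVec (Pi.basisFun R (Fin (N + 1))) k) i =
        if h : k < N + 1 then M i ⟨k, h⟩ else 0 := fun M k i => by
    rw [weightVec]
    split_ifs with h1
    · rw [Pi.basisFun_apply, Matrix.toLin'_apply, Matrix.mulVec_single_one]; rfl
    · rw [map_zero]; rfl
  refine ⟨fun n k => funext fun i => ?_, fun n k => funext fun i => ?_, fun n k => funext fun i => ?_,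
    fun n => funext fun i => ?_⟩
  · rw [vOne, hmat]
    split_ifs with h1 h2 h2
    · rw [hw]; simp [h2, Fin.ext_iff]
    · simp [h2]
    · rw [hw, if_neg (by omega)]
    · rfl
  · rw [vEE, hmat]
    split_ifs with h1 h2 h2
    · rw [Pi.smul_apply, hw]; simp [h2]
    · simp [h2]
    · rw [Pi.smul_apply, hw, if_neg (by omega), smul_zero]
    · rfl
  · rw [vFF, hmat]
    split_ifs with h1 h2 h2
    · rw [Pi.smul_apply, hw]
      simp only [Matrix.of_apply]
      by_cases hi : (i : ℕ) = k
      · simp [hi, h2]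
      · rw [if_neg (by omega), if_neg hi, smul_zero]
    · simp only [Matrix.of_apply]
      rw [if_neg (by omega)]; rfl
    · rw [Pi.smul_apply, hw, show N - k = 0 by omega]
      simp [qnat]
    · rfl
  · rw [vFF, hmat, dif_pos (by omega)]
    simp

theorem IsVN.baseChange {V : Type*} [AddCommGroup V] [Module ℤ[T;T⁻¹] V]
    {B : Module.Basis (Fin (N + 1)) ℤ[T;T⁻¹] V} {one E F : ℤ → Module.End ℤ[T;T⁻¹] V}
    (h : IsVN B one E F) (R : Type*) [CommRing R] [Algebra ℤ[T;T⁻¹] R] :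
    IsVN (B.baseChange R) (fun n => (one n).baseChange R) (fun n => (E n).baseChange R)
      (fun n => (F n).baseChange R) := by
  have hw : ∀ k, weightVec (B.baseChange R) k = 1 ⊗ₜ weightVec B k := fun k => by
    rw [weightVec, weightVec]
    split_ifs
    · simp
    · rw [TensorProduct.tmul_zero]
  have hs : ∀ (c : ℤ[T;T⁻¹]) (v : V), (1 : R) ⊗ₜ[ℤ[T;T⁻¹]] (c • v) =
      algebraMap ℤ[T;T⁻¹] R c • ((1 : R) ⊗ₜ[ℤ[T;T⁻¹]] v) := fun c v => by
    rw [TensorProduct.tmul_smul, algebraMap_smul]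
  refine ⟨fun n k => ?_, fun n k => ?_, fun n k => ?_, fun n => ?_⟩
  · rw [hw, LinearMap.baseChange_tmul, h.one_apply]
    split_ifs
    · rfl
    · rw [TensorProduct.tmul_zero]
  · rw [hw, hw, LinearMap.baseChange_tmul, h.E_apply]
    split_ifs
    · exact hs _ _
    · rw [TensorProduct.tmul_zero]
  · rw [hw, hw, LinearMap.baseChange_tmul, h.F_apply]
    split_ifs
    · exact hs _ _
    · rw [TensorProduct.tmul_zero]
  · rw [hw, LinearMap.baseChange_tmul, h.F_zero, TensorProduct.tmul_zero]

end Representations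

section WeightSpaces

theorem sum_T_eq (r : ℕ) (s : ℤ) :
    (∑ i ∈ Finset.range r, T (2 * i + s) : ℤ[T;T⁻¹]) = T (s + r - 1) * qnat r := by
  rw [qnat, Finset.mul_sum, ← Finset.sum_range_reflect]
  refine Finset.sum_congr rfl fun i hi => ?_
  have := Finset.mem_range.1 hi
  rw [← T_add]
  congr 1
  rw [show r - 1 - i = r - (1 + i) by omega, Nat.cast_sub (by omega)]
  push_cast
  ring

variable {N : ℕ} {K : ℤ → Type*} [∀ n, AddCommGroup (K n)] [∀ n, Module ℤ[T;T⁻¹] (K n)]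

/-- The operator on a direct sum given by a map between two summands. -/
noncomputable def summandOp {n m : ℤ} (t : K n →ₗ[ℤ[T;T⁻¹]] K m) :
    Module.End ℤ[T;T⁻¹] (DirectSum ℤ K) :=
  (DirectSum.lof ℤ[T;T⁻¹] ℤ K m).comp (t.comp (DirectSum.component ℤ[T;T⁻¹] ℤ K n))

theorem component_lof_of_ne {n m : ℤ} (h : n ≠ m) (x : K m) :
    DirectSum.component ℤ[T;T⁻¹] ℤ K n (DirectSum.lof ℤ[T;T⁻¹] ℤ K m x) = 0 := by
  rw [DirectSum.component.of, dif_neg h.symm]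

theorem summandOp_lof {n m : ℤ} (t : K n →ₗ[ℤ[T;T⁻¹]] K m) (x : K n) :
    summandOp t (DirectSum.lof ℤ[T;T⁻¹] ℤ K n x) = DirectSum.lof ℤ[T;T⁻¹] ℤ K m (t x) := by
  rw [summandOp, LinearMap.comp_apply, LinearMap.comp_apply, DirectSum.component.lof_self]

theorem summandOp_lof_of_ne {n m p : ℤ} (t : K n →ₗ[ℤ[T;T⁻¹]] K m) (h : n ≠ p) (x : K p) :
    summandOp t (DirectSum.lof ℤ[T;T⁻¹] ℤ K p x) = 0 := by
  rw [summandOp, LinearMap.comp_apply, LinearMap.comp_apply, component_lof_of_ne h, map_zero, map_zero]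

/-- The weight spaces of `V_N` are free of rank one over `ℤ[q, q⁻¹]`, with generators `c n`. -/
structure IsWeightFamily (N : ℕ) (c : ∀ n, K n) : Prop where
  gen : ∀ n x, ∃ a : ℤ[T;T⁻¹], x = a • c n
  free : ∀ n, Valid N n → ∀ a : ℤ[T;T⁻¹], a • c n = 0 → a = 0
  zero : ∀ n, ¬Valid N n → Subsingleton (K n)

/-- The normalised weight vector `q^{-k(N-k)} c_{2k-N}`. -/
noncomputable def normVec (N : ℕ) (c : ∀ n, K n) (k : ℕ) : DirectSum ℤ K :=
  (T (-((k : ℤ) * ((N : ℤ) - k))) : ℤ[T;T⁻¹]) • DirectSum.lof ℤ[T;T⁻¹] ℤ K (2 * (k : ℤ) - N) (c _)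

/-- The basis of normalised weight vectors. -/
noncomputable def IsWeightFamily.basis {c : ∀ n, K n} (h : IsWeightFamily N c) :
    Module.Basis (Fin (N + 1)) ℤ[T;T⁻¹] (DirectSum ℤ K) :=
  Module.Basis.mk (v := fun k : Fin (N + 1) => normVec N c k) (by
    refine Fintype.linearIndependent_iff.2 fun g hg k => ?_
    have := congrArg (DirectSum.component ℤ[T;T⁻¹] ℤ K (2 * ((k : ℕ) : ℤ) - N)) hg
    rw [map_sum, Finset.sum_eq_single k] at this
    · rw [normVec, map_smul, map_smul, DirectSum.component.lof_self, smul_smul, map_zero] at this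
      have := h.free _ ⟨k, by omega, rfl⟩ _ this
      exact (isUnit_T _).mul_left_eq_zero.1 this
    · intro j _ hj
      rw [normVec, map_smul, map_smul, component_lof_of_ne, smul_zero, smul_zero]
      intro e
      exact hj (Fin.ext (by omega))
    · simp) (by
    rintro x -
    induction x using DirectSum.induction_on with
    | zero => exact zero_mem _
    | add x y hx hy => exact add_mem hx hy
    | of n x =>
      by_cases hn : Valid N n
      · obtain ⟨k, hk, rfl⟩ := hn
        obtain ⟨a, rfl⟩ := h.gen _ x
        have : DirectSum.of K (2 * (k : ℤ) - N) (a • c _) =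
            (a * T ((k : ℤ) * ((N : ℤ) - k))) • normVec N c k := by
          rw [normVec, smul_smul, mul_assoc, ← T_add, add_neg_cancel, T_zero, mul_one, ← map_smul]
          rfl
        rw [this]
        exact Submodule.smul_mem _ _ (Submodule.subset_span ⟨⟨k, by omega⟩, rfl⟩)
      · have := h.zero n hn
        rw [Subsingleton.elim x 0, map_zero]
        exact zero_mem _)

theorem IsWeightFamily.basis_apply {c : ∀ n, K n} (h : IsWeightFamily N c) (k : Fin (N + 1)) :
    h.basis k = normVec N c k := Module.Basis.mk_apply _ _ k

theorem IsWeightFamily.weightVec_eq {c : ∀ n, K n} (h : IsWeightFamily N c) {k : ℕ} (hk : k ≤ N) :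
    weightVec h.basis k = normVec N c k := by
  rw [weightVec, dif_pos (by omega), h.basis_apply]

theorem lof_congr {c : ∀ n, K n} {n m : ℤ} (h : n = m) : DirectSum.lof ℤ[T;T⁻¹] ℤ K n (c n) =
    DirectSum.lof ℤ[T;T⁻¹] ℤ K m (c m) := by rw [h]

theorem IsWeightFamily.isVN {c : ∀ n, K n} (h : IsWeightFamily N c) {t : ∀ n, K n →ₗ[ℤ[T;T⁻¹]] K n}
    {tE : ∀ n, K n →ₗ[ℤ[T;T⁻¹]] K (n + 2)} {tF : ∀ n, K (n + 2) →ₗ[ℤ[T;T⁻¹]] K n}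
    (ht : ∀ n, t n = LinearMap.id)
    (hE : ∀ n, ValidE N n → tE n (c n) =
      (∑ i ∈ Finset.range (kk N n + 1), T (2 * i + (1 - N + kk N n)) : ℤ[T;T⁻¹]) • c (n + 2))
    (hF : ∀ n, ValidE N n → tF n (c (n + 2)) =
      (∑ i ∈ Finset.range (N - kk N n - 1 + 1), T (2 * i + -kk N n) : ℤ[T;T⁻¹]) • c n) :
    IsVN h.basis (fun n => summandOp (t n)) (fun n => summandOp (tE n)) (fun n => summandOp (tF n)) := by
  refine ⟨fun n k => ?_, fun n k => ?_, fun n k => ?_, fun n => ?_⟩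
  · by_cases hk : k ≤ N
    · rw [h.weightVec_eq hk, normVec, map_smul]
      split_ifs with hn
      · subst hn
        rw [summandOp_lof, ht, LinearMap.id_apply]
      · rw [summandOp_lof_of_ne _ hn, smul_zero]
    · rw [weightVec_of_lt _ (by omega)]; simp
  · by_cases hk : k ≤ N
    · rw [h.weightVec_eq hk, normVec, map_smul]
      split_ifs with hn
      · subst hn
        rw [summandOp_lof]
        rcases hk.lt_or_eq with hk' | rfl
        · rw [h.weightVec_eq hk', normVec, hE _ ⟨k, hk', rfl⟩, kk_eq rfl, sum_T_eq, map_smul, smul_smul,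
            ← mul_assoc, ← T_add, lof_congr (show 2 * (k : ℤ) - N + 2 = 2 * ((k + 1 : ℕ) : ℤ) - N by
              push_cast; ring), Algebra.algebraMap_self_apply, smul_smul, mul_comm]
          congr 3
          push_cast
          ring
        · have := h.zero (2 * (k : ℤ) - k + 2) (by rintro ⟨j, hj, hj'⟩; omega)
          rw [Subsingleton.elim (tE _ _) 0, weightVec_of_lt _ (by omega)]
          simp
      · rw [summandOp_lof_of_ne _ hn, smul_zero]
    · rw [weightVec_of_lt _ (by omega), weightVec_of_lt _ (by omega)]; simp
  · by_cases hk : k + 1 ≤ N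
    · rw [h.weightVec_eq hk, normVec, map_smul]
      have e := lof_congr (K := K) (c := c) (show 2 * ((k + 1 : ℕ) : ℤ) - N = 2 * (k : ℤ) - N + 2 by
              push_cast; ring)
      rw [e]
      split_ifs with hn
      · subst hn
        rw [summandOp_lof, h.weightVec_eq (by omega : k ≤ N), normVec, hF _ ⟨k, hk, rfl⟩, kk_eq rfl,
          sum_T_eq, map_smul, smul_smul, ← mul_assoc, ← T_add, Algebra.algebraMap_self_apply, smul_smul,
          mul_comm, show N - k - 1 + 1 = N - k by omega]
        congr 3
        push_cast [Nat.cast_sub (by omega : k ≤ N)]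
        ring
      · rw [summandOp_lof_of_ne _ (by omega), smul_zero]
    · rw [weightVec_of_lt _ (by omega), show N - k = 0 by omega]; simp [qnat]
  · rw [h.weightVec_eq (Nat.zero_le N), normVec, map_smul]
    by_cases hn : n + 2 = 2 * ((0 : ℕ) : ℤ) - N
    · have := h.zero n (by rintro ⟨j, hj, hj'⟩; push_cast at hn; omega)
      rw [summandOp, LinearMap.comp_apply, LinearMap.comp_apply, Subsingleton.elim (tF n _) 0, map_zero,
        smul_zero]
    · rw [summandOp_lof_of_ne _ hn, smul_zero]

end WeightSpaces

section Categorification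

variable {N : ℕ} {G : GenMaps N} {hG : IsRep G} (S : LocalSplitting (Gamma G hG))

theorem grIso_of_iso {a b : EqFlag N} {f g : a ⟶ b} (e : f ≅ g) : GrIso f.val g.val :=
  ⟨e.hom.val, e.inv.val, e.hom.prop, e.inv.prop, congrArg Sub.Hom₂.val e.hom_inv_id,
    congrArg Sub.Hom₂.val e.inv_hom_id⟩

theorem grIso_bimodOf {n m : ℤ} (f : Mor n m) :
    GrIso (A := H N n) (B := H N m) (bimodOf S.extend (Udot.of f)) (Γ₁ N f) :=
  grIso_of_iso (S.imgIncl (a := (⟨n⟩ : Ucat)) (b := ⟨m⟩) (⟨f, trivial⟩ : Sub.Hom₁ (D := UData) ⟨n⟩ ⟨m⟩))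

/-- The action of 1-morphisms on Grothendieck groups. -/
noncomputable def actK0 {a b : Udot} (f : a ⟶ b) :
    K0 (ringOf S.extend a) →ₗ[ℤ[T;T⁻¹]] K0 (ringOf S.extend b) :=
  K0.map (bimodOf S.extend f) (isPmod_res_of_isEqFlag (S.extend.map f).prop)

theorem actK0_of {n m : ℤ} (f : Mor n m) :
    actK0 S (Udot.of f) = K0.map (Γ₁ N f) (isPmod_res_of_isEqFlag (isEqFlag_Γ₁ N f)) :=
  K0.map_iso (A := H N n) (B := H N m) _ _ (grIso_bimodOf S f)

/-- The class of the free module of rank one. -/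
noncomputable def freeCls (n : ℤ) : K0 (ringOf S.extend (Udot.obj n)) :=
  K0.cls (freeMod (H N n) 0) (isPmod_freeMod 0)

theorem isWeightFamily_freeCls :
    IsWeightFamily (K := fun n => K0 (ringOf S.extend (Udot.obj n))) N (freeCls S) where
  gen n x := K0.exists_smul (H_gr_zero N n) x
  free _ hn _ := K0_smul_injective hn
  zero _ hn := K0.subsingleton (H_subsingleton hn)

theorem isVN_actK0 : IsVN (isWeightFamily_freeCls S).basis
    (fun n => opOf S.extend (actK0 S (Udot.of (Mor.id n))))
    (fun n => opOf S.extend (actK0 S (Udot.of (Mor.E n))))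
    (fun n => opOf S.extend (actK0 S (Udot.of (Mor.F n)))) :=
  (isWeightFamily_freeCls S).isVN
    (fun n => (actK0_of S (Mor.id n)).trans (K0.map_regular _))
    (fun n hn => (LinearMap.congr_fun (actK0_of S (Mor.E n)) _).trans
      (K0.map_freeMod (BE N n) _ (grIso_res_BE hn)))
    (fun n hn => (LinearMap.congr_fun (actK0_of S (Mor.F n)) _).trans
      (K0.map_freeMod (BF N n) _ (grIso_res_BF hn)))

theorem induces_actK0 {a b : Udot} (f : a ⟶ b) : Induces (bimodOf S.extend f) (actK0 S f) :=
  fun Q hQ => ⟨isPmod_tensor hQ (isPmod_res_of_isEqFlag (S.extend.map f).prop), K0.map_cls _ _ Q hQ⟩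

/-- The isomorphism from the integral form of `V_N` to the Grothendieck group. -/
noncomputable def equivK0tot : (Fin (N + 1) → ℤ[T;T⁻¹]) ≃ₗ[ℤ[T;T⁻¹]] K0tot S.extend :=
  (Pi.basisFun ℤ[T;T⁻¹] (Fin (N + 1))).equiv (isWeightFamily_freeCls S).basis (Equiv.refl _)

theorem equivK0tot_single (k : Fin (N + 1)) : equivK0tot S (Pi.single k 1) =
    (T (-((k : ℕ) * ((N : ℤ) - (k : ℕ)))) : ℤ[T;T⁻¹]) •
      DirectSum.lof ℤ[T;T⁻¹] ℤ (fun n => K0 (ringOf S.extend (Udot.obj n))) (2 * (k : ℕ) - N)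
        (freeCls S _) := by
  rw [equivK0tot, ← Pi.basisFun_apply, Module.Basis.equiv_apply, Equiv.refl_apply,
    IsWeightFamily.basis_apply]
  rfl

theorem equivK0tot_apply (n : ℤ) (v : Fin (N + 1) → ℤ[T;T⁻¹]) :
    equivK0tot S (vOne ℤ[T;T⁻¹] N n v) =
        opOf S.extend (actK0 S (Udot.of (Mor.id n))) (equivK0tot S v) ∧
      equivK0tot S (vEE ℤ[T;T⁻¹] N n v) =
        opOf S.extend (actK0 S (Udot.of (Mor.E n))) (equivK0tot S v) ∧
      equivK0tot S (vFF ℤ[T;T⁻¹] N n v) =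
        opOf S.extend (actK0 S (Udot.of (Mor.F n))) (equivK0tot S v) :=
  (isVN_vOne ℤ[T;T⁻¹] N).equiv_apply (isVN_actK0 S) n v

/-- The isomorphism from the Grothendieck group over `ℚ(q)` to `V_N`. -/
noncomputable def baseChangeEquiv : (Kq ⊗[ℤ[T;T⁻¹]] K0tot S.extend) ≃ₗ[Kq] (Fin (N + 1) → Kq) :=
  ((isWeightFamily_freeCls S).basis.baseChange Kq).equiv (Pi.basisFun Kq (Fin (N + 1))) (Equiv.refl _)

theorem baseChangeEquiv_apply (n : ℤ) (w : Kq ⊗[ℤ[T;T⁻¹]] K0tot S.extend) :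
    baseChangeEquiv S ((opOf S.extend (actK0 S (Udot.of (Mor.id n)))).baseChange Kq w) =
        vOne Kq N n (baseChangeEquiv S w) ∧
      baseChangeEquiv S ((opOf S.extend (actK0 S (Udot.of (Mor.E n)))).baseChange Kq w) =
        vEE Kq N n (baseChangeEquiv S w) ∧
      baseChangeEquiv S ((opOf S.extend (actK0 S (Udot.of (Mor.F n)))).baseChange Kq w) =
        vFF Kq N n (baseChangeEquiv S w) :=
  ((isVN_actK0 S).baseChange Kq).equiv_apply (isVN_vOne Kq N) n w

theorem categorifies_extend : Categorifies S.extend :=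
  ⟨actK0 S, induces_actK0 S, (isVN_actK0 S).isUdotRep, (isVN_actK0 S).hasDividedPowers,
    ⟨equivK0tot S, fun k => ⟨isPmod_freeMod 0, equivK0tot_single S k⟩, equivK0tot_apply S⟩,
    baseChangeEquiv S, baseChangeEquiv_apply S⟩

end Categorification

end CatVN

theorem mainTheorem2 (N : ℕ) (hN : 0 < N) :
    -- the 2-functor `Γ` on `𝒰`, and its extension to `𝒰̇`
    (∃ (G : CatVN.GenMaps N) (hG : CatVN.IsRep G)
      (P : CategoryTheory.Pseudofunctor CatVN.Udot (CatVN.EqFlag N)),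
      CatVN.Extends P (CatVN.Gamma G hG) ∧
      (∀ P' : CategoryTheory.Pseudofunctor CatVN.Udot (CatVN.EqFlag N),
        CatVN.Extends P' (CatVN.Gamma G hG) →
          ∃ η : CategoryTheory.Pseudofunctor.StrongTrans P' P, CatVN.IsIcon η) ∧
      CatVN.Categorifies P) ∧
    -- idempotent 2-morphisms split in `EqFlag_N`
    (∀ a b : CatVN.EqFlag N, CategoryTheory.IsIdempotentComplete (a ⟶ b)) ∧
    -- `V_N` is an irreducible representation of dimension `N + 1`
    (CatVN.IsUdotRep (CatVN.vOne CatVN.Kq N) (CatVN.vEE CatVN.Kq N) (CatVN.vFF CatVN.Kq N) ∧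
      CatVN.IsIrred (CatVN.vOne CatVN.Kq N) (CatVN.vEE CatVN.Kq N) (CatVN.vFF CatVN.Kq N) ∧
      Module.finrank CatVN.Kq (Fin (N + 1) → CatVN.Kq) = N + 1) ∧
    -- the rings `H_k^G` are graded local, and their graded projectives are free
    (∀ n : ℤ, CatVN.Valid N n →
      CatVN.IsGradedLocal (CatVN.H N n) ∧
      (∀ M : CatVN.GrMod (CatVN.H N n), CatVN.IsPmod M →
        ∃ l : List ℤ, CatVN.GrIso M (CatVN.freeSum (CatVN.H N n) l)) ∧
      (CatVN.IsPmod (CatVN.freeMod (CatVN.H N n) 0) ∧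
        CatVN.IsIndecomposable (CatVN.freeMod (CatVN.H N n) 0)) ∧
      ∀ M : CatVN.GrMod (CatVN.H N n), CatVN.IsPmod M → CatVN.IsIndecomposable M →
        ∃ s : ℤ, CatVN.GrIso M (CatVN.freeMod (CatVN.H N n) s)) := by
  obtain ⟨S⟩ := CatVN.exists_localSplitting
    (CatVN.Gamma (CatVN.flagMaps N) (CatVN.isRep_flagMaps N)) (CatVN.isIdempotentComplete_eqFlag N)
  refine ⟨⟨CatVN.flagMaps N, CatVN.isRep_flagMaps N, S.extend, ⟨S.extendIncl, S.isIcon_extendIncl⟩,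
      fun P' ⟨σ, hσ⟩ => ⟨_, S.isIcon_lift hσ⟩, CatVN.categorifies_extend S⟩,
    CatVN.isIdempotentComplete_eqFlag N,
    ⟨(CatVN.isVN_vOne CatVN.Kq N).isUdotRep, (CatVN.isVN_vOne CatVN.Kq N).isIrred, by simp⟩,
    fun n hn => CatVN.graded_projectives_H hn⟩
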